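/- Let $\lambda>0$, let $m>1$, $K\ge 1$, and let $B_m=\{z\in\mathbb R^2:|z|<m\}$. Let $A=(a_{ij})_{i,j=1,2}$ be a real matrix-valued function on $B_m$, not necessarily symmetric, such that for all $z\in B_m$ and $\xi,\zeta\in\mathbb R^2$ $$\lambda|\xi|^2\le \sum_{i,j}a_{ij}(z)\xi_i\xi_j,\qquad \sum_{i,j}a_{ij}(z)\xi_i\zeta_j\le\lambda^{-1}|\xi||\zeta| ,$$ with weakly differentiable entries, let $V:B_m\to\mathbb R$ and $W:B_m\to\mathbb R^2$ be measurable, and write $$\mathcal L u=-\operatorname{div}(A\nabla u)+W\cdot\nabla u+Vu,\qquad V_+=\max(V,0),\quad V_-=\max(-V,0).$$ Solutions, subsolutions and supersolutions of $\mathcal Lu=0$ in $B_m$ are understood in the weak sense: $u\in W^{1,2}_{loc}(B_m)$ and $\int_{B_m}\big(A\nabla u\cdot\nabla\eta+(W\cdot\nabla u)\eta+Vu\eta\big)$ is $=0$ for all $\eta\in C_c^\infty(B_m)$, respectively $\le 0$ or $\ge 0$ for all $0\le\eta\in C_c^\infty(B_m)$. 1. There is a constant $c>0$ depending only on $\lambda$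 such that the following holds. If $$\|\nabla a_{ij}\|_{L^\infty(B_m)}\le\frac{\lambda}{4m}\ (i,j=1,2),\quad \|V_+\|_{L^\infty(B_m)}\le K^2,\quad \|V_-\|_{L^\infty(B_m)}\le\frac{\lambda}{m^2+1},\quad \|W\|_{L^\infty(B_m)}\le\frac{\lambda}{2m},$$ then $z\mapsto m^2+1-|z|^2$ is a supersolution and $z=(x,y)\mapsto e^{cKx}$ is a subsolution of $\mathcal Lu=0$ in $B_m$, and there exists a positive continuous function $\phi$ on $B_m$ which solves $\mathcal L\phi=0$ in $B_m$ and satisfies $e^{cKx}\le\phi(x,y)\le e^{cKm}(m^2+1-x^2-y^2)$ there. 2. If $\|\nabla a_{ij}\|_{L^\infty(B_m)}\le K$ $(i,j=1,2)$, $\|V\|_{L^\infty(B_m)}\le K^2$, $\|W\|_{L^\infty(B_m)}\le K$, and there exists a positive continuous supersolution $\phi_2$ of $\mathcal Lu=0$ in $B_m$, then there exists a positive continuous function $\phi$ on $B_m$ which solves $\mathcal L\phi=0$ in $B_m$. -/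

import Mathlib

open MeasureTheory Set Metric
open scoped ContDiff

/-- The Euclidean plane. -/
abbrev Plane : Type := EuclideanSpace ℝ (Fin 2)

/-- `f` is measurable on `Ω` and `‖f‖_{L^∞(Ω)} ≤ C`. -/
def EssBoundedOn {F : Type*} [NormedAddCommGroup F] (f : Plane → F) (Ω : Set Plane) (C : ℝ) :
    Prop :=
  AEStronglyMeasurable f (volume.restrict Ω) ∧ ∀ᵐ z ∂(volume.restrict Ω), ‖f z‖ ≤ C

/-- `η` belongs to `C_c^∞(Ω)`. -/
structure IsTestOn (Ω : Set Plane) (η : Plane → ℝ) : Prop where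
  smooth : ContDiff ℝ ∞ η
  compact : HasCompactSupport η
  subset : tsupport η ⊆ Ω

/-- The locally integrable field `g` is the distributional gradient of the locally integrable
function `f` in the open set `Ω`. -/
def HasWeakGradientOn (f : Plane → ℝ) (g : Plane → Plane) (Ω : Set Plane) : Prop :=
  LocallyIntegrableOn f Ω ∧ LocallyIntegrableOn g Ω ∧
    ∀ η : Plane → ℝ, IsTestOn Ω η → ∀ i : Fin 2,
      ∫ z in Ω, f z * gradient η z i = - ∫ z in Ω, g z i * η z

/-- `f` is weakly differentiable in `Ω` and `‖∇f‖_{L^∞(Ω)} ≤ C`. -/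
def WeakGradientBoundedOn (f : Plane → ℝ) (Ω : Set Plane) (C : ℝ) : Prop :=
  ∃ g : Plane → Plane, HasWeakGradientOn f g Ω ∧ EssBoundedOn g Ω C

/-- `f ∈ W^{1,2}_loc(Ω)` with weak gradient `g`. -/
def MemW12Loc (f : Plane → ℝ) (g : Plane → Plane) (Ω : Set Plane) : Prop :=
  HasWeakGradientOn f g Ω ∧
    LocallyIntegrableOn (fun z => f z ^ 2) Ω ∧ LocallyIntegrableOn (fun z => ‖g z‖ ^ 2) Ω

/-- The matrix field `A` is elliptic and bounded in `Ω` with constant `lam`: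
`lam |ξ|² ≤ a_ij ξ_i ξ_j` and `a_ij ξ_i ζ_j ≤ lam⁻¹ |ξ| |ζ|`. -/
def EllipticBoundedOn (A : Plane → Matrix (Fin 2) (Fin 2) ℝ) (Ω : Set Plane) (lam : ℝ) : Prop :=
  ∀ z ∈ Ω, ∀ ξ ζ : Plane,
    lam * ‖ξ‖ ^ 2 ≤ ∑ i, ∑ j, A z i j * ξ i * ξ j ∧
    ∑ i, ∑ j, A z i j * ξ i * ζ j ≤ lam⁻¹ * ‖ξ‖ * ‖ζ‖

noncomputable section

/-- The weak form `∫_Ω A∇u·∇η + (W·∇u) η + V u η` of `-div(A∇u) + W·∇u + V u`,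
where `g` is the weak gradient of `u`. -/
def weakForm (A : Plane → Matrix (Fin 2) (Fin 2) ℝ) (W : Plane → Plane) (V : Plane → ℝ)
    (Ω : Set Plane) (u : Plane → ℝ) (g : Plane → Plane) (η : Plane → ℝ) : ℝ :=
  ∫ z in Ω, ((∑ i, ∑ j, A z i j * g z j * gradient η z i) +
    (∑ i, W z i * g z i) * η z + V z * u z * η z)

end

/-- `u ∈ W^{1,2}_loc(Ω)` is a weak solution of `-div(A∇u) + W·∇u + V u = 0` in `Ω`. -/
def IsWeakSolution (A : Plane → Matrix (Fin 2) (Fin 2) ℝ) (W : Plane → Plane) (V : Plane → ℝ)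
    (Ω : Set Plane) (u : Plane → ℝ) : Prop :=
  ∃ g : Plane → Plane, MemW12Loc u g Ω ∧
    ∀ η : Plane → ℝ, IsTestOn Ω η → weakForm A W V Ω u g η = 0

/-- `u ∈ W^{1,2}_loc(Ω)` is a weak supersolution: `-div(A∇u) + W·∇u + V u ≥ 0` in `Ω`. -/
def IsWeakSupersolution (A : Plane → Matrix (Fin 2) (Fin 2) ℝ) (W : Plane → Plane)
    (V : Plane → ℝ) (Ω : Set Plane) (u : Plane → ℝ) : Prop :=
  ∃ g : Plane → Plane, MemW12Loc u g Ω ∧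
    ∀ η : Plane → ℝ, IsTestOn Ω η → (∀ z, 0 ≤ η z) → 0 ≤ weakForm A W V Ω u g η

/-- `u ∈ W^{1,2}_loc(Ω)` is a weak subsolution: `-div(A∇u) + W·∇u + V u ≤ 0` in `Ω`. -/
def IsWeakSubsolution (A : Plane → Matrix (Fin 2) (Fin 2) ℝ) (W : Plane → Plane)
    (V : Plane → ℝ) (Ω : Set Plane) (u : Plane → ℝ) : Prop :=
  ∃ g : Plane → Plane, MemW12Loc u g Ω ∧
    ∀ η : Plane → ℝ, IsTestOn Ω η → (∀ z, 0 ≤ η z) → weakForm A W V Ω u g η ≤ 0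

/-- `φ` is positive and continuous in `Ω`. -/
def PosContOn (φ : Plane → ℝ) (Ω : Set Plane) : Prop :=
  ContinuousOn φ Ω ∧ ∀ z ∈ Ω, 0 < φ z

/-! Both statements produce a solution between ordered barriers; the second one adds a compactness
argument.

Barriers. For the paraboloid the principal part contributes twice the trace of A, at least 4λ, while
the smallness assumptions on ∇A, W and V₋ cost at most 7λ/2; hence it is a supersolution. For the
exponential with rate cK the term λc²K² beats the terms of order cK and K² once c = 1 + 1/λ. The
factor e^{cKm} puts the paraboloid above the exponential. Between ordered barriers a solution comes
from monotone iteration (`exists_solution_between`). A shift μ makes the operator coercive and gives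
it a weak comparison principle (`ae_nonpos_of_form_nonpos`). Lax–Milgram solves (L + μ)u = μf with
the boundary values of the subsolution. The map f ↦ u is monotone, Lipschitz in L² and respects the
barriers, so its iterates increase to a fixed point, which solves Lu = 0.

Continuity. The coefficients a_ij are Lipschitz, so Nirenberg's difference quotients bound the
second derivatives in L² (`BoundedCoeff.l2_translate_grad_le`). In the plane a square-integrable
mixed derivative already gives Hölder exponent 1/2 (`exists_holder_of_l2`). The resulting bound
involves only the H¹ norm (`BoundedCoeff.exists_holder`).

Second statement. On each smaller ball a small multiple of an exponential lies below the given
supersolution, so there is a positive solution there, which is normalised to equal 1 at the origin.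
As the balls grow, compactness needs Harnack's inequality (`BoundedCoeff.exists_harnack`), obtained
by a planar argument. Testing with η²/u bounds ∇ log u in L². Averaging over radii yields a circle
on which log u oscillates by a bounded amount (`BoundedCoeff.exists_circle_harnack`). Comparison
carries this into the disc, from above with multiples of the supersolution and from below with
exponentials. The comparison principle used here needs no sign of V because a positive supersolution
exists (`BoundedCoeff.nonneg_of_form_nonneg`).

Harnack, Caccioppoli and Hölder estimates bound the normalised solutions locally uniformly. They
converge locally uniformly along an ultrafilter. Caccioppoli applied to differences makes the
gradients converge in L², so the limit is a solution (`BoundedCoeff.isWeakSolution_of_tendsto`), and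
the lower Harnack bound keeps it positive. -/

open Filter Topology

/-! ### Square-integrable functions -/

/-- The `L²` norm as a real number. -/
noncomputable def l2 {α E : Type*} [MeasurableSpace α] [NormedAddCommGroup E] (μ : Measure α)
    (f : α → E) : ℝ := (eLpNorm f 2 μ).toReal

/-- Convergence in `L²` along a filter. -/
def TendstoL2 {α E ι : Type*} [MeasurableSpace α] [NormedAddCommGroup E] (μ : Measure α)
    (l : Filter ι) (s : ι → α → E) (f : α → E) : Prop :=
  Tendsto (fun n => eLpNorm (fun z => s n z - f z) 2 μ) l (𝓝 0)

section L2

variable {α E F ι : Type*} [MeasurableSpace α] [NormedAddCommGroup E]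
  [NormedAddCommGroup F] {μ : Measure α} {l : Filter ι}

theorem l2_nonneg (f : α → E) : 0 ≤ l2 μ f := ENNReal.toReal_nonneg

theorem l2_norm (f : α → E) : l2 μ (fun z => ‖f z‖) = l2 μ f := by
  unfold l2; rw [eLpNorm_norm]

theorem l2_eq_norm_toLp {f : α → E} (hf : MemLp f 2 μ) : l2 μ f = ‖hf.toLp f‖ := by
  rw [Lp.norm_toLp, l2]

theorem l2_sq {f : α → E} (hf : MemLp f 2 μ) : l2 μ f ^ 2 = ∫ z, ‖f z‖ ^ 2 ∂μ := by
  have h := hf.norm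
  rw [← l2_norm, l2_eq_norm_toLp h, ← real_inner_self_eq_norm_sq, L2.inner_def]
  refine integral_congr_ae ?_
  filter_upwards [h.coeFn_toLp] with z hz
  rw [hz, real_inner_self_eq_norm_sq]; simp

theorem l2_le_mul {f : α → E} {g : α → F} (hg : MemLp g 2 μ) {C : ℝ} (hC : 0 ≤ C)
    (h : ∀ᵐ z ∂μ, ‖f z‖ ≤ C * ‖g z‖) : l2 μ f ≤ C * l2 μ g := by
  have := eLpNorm_le_mul_eLpNorm_of_ae_le_mul h 2
  unfold l2
  refine (ENNReal.toReal_mono (ENNReal.mul_ne_top ENNReal.ofReal_ne_top hg.2.ne) this).trans ?_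
  rw [ENNReal.toReal_mul, ENNReal.toReal_ofReal hC]

theorem l2_mono {f : α → E} {g : α → F} (hg : MemLp g 2 μ)
    (h : ∀ᵐ z ∂μ, ‖f z‖ ≤ ‖g z‖) : l2 μ f ≤ l2 μ g := by
  simpa using l2_le_mul hg zero_le_one (by simpa using h)

theorem l2_congr {f g : α → E} (h : f =ᵐ[μ] g) : l2 μ f = l2 μ g := by
  unfold l2; rw [eLpNorm_congr_ae h]

theorem l2_add_le {f g : α → E} (hf : MemLp f 2 μ) (hg : MemLp g 2 μ) :
    l2 μ (fun z => f z + g z) ≤ l2 μ f + l2 μ g := by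
  unfold l2
  rw [← ENNReal.toReal_add hf.2.ne hg.2.ne]
  exact ENNReal.toReal_mono (ENNReal.add_ne_top.2 ⟨hf.2.ne, hg.2.ne⟩)
    (eLpNorm_add_le hf.1 hg.1 one_le_two)

theorem l2_sub_comm (f g : α → E) : l2 μ (fun z => f z - g z) = l2 μ (fun z => g z - f z) := by
  unfold l2
  congr 1
  exact eLpNorm_congr_norm_ae (ae_of_all _ fun z => norm_sub_rev _ _)

theorem l2_mono_measure {ν : Measure α} (h : ν ≤ μ) {f : α → E} (hf : MemLp f 2 μ) :
    l2 ν f ≤ l2 μ f :=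
  ENNReal.toReal_mono hf.2.ne (eLpNorm_mono_measure f h)

theorem memLp_of_le_add {G : Type*} [NormedAddCommGroup G] {f : α → E} {g₁ : α → F} {g₂ : α → G}
    (hf : AEStronglyMeasurable f μ)
    (h₁ : MemLp g₁ 2 μ) (h₂ : MemLp g₂ 2 μ) {C : ℝ}
    (h : ∀ᵐ z ∂μ, ‖f z‖ ≤ C * (‖g₁ z‖ + ‖g₂ z‖)) : MemLp f 2 μ :=
  MemLp.of_le_mul (h₁.norm.add h₂.norm) hf (c := C) (by
    filter_upwards [h] with z hz
    refine hz.trans (le_of_eq ?_)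
    simp only [Pi.add_apply, Real.norm_eq_abs]
    rw [abs_of_nonneg (add_nonneg (norm_nonneg (g₁ z)) (norm_nonneg (g₂ z)))])

section Inner
variable [InnerProductSpace ℝ E]

theorem integrable_inner_of_memLp {f g : α → E} (hf : MemLp f 2 μ) (hg : MemLp g 2 μ) :
    Integrable (fun z => inner ℝ (f z) (g z)) μ := by
  refine (L2.integrable_inner (𝕜 := ℝ) (hf.toLp f) (hg.toLp g)).congr ?_
  filter_upwards [hf.coeFn_toLp, hg.coeFn_toLp] with z h1 h2
  rw [h1, h2]

theorem integral_inner_toLp {f g : α → E} (hf : MemLp f 2 μ) (hg : MemLp g 2 μ) :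
    inner ℝ (hf.toLp f) (hg.toLp g) = ∫ z, inner ℝ (f z) (g z) ∂μ := by
  rw [L2.inner_def]
  refine integral_congr_ae ?_
  filter_upwards [hf.coeFn_toLp, hg.coeFn_toLp] with z h1 h2
  rw [h1, h2]

theorem abs_integral_inner_le {f g : α → E} (hf : MemLp f 2 μ) (hg : MemLp g 2 μ) :
    |∫ z, inner ℝ (f z) (g z) ∂μ| ≤ l2 μ f * l2 μ g := by
  rw [← integral_inner_toLp hf hg, l2_eq_norm_toLp hf, l2_eq_norm_toLp hg]
  exact abs_real_inner_le_norm _ _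

end Inner

theorem integrable_mul_of_memLp {f g : α → ℝ} (hf : MemLp f 2 μ) (hg : MemLp g 2 μ) :
    Integrable (fun z => f z * g z) μ := by
  simpa [mul_comm] using integrable_inner_of_memLp hf hg

theorem abs_integral_mul_le {f g : α → ℝ} (hf : MemLp f 2 μ) (hg : MemLp g 2 μ) :
    |∫ z, f z * g z ∂μ| ≤ l2 μ f * l2 μ g := by
  simpa [mul_comm] using abs_integral_inner_le hf hg

namespace TendstoL2

theorem l2_sub {s : ι → α → E} {f : α → E} (h : TendstoL2 μ l s f) :
    Tendsto (fun n => l2 μ (fun z => s n z - f z)) l (𝓝 0) :=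
  (ENNReal.tendsto_toReal ENNReal.zero_ne_top).comp h

/-- Membership in L² is essential: `l2` sends an infinite norm to 0, so convergence of the real
numbers alone would say nothing. -/
theorem of_l2 {s : ι → α → E} {f : α → E} (hs : ∀ n, MemLp (s n) 2 μ) (hf : MemLp f 2 μ)
    (h : Tendsto (fun n => l2 μ (fun z => s n z - f z)) l (𝓝 0)) : TendstoL2 μ l s f := by
  unfold TendstoL2
  have := ENNReal.tendsto_ofReal h
  simp only [ENNReal.ofReal_zero] at this
  refine this.congr fun n => ?_
  exact ENNReal.ofReal_toReal ((hs n).sub hf).2.ne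

theorem of_eventually_le {s : ι → α → E} {f : α → E} {b : ι → ENNReal}
    (h : ∀ᶠ n in l, eLpNorm (fun z => s n z - f z) 2 μ ≤ b n) (hb : Tendsto b l (𝓝 0)) :
    TendstoL2 μ l s f :=
  tendsto_of_tendsto_of_tendsto_of_le_of_le' tendsto_const_nhds hb
    (Eventually.of_forall fun _ => zero_le) h

theorem of_le {s : ι → α → E} {f : α → E} {s' : ι → α → F} {f' : α → F}
    (h : TendstoL2 μ l s f) (C : ℝ)
    (hle : ∀ᶠ n in l, ∀ᵐ z ∂μ, ‖s' n z - f' z‖ ≤ C * ‖s n z - f z‖) : TendstoL2 μ l s' f' := by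
  have h2 : Tendsto (fun n => ENNReal.ofReal C * eLpNorm (fun z => s n z - f z) 2 μ) l (𝓝 0) := by
    simpa using ENNReal.Tendsto.const_mul h (Or.inr (ENNReal.ofReal_ne_top (r := C)))
  refine of_eventually_le ?_ h2
  filter_upwards [hle] with n hn
  exact eLpNorm_le_mul_eLpNorm_of_ae_le_mul hn 2

theorem congr' {s s' : ι → α → E} {f f' : α → E} (h : TendstoL2 μ l s f)
    (hs : ∀ᶠ n in l, s n =ᵐ[μ] s' n) (hf : f =ᵐ[μ] f') : TendstoL2 μ l s' f' := by
  refine h.of_le 1 ?_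
  filter_upwards [hs] with n hn
  filter_upwards [hn, hf] with z h1 h2
  rw [h1, h2, one_mul]

theorem mono_measure {ν : Measure α} {s : ι → α → E} {f : α → E} (h : TendstoL2 μ l s f)
    (hν : ν ≤ μ) : TendstoL2 ν l s f :=
  of_eventually_le (Eventually.of_forall fun _ => eLpNorm_mono_measure _ hν) h

theorem comp {κ : Type*} {k : Filter κ} {s : ι → α → E} {f : α → E} (h : TendstoL2 μ l s f)
    {p : κ → ι} (hp : Tendsto p k l) : TendstoL2 μ k (fun n => s (p n)) f := by
  unfold TendstoL2 at h ⊢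
  exact Filter.Tendsto.comp (g := fun n => eLpNorm (fun z => s n z - f z) 2 μ) h hp

theorem const (f : α → E) : TendstoL2 μ l (fun _ => f) f := by
  simp only [TendstoL2, sub_self]
  simp [tendsto_const_nhds]

theorem add {s t : ι → α → E} {f g : α → E} (h : TendstoL2 μ l s f) (h' : TendstoL2 μ l t g)
    (hs : ∀ n, AEStronglyMeasurable (s n) μ) (hf : AEStronglyMeasurable f μ)
    (ht : ∀ n, AEStronglyMeasurable (t n) μ) (hg : AEStronglyMeasurable g μ) :
    TendstoL2 μ l (fun n z => s n z + t n z) (fun z => f z + g z) := by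
  have h2 := Tendsto.add h h'
  rw [add_zero] at h2
  refine of_eventually_le (Eventually.of_forall fun n => ?_) h2
  have := eLpNorm_add_le ((hs n).sub hf) ((ht n).sub hg) (p := 2) (one_le_two)
  refine le_trans (le_of_eq ?_) this
  congr 1; ext z; simp only [Pi.add_apply, Pi.sub_apply]; abel

theorem neg {s : ι → α → E} {f : α → E} (h : TendstoL2 μ l s f) :
    TendstoL2 μ l (fun n z => - s n z) (fun z => - f z) :=
  h.of_le 1 (Eventually.of_forall fun n => ae_of_all _ fun z => by
    rw [one_mul, ← norm_neg, neg_sub_neg, neg_sub])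

theorem sub {s t : ι → α → E} {f g : α → E} (h : TendstoL2 μ l s f) (h' : TendstoL2 μ l t g)
    (hs : ∀ n, AEStronglyMeasurable (s n) μ) (hf : AEStronglyMeasurable f μ)
    (ht : ∀ n, AEStronglyMeasurable (t n) μ) (hg : AEStronglyMeasurable g μ) :
    TendstoL2 μ l (fun n z => s n z - t n z) (fun z => f z - g z) := by
  simpa [sub_eq_add_neg] using h.add h'.neg hs hf (fun n => (ht n).neg) hg.neg

theorem l2 {s : ι → α → E} {f : α → E} (h : TendstoL2 μ l s f)
    (hs : ∀ n, MemLp (s n) 2 μ) (hf : MemLp f 2 μ) :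
    Tendsto (fun n => l2 μ (s n)) l (𝓝 (_root_.l2 μ f)) := by
  rw [tendsto_iff_norm_sub_tendsto_zero]
  refine squeeze_zero (fun _ => norm_nonneg _) (fun n => ?_) h.l2_sub
  rw [Real.norm_eq_abs, abs_sub_le_iff]
  constructor
  · have := l2_add_le ((hs n).sub hf) hf
    simp only [Pi.sub_apply, sub_add_cancel] at this
    exact sub_le_iff_le_add.2 this
  · have := l2_add_le (hf.sub (hs n)) (hs n)
    simp only [Pi.sub_apply, sub_add_cancel] at this
    have h3 := l2_sub_comm (μ := μ) f (s n)
    have h4 : _root_.l2 μ (f - s n) = _root_.l2 μ (fun z => f z - s n z) := rfl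
    exact sub_le_iff_le_add.2 (by rw [← h3, ← h4]; exact this)

theorem inner [InnerProductSpace ℝ E] {s : ι → α → E} {f a : α → E} (h : TendstoL2 μ l s f)
    (ha : MemLp a 2 μ) (hs : ∀ n, MemLp (s n) 2 μ) (hf : MemLp f 2 μ) :
    Tendsto (fun n => ∫ z, inner ℝ (a z) (s n z) ∂μ) l (𝓝 (∫ z, inner ℝ (a z) (f z) ∂μ)) := by
  rw [tendsto_iff_norm_sub_tendsto_zero]
  have h2 := h.l2_sub.const_mul (_root_.l2 μ a)
  rw [mul_zero] at h2
  refine squeeze_zero (fun _ => norm_nonneg _) (fun n => ?_) h2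
  rw [← integral_sub (integrable_inner_of_memLp ha (hs n)) (integrable_inner_of_memLp ha hf)]
  simp only [← inner_sub_right]
  exact abs_integral_inner_le ha ((hs n).sub hf)

theorem mul {s : ι → α → ℝ} {f a : α → ℝ} (h : TendstoL2 μ l s f)
    (ha : MemLp a 2 μ) (hs : ∀ n, MemLp (s n) 2 μ) (hf : MemLp f 2 μ) :
    Tendsto (fun n => ∫ z, a z * s n z ∂μ) l (𝓝 (∫ z, a z * f z ∂μ)) := by
  simpa [mul_comm] using h.inner ha hs hf

theorem exists_subseq_ae {s : ℕ → α → E} {f : α → E} (h : TendstoL2 μ atTop s f)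
    (hs : ∀ n, AEStronglyMeasurable (s n) μ) (hf : AEStronglyMeasurable f μ) :
    ∃ ns : ℕ → ℕ, StrictMono ns ∧ ∀ᵐ z ∂μ, Tendsto (fun i => s (ns i) z) atTop (𝓝 (f z)) :=
  (tendstoInMeasure_of_tendsto_eLpNorm two_ne_zero hs hf h).exists_seq_tendsto_ae

/-- Dominated convergence in `L²`. -/
theorem of_dominated {s : ℕ → α → E} {f : α → E} {b : α → F} (hb : MemLp b 2 μ)
    (hs : ∀ n, AEStronglyMeasurable (s n) μ) (hf : AEStronglyMeasurable f μ)
    (hle : ∀ n, ∀ᵐ z ∂μ, ‖s n z - f z‖ ≤ ‖b z‖)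
    (hlim : ∀ᵐ z ∂μ, Tendsto (fun n => s n z) atTop (𝓝 (f z))) : TendstoL2 μ atTop s f := by
  have key : Tendsto (fun n => ∫⁻ z, ‖s n z - f z‖ₑ ^ (2 : ℝ) ∂μ) atTop (𝓝 (∫⁻ _, 0 ∂μ)) := by
    refine tendsto_lintegral_of_dominated_convergence' (fun z => ‖b z‖ₑ ^ (2 : ℝ))
      (fun n => (((hs n).sub hf).enorm).pow_const _) ?_ ?_ ?_
    · intro n
      filter_upwards [hle n] with z hz
      gcongr
      exact enorm_le_iff_norm_le.2 hz
    · have := hb.2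
      rw [eLpNorm_eq_lintegral_rpow_enorm_toReal two_ne_zero ENNReal.ofNat_ne_top] at this
      rw [ENNReal.rpow_lt_top_iff_of_pos (by simp)] at this
      simpa using this.ne
    · filter_upwards [hlim] with z hz
      have h1 : Tendsto (fun n => ‖s n z - f z‖ₑ) atTop (𝓝 0) := by
        have := (hz.sub_const (f z)).enorm
        simpa using this
      have := (ENNReal.continuous_rpow_const (y := 2)).continuousAt.tendsto.comp h1
      simpa [Function.comp_def] using this
  have h3 : TendstoL2 μ atTop s f ↔ Tendsto (fun n => (∫⁻ z, ‖s n z - f z‖ₑ ^ (2 : ℝ) ∂μ) ^ (1 / 2 : ℝ))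
      atTop (𝓝 0) := by
    unfold TendstoL2
    refine iff_of_eq (congrArg (fun q => Tendsto q atTop (𝓝 0)) ?_)
    ext n
    rw [eLpNorm_eq_lintegral_rpow_enorm_toReal two_ne_zero ENNReal.ofNat_ne_top]
    simp
  rw [h3]
  simp only [lintegral_zero] at key
  have := (ENNReal.continuous_rpow_const (y := 1 / 2)).continuousAt.tendsto.comp key
  simpa [Function.comp_def] using this

end TendstoL2

end L2

/-! ### Mollification -/

/-- A sequence of bump functions shrinking to the origin. -/
noncomputable def bumpSeq (n : ℕ) : ContDiffBump (0 : Plane) :=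
  -- The inner radius is half the outer one: a bounded ratio of the two is what gives almost
  -- everywhere convergence of mollifications.
  ⟨1 / (2 * ((n : ℝ) + 1)), 1 / ((n : ℝ) + 1), by positivity, by
    apply one_div_lt_one_div_of_lt <;> linarith [n.cast_nonneg (α := ℝ)]⟩

theorem tendsto_bumpSeq_rOut : Tendsto (fun n => (bumpSeq n).rOut) atTop (𝓝 0) :=
  tendsto_one_div_add_atTop_nhds_zero_nat

/-- The standard mollifier. -/
noncomputable def mollifier (n : ℕ) : Plane → ℝ := (bumpSeq n).normed volume

theorem mollifier_nonneg (n : ℕ) (z : Plane) : 0 ≤ mollifier n z := (bumpSeq n).nonneg_normed z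

theorem contDiff_mollifier (n : ℕ) : ContDiff ℝ ∞ (mollifier n) := (bumpSeq n).contDiff_normed

theorem integral_mollifier (n : ℕ) : ∫ z, mollifier n z = 1 := (bumpSeq n).integral_normed

theorem tsupport_mollifier (n : ℕ) : tsupport (mollifier n) = closedBall 0 (1 / ((n : ℝ) + 1)) :=
  (bumpSeq n).tsupport_normed_eq

theorem hasCompactSupport_mollifier (n : ℕ) : HasCompactSupport (mollifier n) :=
  (bumpSeq n).hasCompactSupport_normed

theorem mollifier_eq_zero {n : ℕ} {z : Plane} (h : 1 / ((n : ℝ) + 1) < ‖z‖) :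
    mollifier n z = 0 := by
  by_contra h0
  have := subset_tsupport _ (Function.mem_support.2 h0)
  rw [tsupport_mollifier, mem_closedBall_zero_iff] at this
  linarith

theorem eLpNorm_two_eq {α E : Type*} [NormedAddCommGroup E] [MeasurableSpace α] (μ : Measure α) (f : α → E) :
    eLpNorm f 2 μ = (∫⁻ z, ‖f z‖ₑ ^ 2 ∂μ) ^ (1 / 2 : ℝ) := by
  rw [eLpNorm_eq_lintegral_rpow_enorm_toReal two_ne_zero ENNReal.ofNat_ne_top]
  simp

section Mollify

variable {E : Type*} [NormedAddCommGroup E] [NormedSpace ℝ E]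

/-- The mollification of `f` at scale `1 / (n + 1)`. -/
noncomputable def moll (n : ℕ) (f : Plane → E) (z : Plane) : E :=
  ∫ t, mollifier n t • f (z - t)

theorem moll_eq_convolution (n : ℕ) (f : Plane → E) :
    moll n f = convolution (mollifier n) f (ContinuousLinearMap.lsmul ℝ ℝ) volume := rfl

theorem moll_eq_integral (n : ℕ) (f : Plane → E) (z : Plane) :
    moll n f z = ∫ y, mollifier n (z - y) • f y := by
  unfold moll
  rw [← integral_sub_left_eq_self (fun y => mollifier n y • f (z - y)) volume z]
  simp

theorem moll_congr_on {f f' : Plane → E} {n : ℕ} {z : Plane}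
    (h : ∀ᵐ y, dist y z ≤ 1 / ((n : ℝ) + 1) → f y = f' y) : moll n f z = moll n f' z := by
  rw [moll_eq_integral, moll_eq_integral]
  refine integral_congr_ae ?_
  filter_upwards [h] with y hy
  by_cases hd : dist y z ≤ 1 / ((n : ℝ) + 1)
  · rw [hy hd]
  · rw [mollifier_eq_zero (by rw [← dist_eq_norm, dist_comm]; exact not_le.1 hd)]; simp

theorem contDiff_moll {f : Plane → E} (hf : LocallyIntegrable f) (n : ℕ) :
    ContDiff ℝ ∞ (moll n f) :=
  (hasCompactSupport_mollifier n).contDiff_convolution_left (ContinuousLinearMap.lsmul ℝ ℝ)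
    (contDiff_mollifier n) hf

theorem integrable_mollifier_smul {f : Plane → E} (hf : LocallyIntegrable f) (n : ℕ) (z : Plane) :
    Integrable (fun t => mollifier n t • f (z - t)) :=
  (hasCompactSupport_mollifier n).convolutionExists_left (ContinuousLinearMap.lsmul ℝ ℝ)
    (contDiff_mollifier n).continuous hf z

theorem dist_moll_le [CompleteSpace E] {f : Plane → E} (hf : AEStronglyMeasurable f) {n : ℕ} {z : Plane} {ε : ℝ}
    (h : ∀ y ∈ ball z (1 / ((n : ℝ) + 1)), dist (f y) (f z) ≤ ε) : dist (moll n f z) (f z) ≤ ε :=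
  (bumpSeq n).dist_normed_convolution_le hf h

theorem ae_tendsto_moll [CompleteSpace E] {f : Plane → E} (hf : LocallyIntegrable f) :
    ∀ᵐ z, Tendsto (fun n => moll n f z) atTop (𝓝 (f z)) := by
  refine ContDiffBump.ae_convolution_tendsto_right_of_locallyIntegrable (K := 2)
    tendsto_bumpSeq_rOut (Eventually.of_forall fun n => le_of_eq ?_) hf
  show 1 / ((n : ℝ) + 1) = 2 * (1 / (2 * ((n : ℝ) + 1)))
  field_simp

theorem norm_moll_le {f : Plane → E} {C : ℝ} {n : ℕ} {z : Plane}
    (h : ∀ᵐ y, dist y z ≤ 1 / ((n : ℝ) + 1) → ‖f y‖ ≤ C) : ‖moll n f z‖ ≤ C := by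
  rw [moll_eq_integral]
  have h1 : Integrable (fun y => mollifier n (z - y) * C) :=
    (((bumpSeq n).integrable_normed (μ := volume)).comp_sub_left z).mul_const C
  refine (norm_integral_le_of_norm_le h1 ?_).trans (le_of_eq ?_)
  · filter_upwards [h] with y hy
    rw [norm_smul, Real.norm_eq_abs, abs_of_nonneg (mollifier_nonneg _ _)]
    by_cases hd : dist y z ≤ 1 / ((n : ℝ) + 1)
    · exact mul_le_mul_of_nonneg_left (hy hd) (mollifier_nonneg _ _)
    · rw [mollifier_eq_zero (by rw [← dist_eq_norm, dist_comm]; exact not_le.1 hd)]; simp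
  · rw [integral_mul_const, integral_sub_left_eq_self (fun y => mollifier n y) volume z,
      integral_mollifier, one_mul]

theorem moll_sub {f g : Plane → E} (hf : LocallyIntegrable f) (hg : LocallyIntegrable g) (n : ℕ)
    (z : Plane) : moll n (fun y => f y - g y) z = moll n f z - moll n g z := by
  unfold moll
  rw [← integral_sub (integrable_mollifier_smul hf n z) (integrable_mollifier_smul hg n z)]
  simp only [smul_sub]

theorem moll_comp_add (f : Plane → E) (n : ℕ) (z h : Plane) :
    moll n (fun y => f (y + h)) z = moll n f (z + h) := by
  unfold moll
  congr 1; ext t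
  show _ • f (z - t + h) = _
  rw [sub_add_eq_add_sub]

theorem lintegral_mollifier (n : ℕ) : ∫⁻ t, ENNReal.ofReal (mollifier n t) = 1 := by
  rw [← ofReal_integral_eq_lintegral_ofReal (f := mollifier n) (bumpSeq n).integrable_normed
    (ae_of_all _ (mollifier_nonneg n)), integral_mollifier, ENNReal.ofReal_one]

/-- The mollifier is a probability density, so the L¹ norm against it is at most the L² norm. -/
theorem sq_enorm_moll_le {f : Plane → E} (hf : AEStronglyMeasurable f) (n : ℕ) (z : Plane) :
    ‖moll n f z‖ₑ ^ 2 ≤ ∫⁻ t, ENNReal.ofReal (mollifier n t) * ‖f (z - t)‖ₑ ^ 2 := by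
  set ν : Measure Plane := volume.withDensity (fun t => ENNReal.ofReal (mollifier n t)) with hν
  have hmeas : Measurable (fun t => ENNReal.ofReal (mollifier n t)) :=
    ((contDiff_mollifier n).continuous.measurable).ennreal_ofReal
  have : IsProbabilityMeasure ν := ⟨by rw [hν, withDensity_apply _ MeasurableSet.univ,
    Measure.restrict_univ, lintegral_mollifier]⟩
  have hfm : AEStronglyMeasurable (fun t => f (z - t)) volume :=
    hf.comp_quasiMeasurePreserving (quasiMeasurePreserving_sub_left volume z)
  have hfν : AEStronglyMeasurable (fun t => f (z - t)) ν :=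
    hfm.mono_ac (withDensity_absolutelyContinuous _ _)
  have h1 : ‖moll n f z‖ₑ ≤ eLpNorm (fun t => f (z - t)) 1 ν := by
    rw [eLpNorm_one_eq_lintegral_enorm, hν, lintegral_withDensity_eq_lintegral_mul₀
      hmeas.aemeasurable hfm.enorm]
    refine (enorm_integral_le_lintegral_enorm _).trans (le_of_eq ?_)
    congr 1; ext t
    rw [enorm_smul, Pi.mul_apply, Real.enorm_eq_ofReal (mollifier_nonneg n t)]
  have h2 := h1.trans (eLpNorm_le_eLpNorm_of_exponent_le (one_le_two (α := ENNReal)) hfν)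
  rw [eLpNorm_eq_lintegral_rpow_enorm_toReal two_ne_zero ENNReal.ofNat_ne_top] at h2
  calc ‖moll n f z‖ₑ ^ 2 ≤ ((∫⁻ t, ‖f (z - t)‖ₑ ^ (2 : ℝ) ∂ν) ^ (1 / 2 : ℝ)) ^ 2 := by
        gcongr; exact h2
    _ = ∫⁻ t, ‖f (z - t)‖ₑ ^ 2 ∂ν := by
        rw [← ENNReal.rpow_natCast (_ ^ (1 / 2 : ℝ)), ← ENNReal.rpow_mul]; simp
    _ = _ := by
        rw [hν, lintegral_withDensity_eq_lintegral_mul₀ hmeas.aemeasurable (hfm.enorm.pow_const _)]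
        rfl

/-- Tonelli: after the integrals are swapped, every translate of f contributes the same integral,
and the weights add up to one. -/
theorem lintegral_sq_enorm_moll_le {f : Plane → E} (hf : AEStronglyMeasurable f) (n : ℕ) :
    ∫⁻ z, ‖moll n f z‖ₑ ^ 2 ≤ ∫⁻ z, ‖f z‖ₑ ^ 2 := by
  refine (lintegral_mono fun z => sq_enorm_moll_le hf n z).trans (le_of_eq ?_)
  have hmeas : Measurable (fun t => ENNReal.ofReal (mollifier n t)) :=
    ((contDiff_mollifier n).continuous.measurable).ennreal_ofReal
  rw [lintegral_lintegral_swap]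
  · have : ∀ t : Plane, ∫⁻ z, ENNReal.ofReal (mollifier n t) * ‖f (z - t)‖ₑ ^ 2 =
        ENNReal.ofReal (mollifier n t) * ∫⁻ z, ‖f z‖ₑ ^ 2 := by
      intro t
      rw [lintegral_const_mul' _ _ ENNReal.ofReal_ne_top,
        lintegral_sub_right_eq_self (fun z => ‖f z‖ₑ ^ 2) t]
    simp only [this]
    rw [lintegral_mul_const _ hmeas, lintegral_mollifier, one_mul]
  · refine AEMeasurable.mul (hmeas.comp measurable_snd).aemeasurable ?_
    exact (hf.comp_quasiMeasurePreserving
      (quasiMeasurePreserving_sub_of_right_invariant volume volume)).enorm.pow_const 2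

theorem eLpNorm_moll_le {f : Plane → E} (hf : AEStronglyMeasurable f) (n : ℕ) :
    eLpNorm (moll n f) 2 volume ≤ eLpNorm f 2 volume := by
  rw [eLpNorm_two_eq, eLpNorm_two_eq]
  exact ENNReal.rpow_le_rpow (lintegral_sq_enorm_moll_le hf n) (by norm_num)

theorem memLp_moll {f : Plane → E} (hf : MemLp f 2 volume) (n : ℕ) : MemLp (moll n f) 2 volume :=
  ⟨(contDiff_moll (hf.locallyIntegrable one_le_two) n).continuous.aestronglyMeasurable,
    (eLpNorm_moll_le hf.1 n).trans_lt hf.2⟩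

theorem l2_moll_le {f : Plane → E} (hf : MemLp f 2 volume) (n : ℕ) :
    l2 volume (moll n f) ≤ l2 volume f :=
  ENNReal.toReal_mono hf.2.ne (eLpNorm_moll_le hf.1 n)

theorem tendstoL2_moll_of_continuous [CompleteSpace E] {g : Plane → E} (hg : Continuous g)
    (hc : HasCompactSupport g) : TendstoL2 volume atTop (fun n => moll n g) g := by
  obtain ⟨M, hM⟩ := hc.exists_bound_of_continuous hg
  have hM0 : 0 ≤ M := (norm_nonneg _).trans (hM 0)
  obtain ⟨r, hr⟩ := hc.isCompact.isBounded.subset_closedBall (0 : Plane)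
  -- Mollification radii are at most 1, so the differences live on a ball one larger than the
  -- support, where 2M dominates them.
  have hb : MemLp ((closedBall (0 : Plane) (r + 1)).indicator (fun _ => 2 * M)) 2 volume :=
    memLp_indicator_const 2 measurableSet_closedBall _ (Or.inr measure_closedBall_lt_top.ne)
  refine TendstoL2.of_dominated hb
    (fun n => (contDiff_moll hg.locallyIntegrable n).continuous.aestronglyMeasurable)
    hg.aestronglyMeasurable ?_ (ae_tendsto_moll hg.locallyIntegrable)
  refine fun n => ae_of_all _ fun z => ?_
  by_cases hz : z ∈ closedBall (0 : Plane) (r + 1)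
  · rw [indicator_of_mem hz, Real.norm_eq_abs, abs_of_nonneg (by positivity), ← dist_eq_norm]
    refine dist_moll_le hg.aestronglyMeasurable fun y _ => ?_
    rw [dist_eq_norm]
    exact (norm_sub_le _ _).trans (by linarith [hM y, hM z])
  · have h0 : ∀ y, dist y z ≤ 1 / ((n : ℝ) + 1) → g y = 0 := by
      intro y hy
      by_contra hne
      apply hz
      have h1 := mem_closedBall_zero_iff.1 (hr (subset_tsupport _ hne))
      have h2 : 1 / ((n : ℝ) + 1) ≤ 1 := by
        rw [div_le_one (by positivity)]; linarith [n.cast_nonneg (α := ℝ)]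
      rw [mem_closedBall_zero_iff]
      have h3 : ‖z‖ ≤ ‖y‖ + dist y z := by
        rw [dist_eq_norm, norm_sub_rev]
        have := norm_add_le y (z - y); simpa using this
      linarith
    have h1 : moll n g z = moll n (fun _ => (0 : E)) z :=
      moll_congr_on (ae_of_all _ h0)
    rw [h1, h0 z (by simp; positivity)]
    simp [moll]

/-- Density of continuous compactly supported g: mollification contracts L², so one third of ε each
covers the mollified f - g, the convergence for g, and g - f. -/
theorem tendstoL2_moll [CompleteSpace E] {f : Plane → E} (hf : MemLp f 2 volume) :
    TendstoL2 volume atTop (fun n => moll n f) f := by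
  unfold TendstoL2
  rw [ENNReal.tendsto_atTop_zero]
  intro ε hε
  have hε3 : ε / 3 ≠ 0 := (ENNReal.div_pos hε.ne' (by simp)).ne'
  obtain ⟨g, hgc, hfg, hg, hgm⟩ := hf.exists_hasCompactSupport_eLpNorm_sub_le
    (by simp : (2 : ENNReal) ≠ ⊤) hε3
  have h3 := tendstoL2_moll_of_continuous hg hgc
  unfold TendstoL2 at h3
  rw [ENNReal.tendsto_atTop_zero] at h3
  obtain ⟨N, hN⟩ := h3 (ε / 3) (pos_iff_ne_zero.2 hε3)
  refine ⟨N, fun n hn => ?_⟩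
  have hfl := hf.locallyIntegrable one_le_two
  have hgl := hgm.locallyIntegrable one_le_two
  have hsplit : (fun z => moll n f z - f z) =
      ((moll n (fun y => f y - g y)) + (fun z => moll n g z - g z)) + (fun z => g z - f z) := by
    ext z
    simp only [Pi.add_apply]
    rw [moll_sub hfl hgl]; abel
  rw [hsplit]
  have hm1 := memLp_moll (hf.sub hgm) n
  have hm2 : MemLp (fun z => moll n g z - g z) 2 volume := (memLp_moll hgm n).sub hgm
  have hm3 : MemLp (fun z => g z - f z) 2 volume := hgm.sub hf
  refine (eLpNorm_add_le (hm1.1.add hm2.1) hm3.1 one_le_two).trans ?_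
  refine (add_le_add_left (eLpNorm_add_le hm1.1 hm2.1 one_le_two) _).trans ?_
  have e1 : eLpNorm (moll n (fun y => f y - g y)) 2 volume ≤ ε / 3 :=
    (eLpNorm_moll_le (hf.sub hgm).1 n).trans hfg
  have e3 : eLpNorm (fun z => g z - f z) 2 volume ≤ ε / 3 := by
    refine le_trans (le_of_eq ?_) hfg
    exact eLpNorm_congr_norm_ae (ae_of_all _ fun z => norm_sub_rev _ _)
  calc _ ≤ ε / 3 + ε / 3 + ε / 3 := add_le_add (add_le_add e1 (hN n hn)) e3
    _ = ε := ENNReal.add_thirds ε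

end Mollify

/-! ### Gradients and weak gradients -/

/-- The coordinate vectors of the plane. -/
noncomputable abbrev stdVec (i : Fin 2) : Plane := EuclideanSpace.single i (1 : ℝ)

theorem gradient_apply (f : Plane → ℝ) (z : Plane) (i : Fin 2) :
    gradient f z i = fderiv ℝ f z (stdVec i) := by
  rw [← inner_gradient_left, EuclideanSpace.inner_single_right]; simp

theorem inner_plane (v w : Plane) : inner ℝ v w = v 0 * w 0 + v 1 * w 1 := by
  simp [PiLp.inner_apply, Fin.sum_univ_two, mul_comm]

theorem norm_sq_plane (v : Plane) : ‖v‖ ^ 2 = v 0 ^ 2 + v 1 ^ 2 := by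
  rw [← real_inner_self_eq_norm_sq, inner_plane]; ring

theorem abs_coord_le (v : Plane) (i : Fin 2) : |v i| ≤ ‖v‖ := by
  simpa using PiLp.norm_apply_le v i

theorem norm_gradient (f : Plane → ℝ) (z : Plane) : ‖gradient f z‖ = ‖fderiv ℝ f z‖ := by
  rw [gradient]; simp

theorem continuous_gradient {f : Plane → ℝ} (hf : ContDiff ℝ ∞ f) : Continuous (gradient f) :=
  (InnerProductSpace.toDual ℝ Plane).symm.continuous.comp
    (hf.continuous_fderiv (by simp))

theorem contDiff_gradient_apply {f : Plane → ℝ} (hf : ContDiff ℝ ∞ f) (i : Fin 2) :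
    ContDiff ℝ ∞ (fun z => gradient f z i) := by
  simp only [gradient_apply]
  exact (hf.fderiv_right (m := ∞) (by simp)).clm_apply contDiff_const

theorem hasCompactSupport_gradient {f : Plane → ℝ} (hf : HasCompactSupport f) :
    HasCompactSupport (gradient f) :=
  (hf.fderiv ℝ).comp_left (g := (InnerProductSpace.toDual ℝ Plane).symm) (map_zero _)

theorem gradient_mul {f g : Plane → ℝ} {z : Plane} (hf : DifferentiableAt ℝ f z)
    (hg : DifferentiableAt ℝ g z) :
    gradient (fun y => f y * g y) z = f z • gradient g z + g z • gradient f z := by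
  ext i
  rw [gradient_apply, fderiv_fun_mul hf hg]
  simp [gradient_apply]

theorem gradient_sub' {f g : Plane → ℝ} {z : Plane} (hf : DifferentiableAt ℝ f z)
    (hg : DifferentiableAt ℝ g z) :
    gradient (fun y => f y - g y) z = gradient f z - gradient g z := by
  ext i
  rw [gradient_apply, fderiv_fun_sub hf hg]
  simp [gradient_apply]

theorem gradient_add' {f g : Plane → ℝ} {z : Plane} (hf : DifferentiableAt ℝ f z)
    (hg : DifferentiableAt ℝ g z) :
    gradient (fun y => f y + g y) z = gradient f z + gradient g z := by
  ext i
  rw [gradient_apply, fderiv_fun_add hf hg]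
  simp [gradient_apply]

theorem gradient_const_mul' {f : Plane → ℝ} {z : Plane} (c : ℝ) (hf : DifferentiableAt ℝ f z) :
    gradient (fun y => c * f y) z = c • gradient f z := by
  ext i
  rw [gradient_apply, fderiv_const_mul hf]
  simp [gradient_apply]

theorem gradient_comp' {f : Plane → ℝ} {F : ℝ → ℝ} {F' : ℝ} {z : Plane}
    (hF : HasDerivAt F F' (f z)) (hf : DifferentiableAt ℝ f z) :
    gradient (fun y => F (f y)) z = F' • gradient f z := by
  ext i
  rw [gradient_apply, (show HasFDerivAt (fun y => F (f y)) _ z from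
    hF.comp_hasFDerivAt z hf.hasFDerivAt).fderiv]
  simp [gradient_apply]

theorem ContDiff.differentiableAt' {f : Plane → ℝ} (hf : ContDiff ℝ ∞ f) {z : Plane} :
    DifferentiableAt ℝ f z := hf.differentiable (by simp) z

theorem IsTestOn.mono {Ω Ω' : Set Plane} {η : Plane → ℝ} (h : IsTestOn Ω η) (hΩ : Ω ⊆ Ω') :
    IsTestOn Ω' η := ⟨h.smooth, h.compact, h.subset.trans hΩ⟩

theorem IsTestOn.eq_zero {Ω : Set Plane} {η : Plane → ℝ} (h : IsTestOn Ω η) {z : Plane}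
    (hz : z ∉ Ω) : η z = 0 := image_eq_zero_of_notMem_tsupport fun h' => hz (h.subset h')

theorem tsupport_gradient_subset (f : Plane → ℝ) : tsupport (gradient f) ⊆ tsupport f :=
  (closure_mono (fun z hz => by
    simp only [Function.mem_support] at hz ⊢
    intro h; apply hz; rw [gradient, h]; simp : Function.support (gradient f) ⊆
      Function.support (fderiv ℝ f))).trans (tsupport_fderiv_subset ℝ)

theorem gradient_eq_zero_of_notMem_tsupport {f : Plane → ℝ} {z : Plane} (hz : z ∉ tsupport f) :
    gradient f z = 0 := image_eq_zero_of_notMem_tsupport fun h => hz (tsupport_gradient_subset f h)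

theorem IsTestOn.gradient_eq_zero {Ω : Set Plane} {η : Plane → ℝ} (h : IsTestOn Ω η) {z : Plane}
    (hz : z ∉ Ω) : gradient η z = 0 :=
  gradient_eq_zero_of_notMem_tsupport fun h' => hz (h.subset h')

theorem IsTestOn.smul_left {Ω : Set Plane} {η f : Plane → ℝ} (h : IsTestOn Ω η)
    (hf : ContDiff ℝ ∞ f) : IsTestOn Ω (fun z => f z * η z) :=
  ⟨hf.mul h.smooth, h.compact.mul_left, (tsupport_mul_subset_right).trans h.subset⟩

theorem IsTestOn.memLp {Ω : Set Plane} {η : Plane → ℝ} (h : IsTestOn Ω η) (μ : Measure Plane)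
    [IsLocallyFiniteMeasure μ] : MemLp η 2 μ :=
  h.smooth.continuous.memLp_of_hasCompactSupport h.compact

theorem IsTestOn.memLp_gradient {Ω : Set Plane} {η : Plane → ℝ} (h : IsTestOn Ω η)
    (μ : Measure Plane) [IsLocallyFiniteMeasure μ] : MemLp (gradient η) 2 μ :=
  (continuous_gradient h.smooth).memLp_of_hasCompactSupport (hasCompactSupport_gradient h.compact)

theorem HasWeakGradientOn.mono {f : Plane → ℝ} {g : Plane → Plane} {Ω Ω' : Set Plane}
    (h : HasWeakGradientOn f g Ω) (hΩ : Ω' ⊆ Ω) : HasWeakGradientOn f g Ω' := by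
  refine ⟨h.1.mono_set hΩ, h.2.1.mono_set hΩ, fun η hη i => ?_⟩
  have := h.2.2 η (hη.mono hΩ) i
  have e1 : ∀ F : Plane → ℝ, (∀ z, z ∉ Ω' → F z = 0) → ∫ z in Ω, F z = ∫ z in Ω', F z := by
    intro F hF
    rw [setIntegral_eq_integral_of_forall_compl_eq_zero hF,
      setIntegral_eq_integral_of_forall_compl_eq_zero (fun z hz => hF z fun h' => hz (hΩ h'))]
  rwa [e1 _ (fun z hz => by simp [hη.gradient_eq_zero hz]),
    e1 _ (fun z hz => by simp [hη.eq_zero hz])] at this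

theorem moll_apply_coord {G : Plane → Plane} (hG : LocallyIntegrable G) (n : ℕ) (z : Plane)
    (i : Fin 2) : moll n G z i = ∫ y, mollifier n (z - y) * G y i := by
  have h1 : Integrable (fun t => mollifier n t • G (z - t)) := integrable_mollifier_smul hG n z
  have h2 := (EuclideanSpace.proj i : Plane →L[ℝ] ℝ).integral_comp_comm h1
  rw [← integral_sub_left_eq_self (fun y => mollifier n (z - y) * G y i) volume z]
  simp only [sub_sub_cancel]
  exact h2.symm

/-- The mollifier centred at z is itself a test function of the ball while its support stays inside,
which `hz` guarantees. Moving the derivative from the kernel to f is then the definition of the weak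
gradient. -/
theorem gradient_moll {f : Plane → ℝ} {g : Plane → Plane} {R : ℝ}
    (hw : HasWeakGradientOn f g (ball 0 R)) (hf : IntegrableOn f (ball 0 R))
    (hg : IntegrableOn g (ball 0 R)) {n : ℕ} {z : Plane} (hz : ‖z‖ + 1 / ((n : ℝ) + 1) < R) :
    gradient (moll n ((ball 0 R).indicator f)) z = moll n ((ball 0 R).indicator g) z := by
  have hF : LocallyIntegrable ((ball (0 : Plane) R).indicator f) :=
    ((integrable_indicator_iff measurableSet_ball).2 hf).locallyIntegrable
  have hG : LocallyIntegrable ((ball (0 : Plane) R).indicator g) :=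
    ((integrable_indicator_iff measurableSet_ball).2 hg).locallyIntegrable
  set η : Plane → ℝ := fun y => mollifier n (z - y) with hη
  have hsupp : tsupport η ⊆ closedBall z (1 / ((n : ℝ) + 1)) := by
    refine closure_minimal (fun y hy => ?_) isClosed_closedBall
    rw [mem_closedBall, dist_comm, dist_eq_norm]
    exact not_lt.1 fun h => hy (mollifier_eq_zero h)
  have htest : IsTestOn (ball 0 R) η := by
    refine ⟨(contDiff_mollifier n).comp (contDiff_const.sub contDiff_id),
      (isCompact_closedBall z _).of_isClosed_subset (isClosed_tsupport _) hsupp, hsupp.trans ?_⟩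
    intro y hy
    rw [mem_ball_zero_iff]
    have h1 : ‖y‖ ≤ ‖z‖ + dist y z := by
      rw [dist_eq_norm]; simpa using norm_add_le z (y - z)
    linarith [mem_closedBall.1 hy]
  ext i
  rw [gradient_apply, moll_apply_coord hG]
  have hd := (hasCompactSupport_mollifier n).hasFDerivAt_convolution_left
    (ContinuousLinearMap.lsmul ℝ ℝ) ((contDiff_mollifier n).of_le (by simp)) hF z
  have hint : Integrable (fun t => (ContinuousLinearMap.precompL Plane
      (ContinuousLinearMap.lsmul ℝ ℝ)) (fderiv ℝ (mollifier n) t)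
      ((ball (0 : Plane) R).indicator f (z - t))) volume :=
    ((hasCompactSupport_mollifier n).fderiv ℝ).convolutionExists_left _
      ((contDiff_mollifier n).continuous_fderiv (by simp)) hF z
  have e1 : fderiv ℝ (moll n ((ball 0 R).indicator f)) z (stdVec i) =
      ∫ t, fderiv ℝ (mollifier n) t (stdVec i) * (ball (0 : Plane) R).indicator f (z - t) := by
    rw [moll_eq_convolution, hd.fderiv, convolution, ContinuousLinearMap.integral_apply hint]
    rfl
  have e2 : ∀ y, gradient η y i = - fderiv ℝ (mollifier n) (z - y) (stdVec i) := by
    intro y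
    have h1 : HasFDerivAt (mollifier n) (fderiv ℝ (mollifier n) (z - y)) (z - y) :=
      ((contDiff_mollifier n).differentiableAt').hasFDerivAt
    have h2 : HasFDerivAt (fun y : Plane => z - y) (-ContinuousLinearMap.id ℝ Plane) y :=
      (hasFDerivAt_id y).const_sub z
    rw [gradient_apply, (show HasFDerivAt η _ y from h1.comp y h2).fderiv]
    simp
  have e3 := hw.2.2 η htest i
  rw [e1, ← integral_sub_left_eq_self (fun t => fderiv ℝ (mollifier n) t (stdVec i) *
    (ball (0 : Plane) R).indicator f (z - t)) volume z]
  simp only [sub_sub_cancel]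
  have e4 : ∀ y, fderiv ℝ (mollifier n) (z - y) (stdVec i) * (ball (0 : Plane) R).indicator f y
      = (ball (0 : Plane) R).indicator (fun y => - (f y * gradient η y i)) y := by
    intro y
    by_cases hy : y ∈ ball (0 : Plane) R
    · rw [indicator_of_mem hy, indicator_of_mem hy, e2]; ring
    · rw [indicator_of_notMem hy, indicator_of_notMem hy, mul_zero]
  have e5 : ∀ y, mollifier n (z - y) * (ball (0 : Plane) R).indicator g y i
      = (ball (0 : Plane) R).indicator (fun y => g y i * η y) y := by
    intro y
    by_cases hy : y ∈ ball (0 : Plane) R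
    · rw [indicator_of_mem hy, indicator_of_mem hy, mul_comm]
    · rw [indicator_of_notMem hy, indicator_of_notMem hy]; simp
  simp only [e4, e5]
  rw [integral_indicator measurableSet_ball, integral_indicator measurableSet_ball, integral_neg,
    e3, neg_neg]

theorem integrableOn_ball_of_locallyIntegrableOn {E : Type*} [NormedAddCommGroup E]
    {f : Plane → E} {r R : ℝ} (hr : r < R)
    (hf : LocallyIntegrableOn f (ball 0 R)) : IntegrableOn f (ball 0 r) :=
  (hf.integrableOn_compact_subset (closedBall_subset_ball hr)
    (isCompact_closedBall 0 r)).mono_set ball_subset_closedBall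

theorem eventually_one_div_lt {δ : ℝ} (hδ : 0 < δ) : ∀ᶠ n : ℕ in atTop, 1 / ((n : ℝ) + 1) < δ :=
  tendsto_one_div_add_atTop_nhds_zero_nat.eventually (gt_mem_nhds hδ)

theorem MemW12Loc.memLp {u : Plane → ℝ} {g : Plane → Plane} {r R : ℝ}
    (h : MemW12Loc u g (ball 0 R)) (hr : r < R) :
    MemLp u 2 (volume.restrict (ball 0 r)) ∧ MemLp g 2 (volume.restrict (ball 0 r)) := by
  constructor
  · rw [memLp_two_iff_integrable_sq
      (integrableOn_ball_of_locallyIntegrableOn hr h.1.1).aestronglyMeasurable]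
    exact integrableOn_ball_of_locallyIntegrableOn hr h.2.1
  · rw [memLp_two_iff_integrable_sq_norm
      (integrableOn_ball_of_locallyIntegrableOn hr h.1.2.1).aestronglyMeasurable]
    exact integrableOn_ball_of_locallyIntegrableOn hr h.2.2

/-- Continuous Sobolev functions are approximated by smooth functions, locally uniformly and with
`L²` convergence of the gradients. -/
theorem exists_smooth_approx {u : Plane → ℝ} {g : Plane → Plane} {r R : ℝ}
    (h : MemW12Loc u g (ball 0 R)) (hu : ContinuousOn u (ball 0 R)) (hr : r < R) :
    ∃ s : ℕ → Plane → ℝ, (∀ n, ContDiff ℝ ∞ (s n)) ∧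
      (∀ ε > 0, ∀ᶠ n in atTop, ∀ z ∈ closedBall (0 : Plane) r, |s n z - u z| ≤ ε) ∧
      TendstoL2 (volume.restrict (ball 0 r)) atTop (fun n => gradient (s n)) g := by
  obtain ⟨R', hrR', hR'R⟩ := exists_between hr
  have hm := h.memLp hR'R
  have hfi := integrableOn_ball_of_locallyIntegrableOn hR'R h.1.1
  have hgi := integrableOn_ball_of_locallyIntegrableOn hR'R h.1.2.1
  have hF := (integrable_indicator_iff measurableSet_ball).2 hfi
  have hG2 : MemLp ((ball (0 : Plane) R').indicator g) 2 volume :=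
    (memLp_indicator_iff_restrict measurableSet_ball).2 hm.2
  refine ⟨fun n => moll n ((ball 0 R').indicator u), fun n => contDiff_moll hF.locallyIntegrable n,
    ?_, ?_⟩
  · intro ε hε
    have huc : UniformContinuousOn u (closedBall 0 R') :=
      (isCompact_closedBall _ _).uniformContinuousOn_of_continuous
        (hu.mono (closedBall_subset_ball hR'R))
    obtain ⟨δ, hδ, hδ'⟩ := Metric.uniformContinuousOn_iff_le.1 huc ε hε
    filter_upwards [eventually_one_div_lt hδ, eventually_one_div_lt (sub_pos.2 hrR')]
      with n hn1 hn2 z hz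
    have hz' : z ∈ ball (0 : Plane) R' :=
      closedBall_subset_ball hrR' hz
    have := dist_moll_le (n := n) (z := z) (ε := ε) hF.aestronglyMeasurable (fun y hy => by
      have hy' : y ∈ ball (0 : Plane) R' := by
        rw [mem_ball_zero_iff]
        have h1 : ‖y‖ ≤ ‖z‖ + dist y z := by
          rw [dist_eq_norm]; simpa using norm_add_le z (y - z)
        linarith [mem_ball.1 hy, mem_closedBall_zero_iff.1 hz]
      rw [indicator_of_mem hy', indicator_of_mem hz']
      exact hδ' y (ball_subset_closedBall hy') z (ball_subset_closedBall hz')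
        ((mem_ball.1 hy).le.trans hn1.le))
    rwa [indicator_of_mem hz', Real.dist_eq] at this
  · refine (((tendstoL2_moll hG2).mono_measure Measure.restrict_le_self).congr'
      (μ := volume.restrict (ball 0 r)) ?_ ?_)
    · filter_upwards [eventually_one_div_lt (sub_pos.2 hrR')] with n hn
      filter_upwards [ae_restrict_mem measurableSet_ball] with z hz
      rw [gradient_moll (h.1.mono (ball_subset_ball hR'R.le)) hfi hgi]
      linarith [mem_ball_zero_iff.1 hz]
    · filter_upwards [ae_restrict_mem measurableSet_ball] with z hz
      rw [indicator_of_mem (ball_subset_ball hrR'.le hz)]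

/-- Functions with bounded weak gradient are almost everywhere Lipschitz. -/
theorem WeakGradientBoundedOn.ae_abs_sub_le {a : Plane → ℝ} {r R L : ℝ} {h : Plane}
    (ha : WeakGradientBoundedOn a (ball 0 R) L) (hr : r + ‖h‖ < R) :
    ∀ᵐ z, z ∈ ball (0 : Plane) r → |a (z + h) - a z| ≤ L * ‖h‖ := by
  obtain ⟨g, hw, hb⟩ := ha
  obtain ⟨R', hrR', hR'R⟩ := exists_between hr
  have hfi := integrableOn_ball_of_locallyIntegrableOn hR'R hw.1
  have hgi := integrableOn_ball_of_locallyIntegrableOn hR'R hw.2.1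
  have hF := (integrable_indicator_iff measurableSet_ball).2 hfi
  have hlim := ae_tendsto_moll hF.locallyIntegrable
  have hlim' := (measurePreserving_add_right volume h).quasiMeasurePreserving.ae hlim
  have hgb : ∀ᵐ y, y ∈ ball (0 : Plane) R → ‖g y‖ ≤ L :=
    (ae_restrict_iff' measurableSet_ball).1 hb.2
  filter_upwards [hlim, hlim'] with z h1 h2 hz
  have hzr := mem_ball_zero_iff.1 hz
  have hz1 : z ∈ ball (0 : Plane) R' := by
    rw [mem_ball_zero_iff]; linarith [norm_nonneg h]
  have hz2' : z + h ∈ ball (0 : Plane) (r + ‖h‖) := by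
    rw [mem_ball_zero_iff]; linarith [norm_add_le z h]
  have hz2 : z + h ∈ ball (0 : Plane) R' := ball_subset_ball hrR'.le hz2'
  rw [indicator_of_mem hz1] at h1
  rw [indicator_of_mem hz2] at h2
  refine le_of_tendsto (h2.sub h1).abs ?_
  filter_upwards [eventually_one_div_lt (sub_pos.2 hrR')] with n hn
  -- On this convex ball the gradient of the mollification is an average of g, hence bounded by L,
  -- and the mean value inequality applies. Convergence at both z and z + h holds for almost every
  -- z.
  have key := (convex_ball (0 : Plane) (r + ‖h‖)).norm_image_sub_le_of_norm_fderiv_le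
    (f := moll n ((ball 0 R').indicator a)) (C := L) (𝕜 := ℝ)
    (fun y _ => (contDiff_moll hF.locallyIntegrable n).differentiableAt') (fun y hy => by
      rw [← norm_gradient, gradient_moll (hw.mono (ball_subset_ball hR'R.le)) hfi hgi
        (by linarith [mem_ball_zero_iff.1 hy])]
      refine norm_moll_le ?_
      filter_upwards [hgb] with x hx hxy
      have hx' : x ∈ ball (0 : Plane) R' := by
        rw [mem_ball_zero_iff]
        have h1 : ‖x‖ ≤ ‖y‖ + dist x y := by
          rw [dist_eq_norm]; simpa using norm_add_le y (x - y)
        linarith [mem_ball_zero_iff.1 hy]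
      rw [indicator_of_mem hx']
      exact hx (ball_subset_ball hR'R.le hx'))
    (mem_ball_zero_iff.2 (by linarith [norm_nonneg h]) : z ∈ ball (0 : Plane) (r + ‖h‖)) hz2'
  simpa using key

/-! ### The bilinear form -/

/-- The flux `A g`. -/
noncomputable def flux (A : Plane → Matrix (Fin 2) (Fin 2) ℝ) (g : Plane → Plane) (z : Plane) :
    Plane := WithLp.toLp 2 (fun i => ∑ j, A z i j * g z j)

/-- The lower order part `W · g + V u`. -/
noncomputable def lowerOrder (W : Plane → Plane) (V : Plane → ℝ) (u : Plane → ℝ) (g : Plane → Plane)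
    (z : Plane) : ℝ := inner ℝ (W z) (g z) + V z * u z

/-- The bilinear form of the operator on the ball of radius `R`, with the gradients as separate
arguments. -/
noncomputable def form (A : Plane → Matrix (Fin 2) (Fin 2) ℝ) (W : Plane → Plane) (V : Plane → ℝ)
    (R : ℝ) (u : Plane → ℝ) (g : Plane → Plane) (v : Plane → ℝ) (k : Plane → Plane) : ℝ :=
  ∫ z in ball (0 : Plane) R, (inner ℝ (flux A g z) (k z) + lowerOrder W V u g z * v z)

theorem weakForm_eq_form (A : Plane → Matrix (Fin 2) (Fin 2) ℝ) (W : Plane → Plane) (V : Plane → ℝ)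
    (R : ℝ) (u : Plane → ℝ) (g : Plane → Plane) (η : Plane → ℝ) :
    weakForm A W V (ball 0 R) u g η = form A W V R u g η (gradient η) := by
  unfold weakForm form
  congr 1; ext z
  simp only [inner_plane, flux, lowerOrder, Fin.sum_univ_two]
  ring

/-- Bounded measurable coefficients with an elliptic leading part on the ball of radius `R`. -/
structure BoundedCoeff (A : Plane → Matrix (Fin 2) (Fin 2) ℝ) (W : Plane → Plane) (V : Plane → ℝ)
    (R lam K : ℝ) : Prop where
  lam_pos : 0 < lam
  K_nonneg : 0 ≤ K
  elliptic : EllipticBoundedOn A (ball 0 R) lam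
  meas : ∀ i j, AEStronglyMeasurable (fun z => A z i j) (volume.restrict (ball 0 R))
  drift : EssBoundedOn W (ball 0 R) K
  potential : EssBoundedOn V (ball 0 R) K

theorem EssBoundedOn.mono {F : Type*} [NormedAddCommGroup F] {f : Plane → F} {Ω Ω' : Set Plane}
    {C C' : ℝ} (h : EssBoundedOn f Ω C) (hΩ : Ω' ⊆ Ω) (hC : C ≤ C') : EssBoundedOn f Ω' C' :=
  ⟨h.1.mono_measure (Measure.restrict_mono hΩ le_rfl),
    (h.2.filter_mono (ae_mono (Measure.restrict_mono hΩ le_rfl))).mono fun _ hz => hz.trans hC⟩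

section Coeff

variable {A : Plane → Matrix (Fin 2) (Fin 2) ℝ} {W : Plane → Plane} {V : Plane → ℝ}
  {R lam K : ℝ} {u v w : Plane → ℝ} {g k : Plane → Plane}

theorem BoundedCoeff.mono (h : BoundedCoeff A W V R lam K) {r : ℝ} (hr : r ≤ R) :
    BoundedCoeff A W V r lam K where
  lam_pos := h.lam_pos
  K_nonneg := h.K_nonneg
  elliptic := fun z hz => h.elliptic z (ball_subset_ball hr hz)
  meas := fun i j => (h.meas i j).mono_measure (Measure.restrict_mono (ball_subset_ball hr) le_rfl)
  drift := h.drift.mono (ball_subset_ball hr) le_rfl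
  potential := h.potential.mono (ball_subset_ball hr) le_rfl

theorem BoundedCoeff.add_const (h : BoundedCoeff A W V R lam K) {μ : ℝ} (hμ : 0 ≤ μ) :
    BoundedCoeff A W (fun z => V z + μ) R lam (K + μ) where
  lam_pos := h.lam_pos
  K_nonneg := add_nonneg h.K_nonneg hμ
  elliptic := h.elliptic
  meas := h.meas
  drift := h.drift.mono subset_rfl (by linarith)
  potential := ⟨h.potential.1.add aestronglyMeasurable_const, h.potential.2.mono fun z hz =>
    (norm_add_le _ _).trans (by rw [Real.norm_of_nonneg hμ]; linarith)⟩

/-- The upper ellipticity bound is used with ξ = Ag and ζ = g, where the double sum is |Ag|²; one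
factor |Ag| is then divided out. -/
theorem EllipticBoundedOn.norm_flux_le {Ω : Set Plane} (h : EllipticBoundedOn A Ω lam) {z : Plane}
    (hz : z ∈ Ω) : ‖flux A g z‖ ≤ lam⁻¹ * ‖g z‖ := by
  have h1 := (h z hz (flux A g z) (g z)).2
  have h2 : ∑ i, ∑ j, A z i j * flux A g z i * g z j = ‖flux A g z‖ ^ 2 := by
    rw [norm_sq_plane]
    simp only [flux, Fin.sum_univ_two]
    ring
  rw [h2] at h1
  rcases eq_or_lt_of_le (norm_nonneg (flux A g z)) with h0 | h0
  · rw [← h0] at h1 ⊢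
    -- Nothing can be divided out when the flux vanishes, and λ is not assumed positive here. The
    -- sign of λ⁻¹|g| comes from the upper bound at ξ = ζ = g.
    by_contra hcon
    push Not at hcon
    have h3 := (h z hz (g z) (g z)).2
    have h4 := (h z hz (g z) (g z)).1
    have h5 : flux A g z = 0 := norm_eq_zero.1 h0.symm
    have h6 : ∑ i, ∑ j, A z i j * g z i * g z j = 0 := by
      have e0 : flux A g z 0 = 0 := by rw [h5]; rfl
      have e1 : flux A g z 1 = 0 := by rw [h5]; rfl
      simp only [flux, Fin.sum_univ_two] at e0 e1 ⊢
      linear_combination (g z 0) * e0 + (g z 1) * e1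
    rw [h6] at h4
    have h7 : 0 < ‖g z‖ := lt_of_le_of_ne (norm_nonneg _) fun h => by simp [← h] at hcon
    nlinarith [mul_neg_of_neg_of_pos hcon h7]
  · refine le_of_mul_le_mul_left ?_ h0
    nlinarith

theorem EllipticBoundedOn.le_inner_flux {Ω : Set Plane} (h : EllipticBoundedOn A Ω lam) {z : Plane}
    (hz : z ∈ Ω) : lam * ‖g z‖ ^ 2 ≤ inner ℝ (flux A g z) (g z) := by
  refine ((h z hz (g z) (g z)).1).trans (le_of_eq ?_)
  simp only [inner_plane, flux, Fin.sum_univ_two]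
  ring

theorem EllipticBoundedOn.abs_entry_le {Ω : Set Plane} (h : EllipticBoundedOn A Ω lam) {z : Plane}
    (hz : z ∈ Ω) (i j : Fin 2) : |A z i j| ≤ lam⁻¹ := by
  have h1 := (h z hz (stdVec i) (stdVec j)).2
  have h2 := (h z hz (stdVec i) (-stdVec j)).2
  rw [abs_le]
  fin_cases i <;> fin_cases j <;> simp at h1 h2 ⊢ <;> constructor <;> linarith

theorem aestronglyMeasurable_flux {μ : Measure Plane}
    (hA : ∀ i j, AEStronglyMeasurable (fun z => A z i j) μ)
    (hg : AEStronglyMeasurable g μ) : AEStronglyMeasurable (flux A g) μ := by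
  have h1 : AEMeasurable (fun z => fun i => ∑ j, A z i j * g z j) μ := by
    refine aemeasurable_pi_lambda _ fun i => ?_
    refine Finset.aemeasurable_fun_sum _ fun j _ => (hA i j).aemeasurable.mul ?_
    exact ((EuclideanSpace.proj j : Plane →L[ℝ] ℝ).continuous.comp_aestronglyMeasurable hg).aemeasurable
  exact ((PiLp.continuous_toLp 2 (fun _ : Fin 2 => ℝ)).measurable.comp_aemeasurable
    h1).aestronglyMeasurable

theorem BoundedCoeff.memLp_flux (h : BoundedCoeff A W V R lam K)
    (hg : MemLp g 2 (volume.restrict (ball 0 R))) :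
    MemLp (flux A g) 2 (volume.restrict (ball 0 R)) :=
  MemLp.of_le_mul hg (aestronglyMeasurable_flux h.meas hg.1)
    ((ae_restrict_mem measurableSet_ball).mono fun _ hz => h.elliptic.norm_flux_le hz)

/-- The quantifiers over u and g stand inside the almost everywhere statement, so that one null set
serves all functions. -/
theorem BoundedCoeff.abs_lower_le (h : BoundedCoeff A W V R lam K) :
    ∀ᵐ z ∂(volume.restrict (ball 0 R)), ∀ (u : Plane → ℝ) (g : Plane → Plane),
      |lowerOrder W V u g z| ≤ K * (‖g z‖ + ‖u z‖) := by
  filter_upwards [h.drift.2, h.potential.2] with z h1 h2 u g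
  unfold lowerOrder
  refine (abs_add_le _ _).trans ?_
  rw [mul_add, abs_mul]
  refine add_le_add ((abs_real_inner_le_norm _ _).trans ?_) ?_
  · exact mul_le_mul_of_nonneg_right h1 (norm_nonneg _)
  · exact mul_le_mul_of_nonneg_right h2 (abs_nonneg _)

theorem BoundedCoeff.memLp_lower (h : BoundedCoeff A W V R lam K)
    (hu : MemLp u 2 (volume.restrict (ball 0 R))) (hg : MemLp g 2 (volume.restrict (ball 0 R))) :
    MemLp (lowerOrder W V u g) 2 (volume.restrict (ball 0 R)) :=
  memLp_of_le_add ((h.drift.1.inner hg.1).add (h.potential.1.mul hu.1)) hg hu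
    (h.abs_lower_le.mono fun _ hz => hz u g)

theorem flux_sub (A : Plane → Matrix (Fin 2) (Fin 2) ℝ) (g k : Plane → Plane) (z : Plane) :
    flux A (fun z => g z - k z) z = flux A g z - flux A k z := by
  ext i
  simp only [flux, Fin.sum_univ_two, PiLp.sub_apply]; ring

theorem lowerOrder_sub (W : Plane → Plane) (V : Plane → ℝ) (u v : Plane → ℝ) (g k : Plane → Plane)
    (z : Plane) : lowerOrder W V (fun z => u z - v z) (fun z => g z - k z) z =
      lowerOrder W V u g z - lowerOrder W V v k z := by
  simp only [lowerOrder, inner_sub_right]; ring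

theorem flux_smul (A : Plane → Matrix (Fin 2) (Fin 2) ℝ) (c : ℝ) (g : Plane → Plane) (z : Plane) :
    flux A (fun z => c • g z) z = c • flux A g z := by
  ext i
  simp only [flux, Fin.sum_univ_two, PiLp.smul_apply, smul_eq_mul]; ring

theorem lowerOrder_smul (W : Plane → Plane) (V : Plane → ℝ) (c : ℝ) (u : Plane → ℝ) (g : Plane → Plane)
    (z : Plane) : lowerOrder W V (fun z => c * u z) (fun z => c • g z) z = c * lowerOrder W V u g z := by
  simp only [lowerOrder, inner_smul_right]; ring

theorem BoundedCoeff.integrable_form (h : BoundedCoeff A W V R lam K)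
    (hu : MemLp u 2 (volume.restrict (ball 0 R))) (hg : MemLp g 2 (volume.restrict (ball 0 R)))
    (hv : MemLp v 2 (volume.restrict (ball 0 R))) (hk : MemLp k 2 (volume.restrict (ball 0 R))) :
    Integrable (fun z => inner ℝ (flux A g z) (k z) + lowerOrder W V u g z * v z)
      (volume.restrict (ball 0 R)) :=
  (integrable_inner_of_memLp (h.memLp_flux hg) hk).add
    (integrable_mul_of_memLp (h.memLp_lower hu hg) hv)

theorem BoundedCoeff.form_eq_add (h : BoundedCoeff A W V R lam K)
    (hu : MemLp u 2 (volume.restrict (ball 0 R))) (hg : MemLp g 2 (volume.restrict (ball 0 R)))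
    (hv : MemLp v 2 (volume.restrict (ball 0 R))) (hk : MemLp k 2 (volume.restrict (ball 0 R))) :
    form A W V R u g v k = (∫ z in ball (0 : Plane) R, inner ℝ (flux A g z) (k z)) +
      ∫ z in ball (0 : Plane) R, lowerOrder W V u g z * v z :=
  integral_add (integrable_inner_of_memLp (h.memLp_flux hg) hk)
    (integrable_mul_of_memLp (h.memLp_lower hu hg) hv)

theorem BoundedCoeff.form_sub_left (h : BoundedCoeff A W V R lam K)
    {u' : Plane → ℝ} {g' : Plane → Plane}
    (hu : MemLp u 2 (volume.restrict (ball 0 R))) (hg : MemLp g 2 (volume.restrict (ball 0 R)))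
    (hu' : MemLp u' 2 (volume.restrict (ball 0 R))) (hg' : MemLp g' 2 (volume.restrict (ball 0 R)))
    (hv : MemLp v 2 (volume.restrict (ball 0 R))) (hk : MemLp k 2 (volume.restrict (ball 0 R))) :
    form A W V R (fun z => u z - u' z) (fun z => g z - g' z) v k =
      form A W V R u g v k - form A W V R u' g' v k := by
  unfold form
  rw [← integral_sub (h.integrable_form hu hg hv hk) (h.integrable_form hu' hg' hv hk)]
  congr 1; ext z
  rw [flux_sub, lowerOrder_sub, inner_sub_left]; ring

theorem form_smul_left (c : ℝ) :
    form A W V R (fun z => c * u z) (fun z => c • g z) v k = c * form A W V R u g v k := by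
  unfold form
  rw [← integral_const_mul]
  congr 1; ext z
  rw [flux_smul, lowerOrder_smul, real_inner_smul_left]; ring

theorem BoundedCoeff.form_add_const (h : BoundedCoeff A W V R lam K) (μ : ℝ)
    (hu : MemLp u 2 (volume.restrict (ball 0 R))) (hg : MemLp g 2 (volume.restrict (ball 0 R)))
    (hv : MemLp v 2 (volume.restrict (ball 0 R))) (hk : MemLp k 2 (volume.restrict (ball 0 R))) :
    form A W (fun z => V z + μ) R u g v k =
      form A W V R u g v k + μ * ∫ z in ball (0 : Plane) R, u z * v z := by
  unfold form
  rw [← integral_const_mul, ← integral_add (h.integrable_form hu hg hv hk)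
    ((integrable_mul_of_memLp hu hv).const_mul μ)]
  congr 1; ext z
  simp only [lowerOrder]; ring

theorem BoundedCoeff.tendsto_form_right {ι : Type*} {l : Filter ι}
    (h : BoundedCoeff A W V R lam K)
    (hu : MemLp u 2 (volume.restrict (ball 0 R))) (hg : MemLp g 2 (volume.restrict (ball 0 R)))
    {vs : ι → Plane → ℝ} {ks : ι → Plane → Plane}
    (hvs : ∀ n, MemLp (vs n) 2 (volume.restrict (ball 0 R)))
    (hks : ∀ n, MemLp (ks n) 2 (volume.restrict (ball 0 R)))
    (hv : MemLp v 2 (volume.restrict (ball 0 R))) (hk : MemLp k 2 (volume.restrict (ball 0 R)))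
    (hvl : TendstoL2 (volume.restrict (ball 0 R)) l vs v)
    (hkl : TendstoL2 (volume.restrict (ball 0 R)) l ks k) :
    Tendsto (fun n => form A W V R u g (vs n) (ks n)) l (𝓝 (form A W V R u g v k)) := by
  rw [h.form_eq_add hu hg hv hk]
  simp only [fun n => h.form_eq_add hu hg (hvs n) (hks n)]
  exact (hkl.inner (h.memLp_flux hg) hks hk).add (hvl.mul (h.memLp_lower hu hg) hvs hv)

theorem BoundedCoeff.tendstoL2_flux {ι : Type*} {l : Filter ι} (h : BoundedCoeff A W V R lam K)
    {gs : ι → Plane → Plane} (hgl : TendstoL2 (volume.restrict (ball 0 R)) l gs g) :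
    TendstoL2 (volume.restrict (ball 0 R)) l (fun n => flux A (gs n)) (flux A g) :=
  hgl.of_le lam⁻¹ (Eventually.of_forall fun n =>
    (ae_restrict_mem measurableSet_ball).mono fun z hz => by
      rw [← flux_sub]; exact h.elliptic.norm_flux_le hz)

theorem BoundedCoeff.tendsto_form_left {ι : Type*} {l : Filter ι}
    (h : BoundedCoeff A W V R lam K)
    {us : ι → Plane → ℝ} {gs : ι → Plane → Plane}
    (hus : ∀ n, MemLp (us n) 2 (volume.restrict (ball 0 R)))
    (hgs : ∀ n, MemLp (gs n) 2 (volume.restrict (ball 0 R)))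
    (hu : MemLp u 2 (volume.restrict (ball 0 R))) (hg : MemLp g 2 (volume.restrict (ball 0 R)))
    (hv : MemLp v 2 (volume.restrict (ball 0 R))) (hk : MemLp k 2 (volume.restrict (ball 0 R)))
    (hul : TendstoL2 (volume.restrict (ball 0 R)) l us u)
    (hgl : TendstoL2 (volume.restrict (ball 0 R)) l gs g) :
    Tendsto (fun n => form A W V R (us n) (gs n) v k) l (𝓝 (form A W V R u g v k)) := by
  rw [h.form_eq_add hu hg hv hk]
  simp only [fun n => h.form_eq_add (hus n) (hgs n) hv hk]
  have h1 := (h.tendstoL2_flux hgl).inner hk (fun n => h.memLp_flux (hgs n)) (h.memLp_flux hg)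
  have h2 : TendstoL2 (volume.restrict (ball 0 R)) l (fun n => lowerOrder W V (us n) (gs n))
      (lowerOrder W V u g) := by
    have h3 := (hgl.of_le 1 (s' := fun n z => ‖gs n z - g z‖) (f' := fun _ => (0 : ℝ))
      (Eventually.of_forall fun n => ae_of_all _ fun z => by simp)).add
      (hul.of_le 1 (s' := fun n z => ‖us n z - u z‖) (f' := fun _ => (0 : ℝ))
      (Eventually.of_forall fun n => ae_of_all _ fun z => by simp))
      (fun n => ((hgs n).sub hg).1.norm) aestronglyMeasurable_const
      (fun n => ((hus n).sub hu).1.norm) aestronglyMeasurable_const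
    refine h3.of_le K (Eventually.of_forall fun n => h.abs_lower_le.mono fun z hz => ?_)
    have := hz (fun z => us n z - u z) (fun z => gs n z - g z)
    rw [lowerOrder_sub] at this
    rw [add_zero, sub_zero, Real.norm_of_nonneg (add_nonneg (norm_nonneg (gs n z - g z))
      (norm_nonneg (us n z - u z)))]
    exact this
  have h4 := h2.mul hv (fun n => h.memLp_lower (hus n) (hgs n)) (h.memLp_lower hu hg)
  have e1 : ∀ G, ∫ z in ball (0 : Plane) R, inner ℝ (k z) (flux A G z) =
      ∫ z in ball (0 : Plane) R, inner ℝ (flux A G z) (k z) := fun G => by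
    congr 1; ext z; exact real_inner_comm _ _
  have e2 : ∀ f : Plane → ℝ, ∫ z in ball (0 : Plane) R, v z * f z =
      ∫ z in ball (0 : Plane) R, f z * v z := fun f => by
    congr 1; ext z; exact mul_comm _ _
  simp only [e1] at h1
  simp only [e2] at h4
  exact h1.add h4

end Coeff

/-! ### The comparison principle -/

/-- A smooth regularisation of the positive part. -/
noncomputable def smoothPos (t : ℝ) : ℝ := t * expNegInvGlue t

/-- The derivative of `smoothPos`. -/
noncomputable def smoothPosDeriv (t : ℝ) : ℝ := (1 + t⁻¹) * expNegInvGlue t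

theorem contDiff_smoothPos : ContDiff ℝ ∞ smoothPos := contDiff_id.mul expNegInvGlue.contDiff

theorem hasDerivAt_smoothPos (t : ℝ) : HasDerivAt smoothPos (smoothPosDeriv t) t := by
  have h := expNegInvGlue.hasDerivAt_polynomial_eval_inv_mul (1 : Polynomial ℝ) t
  simp only [Polynomial.eval_one, one_mul] at h
  have h2 := (hasDerivAt_id t).mul h
  refine h2.congr_deriv ?_
  rcases eq_or_ne t 0 with rfl | ht
  · simp [smoothPosDeriv, expNegInvGlue.zero]
  · simp [smoothPosDeriv]
    field_simp

theorem continuous_smoothPosDeriv : Continuous smoothPosDeriv := by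
  have : smoothPosDeriv = deriv smoothPos := by
    ext t; exact (hasDerivAt_smoothPos t).deriv.symm
  rw [this]
  exact contDiff_smoothPos.continuous_deriv (by simp)

theorem smoothPos_of_nonpos {t : ℝ} (ht : t ≤ 0) : smoothPos t = 0 := by
  simp [smoothPos, expNegInvGlue.zero_of_nonpos ht]

theorem smoothPosDeriv_of_nonpos {t : ℝ} (ht : t ≤ 0) : smoothPosDeriv t = 0 := by
  simp [smoothPosDeriv, expNegInvGlue.zero_of_nonpos ht]

theorem smoothPos_pos {t : ℝ} (ht : 0 < t) : 0 < smoothPos t :=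
  mul_pos ht (expNegInvGlue.pos_of_pos ht)

theorem smoothPos_nonneg (t : ℝ) : 0 ≤ smoothPos t := by
  rcases le_or_gt t 0 with h | h
  · rw [smoothPos_of_nonpos h]
  · exact (smoothPos_pos h).le

theorem smoothPosDeriv_nonneg (t : ℝ) : 0 ≤ smoothPosDeriv t := by
  rcases le_or_gt t 0 with h | h
  · rw [smoothPosDeriv_of_nonpos h]
  · exact mul_nonneg (by positivity) (expNegInvGlue.nonneg t)

/-- This is 1 + x ≤ eˣ at x = 1/t. It makes the regularised positive part 1-Lipschitz, so that
composition with it preserves L² and L² convergence. -/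
theorem smoothPosDeriv_le_one (t : ℝ) : smoothPosDeriv t ≤ 1 := by
  rcases le_or_gt t 0 with h | h
  · rw [smoothPosDeriv_of_nonpos h]; exact zero_le_one
  · rw [smoothPosDeriv, expNegInvGlue, if_neg (not_le.2 h)]
    have := Real.add_one_le_exp t⁻¹
    calc (1 + t⁻¹) * Real.exp (-t⁻¹) ≤ Real.exp t⁻¹ * Real.exp (-t⁻¹) := by
          gcongr; linarith
      _ = 1 := by rw [← Real.exp_add]; simp

/-- In the comparison principle the elliptic term carries the derivative of `smoothPos` and the
drift term carries `smoothPos` itself; this bound lets the first absorb the second. -/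
theorem smoothPos_le_mul_deriv (t : ℝ) : smoothPos t ≤ t * smoothPosDeriv t := by
  rcases le_or_gt t 0 with h | h
  · rw [smoothPos_of_nonpos h, smoothPosDeriv_of_nonpos h, mul_zero]
  · have : t * smoothPosDeriv t = (t + 1) * expNegInvGlue t := by
      rw [smoothPosDeriv]; field_simp
    rw [this, smoothPos]
    nlinarith [expNegInvGlue.nonneg t]

theorem abs_smoothPos_sub_le (a b : ℝ) : |smoothPos a - smoothPos b| ≤ |a - b| := by
  have := convex_univ.norm_image_sub_le_of_norm_hasDerivWithin_le (f := smoothPos) (C := 1)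
    (fun x _ => (hasDerivAt_smoothPos x).hasDerivWithinAt) (fun x _ => by
      rw [Real.norm_of_nonneg (smoothPosDeriv_nonneg x)]; exact smoothPosDeriv_le_one x)
    (mem_univ b) (mem_univ a)
  simpa using this

theorem memLp_ball_of_continuous {E : Type*} [NormedAddCommGroup E] {f : Plane → E}
    (hf : Continuous f) (R : ℝ) : MemLp f 2 (volume.restrict (ball (0 : Plane) R)) := by
  have h1 : MemLp f 2 (volume.restrict (closedBall (0 : Plane) R)) := by
    obtain ⟨C, hC⟩ := (isCompact_closedBall (0 : Plane) R).exists_bound_of_continuousOn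
      hf.continuousOn
    have : IsFiniteMeasure (volume.restrict (closedBall (0 : Plane) R)) :=
      ⟨by rw [Measure.restrict_apply_univ]; exact measure_closedBall_lt_top⟩
    exact MemLp.of_bound hf.aestronglyMeasurable C
      ((ae_restrict_mem measurableSet_closedBall).mono fun z hz => hC z hz)
  exact h1.mono_measure (Measure.restrict_mono ball_subset_closedBall le_rfl)

/-- Extension by zero is smooth because the function already vanishes in Ω near the boundary. Values
of f outside Ω are irrelevant, which suits approximations that are controlled only inside a ball. -/
theorem isTestOn_indicator {Ω K : Set Plane} (hΩ : IsOpen Ω) {f : Plane → ℝ}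
    (hf : ContDiff ℝ ∞ f) (hK : IsCompact K) (hKΩ : K ⊆ Ω) (h0 : ∀ z ∈ Ω, z ∉ K → f z = 0) :
    IsTestOn Ω (Ω.indicator f) := by
  have hsub : tsupport (Ω.indicator f) ⊆ K := by
    refine closure_minimal (fun z hz => ?_) hK.isClosed
    by_contra hzK
    apply hz
    by_cases hzΩ : z ∈ Ω
    · rw [indicator_of_mem hzΩ, h0 z hzΩ hzK]
    · rw [indicator_of_notMem hzΩ]
  refine ⟨?_, hK.of_isClosed_subset (isClosed_tsupport _) hsub, hsub.trans hKΩ⟩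
  rw [contDiff_iff_contDiffAt]
  intro z
  by_cases hz : z ∈ Ω
  · refine hf.contDiffAt.congr_of_eventuallyEq ?_
    filter_upwards [hΩ.mem_nhds hz] with y hy
    rw [indicator_of_mem hy]
  · have hzK : z ∈ Kᶜ := fun h => hz (hKΩ h)
    refine (contDiffAt_const (c := (0 : ℝ))).congr_of_eventuallyEq ?_
    filter_upwards [hK.isClosed.isOpen_compl.mem_nhds hzK] with y hy
    by_cases hyΩ : y ∈ Ω
    · rw [indicator_of_mem hyΩ, h0 y hyΩ hy]
    · rw [indicator_of_notMem hyΩ]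

theorem gradient_indicator {Ω : Set Plane} (hΩ : IsOpen Ω) (f : Plane → ℝ) {z : Plane}
    (hz : z ∈ Ω) : gradient (Ω.indicator f) z = gradient f z := by
  refine Filter.EventuallyEq.gradient_eq ?_
  filter_upwards [hΩ.mem_nhds hz] with y hy
  rw [indicator_of_mem hy]

/-- `(u, g)` is the limit in `H¹` of the ball of radius `R` of the smooth functions `s n`. -/
structure H1Approx (R : ℝ) (u : Plane → ℝ) (g : Plane → Plane) (s : ℕ → Plane → ℝ) : Prop where
  memLp : MemLp u 2 (volume.restrict (ball 0 R))
  memLp_grad : MemLp g 2 (volume.restrict (ball 0 R))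
  smooth : ∀ n, ContDiff ℝ ∞ (s n)
  tendsto : TendstoL2 (volume.restrict (ball 0 R)) atTop s u
  tendsto_grad : TendstoL2 (volume.restrict (ball 0 R)) atTop (fun n => gradient (s n)) g

theorem H1Approx.of_contDiff {f : Plane → ℝ} (hf : ContDiff ℝ ∞ f) (R : ℝ) :
    H1Approx R f (gradient f) (fun _ => f) :=
  ⟨memLp_ball_of_continuous hf.continuous R, memLp_ball_of_continuous (continuous_gradient hf) R,
    fun _ => hf, TendstoL2.const _, TendstoL2.const _⟩

theorem H1Approx.subseq {R : ℝ} {u : Plane → ℝ} {g : Plane → Plane} {s : ℕ → Plane → ℝ}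
    (h : H1Approx R u g s) {p : ℕ → ℕ} (hp : Tendsto p atTop atTop) :
    H1Approx R u g (fun n => s (p n)) :=
  ⟨h.memLp, h.memLp_grad, fun n => h.smooth _, h.tendsto.comp hp, h.tendsto_grad.comp hp⟩

theorem H1Approx.sub {R : ℝ} {u v : Plane → ℝ} {g k : Plane → Plane} {s t : ℕ → Plane → ℝ}
    (h : H1Approx R u g s) (h' : H1Approx R v k t) :
    H1Approx R (fun z => u z - v z) (fun z => g z - k z) (fun n z => s n z - t n z) := by
  refine ⟨h.memLp.sub h'.memLp, h.memLp_grad.sub h'.memLp_grad,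
    fun n => (h.smooth n).sub (h'.smooth n), ?_, ?_⟩
  · exact h.tendsto.sub h'.tendsto (fun n => (h.smooth n).continuous.aestronglyMeasurable) h.memLp.1
      (fun n => (h'.smooth n).continuous.aestronglyMeasurable) h'.memLp.1
  · have := h.tendsto_grad.sub h'.tendsto_grad
      (fun n => (continuous_gradient (h.smooth n)).aestronglyMeasurable) h.memLp_grad.1
      (fun n => (continuous_gradient (h'.smooth n)).aestronglyMeasurable) h'.memLp_grad.1
    convert this using 3 with n z
    exact gradient_sub' (h.smooth n).differentiableAt' (h'.smooth n).differentiableAt'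

theorem H1Approx.add {R : ℝ} {u v : Plane → ℝ} {g k : Plane → Plane} {s t : ℕ → Plane → ℝ}
    (h : H1Approx R u g s) (h' : H1Approx R v k t) :
    H1Approx R (fun z => u z + v z) (fun z => g z + k z) (fun n z => s n z + t n z) := by
  refine ⟨h.memLp.add h'.memLp, h.memLp_grad.add h'.memLp_grad,
    fun n => (h.smooth n).add (h'.smooth n), ?_, ?_⟩
  · exact h.tendsto.add h'.tendsto (fun n => (h.smooth n).continuous.aestronglyMeasurable) h.memLp.1
      (fun n => (h'.smooth n).continuous.aestronglyMeasurable) h'.memLp.1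
  · have := h.tendsto_grad.add h'.tendsto_grad
      (fun n => (continuous_gradient (h.smooth n)).aestronglyMeasurable) h.memLp_grad.1
      (fun n => (continuous_gradient (h'.smooth n)).aestronglyMeasurable) h'.memLp_grad.1
    convert this using 3 with n z
    exact gradient_add' (h.smooth n).differentiableAt' (h'.smooth n).differentiableAt'

theorem H1Approx.const_mul {R : ℝ} {u : Plane → ℝ} {g : Plane → Plane} {s : ℕ → Plane → ℝ}
    (h : H1Approx R u g s) (c : ℝ) :
    H1Approx R (fun z => c * u z) (fun z => c • g z) (fun n z => c * s n z) := by
  refine ⟨h.memLp.const_mul c, h.memLp_grad.const_smul c,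
    fun n => contDiff_const.mul (h.smooth n), ?_, ?_⟩
  · exact h.tendsto.of_le |c| (Eventually.of_forall fun n => ae_of_all _ fun z => by
      rw [← mul_sub, norm_mul, Real.norm_eq_abs])
  · exact h.tendsto_grad.of_le |c| (Eventually.of_forall fun n => ae_of_all _ fun z => by
      rw [gradient_const_mul' c (h.smooth n).differentiableAt', ← smul_sub, norm_smul,
        Real.norm_eq_abs])

/-- The chain rule for the smooth regularisation of the positive part. -/
theorem H1Approx.tendsto_smoothPos {R : ℝ} {w : Plane → ℝ} {g : Plane → Plane} {s : ℕ → Plane → ℝ}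
    (h : H1Approx R w g s) : ∃ p : ℕ → ℕ, StrictMono p ∧
    TendstoL2 (volume.restrict (ball 0 R)) atTop (fun n z => smoothPos (s (p n) z))
      (fun z => smoothPos (w z)) ∧
    TendstoL2 (volume.restrict (ball 0 R)) atTop
      (fun n z => smoothPosDeriv (s (p n) z) • gradient (s (p n)) z)
      (fun z => smoothPosDeriv (w z) • g z) := by
  obtain ⟨p, hp, hae⟩ := h.tendsto.exists_subseq_ae
    (fun n => (h.smooth n).continuous.aestronglyMeasurable) h.memLp.1
  have h' := h.subseq hp.tendsto_atTop
  refine ⟨p, hp, ?_, ?_⟩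
  · refine h'.tendsto.of_le 1 (Eventually.of_forall fun n => ae_of_all _ fun z => ?_)
    rw [one_mul]; exact abs_smoothPos_sub_le _ _
  · have hcs : ∀ n, Continuous (fun z => smoothPosDeriv (s (p n) z)) :=
      fun n => continuous_smoothPosDeriv.comp (h'.smooth n).continuous
    have hw : AEStronglyMeasurable (fun z => smoothPosDeriv (w z))
        (volume.restrict (ball (0 : Plane) R)) :=
      continuous_smoothPosDeriv.comp_aestronglyMeasurable h.memLp.1
    -- With F = `smoothPos`, the difference F'(s)∇s - F'(w)g is F'(s)(∇s - g), controlled by F' ≤ 1,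
    -- plus (F'(s) - F'(w))g, which tends to zero by dominated convergence along the almost
    -- everywhere convergent subsequence.
    have t1 : TendstoL2 (volume.restrict (ball 0 R)) atTop
        (fun n z => smoothPosDeriv (s (p n) z) • (gradient (s (p n)) z - g z)) (fun _ => 0) := by
      refine h'.tendsto_grad.of_le 1 (Eventually.of_forall fun n => ae_of_all _ fun z => ?_)
      rw [sub_zero, norm_smul, Real.norm_of_nonneg (smoothPosDeriv_nonneg _)]
      exact mul_le_mul_of_nonneg_right (smoothPosDeriv_le_one _) (norm_nonneg _)
    have t2 : TendstoL2 (volume.restrict (ball 0 R)) atTop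
        (fun n z => smoothPosDeriv (s (p n) z) • g z) (fun z => smoothPosDeriv (w z) • g z) := by
      refine TendstoL2.of_dominated h.memLp_grad
        (fun n => (hcs n).aestronglyMeasurable.smul h.memLp_grad.1)
        (hw.smul h.memLp_grad.1) (fun n => ae_of_all _ fun z => ?_) ?_
      · rw [← sub_smul, norm_smul]
        refine mul_le_of_le_one_left (norm_nonneg _) ?_
        rw [Real.norm_eq_abs, abs_le]
        constructor <;> linarith [smoothPosDeriv_nonneg (w z), smoothPosDeriv_nonneg (s (p n) z),
          smoothPosDeriv_le_one (w z), smoothPosDeriv_le_one (s (p n) z)]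
      · filter_upwards [hae] with z hz
        exact ((continuous_smoothPosDeriv.tendsto _).comp hz).smul_const _
    have t3 := t1.add t2
      (fun n => (hcs n).aestronglyMeasurable.smul
        ((continuous_gradient (h'.smooth n)).aestronglyMeasurable.sub h.memLp_grad.1))
      aestronglyMeasurable_const (fun n => (hcs n).aestronglyMeasurable.smul h.memLp_grad.1)
      (hw.smul h.memLp_grad.1)
    refine t3.congr' (Eventually.of_forall fun n => ae_of_all _ fun z => ?_)
      (ae_of_all _ fun z => ?_)
    · simp only [← smul_add, sub_add_cancel]
    · simp only [zero_add]

/-- Weak comparison principle for operators with large potential. -/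
theorem ae_nonpos_of_form_nonpos {A : Plane → Matrix (Fin 2) (Fin 2) ℝ} {W : Plane → Plane}
    {V : Plane → ℝ} {R lam K K' : ℝ} (hc : BoundedCoeff A W V R lam K)
    (hW : ∀ᵐ z ∂volume.restrict (ball (0 : Plane) R), ‖W z‖ ≤ K')
    (hV : ∀ᵐ z ∂volume.restrict (ball (0 : Plane) R), K' ^ 2 / (4 * lam) + 1 ≤ V z)
    {w : Plane → ℝ} {g : Plane → Plane} {s : ℕ → Plane → ℝ} (hs : H1Approx R w g s)
    (hK : ∀ᶠ n in atTop, ∃ K : Set Plane, IsCompact K ∧ K ⊆ ball 0 R ∧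
      ∀ z ∈ ball (0 : Plane) R, z ∉ K → s n z ≤ 0)
    (hform : ∀ η, IsTestOn (ball 0 R) η → (∀ z, 0 ≤ η z) →
      form A W V R w g η (gradient η) ≤ 0) :
    ∀ᵐ z ∂volume.restrict (ball (0 : Plane) R), w z ≤ 0 := by
  obtain ⟨p, hp, t1, t2⟩ := hs.tendsto_smoothPos
  have hcw : MemLp (fun z => smoothPos (w z)) 2 (volume.restrict (ball (0 : Plane) R)) :=
    MemLp.of_le_mul (c := 1) hs.memLp
      (contDiff_smoothPos.continuous.comp_aestronglyMeasurable hs.memLp.1) (ae_of_all _ fun z => by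
        have := abs_smoothPos_sub_le (w z) 0
        rw [smoothPos_of_nonpos le_rfl, sub_zero, sub_zero] at this
        simpa using this)
  have hcg : MemLp (fun z => smoothPosDeriv (w z) • g z) 2 (volume.restrict (ball (0 : Plane) R)) :=
    MemLp.of_le_mul (c := 1) hs.memLp_grad
      ((continuous_smoothPosDeriv.comp_aestronglyMeasurable hs.memLp.1).smul hs.memLp_grad.1)
      (ae_of_all _ fun z => by
        rw [norm_smul, Real.norm_of_nonneg (smoothPosDeriv_nonneg _)]
        exact mul_le_mul_of_nonneg_right (smoothPosDeriv_le_one _) (norm_nonneg _))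
  have hlim := hc.tendsto_form_right hs.memLp hs.memLp_grad
    (fun n => memLp_ball_of_continuous (contDiff_smoothPos.comp (hs.smooth (p n))).continuous R)
    (fun n => memLp_ball_of_continuous
      ((continuous_smoothPosDeriv.comp (hs.smooth (p n)).continuous).smul
        (continuous_gradient (hs.smooth (p n)))) R) hcw hcg t1 t2
  -- Since the approximation is eventually nonpositive off a compact set, its regularised positive
  -- part, extended by zero, is an admissible test function; the inequality survives the limit.
  have hle : form A W V R w g (fun z => smoothPos (w z)) (fun z => smoothPosDeriv (w z) • g z) ≤ 0 := by
    refine le_of_tendsto hlim ?_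
    filter_upwards [hp.tendsto_atTop.eventually hK] with n hn
    obtain ⟨K, hKc, hKs, hK0⟩ := hn
    have htest : IsTestOn (ball 0 R) ((ball 0 R).indicator (fun z => smoothPos (s (p n) z))) :=
      isTestOn_indicator isOpen_ball (contDiff_smoothPos.comp (hs.smooth (p n))) hKc hKs
        fun z hz hzK => smoothPos_of_nonpos (hK0 z hz hzK)
    refine le_trans (le_of_eq ?_) (hform _ htest fun z => indicator_nonneg
      (fun z _ => smoothPos_nonneg _) z)
    unfold form
    refine setIntegral_congr_fun measurableSet_ball fun z hz => ?_
    simp only [indicator_of_mem hz, gradient_indicator isOpen_ball _ hz]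
    rw [gradient_comp' (hasDerivAt_smoothPos _) (hs.smooth (p n)).differentiableAt']
    rfl
  have hpt : ∀ᵐ z ∂volume.restrict (ball (0 : Plane) R), w z * smoothPos (w z) ≤
      inner ℝ (flux A g z) (smoothPosDeriv (w z) • g z) + lowerOrder W V w g z * smoothPos (w z) := by
    filter_upwards [hW, hV, ae_restrict_mem measurableSet_ball] with z h1 h2 hz
    rcases le_or_gt (w z) 0 with h0 | h0
    · simp [smoothPos_of_nonpos h0, smoothPosDeriv_of_nonpos h0]
    have hF := smoothPos_pos h0
    have hF1 := smoothPos_le_mul_deriv (w z)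
    have hell := hc.elliptic.le_inner_flux (g := g) hz
    have hlam := hc.lam_pos
    rw [real_inner_smul_right, lowerOrder]
    set F := smoothPos (w z)
    set F' := smoothPosDeriv (w z)
    set a := inner ℝ (flux A g z) (g z)
    have hb : -(K' * ‖g z‖) ≤ inner ℝ (W z) (g z) := by
      have := abs_real_inner_le_norm (W z) (g z)
      have h3 := mul_le_mul_of_nonneg_right h1 (norm_nonneg (g z))
      linarith [neg_abs_le (inner ℝ (W z) (g z))]
    have hq : (K' ^ 2 / (4 * lam) + 1) * (w z * F) ≤ V z * (w z * F) :=
      mul_le_mul_of_nonneg_right h2 (by positivity)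
    have hF'pos : F / w z ≤ F' := by rw [div_le_iff₀ h0]; linarith
    have h5 : F / w z * (lam * ‖g z‖ ^ 2) ≤ F' * a :=
      mul_le_mul hF'pos hell (by positivity) (smoothPosDeriv_nonneg _)
    -- Completing the square in |g|: the drift term K'|g|F costs exactly K'²/(4λ) times wF. The
    -- lower bound on V pays for this and leaves wF.
    have h6 : 0 ≤ F / w z * (lam * (‖g z‖ - K' / (2 * lam) * w z) ^ 2) := by positivity
    have h7 : F / w z * (lam * (‖g z‖ - K' / (2 * lam) * w z) ^ 2) =
        F / w z * (lam * ‖g z‖ ^ 2) - K' * ‖g z‖ * F + K' ^ 2 / (4 * lam) * (w z * F) := by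
      field_simp; ring
    have h8 := mul_le_mul_of_nonneg_right hb hF.le
    nlinarith
  have hint := hc.integrable_form hs.memLp hs.memLp_grad hcw hcg
  have hint2 : Integrable (fun z => w z * smoothPos (w z)) (volume.restrict (ball (0 : Plane) R)) :=
    integrable_mul_of_memLp hs.memLp hcw
  have hnn : ∀ z, 0 ≤ w z * smoothPos (w z) := fun z => by
    rcases le_or_gt (w z) 0 with h0 | h0
    · rw [smoothPos_of_nonpos h0, mul_zero]
    · exact mul_nonneg h0.le (smoothPos_nonneg _)
  have h0 : ∫ z in ball (0 : Plane) R, w z * smoothPos (w z) = 0 :=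
    le_antisymm ((integral_mono_ae hint2 hint hpt).trans hle) (integral_nonneg hnn)
  rw [integral_eq_zero_iff_of_nonneg hnn hint2] at h0
  filter_upwards [h0] with z hz
  by_contra hcon
  push Not at hcon
  exact (mul_pos hcon (smoothPos_pos hcon)).ne' hz

/-! ### Smooth sub- and supersolutions -/

theorem IsTestOn.integral_mul_gradient {Ω : Set Plane} {η f : Plane → ℝ} (hη : IsTestOn Ω η)
    (hf : ContDiff ℝ ∞ f) (i : Fin 2) :
    ∫ z in Ω, f z * gradient η z i = - ∫ z in Ω, gradient f z i * η z := by
  rw [setIntegral_eq_integral_of_forall_compl_eq_zero (fun z hz => by simp [hη.gradient_eq_zero hz]),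
    setIntegral_eq_integral_of_forall_compl_eq_zero (fun z hz => by simp [hη.eq_zero hz])]
  simp only [gradient_apply]
  have hfd : Continuous (fun z => fderiv ℝ f z (stdVec i)) := by
    simpa only [gradient_apply] using (contDiff_gradient_apply hf i).continuous
  have hηd : Continuous (fun z => fderiv ℝ η z (stdVec i)) := by
    simpa only [gradient_apply] using (contDiff_gradient_apply hη.smooth i).continuous
  have hcd : HasCompactSupport (fun z => fderiv ℝ η z (stdVec i)) :=
    hη.compact.fderiv_apply ℝ (stdVec i)
  refine integral_mul_fderiv_eq_neg_fderiv_mul_of_integrable ?_ ?_ ?_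
    (fun z _ => hf.differentiableAt') (fun z _ => hη.smooth.differentiableAt')
  · exact (hfd.mul hη.smooth.continuous).integrable_of_hasCompactSupport hη.compact.mul_left
  · exact (hf.continuous.mul hηd).integrable_of_hasCompactSupport hcd.mul_left
  · exact (hf.continuous.mul hη.smooth.continuous).integrable_of_hasCompactSupport
      hη.compact.mul_left

theorem memW12Loc_of_contDiff {f : Plane → ℝ} (hf : ContDiff ℝ ∞ f) (Ω : Set Plane) :
    MemW12Loc f (gradient f) Ω :=
  ⟨⟨hf.continuous.locallyIntegrable.locallyIntegrableOn _,
    (continuous_gradient hf).locallyIntegrable.locallyIntegrableOn _,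
    fun _ hη i => hη.integral_mul_gradient hf i⟩,
    (hf.continuous.pow 2).locallyIntegrable.locallyIntegrableOn _,
    ((continuous_gradient hf).norm.pow 2).locallyIntegrable.locallyIntegrableOn _⟩

theorem memLp_ball_of_bound {E : Type*} [NormedAddCommGroup E] {f : Plane → E} {R C : ℝ}
    (hf : AEStronglyMeasurable f (volume.restrict (ball (0 : Plane) R)))
    (h : ∀ᵐ z ∂volume.restrict (ball (0 : Plane) R), ‖f z‖ ≤ C) :
    MemLp f 2 (volume.restrict (ball (0 : Plane) R)) := by
  have : IsFiniteMeasure (volume.restrict (ball (0 : Plane) R)) :=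
    ⟨by rw [Measure.restrict_apply_univ]; exact measure_ball_lt_top⟩
  exact MemLp.of_bound hf C h

section Barrier

variable {A : Plane → Matrix (Fin 2) (Fin 2) ℝ} {W : Plane → Plane} {V : Plane → ℝ}
  {R lam K L : ℝ}

/-- The weak form of a smooth function, integrated by parts. -/
theorem BoundedCoeff.form_contDiff (hc : BoundedCoeff A W V R lam K)
    {G : Fin 2 → Fin 2 → Plane → Plane}
    (hG : ∀ i j, HasWeakGradientOn (fun z => A z i j) (G i j) (ball 0 R))
    (hGb : ∀ i j, EssBoundedOn (G i j) (ball 0 R) L) {f : Plane → ℝ} (hf : ContDiff ℝ ∞ f)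
    {η : Plane → ℝ} (hη : IsTestOn (ball 0 R) η) :
    form A W V R f (gradient f) η (gradient η) = ∫ z in ball (0 : Plane) R,
      (lowerOrder W V f (gradient f) z - ∑ i, ∑ j, (G i j z i * gradient f z j +
        A z i j * gradient (fun y => gradient f y j) z i)) * η z := by
  have hAm : ∀ i j, MemLp (fun z => A z i j) 2 (volume.restrict (ball (0 : Plane) R)) := fun i j =>
    memLp_ball_of_bound (hc.meas i j)
      ((ae_restrict_mem measurableSet_ball).mono fun z hz => hc.elliptic.abs_entry_le hz i j)
  have hGm : ∀ i j, MemLp (fun z => G i j z i) 2 (volume.restrict (ball (0 : Plane) R)) := fun i j =>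
    memLp_ball_of_bound ((EuclideanSpace.proj i : Plane →L[ℝ] ℝ).continuous.comp_aestronglyMeasurable
      (hGb i j).1) ((hGb i j).2.mono fun z hz => (abs_coord_le _ _).trans hz)
  have hfj : ∀ j, ContDiff ℝ ∞ (fun z => gradient f z j) := contDiff_gradient_apply hf
  have hηi : ∀ i, ContDiff ℝ ∞ (fun z => gradient η z i) := contDiff_gradient_apply hη.smooth
  have hfij : ∀ i j, Continuous (fun z => gradient (fun y => gradient f y j) z i) := fun i j =>
    (contDiff_gradient_apply (hfj j) i).continuous
  have hlow : MemLp (lowerOrder W V f (gradient f)) 2 (volume.restrict (ball (0 : Plane) R)) :=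
    hc.memLp_lower (memLp_ball_of_continuous hf.continuous R)
      (memLp_ball_of_continuous (continuous_gradient hf) R)
  have i1 : ∀ i j, Integrable (fun z => A z i j * (gradient f z j * gradient η z i))
      (volume.restrict (ball (0 : Plane) R)) := fun i j =>
    integrable_mul_of_memLp (hAm i j) (memLp_ball_of_continuous
      ((hfj j).continuous.mul (hηi i).continuous) R)
  have i2 : ∀ i j, Integrable (fun z => G i j z i * (gradient f z j * η z))
      (volume.restrict (ball (0 : Plane) R)) := fun i j =>
    integrable_mul_of_memLp (hGm i j) (memLp_ball_of_continuous
      ((hfj j).continuous.mul hη.smooth.continuous) R)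
  have i3 : ∀ i j, Integrable (fun z => A z i j * (gradient (fun y => gradient f y j) z i * η z))
      (volume.restrict (ball (0 : Plane) R)) := fun i j =>
    integrable_mul_of_memLp (hAm i j) (memLp_ball_of_continuous
      ((hfij i j).mul hη.smooth.continuous) R)
  have i23 : ∀ i j, Integrable (fun z => G i j z i * (gradient f z j * η z) +
      A z i j * (gradient (fun y => gradient f y j) z i * η z))
      (volume.restrict (ball (0 : Plane) R)) := fun i j => (i2 i j).add (i3 i j)
  have i4 : Integrable (fun z => lowerOrder W V f (gradient f) z * η z)
      (volume.restrict (ball (0 : Plane) R)) :=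
    integrable_mul_of_memLp hlow (memLp_ball_of_continuous hη.smooth.continuous R)
  -- The weak derivative of a_ij is tested with (∂_j f)η, so f has to be smooth but the coefficients
  -- need not be.
  have key : ∀ i j, ∫ z in ball (0 : Plane) R, A z i j * (gradient f z j * gradient η z i) =
      - ((∫ z in ball (0 : Plane) R, G i j z i * (gradient f z j * η z)) +
        ∫ z in ball (0 : Plane) R, A z i j * (gradient (fun y => gradient f y j) z i * η z)) := by
    intro i j
    have h1 := (hG i j).2.2 _ (hη.smul_left (hfj j)) i
    have h2 : ∀ z, A z i j * gradient (fun z => gradient f z j * η z) z i =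
        A z i j * (gradient f z j * gradient η z i) +
        A z i j * (gradient (fun y => gradient f y j) z i * η z) := by
      intro z
      rw [gradient_mul (hfj j).differentiableAt' hη.smooth.differentiableAt']
      simp only [PiLp.add_apply, PiLp.smul_apply, smul_eq_mul]; ring
    simp only [h2] at h1
    rw [integral_add (i1 i j) (i3 i j)] at h1
    linarith
  have e1 : form A W V R f (gradient f) η (gradient η) =
      ∫ z in ball (0 : Plane) R, ((∑ i, ∑ j, A z i j * (gradient f z j * gradient η z i)) +
        lowerOrder W V f (gradient f) z * η z) := by
    unfold form
    congr 1; ext z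
    simp only [inner_plane, flux, Fin.sum_univ_two]; ring
  have e2 : ∀ z, (lowerOrder W V f (gradient f) z - ∑ i, ∑ j, (G i j z i * gradient f z j +
        A z i j * gradient (fun y => gradient f y j) z i)) * η z =
      lowerOrder W V f (gradient f) z * η z - ∑ i, ∑ j, (G i j z i * (gradient f z j * η z) +
        A z i j * (gradient (fun y => gradient f y j) z i * η z)) := by
    intro z; simp only [Fin.sum_univ_two]; ring
  simp only [e2]
  have i5 : Integrable (fun z => ∑ i, ∑ j, (G i j z i * (gradient f z j * η z) +
      A z i j * (gradient (fun y => gradient f y j) z i * η z)))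
      (volume.restrict (ball (0 : Plane) R)) :=
    integrable_finsetSum _ fun i _ => integrable_finsetSum _ fun j _ => i23 i j
  rw [e1, integral_add (integrable_finsetSum _ fun i _ => integrable_finsetSum _ fun j _ => i1 i j)
    i4, integral_sub i4 i5, integral_finsetSum _ (fun i _ => integrable_finsetSum _ fun j _ => i1 i j),
    integral_finsetSum _ (fun i _ => integrable_finsetSum _ fun j _ => i23 i j)]
  have e3 : ∀ i, ∫ z in ball (0 : Plane) R, ∑ j, A z i j * (gradient f z j * gradient η z i) =
      - ∫ z in ball (0 : Plane) R, ∑ j, (G i j z i * (gradient f z j * η z) +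
        A z i j * (gradient (fun y => gradient f y j) z i * η z)) := by
    intro i
    rw [integral_finsetSum _ (fun j _ => i1 i j),
      integral_finsetSum _ (fun j _ => i23 i j), ← Finset.sum_neg_distrib]
    refine Finset.sum_congr rfl fun j _ => ?_
    rw [key i j, integral_add (i2 i j) (i3 i j)]
  rw [Finset.sum_congr rfl fun i _ => e3 i, Finset.sum_neg_distrib]
  ring

theorem gradient_coord (i : Fin 2) (z : Plane) : gradient (fun y : Plane => y i) z = stdVec i := by
  ext k
  rw [gradient_apply, (show HasFDerivAt (fun y : Plane => y i)
    (EuclideanSpace.proj i : Plane →L[ℝ] ℝ) z from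
      (EuclideanSpace.proj i : Plane →L[ℝ] ℝ).hasFDerivAt).fderiv]
  simp [eq_comm]

theorem contDiff_coord (i : Fin 2) : ContDiff ℝ ∞ (fun y : Plane => y i) :=
  (EuclideanSpace.proj i : Plane →L[ℝ] ℝ).contDiff

theorem gradient_exp_coord (c : ℝ) (z : Plane) :
    gradient (fun y : Plane => Real.exp (c * y 0)) z = (c * Real.exp (c * z 0)) • stdVec 0 := by
  have h := gradient_comp' (F := fun t => Real.exp (c * t)) (F' := Real.exp (c * z 0) * c)
    (f := fun y : Plane => y 0) (z := z) (by
      have := ((hasDerivAt_id (z 0)).const_mul c).exp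
      simpa using this) (contDiff_coord 0).differentiableAt'
  rw [gradient_coord] at h
  rw [h, mul_comm]

theorem contDiff_exp_coord (c : ℝ) : ContDiff ℝ ∞ (fun y : Plane => Real.exp (c * y 0)) :=
  (contDiff_const.mul (contDiff_coord 0)).exp

theorem gradient_const_sub_norm_sq (c : ℝ) (z : Plane) :
    gradient (fun y : Plane => c - ‖y‖ ^ 2) z = (-2 : ℝ) • z := by
  have h : HasFDerivAt (fun y : Plane => c - ‖y‖ ^ 2) (-(2 • innerSL ℝ z)) z :=
    ((hasStrictFDerivAt_norm_sq z).hasFDerivAt).const_sub c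
  ext k
  rw [gradient_apply, h.fderiv]
  simp [EuclideanSpace.inner_single_right]

theorem contDiff_const_sub_norm_sq (c : ℝ) : ContDiff ℝ ∞ (fun y : Plane => c - ‖y‖ ^ 2) :=
  contDiff_const.sub (contDiff_norm_sq ℝ)

/-- Exponentials in the first coordinate with a large rate are subsolutions. -/
theorem BoundedCoeff.form_exp_nonpos (hc : BoundedCoeff A W V R lam K)
    (hA : ∀ i j, WeakGradientBoundedOn (fun z => A z i j) (ball 0 R) L) {c b p : ℝ} (hc0 : 0 ≤ c)
    (hW : ∀ᵐ z ∂volume.restrict (ball (0 : Plane) R), ‖W z‖ ≤ b)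
    (hV : ∀ᵐ z ∂volume.restrict (ball (0 : Plane) R), V z ≤ p)
    (hcb : 2 * L * c + b * c + p ≤ lam * c ^ 2) {η : Plane → ℝ} (hη : IsTestOn (ball 0 R) η)
    (hη0 : ∀ z, 0 ≤ η z) :
    form A W V R (fun y => Real.exp (c * y 0)) (gradient (fun y => Real.exp (c * y 0))) η
      (gradient η) ≤ 0 := by
  choose G hG hGb using hA
  rw [hc.form_contDiff hG hGb (contDiff_exp_coord c) hη]
  refine integral_nonpos_of_ae ?_
  filter_upwards [hW, hV, ae_restrict_mem measurableSet_ball, (hGb 0 0).2, (hGb 1 0).2]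
    with z h1 h2 hz h3 h4
  refine mul_nonpos_of_nonpos_of_nonneg ?_ (hη0 z)
  have e0 : ∀ y : Plane, gradient (fun y : Plane => Real.exp (c * y 0)) y 0 =
      c * Real.exp (c * y 0) := fun y => by rw [gradient_exp_coord]; simp
  have e1 : ∀ y : Plane, gradient (fun y : Plane => Real.exp (c * y 0)) y 1 = 0 := fun y => by
    rw [gradient_exp_coord]; simp
  have d0 : gradient (fun y => gradient (fun y : Plane => Real.exp (c * y 0)) y 0) z =
      (c * (c * Real.exp (c * z 0))) • stdVec 0 := by
    simp only [e0]
    rw [gradient_const_mul' c (contDiff_exp_coord c).differentiableAt', gradient_exp_coord, smul_smul]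
  have d1 : gradient (fun y => gradient (fun y : Plane => Real.exp (c * y 0)) y 1) z = 0 := by
    simp only [e1]; exact gradient_fun_const z 0
  simp only [Fin.sum_univ_two]
  rw [d0, d1]
  simp only [e0, e1, lowerOrder, inner_plane]
  have h5 := (abs_coord_le (G 0 0 z) 0).trans h3
  have h6 := (abs_coord_le (G 1 0 z) 1).trans h4
  have h7 := (abs_coord_le (W z) 0).trans h1
  have h8 : lam ≤ A z 0 0 := by
    have := (hc.elliptic z hz (stdVec 0) 0).1
    simpa using this
  have he := Real.exp_pos (c * z 0)
  rw [abs_le] at h5 h6 h7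
  set E := Real.exp (c * z 0)
  -- After division by the exponential only the first column of A remains: its divergence costs 2Lc,
  -- the drift bc and the potential p, against λc² from a₀₀.
  have h9 : W z 0 * c + V z - (G 0 0 z 0 * c + G 1 0 z 1 * c + A z 0 0 * c ^ 2) ≤ 0 := by
    nlinarith [mul_le_mul_of_nonneg_right h7.2 hc0, mul_le_mul_of_nonneg_right h5.1 hc0,
      mul_le_mul_of_nonneg_right h6.1 hc0, mul_le_mul_of_nonneg_right h8 (sq_nonneg c)]
  simp
  nlinarith [mul_nonpos_of_nonneg_of_nonpos he.le h9]

/-- The paraboloid supersolution. -/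
theorem BoundedCoeff.form_paraboloid_nonneg {m : ℝ} (hm : 1 < m) (hc : BoundedCoeff A W V m lam K)
    (hA : ∀ i j, WeakGradientBoundedOn (fun z => A z i j) (ball 0 m) (lam / (4 * m)))
    (hW : ∀ᵐ z ∂volume.restrict (ball (0 : Plane) m), ‖W z‖ ≤ lam / (2 * m))
    (hV : ∀ᵐ z ∂volume.restrict (ball (0 : Plane) m), -(lam / (m ^ 2 + 1)) ≤ V z)
    {η : Plane → ℝ} (hη : IsTestOn (ball 0 m) η) (hη0 : ∀ z, 0 ≤ η z) :
    0 ≤ form A W V m (fun y => m ^ 2 + 1 - ‖y‖ ^ 2) (gradient (fun y => m ^ 2 + 1 - ‖y‖ ^ 2)) η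
      (gradient η) := by
  choose G hG hGb using hA
  rw [hc.form_contDiff hG hGb (contDiff_const_sub_norm_sq _) hη]
  refine integral_nonneg_of_ae ?_
  filter_upwards [hW, hV, ae_restrict_mem measurableSet_ball, (hGb 0 0).2, (hGb 1 0).2,
    (hGb 0 1).2, (hGb 1 1).2] with z h1 h2 hz h3 h4 h5 h6
  refine mul_nonneg ?_ (hη0 z)
  have hlam := hc.lam_pos
  have e0 : ∀ y : Plane, gradient (fun y : Plane => m ^ 2 + 1 - ‖y‖ ^ 2) y = (-2 : ℝ) • y :=
    fun y => gradient_const_sub_norm_sq _ y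
  have d0 : ∀ j, gradient (fun y => gradient (fun y : Plane => m ^ 2 + 1 - ‖y‖ ^ 2) y j) z =
      (-2 : ℝ) • stdVec j := by
    intro j
    simp only [e0, PiLp.smul_apply, smul_eq_mul]
    rw [gradient_const_mul' _ (contDiff_coord j).differentiableAt', gradient_coord]
  have g1 := abs_le.1 ((abs_coord_le (G 0 0 z) 0).trans h3)
  have g2 := abs_le.1 ((abs_coord_le (G 1 0 z) 1).trans h4)
  have g3 := abs_le.1 ((abs_coord_le (G 0 1 z) 0).trans h5)
  have g4 := abs_le.1 ((abs_coord_le (G 1 1 z) 1).trans h6)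
  have hzm : ‖z‖ < m := mem_ball_zero_iff.1 hz
  have a1 : lam ≤ A z 0 0 := by
    have := (hc.elliptic z hz (stdVec 0) 0).1
    simpa using this
  have a2 : lam ≤ A z 1 1 := by
    have := (hc.elliptic z hz (stdVec 1) 0).1
    simpa using this
  -- The sharp factor √2 is rounded up to 3/2.
  have hz0 : |z 0| + |z 1| ≤ 3 / 2 * m := by
    have h7 := norm_sq_plane z
    rw [← sq_abs (z 0), ← sq_abs (z 1)] at h7
    refine abs_le_of_sq_le_sq' ?_ (by positivity) |>.2
    nlinarith [sq_nonneg (|z 0| - |z 1|), norm_nonneg z]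
  have hw : |inner ℝ (W z) z| ≤ lam / 2 := by
    refine (abs_real_inner_le_norm _ _).trans ?_
    calc ‖W z‖ * ‖z‖ ≤ lam / (2 * m) * m := by gcongr
      _ = lam / 2 := by field_simp
  have hpos : 0 ≤ m ^ 2 + 1 - ‖z‖ ^ 2 := by nlinarith [norm_nonneg z]
  have hv : -lam ≤ V z * (m ^ 2 + 1 - ‖z‖ ^ 2) := by
    have hq : 0 ≤ lam / (m ^ 2 + 1) := by positivity
    have h8 : lam / (m ^ 2 + 1) * (m ^ 2 + 1) = lam := by field_simp
    nlinarith [mul_le_mul_of_nonneg_right h2 hpos, mul_nonneg hq (sq_nonneg ‖z‖)]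
  have hl : lam / (4 * m) * (3 / 2 * m) = 3 / 8 * lam := by field_simp; ring
  have hl0 : 0 ≤ lam / (4 * m) := by positivity
  set ℓ := lam / (4 * m)
  have b0 : ∀ x y : ℝ, -ℓ ≤ x ∧ x ≤ ℓ → -(ℓ * |y|) ≤ x * y := by
    intro x y hx
    have := abs_mul x y
    have h9 : |x| * |y| ≤ ℓ * |y| := mul_le_mul_of_nonneg_right (abs_le.2 hx) (abs_nonneg _)
    linarith [neg_abs_le (x * y)]
  have c1 := b0 _ (z 0) g1
  have c2 := b0 _ (z 0) g2
  have c3 := b0 _ (z 1) g3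
  have c4 := b0 _ (z 1) g4
  have c5 : ℓ * (|z 0| + |z 1|) ≤ 3 / 8 * lam := hl ▸ mul_le_mul_of_nonneg_left hz0 hl0
  have hw' := (abs_le.1 hw).2
  -- The balance: the second derivatives give at least 4λ; the derivatives of A cost at most 4 ·
  -- 3λ/8, the drift λ and the potential λ. A surplus of λ/2 remains.
  simp only [Fin.sum_univ_two]
  rw [d0, d0]
  simp only [e0, lowerOrder, real_inner_smul_right]
  simp
  nlinarith

end Barrier

/-! ### Existence for coercive operators -/

theorem TendstoL2.of_tendsto_Lp {α E ι : Type*} [MeasurableSpace α] [NormedAddCommGroup E]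
    {μ : Measure α} {l : Filter ι} {x : ι → Lp E 2 μ} {f : Lp E 2 μ} (h : Tendsto x l (𝓝 f)) :
    TendstoL2 μ l (fun n => (x n : α → E)) f :=
  (Lp.tendsto_Lp_iff_tendsto_eLpNorm' _ _).1 h

/-- Lax–Milgram on a complete subspace. -/
theorem exists_mem_inner_eq {X : Type*} [NormedAddCommGroup X] [InnerProductSpace ℝ X]
    (T : X →L[ℝ] X) (H : Submodule ℝ X) [CompleteSpace H] {κ : ℝ} (hκ : 0 < κ)
    (hT : ∀ x ∈ H, κ * ‖x‖ ^ 2 ≤ inner ℝ (T x) x) (c : X) :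
    ∃ v ∈ H, ∀ w ∈ H, inner ℝ (T v) w = inner ℝ c w := by
  let B : H →L[ℝ] H →L[ℝ] ℝ :=
    ((isBoundedBilinearMap_inner (𝕜 := ℝ)).toContinuousLinearMap).bilinearComp
      (T.comp H.subtypeL) H.subtypeL
  have hB : ∀ v w : H, B v w = inner ℝ (T v) (w : X) := fun v w => rfl
  have hcoer : IsCoercive B := ⟨κ, hκ, fun v => by
    rw [hB, mul_assoc, ← sq]; exact hT v v.2⟩
  -- The functional is represented by a vector of X; projecting it to H does not change its inner
  -- products with H.
  refine ⟨(hcoer.continuousLinearEquivOfBilin.symm (H.orthogonalProjectionOnto c) : H),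
    Subtype.coe_prop _, fun w hw => ?_⟩
  have := hcoer.continuousLinearEquivOfBilin_apply
    (hcoer.continuousLinearEquivOfBilin.symm (H.orthogonalProjectionOnto c)) ⟨w, hw⟩
  rw [ContinuousLinearEquiv.apply_symm_apply, hB,
    Submodule.inner_orthogonalProjectionOnto_eq_of_mem_right] at this
  exact this.symm

/-- Pairs consisting of a square-integrable function and a square-integrable field on a ball. -/
abbrev PairSpace (R : ℝ) : Type :=
  WithLp 2 (Lp ℝ 2 (volume.restrict (ball (0 : Plane) R)) ×
    Lp Plane 2 (volume.restrict (ball (0 : Plane) R)))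

/-- The test functions, embedded by their values and gradients. -/
noncomputable def testSubmodule (R : ℝ) : Submodule ℝ (PairSpace R) where
  carrier := {x | ∃ η, IsTestOn (ball 0 R) η ∧ x.fst =ᵐ[volume.restrict (ball (0 : Plane) R)] η ∧
    x.snd =ᵐ[volume.restrict (ball (0 : Plane) R)] gradient η}
  zero_mem' := ⟨fun _ => 0, ⟨contDiff_const, HasCompactSupport.zero, by simp [tsupport]⟩,
    Lp.coeFn_zero _ _ _, by
      have := Lp.coeFn_zero Plane 2 (volume.restrict (ball (0 : Plane) R))
      filter_upwards [this] with z hz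
      rw [WithLp.zero_snd, hz, gradient_fun_const]; rfl⟩
  add_mem' := by
    rintro x y ⟨η, hη, h1, h2⟩ ⟨θ, hθ, h3, h4⟩
    refine ⟨fun z => η z + θ z, ⟨hη.smooth.add hθ.smooth, hη.compact.add hθ.compact,
      (tsupport_add η θ).trans (union_subset hη.subset hθ.subset)⟩, ?_, ?_⟩
    · filter_upwards [h1, h3, Lp.coeFn_add x.fst y.fst] with z e1 e2 e3
      rw [WithLp.add_fst, e3, Pi.add_apply, e1, e2]
    · filter_upwards [h2, h4, Lp.coeFn_add x.snd y.snd] with z e1 e2 e3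
      rw [WithLp.add_snd, e3, Pi.add_apply, e1, e2,
        gradient_add' hη.smooth.differentiableAt' hθ.smooth.differentiableAt']
  smul_mem' := by
    rintro c x ⟨η, hη, h1, h2⟩
    refine ⟨fun z => c * η z, hη.smul_left contDiff_const, ?_, ?_⟩
    · filter_upwards [h1, Lp.coeFn_smul c x.fst] with z e1 e3
      rw [WithLp.smul_fst, e3, Pi.smul_apply, e1, smul_eq_mul]
    · filter_upwards [h2, Lp.coeFn_smul c x.snd] with z e1 e3
      rw [WithLp.smul_snd, e3, Pi.smul_apply, e1,
        gradient_const_mul' c hη.smooth.differentiableAt']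

theorem tendstoL2_fst {R : ℝ} {x : ℕ → PairSpace R} {v : PairSpace R}
    (h : Tendsto x atTop (𝓝 v)) :
    TendstoL2 (volume.restrict (ball (0 : Plane) R)) atTop (fun n => ((x n).fst : Plane → ℝ))
      v.fst := by
  refine TendstoL2.of_tendsto_Lp (x := fun n => (x n).fst) (f := v.fst) ?_
  rw [tendsto_iff_norm_sub_tendsto_zero] at h ⊢
  exact squeeze_zero (fun _ => norm_nonneg _) (fun n => WithLp.norm_fst_le _ (x n - v)) h

theorem tendstoL2_snd {R : ℝ} {x : ℕ → PairSpace R} {v : PairSpace R}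
    (h : Tendsto x atTop (𝓝 v)) :
    TendstoL2 (volume.restrict (ball (0 : Plane) R)) atTop (fun n => ((x n).snd : Plane → Plane))
      v.snd := by
  refine TendstoL2.of_tendsto_Lp (x := fun n => (x n).snd) (f := v.snd) ?_
  rw [tendsto_iff_norm_sub_tendsto_zero] at h ⊢
  exact squeeze_zero (fun _ => norm_nonneg _) (fun n => WithLp.norm_snd_le _ (x n - v)) h

section LaxMilgram

variable {A : Plane → Matrix (Fin 2) (Fin 2) ℝ} {W : Plane → Plane} {V : Plane → ℝ}
  {R lam K K' : ℝ}

theorem flux_add (A : Plane → Matrix (Fin 2) (Fin 2) ℝ) (g k : Plane → Plane) (z : Plane) :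
    flux A (fun z => g z + k z) z = flux A g z + flux A k z := by
  ext i
  simp only [flux, Fin.sum_univ_two, PiLp.add_apply]; ring

theorem flux_congr {g k : Plane → Plane} {z : Plane} (h : g z = k z) : flux A g z = flux A k z := by
  simp only [flux, h]

theorem lowerOrder_congr {u v : Plane → ℝ} {g k : Plane → Plane} {z : Plane} (h : u z = v z)
    (h' : g z = k z) : lowerOrder W V u g z = lowerOrder W V v k z := by
  simp only [lowerOrder, h, h']

/-- The operator on pairs that represents the bilinear form. -/
noncomputable def BoundedCoeff.pairMap (hc : BoundedCoeff A W V R lam K) :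
    PairSpace R →L[ℝ] PairSpace R :=
  LinearMap.mkContinuousOfExistsBound
    { toFun := fun x => WithLp.toLp 2
        ((hc.memLp_lower (Lp.memLp x.fst) (Lp.memLp x.snd)).toLp,
          (hc.memLp_flux (Lp.memLp x.snd)).toLp)
      map_add' := fun x y => by
        refine (WithLp.ofLp_injective 2) (Prod.ext ?_ ?_)
        · refine Lp.ext ?_
          filter_upwards [MemLp.coeFn_toLp (hc.memLp_lower (Lp.memLp (x + y).fst)
              (Lp.memLp (x + y).snd)),
            Lp.coeFn_add ((hc.memLp_lower (Lp.memLp x.fst) (Lp.memLp x.snd)).toLp)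
              ((hc.memLp_lower (Lp.memLp y.fst) (Lp.memLp y.snd)).toLp),
            MemLp.coeFn_toLp (hc.memLp_lower (Lp.memLp x.fst) (Lp.memLp x.snd)),
            MemLp.coeFn_toLp (hc.memLp_lower (Lp.memLp y.fst) (Lp.memLp y.snd)),
            Lp.coeFn_add x.fst y.fst, Lp.coeFn_add x.snd y.snd] with z e1 e2 e3 e4 e5 e6
          refine e1.trans (Eq.trans ?_ e2.symm)
          rw [Pi.add_apply, e3, e4]
          simp only [lowerOrder, WithLp.add_fst, WithLp.add_snd, e5, e6, Pi.add_apply,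
            inner_add_right]
          ring
        · refine Lp.ext ?_
          filter_upwards [MemLp.coeFn_toLp (hc.memLp_flux (Lp.memLp (x + y).snd)),
            Lp.coeFn_add ((hc.memLp_flux (Lp.memLp x.snd)).toLp)
              ((hc.memLp_flux (Lp.memLp y.snd)).toLp),
            MemLp.coeFn_toLp (hc.memLp_flux (Lp.memLp x.snd)),
            MemLp.coeFn_toLp (hc.memLp_flux (Lp.memLp y.snd)),
            Lp.coeFn_add x.snd y.snd] with z e1 e2 e3 e4 e6
          refine e1.trans (Eq.trans ?_ e2.symm)
          rw [Pi.add_apply, e3, e4, ← flux_add]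
          exact flux_congr (by rw [WithLp.add_snd, e6, Pi.add_apply])
      map_smul' := fun c x => by
        refine (WithLp.ofLp_injective 2) (Prod.ext ?_ ?_)
        · refine Lp.ext ?_
          filter_upwards [MemLp.coeFn_toLp (hc.memLp_lower (Lp.memLp (c • x).fst)
              (Lp.memLp (c • x).snd)),
            Lp.coeFn_smul c ((hc.memLp_lower (Lp.memLp x.fst) (Lp.memLp x.snd)).toLp),
            MemLp.coeFn_toLp (hc.memLp_lower (Lp.memLp x.fst) (Lp.memLp x.snd)),
            Lp.coeFn_smul c x.fst, Lp.coeFn_smul c x.snd] with z e1 e2 e3 e5 e6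
          refine e1.trans (Eq.trans ?_ e2.symm)
          rw [Pi.smul_apply, e3, smul_eq_mul, ← lowerOrder_smul]
          exact lowerOrder_congr (by rw [WithLp.smul_fst, e5]; rfl) (by rw [WithLp.smul_snd, e6]; rfl)
        · refine Lp.ext ?_
          filter_upwards [MemLp.coeFn_toLp (hc.memLp_flux (Lp.memLp (c • x).snd)),
            Lp.coeFn_smul c ((hc.memLp_flux (Lp.memLp x.snd)).toLp),
            MemLp.coeFn_toLp (hc.memLp_flux (Lp.memLp x.snd)),
            Lp.coeFn_smul c x.snd] with z e1 e2 e3 e6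
          refine e1.trans (Eq.trans ?_ e2.symm)
          rw [Pi.smul_apply, e3, ← flux_smul]
          exact flux_congr (by rw [WithLp.smul_snd, e6]; rfl) }
    ⟨2 * K + lam⁻¹, fun x => by
      have hK := hc.K_nonneg
      have hl := inv_pos.2 hc.lam_pos
      have h1 : ‖x.fst‖ ≤ ‖x‖ := WithLp.norm_fst_le _ x
      have h2 : ‖x.snd‖ ≤ ‖x‖ := WithLp.norm_snd_le _ x
      have e1 : ‖(hc.memLp_lower (Lp.memLp x.fst) (Lp.memLp x.snd)).toLp‖ ≤
          K * (‖x.snd‖ + ‖x.fst‖) := by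
        rw [← l2_eq_norm_toLp]
        have m1 := (Lp.memLp x.snd).norm
        have m2 := (Lp.memLp x.fst).norm
        refine (l2_le_mul (m1.add m2) hK (hc.abs_lower_le.mono fun z hz => ?_)).trans ?_
        · rw [Pi.add_apply, Real.norm_of_nonneg (add_nonneg (norm_nonneg (x.snd z))
            (norm_nonneg (x.fst z)))]
          exact hz _ _
        · refine mul_le_mul_of_nonneg_left ((l2_add_le m1 m2).trans (le_of_eq ?_)) hK
          rw [l2_norm, l2_norm, l2_eq_norm_toLp (Lp.memLp x.snd), l2_eq_norm_toLp (Lp.memLp x.fst),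
            Lp.toLp_coeFn, Lp.toLp_coeFn]
      have e2 : ‖(hc.memLp_flux (Lp.memLp x.snd)).toLp‖ ≤ lam⁻¹ * ‖x.snd‖ := by
        rw [← l2_eq_norm_toLp]
        refine (l2_le_mul (Lp.memLp x.snd) hl.le ((ae_restrict_mem measurableSet_ball).mono
          fun _ hz => hc.elliptic.norm_flux_le hz)).trans (le_of_eq ?_)
        rw [l2_eq_norm_toLp (Lp.memLp x.snd), Lp.toLp_coeFn]
      have e3 : ∀ y : PairSpace R, ‖y‖ ≤ ‖y.fst‖ + ‖y.snd‖ := fun y => by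
        refine abs_le_of_sq_le_sq' ?_ (by positivity) |>.2
        rw [WithLp.prod_norm_sq_eq_of_L2]
        nlinarith [norm_nonneg y.fst, norm_nonneg y.snd]
      refine (e3 _).trans ?_
      refine (add_le_add e1 e2).trans ?_
      nlinarith [norm_nonneg x]⟩

theorem BoundedCoeff.inner_pairMap (hc : BoundedCoeff A W V R lam K) (x y : PairSpace R) :
    inner ℝ (hc.pairMap x) y = form A W V R x.fst x.snd y.fst y.snd := by
  rw [hc.form_eq_add (Lp.memLp _) (Lp.memLp _) (Lp.memLp _) (Lp.memLp _), WithLp.prod_inner_apply,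
    add_comm]
  congr 1
  · rw [L2.inner_def]
    refine integral_congr_ae ?_
    filter_upwards [MemLp.coeFn_toLp (hc.memLp_flux (Lp.memLp x.snd))] with z hz
    exact congrArg (fun v => inner ℝ v (y.snd z)) hz
  · rw [L2.inner_def]
    refine integral_congr_ae ?_
    filter_upwards [MemLp.coeFn_toLp (hc.memLp_lower (Lp.memLp x.fst) (Lp.memLp x.snd))] with z hz
    refine (congrArg (fun v => inner ℝ v (y.fst z)) hz).trans ?_
    rw [RCLike.inner_apply, conj_trivial, mul_comm]

/-- Coercivity. Half of the ellipticity absorbs the drift by completing a square, at the price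
K'²/(2λ) u². The other half and the excess 1 of the potential survive. -/
theorem BoundedCoeff.le_form_self (hc : BoundedCoeff A W V R lam K)
    (hW : ∀ᵐ z ∂volume.restrict (ball (0 : Plane) R), ‖W z‖ ≤ K')
    (hV : ∀ᵐ z ∂volume.restrict (ball (0 : Plane) R), K' ^ 2 / (2 * lam) + 1 ≤ V z)
    {u : Plane → ℝ} {g : Plane → Plane} (hu : MemLp u 2 (volume.restrict (ball (0 : Plane) R)))
    (hg : MemLp g 2 (volume.restrict (ball (0 : Plane) R))) :
    l2 (volume.restrict (ball (0 : Plane) R)) u ^ 2 +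
      lam / 2 * l2 (volume.restrict (ball (0 : Plane) R)) g ^ 2 ≤ form A W V R u g u g := by
  have hi : Integrable (fun z => ‖u z‖ ^ 2) (volume.restrict (ball (0 : Plane) R)) :=
    hu.integrable_norm_pow two_ne_zero
  have hi2 : Integrable (fun z => ‖g z‖ ^ 2) (volume.restrict (ball (0 : Plane) R)) :=
    hg.integrable_norm_pow two_ne_zero
  rw [l2_sq hu, l2_sq hg, ← integral_const_mul, ← integral_add hi (hi2.const_mul _)]
  refine integral_mono_ae (hi.add (hi2.const_mul _)) (hc.integrable_form hu hg hu hg) ?_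
  filter_upwards [hW, hV, ae_restrict_mem measurableSet_ball] with z h1 h2 hz
  have hell := hc.elliptic.le_inner_flux (g := g) hz
  have hlam := hc.lam_pos
  have hb : -(K' * ‖g z‖ * |u z|) ≤ inner ℝ (W z) (g z) * u z := by
    have := (abs_mul (inner ℝ (W z) (g z)) (u z)).le.trans
      (mul_le_mul_of_nonneg_right ((abs_real_inner_le_norm (W z) (g z)).trans
        (mul_le_mul_of_nonneg_right h1 (norm_nonneg (g z)))) (abs_nonneg (u z)))
    linarith [neg_abs_le (inner ℝ (W z) (g z) * u z)]
  have hq := mul_le_mul_of_nonneg_right h2 (sq_nonneg (u z))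
  have h6 : 0 ≤ lam / 2 * (‖g z‖ - K' / lam * |u z|) ^ 2 := by positivity
  have h7 : lam / 2 * (‖g z‖ - K' / lam * |u z|) ^ 2 =
      lam / 2 * ‖g z‖ ^ 2 - K' * ‖g z‖ * |u z| + K' ^ 2 / (2 * lam) * u z ^ 2 := by
    rw [← sq_abs (u z)]; field_simp; ring
  simp only [lowerOrder, Real.norm_eq_abs, sq_abs]
  nlinarith

/-- The Dirichlet problem with zero boundary values. -/
theorem BoundedCoeff.exists_solution (hc : BoundedCoeff A W V R lam K)
    (hW : ∀ᵐ z ∂volume.restrict (ball (0 : Plane) R), ‖W z‖ ≤ K')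
    (hV : ∀ᵐ z ∂volume.restrict (ball (0 : Plane) R), K' ^ 2 / (2 * lam) + 1 ≤ V z)
    {q : Plane → ℝ} {Q : Plane → Plane} (hq : MemLp q 2 (volume.restrict (ball (0 : Plane) R)))
    (hQ : MemLp Q 2 (volume.restrict (ball (0 : Plane) R))) :
    ∃ (h : Plane → ℝ) (k : Plane → Plane) (s : ℕ → Plane → ℝ), H1Approx R h k s ∧
      (∀ n, IsTestOn (ball 0 R) (s n)) ∧ ∀ η, IsTestOn (ball 0 R) η →
        form A W V R h k η (gradient η) = (∫ z in ball (0 : Plane) R, inner ℝ (Q z) (gradient η z)) +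
          ∫ z in ball (0 : Plane) R, q z * η z := by
  -- The closure of the test functions among pairs plays the role of H¹₀: each of its elements is by
  -- construction a limit of test functions together with their gradients.
  set H := (testSubmodule R).topologicalClosure with hH
  have : CompleteSpace H := (testSubmodule R).isClosed_topologicalClosure.completeSpace_coe
  have hlam := hc.lam_pos
  have hcoer : ∀ v ∈ H, min 1 (lam / 2) * ‖v‖ ^ 2 ≤ inner ℝ (hc.pairMap v) v := by
    intro v _
    rw [hc.inner_pairMap, WithLp.prod_norm_sq_eq_of_L2]
    refine le_trans ?_ (hc.le_form_self hW hV (Lp.memLp _) (Lp.memLp _))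
    rw [l2_eq_norm_toLp (Lp.memLp _), l2_eq_norm_toLp (Lp.memLp _), Lp.toLp_coeFn, Lp.toLp_coeFn,
      mul_add]
    refine add_le_add ?_ ?_
    · exact mul_le_of_le_one_left (sq_nonneg _) (min_le_left _ _)
    · exact mul_le_mul_of_nonneg_right (min_le_right _ _) (sq_nonneg _)
  obtain ⟨v, hvH, hv⟩ := exists_mem_inner_eq hc.pairMap H (lt_min one_pos (half_pos hlam)) hcoer
    (WithLp.toLp 2 (hq.toLp, hQ.toLp))
  obtain ⟨x, hx, hxl⟩ := mem_closure_iff_seq_limit.1 (show v ∈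
    closure (testSubmodule R : Set (PairSpace R)) from hvH)
  choose s hs h1 h2 using hx
  refine ⟨v.fst, v.snd, s,
    ⟨Lp.memLp _, Lp.memLp _, fun n => (hs n).smooth, ?_, ?_⟩, hs, ?_⟩
  · exact (tendstoL2_fst hxl).congr' (Eventually.of_forall h1) (ae_eq_refl _)
  · exact (tendstoL2_snd hxl).congr' (Eventually.of_forall h2) (ae_eq_refl _)
  · intro η hη
    have m1 := hη.memLp (volume.restrict (ball (0 : Plane) R))
    have m2 := hη.memLp_gradient (volume.restrict (ball (0 : Plane) R))
    have hw : (WithLp.toLp 2 (m1.toLp, m2.toLp) : PairSpace R) ∈ H :=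
      (testSubmodule R).le_topologicalClosure ⟨η, hη, m1.coeFn_toLp, m2.coeFn_toLp⟩
    have key := hv _ hw
    rw [hc.inner_pairMap, WithLp.prod_inner_apply] at key
    have e1 := integral_inner_toLp hq m1
    have e2 := integral_inner_toLp hQ m2
    have e3 : ∫ z in ball (0 : Plane) R, inner ℝ (q z) (η z) =
        ∫ z in ball (0 : Plane) R, q z * η z := by
      congr 1; ext z; rw [RCLike.inner_apply, conj_trivial, mul_comm]
    refine Eq.trans ?_ (key.trans ((congrArg₂ (· + ·) (e1.trans e3) e2).trans (add_comm _ _)))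
    unfold form
    refine integral_congr_ae ?_
    filter_upwards [m1.coeFn_toLp, m2.coeFn_toLp] with z hz1 hz2
    exact congrArg₂ (fun a b => inner ℝ (flux A v.snd z) b + lowerOrder W V v.fst v.snd z * a)
      hz1.symm hz2.symm

/-- A solution with zero boundary values is a limit of test functions in H¹ and may therefore serve
as its own test function. -/
theorem BoundedCoeff.form_self_of_approx (hc : BoundedCoeff A W V R lam K)
    {h : Plane → ℝ} {k : Plane → Plane} {s : ℕ → Plane → ℝ} (hs : H1Approx R h k s)
    (ht : ∀ n, IsTestOn (ball 0 R) (s n)) {q : Plane → ℝ}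
    (hq : MemLp q 2 (volume.restrict (ball (0 : Plane) R)))
    (heq : ∀ η, IsTestOn (ball 0 R) η →
        form A W V R h k η (gradient η) = ∫ z in ball (0 : Plane) R, q z * η z) :
    form A W V R h k h k = ∫ z in ball (0 : Plane) R, q z * h z := by
  have m : ∀ n, MemLp (s n) 2 (volume.restrict (ball (0 : Plane) R)) := fun n => (ht n).memLp _
  have h1 := hc.tendsto_form_right hs.memLp hs.memLp_grad m
    (fun n => (ht n).memLp_gradient _) hs.memLp hs.memLp_grad hs.tendsto hs.tendsto_grad
  have h2 := hs.tendsto.mul hq m hs.memLp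
  simp only [fun n => heq _ (ht n)] at h1
  exact tendsto_nhds_unique h1 h2

end LaxMilgram

/-! ### Solutions between sub- and supersolutions -/

theorem TendstoL2.ae_unique {α E ι : Type*} [MeasurableSpace α] [NormedAddCommGroup E]
    {μ : Measure α} {l : Filter ι} [l.NeBot] {s : ι → α → E} {f g : α → E}
    (hs : ∀ n, AEStronglyMeasurable (s n) μ) (hf : AEStronglyMeasurable f μ)
    (hg : AEStronglyMeasurable g μ) (h : TendstoL2 μ l s f) (h' : TendstoL2 μ l s g) :
    f =ᵐ[μ] g := by
  have h1 := h'.sub h hs hg hs hf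
  have h2 : Tendsto (fun _ : ι => eLpNorm (f - g) 2 μ) l (𝓝 0) := by
    refine Tendsto.congr (fun n => ?_) h1
    congr 1; ext z; simp
  have h3 : eLpNorm (f - g) 2 μ = 0 := tendsto_nhds_unique tendsto_const_nhds h2
  rw [eLpNorm_eq_zero_iff (hf.sub hg) two_ne_zero] at h3
  filter_upwards [h3] with z hz
  exact sub_eq_zero.1 hz

/-- Monotone iteration between an a.e. lower and an a.e. upper barrier. -/
theorem exists_fixedPoint_between {α : Type*} [MeasurableSpace α] {ν : Measure α}
    {U : (α → ℝ) → α → ℝ} {C : ℝ} {φ₁ φ₂ : α → ℝ} (h1 : MemLp φ₁ 2 ν) (h2 : MemLp φ₂ 2 ν)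
    (hle12 : φ₁ ≤ᵐ[ν] φ₂) (hU : ∀ f, MemLp f 2 ν → MemLp (U f) 2 ν)
    (hlip : ∀ f f', MemLp f 2 ν → MemLp f' 2 ν →
      l2 ν (fun z => U f z - U f' z) ≤ C * l2 ν (fun z => f z - f' z))
    (hmono : ∀ f f', MemLp f 2 ν → MemLp f' 2 ν → f ≤ᵐ[ν] f' → U f ≤ᵐ[ν] U f')
    (hsub : φ₁ ≤ᵐ[ν] U φ₁) (hsup : ∀ f, MemLp f 2 ν → f ≤ᵐ[ν] φ₂ → U f ≤ᵐ[ν] φ₂) :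
    ∃ u, MemLp u 2 ν ∧ u =ᵐ[ν] U u ∧ ∀ᵐ z ∂ν, φ₁ z ≤ u z ∧ u z ≤ φ₂ z := by
  set seq : ℕ → α → ℝ := fun k => U^[k] φ₁ with hseq_def
  have hseq : ∀ k, seq (k + 1) = U (seq k) := fun k => Function.iterate_succ_apply' U k φ₁
  have hm : ∀ k, MemLp (seq k) 2 ν := fun k => by
    induction k with
    | zero => exact h1
    | succ k ih => rw [hseq]; exact hU _ ih
  have hinc : ∀ k, seq k ≤ᵐ[ν] seq (k + 1) := by
    intro k
    induction k with
    | zero => exact hsub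
    | succ k ih => rw [hseq (k + 1)]; nth_rewrite 1 [hseq k]; exact hmono _ _ (hm k) (hm _) ih
  have hbd : ∀ k, seq k ≤ᵐ[ν] φ₂ := by
    intro k
    induction k with
    | zero => exact hle12
    | succ k ih => rw [hseq]; exact hsup _ (hm k) ih
  set u : α → ℝ := fun z => ⨆ k, seq k z with hu
  have hall : ∀ᵐ z ∂ν, Tendsto (fun k => seq k z) atTop (𝓝 (u z)) ∧ φ₁ z ≤ u z ∧ u z ≤ φ₂ z ∧
      (∀ k, seq k z ≤ u z) ∧ ∀ k, φ₁ z ≤ seq k z := by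
    filter_upwards [ae_all_iff.2 hinc, ae_all_iff.2 hbd] with z h3 h4
    have hm : Monotone fun k => seq k z := monotone_nat_of_le_succ h3
    have hb : BddAbove (range fun k => seq k z) := ⟨φ₂ z, by rintro _ ⟨k, rfl⟩; exact h4 k⟩
    exact ⟨tendsto_atTop_ciSup hm hb, le_ciSup hb 0, ciSup_le h4, fun k => le_ciSup hb k,
      fun k => hm (Nat.zero_le k)⟩
  have hum : AEStronglyMeasurable u ν :=
    aestronglyMeasurable_of_tendsto_ae atTop (fun k => (hm k).1) (hall.mono fun _ h => h.1)
  have hu2 : MemLp u 2 ν := by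
    refine memLp_of_le_add (C := 1) hum h1 h2 (hall.mono fun z hz => ?_)
    rw [one_mul, Real.norm_eq_abs, Real.norm_eq_abs, Real.norm_eq_abs, abs_le]
    constructor
    · linarith [neg_abs_le (φ₁ z), abs_nonneg (φ₂ z), hz.2.1]
    · linarith [le_abs_self (φ₂ z), abs_nonneg (φ₁ z), hz.2.2.1]
  have hconv : TendstoL2 ν atTop seq u := by
    refine TendstoL2.of_dominated (h2.sub h1) (fun k => (hm k).1) hum
      (fun k => hall.mono fun z hz => ?_) (hall.mono fun _ h => h.1)
    rw [Real.norm_eq_abs, Real.norm_eq_abs, Pi.sub_apply, abs_sub_comm,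
      abs_of_nonneg (sub_nonneg.2 (hz.2.2.2.1 k))]
    refine le_trans ?_ (le_abs_self _)
    linarith [hz.2.2.1, hz.2.2.2.2 k]
  -- The Lipschitz bound is needed only here, as continuity: it identifies the limit of the shifted
  -- sequence with U u.
  have hconv2 : TendstoL2 ν atTop (fun k => seq (k + 1)) (U u) := by
    refine TendstoL2.of_l2 (fun k => hm (k + 1)) (hU _ hu2) ?_
    have := hconv.l2_sub.const_mul C
    rw [mul_zero] at this
    refine squeeze_zero (fun k => l2_nonneg _) (fun k => ?_) this
    rw [hseq]
    exact hlip _ _ (hm k) hu2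
  exact ⟨u, hu2, TendstoL2.ae_unique (fun k => (hm (k + 1)).1) hum (hU _ hu2).1
      (hconv.comp (tendsto_add_atTop_nat 1)) hconv2, hall.mono fun z hz => ⟨hz.2.1, hz.2.2.1⟩⟩

section Existence

variable {A : Plane → Matrix (Fin 2) (Fin 2) ℝ} {W : Plane → Plane} {V : Plane → ℝ}
  {R lam K : ℝ}

theorem BoundedCoeff.form_add_left {u u' v : Plane → ℝ} {g g' k : Plane → Plane}
    (h : BoundedCoeff A W V R lam K)
    (hu : MemLp u 2 (volume.restrict (ball 0 R))) (hg : MemLp g 2 (volume.restrict (ball 0 R)))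
    (hu' : MemLp u' 2 (volume.restrict (ball 0 R))) (hg' : MemLp g' 2 (volume.restrict (ball 0 R)))
    (hv : MemLp v 2 (volume.restrict (ball 0 R))) (hk : MemLp k 2 (volume.restrict (ball 0 R))) :
    form A W V R (fun z => u z + u' z) (fun z => g z + g' z) v k =
      form A W V R u g v k + form A W V R u' g' v k := by
  unfold form
  rw [← integral_add (h.integrable_form hu hg hv hk) (h.integrable_form hu' hg' hv hk)]
  congr 1; ext z
  rw [flux_add, inner_add_left]
  simp only [lowerOrder, inner_add_right]; ring

/-- A shift that makes the potential large. -/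
noncomputable def shift (lam K : ℝ) : ℝ := K + K ^ 2 / (2 * lam) + 1

theorem shift_pos (hlam : 0 < lam) (hK : 0 ≤ K) : 0 < shift lam K := by
  unfold shift; positivity

/-- The summand K of `shift` offsets the lower bound -K of V; the rest is the coercivity threshold
of `BoundedCoeff.le_form_self`. -/
theorem BoundedCoeff.le_add_shift (hc : BoundedCoeff A W V R lam K) :
    ∀ᵐ z ∂volume.restrict (ball (0 : Plane) R), K ^ 2 / (2 * lam) + 1 ≤ V z + shift lam K := by
  filter_upwards [hc.potential.2] with z hz
  have := (abs_le.1 hz).1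
  unfold shift; linarith

theorem BoundedCoeff.le_add_shift' (hc : BoundedCoeff A W V R lam K) :
    ∀ᵐ z ∂volume.restrict (ball (0 : Plane) R), K ^ 2 / (4 * lam) + 1 ≤ V z + shift lam K := by
  filter_upwards [hc.le_add_shift] with z hz
  have hlam := hc.lam_pos
  have : K ^ 2 / (4 * lam) ≤ K ^ 2 / (2 * lam) := by gcongr; norm_num
  linarith

/-- One step of the iteration: (L + μ)u = μf with the boundary values of φ₁. The unknown is u - φ₁,
which has zero boundary values; the flux and the lower order part of φ₁ move to the right-hand side.
-/
theorem BoundedCoeff.exists_solution_shift (hc : BoundedCoeff A W V R lam K) {φ₁ : Plane → ℝ}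
    (hφ₁ : ContDiff ℝ ∞ φ₁) {f : Plane → ℝ} (hf : MemLp f 2 (volume.restrict (ball 0 R))) :
    ∃ (u : Plane → ℝ) (g : Plane → Plane) (s : ℕ → Plane → ℝ),
      H1Approx R u g (fun n z => φ₁ z + s n z) ∧ (∀ n, IsTestOn (ball 0 R) (s n)) ∧
      ∀ η, IsTestOn (ball 0 R) η →
        form A W (fun z => V z + shift lam K) R u g η (gradient η) =
          shift lam K * ∫ z in ball (0 : Plane) R, f z * η z := by
  have h1 := H1Approx.of_contDiff hφ₁ R
  have hc' := hc.add_const (shift_pos hc.lam_pos hc.K_nonneg).le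
  have ml := hc'.memLp_lower h1.memLp h1.memLp_grad
  have mf := hc'.memLp_flux h1.memLp_grad
  obtain ⟨h, k, s, hs, hts, heq⟩ := hc'.exists_solution hc.drift.2 hc.le_add_shift
    ((hf.const_mul (shift lam K)).sub ml) mf.neg
  refine ⟨_, _, s, h1.add hs, hts, fun η hη => ?_⟩
  have m1 := hη.memLp (volume.restrict (ball (0 : Plane) R))
  have m2 := hη.memLp_gradient (volume.restrict (ball (0 : Plane) R))
  rw [hc'.form_add_left h1.memLp h1.memLp_grad hs.memLp hs.memLp_grad m1 m2, heq η hη,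
    hc'.form_eq_add h1.memLp h1.memLp_grad m1 m2]
  simp only [Pi.neg_apply, Pi.sub_apply, inner_neg_left, sub_mul, mul_assoc]
  rw [integral_neg, integral_sub ((integrable_mul_of_memLp hf m1).const_mul (shift lam K))
    (integrable_mul_of_memLp ml m1), integral_const_mul]
  ring

/-- Let U f be the solution of the shifted problem with right-hand side μf. Comparison makes U
monotone, keeps U f below φ₂ and puts U φ₁ above φ₁; coercivity makes U Lipschitz in L², so
`exists_fixedPoint_between` applies. The order of the barriers at the boundary is expressed by
smooth approximations of φ₂ lying above φ₁: then U f - φ₂ has approximations that are nonpositive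
off a compact set, as comparison requires. -/
theorem exists_solution_between (hc : BoundedCoeff A W V R lam K) {φ₁ : Plane → ℝ}
    (hφ₁ : ContDiff ℝ ∞ φ₁)
    (hsub : ∀ η, IsTestOn (ball 0 R) η → (∀ z, 0 ≤ η z) →
      form A W V R φ₁ (gradient φ₁) η (gradient η) ≤ 0)
    {φ₂ : Plane → ℝ} {g₂ : Plane → Plane} {t : ℕ → Plane → ℝ} (hφ₂ : H1Approx R φ₂ g₂ t)
    (hsup : ∀ η, IsTestOn (ball 0 R) η → (∀ z, 0 ≤ η z) →
      0 ≤ form A W V R φ₂ g₂ η (gradient η))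
    (hle : ∀ᶠ n in atTop, ∀ z ∈ ball (0 : Plane) R, φ₁ z ≤ t n z) :
    ∃ (u : Plane → ℝ) (g : Plane → Plane) (s : ℕ → Plane → ℝ), H1Approx R u g s ∧
      (∀ η, IsTestOn (ball 0 R) η → form A W V R u g η (gradient η) = 0) ∧
      ∀ᵐ z ∂volume.restrict (ball (0 : Plane) R), φ₁ z ≤ u z ∧ u z ≤ φ₂ z := by
  set μ := shift lam K with hμ
  have hμ0 : 0 < μ := shift_pos hc.lam_pos hc.K_nonneg
  have hc' := hc.add_const hμ0.le
  have h1 := H1Approx.of_contDiff hφ₁ R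
  have hV2 := hc.le_add_shift
  have hV4 := hc.le_add_shift'
  have hle12 : ∀ᵐ z ∂volume.restrict (ball (0 : Plane) R), φ₁ z ≤ φ₂ z := by
    obtain ⟨p, hp, hae⟩ := hφ₂.tendsto.exists_subseq_ae
      (fun n => (hφ₂.smooth n).continuous.aestronglyMeasurable) hφ₂.memLp.1
    filter_upwards [hae, ae_restrict_mem measurableSet_ball] with z hz hzb
    exact ge_of_tendsto hz ((hp.tendsto_atTop.eventually hle).mono fun n hn => hn z hzb)
  choose! U G S hU hS hUeq using fun (f : Plane → ℝ)
    (hf : MemLp f 2 (volume.restrict (ball (0 : Plane) R))) => hc.exists_solution_shift hφ₁ hf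
  have hmono : ∀ f f' : Plane → ℝ, MemLp f 2 (volume.restrict (ball (0 : Plane) R)) →
      MemLp f' 2 (volume.restrict (ball (0 : Plane) R)) →
      f ≤ᵐ[volume.restrict (ball (0 : Plane) R)] f' →
      U f ≤ᵐ[volume.restrict (ball (0 : Plane) R)] U f' := by
    intro f f' hf hf' hff
    have := ae_nonpos_of_form_nonpos hc' hc.drift.2 hV4 ((hU f hf).sub (hU f' hf'))
      (Eventually.of_forall fun n => ⟨tsupport (S f n) ∪ tsupport (S f' n),
        ((hS f hf n).compact.isCompact).union (hS f' hf' n).compact.isCompact,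
        union_subset (hS f hf n).subset (hS f' hf' n).subset, fun z _ hz => by
          rw [mem_union, not_or] at hz
          rw [image_eq_zero_of_notMem_tsupport hz.1, image_eq_zero_of_notMem_tsupport hz.2]; simp⟩)
      (fun η hη hη0 => by
        have m1 := hη.memLp (volume.restrict (ball (0 : Plane) R))
        have m2 := hη.memLp_gradient (volume.restrict (ball (0 : Plane) R))
        rw [hc'.form_sub_left (hU f hf).memLp (hU f hf).memLp_grad (hU f' hf').memLp
          (hU f' hf').memLp_grad m1 m2, hUeq f hf η hη, hUeq f' hf' η hη, ← mul_sub]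
        refine mul_nonpos_of_nonneg_of_nonpos hμ0.le (sub_nonpos.2 ?_)
        refine integral_mono_ae (integrable_mul_of_memLp hf m1) (integrable_mul_of_memLp hf' m1) ?_
        filter_upwards [hff] with z hz
        exact mul_le_mul_of_nonneg_right hz (hη0 z))
    filter_upwards [this] with z hz
    linarith
  have hupper : ∀ f : Plane → ℝ, MemLp f 2 (volume.restrict (ball (0 : Plane) R)) →
      f ≤ᵐ[volume.restrict (ball (0 : Plane) R)] φ₂ →
      U f ≤ᵐ[volume.restrict (ball (0 : Plane) R)] φ₂ := by
    intro f hf hff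
    have := ae_nonpos_of_form_nonpos hc' hc.drift.2 hV4 ((hU f hf).sub hφ₂)
      (hle.mono fun n hn => ⟨tsupport (S f n), (hS f hf n).compact.isCompact, (hS f hf n).subset,
        fun z hzb hz => by
          rw [image_eq_zero_of_notMem_tsupport hz]; linarith [hn z hzb]⟩)
      (fun η hη hη0 => by
        have m1 := hη.memLp (volume.restrict (ball (0 : Plane) R))
        have m2 := hη.memLp_gradient (volume.restrict (ball (0 : Plane) R))
        rw [hc'.form_sub_left (hU f hf).memLp (hU f hf).memLp_grad hφ₂.memLp hφ₂.memLp_grad m1 m2,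
          hUeq f hf η hη, hc.form_add_const μ hφ₂.memLp hφ₂.memLp_grad m1 m2]
        have e1 : ∫ z in ball (0 : Plane) R, f z * η z ≤ ∫ z in ball (0 : Plane) R, φ₂ z * η z := by
          refine integral_mono_ae (integrable_mul_of_memLp hf m1)
            (integrable_mul_of_memLp hφ₂.memLp m1) ?_
          filter_upwards [hff] with z hz
          exact mul_le_mul_of_nonneg_right hz (hη0 z)
        linarith [hsup η hη hη0, mul_le_mul_of_nonneg_left e1 hμ0.le])
    filter_upwards [this] with z hz
    linarith
  have hlower : φ₁ ≤ᵐ[volume.restrict (ball (0 : Plane) R)] U φ₁ := by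
    have hU1 := hU φ₁ h1.memLp
    have hS1 := hS φ₁ h1.memLp
    have := ae_nonpos_of_form_nonpos hc' hc.drift.2 hV4 (h1.sub hU1)
      (Eventually.of_forall fun n => ⟨tsupport (S φ₁ n), (hS1 n).compact.isCompact,
        (hS1 n).subset, fun z _ hz => by
          rw [image_eq_zero_of_notMem_tsupport hz]; simp⟩)
      (fun η hη hη0 => by
        have m1 := hη.memLp (volume.restrict (ball (0 : Plane) R))
        have m2 := hη.memLp_gradient (volume.restrict (ball (0 : Plane) R))
        rw [hc'.form_sub_left h1.memLp h1.memLp_grad hU1.memLp hU1.memLp_grad m1 m2,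
          hUeq φ₁ h1.memLp η hη, hc.form_add_const μ h1.memLp h1.memLp_grad m1 m2]
        linarith [hsub η hη hη0])
    filter_upwards [this] with z hz
    exact sub_nonpos.1 hz
  have hlip : ∀ f f' : Plane → ℝ, MemLp f 2 (volume.restrict (ball (0 : Plane) R)) →
      MemLp f' 2 (volume.restrict (ball (0 : Plane) R)) →
      l2 (volume.restrict (ball (0 : Plane) R)) (fun z => U f z - U f' z) ≤
        μ * l2 (volume.restrict (ball (0 : Plane) R)) (fun z => f z - f' z) := by
    intro f f' hf hf'
    have hw := (hU f hf).sub (hU f' hf')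
    have hw' : H1Approx R (fun z => U f z - U f' z) (fun z => G f z - G f' z)
        (fun n z => S f n z - S f' n z) := by
      convert hw using 3; ring
    have hq : MemLp (fun z => μ * (f z - f' z)) 2 (volume.restrict (ball (0 : Plane) R)) :=
      (hf.sub hf').const_mul μ
    have hself := hc'.form_self_of_approx hw' (fun n => ⟨hw'.smooth n,
        (hS f hf n).compact.sub (hS f' hf' n).compact,
        (tsupport_sub _ _).trans (union_subset (hS f hf n).subset (hS f' hf' n).subset)⟩) hq
      (fun η hη => by
        have m1 := hη.memLp (volume.restrict (ball (0 : Plane) R))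
        have m2 := hη.memLp_gradient (volume.restrict (ball (0 : Plane) R))
        rw [hc'.form_sub_left (hU _ hf).memLp (hU _ hf).memLp_grad (hU _ hf').memLp
          (hU _ hf').memLp_grad m1 m2, hUeq _ hf η hη, hUeq _ hf' η hη, ← mul_sub,
          ← integral_sub (integrable_mul_of_memLp hf m1) (integrable_mul_of_memLp hf' m1),
          ← integral_const_mul]
        congr 1; ext z; ring)
    -- The difference w of two solutions is tested with itself: ‖w‖² ≤ μ ∫ (f - f')w. Since μ ≥ 1
    -- this is no contraction, only continuity.
    have hco := hc'.le_form_self hc.drift.2 hV2 hw'.memLp hw'.memLp_grad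
    rw [hself] at hco
    have hcs := (le_abs_self _).trans (abs_integral_mul_le hq hw'.memLp)
    have e5 : l2 (volume.restrict (ball (0 : Plane) R)) (fun z => μ * (f z - f' z)) ≤
        μ * l2 (volume.restrict (ball (0 : Plane) R)) (fun z => f z - f' z) :=
      l2_le_mul (hf.sub hf') hμ0.le (ae_of_all _ fun z => by
        rw [norm_mul, Real.norm_of_nonneg hμ0.le]; exact le_rfl)
    have hlam := hc.lam_pos
    set a := l2 (volume.restrict (ball (0 : Plane) R)) (fun z => U f z - U f' z)
    have ha : 0 ≤ a := l2_nonneg _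
    set b := l2 (volume.restrict (ball (0 : Plane) R)) (fun z => G f z - G f' z)
    refine le_trans ?_ e5
    rcases eq_or_lt_of_le ha with h0 | h0
    · rw [← h0]; exact l2_nonneg _
    · refine le_of_mul_le_mul_right ?_ h0
      nlinarith [mul_nonneg hlam.le (sq_nonneg b)]
  obtain ⟨u, hu2, huv, hbds⟩ := exists_fixedPoint_between h1.memLp hφ₂.memLp hle12
    (fun f hf => (hU f hf).memLp) hlip hmono hlower hupper
  have hUu := hU u hu2
  refine ⟨U u, G u, _, hUu, fun η hη => ?_, ?_⟩
  · have m1 := hη.memLp (volume.restrict (ball (0 : Plane) R))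
    have m2 := hη.memLp_gradient (volume.restrict (ball (0 : Plane) R))
    have e1 := hUeq u hu2 η hη
    rw [hc.form_add_const μ hUu.memLp hUu.memLp_grad m1 m2] at e1
    have e2 : ∫ z in ball (0 : Plane) R, u z * η z =
        ∫ z in ball (0 : Plane) R, U u z * η z := by
      refine integral_congr_ae ?_
      filter_upwards [huv] with z hz
      rw [hz]
    rw [← e2] at e1
    linarith
  · filter_upwards [hbds, huv] with z hz hz2
    rw [← hz2]
    exact hz

end Existence

/-! ### Translations -/

/-- Lebesgue measure on the ball of radius `r`. -/
noncomputable abbrev volB (r : ℝ) : Measure Plane := volume.restrict (ball (0 : Plane) r)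

theorem volB_mono {r R : ℝ} (h : r ≤ R) : volB r ≤ volB R :=
  Measure.restrict_mono (ball_subset_ball h) le_rfl

theorem measurePreserving_add_ball (h : Plane) (R : ℝ) :
    MeasurePreserving (fun z : Plane => z + h)
      (volume.restrict ((fun z : Plane => z + h) ⁻¹' ball 0 R)) (volB R) :=
  (measurePreserving_add_right volume h).restrict_preimage_emb
    (MeasurableEquiv.addRight h).measurableEmbedding _

theorem volB_le_preimage_add {r R : ℝ} {h : Plane} (hr : r + ‖h‖ ≤ R) :
    volB r ≤ volume.restrict ((fun z : Plane => z + h) ⁻¹' ball 0 R) := by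
  refine Measure.restrict_mono (fun z hz => ?_) le_rfl
  rw [mem_ball_zero_iff] at hz
  rw [mem_preimage, mem_ball_zero_iff]
  linarith [norm_add_le z h]

section Translate

variable {E : Type*} [NormedAddCommGroup E] {r R : ℝ} {h : Plane}

theorem AEStronglyMeasurable.comp_add_ball {f : Plane → E} (hf : AEStronglyMeasurable f (volB R))
    (hr : r + ‖h‖ ≤ R) : AEStronglyMeasurable (fun z => f (z + h)) (volB r) :=
  (hf.comp_measurePreserving (measurePreserving_add_ball h R)).mono_measure
    (volB_le_preimage_add hr)

theorem eLpNorm_comp_add_le {f : Plane → E} (hf : AEStronglyMeasurable f (volB R))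
    (hr : r + ‖h‖ ≤ R) : eLpNorm (fun z => f (z + h)) 2 (volB r) ≤ eLpNorm f 2 (volB R) := by
  rw [← eLpNorm_comp_measurePreserving hf (measurePreserving_add_ball h R)]
  exact eLpNorm_mono_measure _ (volB_le_preimage_add hr)

theorem MeasureTheory.MemLp.comp_add_ball {f : Plane → E} (hf : MemLp f 2 (volB R)) (hr : r + ‖h‖ ≤ R) :
    MemLp (fun z => f (z + h)) 2 (volB r) :=
  ⟨AEStronglyMeasurable.comp_add_ball hf.1 hr, (eLpNorm_comp_add_le hf.1 hr).trans_lt hf.2⟩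

theorem TendstoL2.comp_add_ball {ι : Type*} {l : Filter ι} {s : ι → Plane → E} {f : Plane → E}
    (hs : ∀ n, AEStronglyMeasurable (s n) (volB R)) (hf : AEStronglyMeasurable f (volB R))
    (hsf : TendstoL2 (volB R) l s f) (hr : r + ‖h‖ ≤ R) :
    TendstoL2 (volB r) l (fun n z => s n (z + h)) (fun z => f (z + h)) :=
  TendstoL2.of_eventually_le (Eventually.of_forall fun n =>
    eLpNorm_comp_add_le (f := fun z => s n z - f z) ((hs n).sub hf) hr) hsf

theorem l2_ball_eq_of_support {f : Plane → E} (hf : ∀ z, z ∉ ball (0 : Plane) r → f z = 0)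
    (hr : r ≤ R) : l2 (volB R) f = l2 (volB r) f := by
  have hs : Function.support f ⊆ ball 0 r := fun z hz => by
    by_contra hcon; exact hz (hf z hcon)
  unfold l2
  rw [eLpNorm_restrict_eq_of_support_subset hs,
    eLpNorm_restrict_eq_of_support_subset (hs.trans (ball_subset_ball hr))]

end Translate

/-- The fundamental theorem of calculus along the segment from z to z + h, followed by Jensen's
inequality on the unit interval. -/
theorem enorm_sub_le_lintegral_gradient {f : Plane → ℝ} (hf : ContDiff ℝ ∞ f) (z h : Plane) :
    ‖f (z + h) - f z‖ₑ ^ 2 ≤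
      ∫⁻ σ in Icc (0 : ℝ) 1, (‖h‖ₑ * ‖gradient f (z + σ • h)‖ₑ) ^ 2 := by
  have hd : ∀ σ : ℝ, HasDerivAt (fun σ : ℝ => f (z + σ • h))
      (inner ℝ (gradient f (z + σ • h)) h) σ := by
    intro σ
    have h1 : HasDerivAt (fun σ : ℝ => z + σ • h) h σ := by
      simpa using ((hasDerivAt_id σ).smul_const h).const_add z
    have h2 := (hf.differentiableAt' (z := z + σ • h)).hasFDerivAt.comp_hasDerivAt σ h1
    rw [inner_gradient_left]
    exact h2
  have hcont : Continuous fun σ : ℝ => gradient f (z + σ • h) :=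
    (continuous_gradient hf).comp (by fun_prop)
  have hint := intervalIntegral.integral_eq_sub_of_hasDerivAt (a := 0) (b := 1)
    (fun σ _ => hd σ) ((hcont.inner continuous_const).intervalIntegrable _ _)
  simp only [one_smul, zero_smul, add_zero] at hint
  have h1 : ‖f (z + h) - f z‖ₑ ≤ ∫⁻ σ in Icc (0 : ℝ) 1, ‖h‖ₑ * ‖gradient f (z + σ • h)‖ₑ := by
    rw [← hint, intervalIntegral.integral_of_le zero_le_one, ← integral_Icc_eq_integral_Ioc]
    refine (enorm_integral_le_lintegral_enorm _).trans (lintegral_mono fun σ => ?_)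
    rw [mul_comm]
    simp only [← ofReal_norm]
    rw [← ENNReal.ofReal_mul (norm_nonneg _)]
    exact ENNReal.ofReal_le_ofReal (norm_inner_le_norm _ _)
  have : IsProbabilityMeasure (volume.restrict (Icc (0 : ℝ) 1)) := ⟨by simp⟩
  set φ : ℝ → ℝ := fun σ => ‖h‖ * ‖gradient f (z + σ • h)‖ with hφ
  have hφm : Continuous φ := continuous_const.mul hcont.norm
  have h2 := eLpNorm_le_eLpNorm_of_exponent_le (μ := volume.restrict (Icc (0 : ℝ) 1))
    (p := 1) (q := 2) (by norm_num) hφm.aestronglyMeasurable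
  rw [eLpNorm_one_eq_lintegral_enorm, eLpNorm_two_eq] at h2
  have h3 : ∀ σ, ‖φ σ‖ₑ = ‖h‖ₑ * ‖gradient f (z + σ • h)‖ₑ := by
    intro σ; rw [hφ]; simp [enorm_mul]
  simp only [h3] at h2
  refine (pow_le_pow_left' (h1.trans h2) 2).trans (le_of_eq ?_)
  rw [← ENNReal.rpow_natCast, ← ENNReal.rpow_mul]
  norm_num

theorem eLpNorm_translate_sub_le {f : Plane → ℝ} (hf : ContDiff ℝ ∞ f) {r R : ℝ} {h : Plane}
    (hr : r + ‖h‖ ≤ R) :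
    eLpNorm (fun z => f (z + h) - f z) 2 (volB r) ≤ ‖h‖ₑ * eLpNorm (gradient f) 2 (volB R) := by
  have hg := continuous_gradient hf
  have key : ∫⁻ z in ball (0 : Plane) r, ‖f (z + h) - f z‖ₑ ^ 2 ≤
      ‖h‖ₑ ^ 2 * ∫⁻ z in ball (0 : Plane) R, ‖gradient f z‖ₑ ^ 2 := by
    have hm : Continuous fun p : Plane × ℝ => gradient f (p.1 + p.2 • h) :=
      hg.comp (by fun_prop)
    calc _ ≤ ∫⁻ z in ball (0 : Plane) r, ∫⁻ σ in Icc (0 : ℝ) 1,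
          (‖h‖ₑ * ‖gradient f (z + σ • h)‖ₑ) ^ 2 :=
          lintegral_mono fun z => enorm_sub_le_lintegral_gradient hf z h
      _ = ∫⁻ σ in Icc (0 : ℝ) 1, ∫⁻ z in ball (0 : Plane) r,
          (‖h‖ₑ * ‖gradient f (z + σ • h)‖ₑ) ^ 2 :=
          lintegral_lintegral_swap (by
            refine Measurable.aemeasurable ?_
            exact ((hm.enorm.measurable).const_mul _).pow_const 2)
      _ ≤ ∫⁻ σ in Icc (0 : ℝ) 1, ‖h‖ₑ ^ 2 * ∫⁻ z in ball (0 : Plane) R, ‖gradient f z‖ₑ ^ 2 := by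
          refine setLIntegral_mono measurable_const fun σ hσ => ?_
          simp only [mul_pow]
          rw [lintegral_const_mul' _ _ (by simp)]
          refine mul_le_mul' le_rfl ?_
          have hσh : r + ‖σ • h‖ ≤ R := by
            rw [norm_smul, Real.norm_of_nonneg hσ.1]
            linarith [mul_le_of_le_one_left (norm_nonneg h) hσ.2]
          have := eLpNorm_comp_add_le (f := gradient f) (R := R) hg.aestronglyMeasurable hσh
          rw [eLpNorm_two_eq, eLpNorm_two_eq] at this
          exact (ENNReal.rpow_le_rpow_iff (by norm_num)).1 this
      _ = _ := by simp
  rw [eLpNorm_two_eq, eLpNorm_two_eq]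
  calc _ ≤ (‖h‖ₑ ^ 2 * ∫⁻ z in ball (0 : Plane) R, ‖gradient f z‖ₑ ^ 2) ^ (1 / 2 : ℝ) := by
        gcongr
    _ = _ := by
      rw [ENNReal.mul_rpow_of_nonneg _ _ (by norm_num), ← ENNReal.rpow_natCast, ← ENNReal.rpow_mul]
      norm_num

theorem l2_translate_sub_le {f : Plane → ℝ} (hf : ContDiff ℝ ∞ f) {r R : ℝ} {h : Plane}
    (hr : r + ‖h‖ ≤ R) :
    l2 (volB r) (fun z => f (z + h) - f z) ≤ ‖h‖ * l2 (volB R) (gradient f) := by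
  have := eLpNorm_translate_sub_le hf hr
  have hfin := (memLp_ball_of_continuous (continuous_gradient hf) R).2.ne
  have h2 := ENNReal.toReal_mono (ENNReal.mul_ne_top (by simp) hfin) this
  rwa [ENNReal.toReal_mul, toReal_enorm] at h2

theorem H1Approx.l2_translate_sub_le {R r : ℝ} {u : Plane → ℝ} {g : Plane → Plane}
    {s : ℕ → Plane → ℝ} (hs : H1Approx R u g s) {h : Plane} (hr : r + ‖h‖ ≤ R) :
    l2 (volB r) (fun z => u (z + h) - u z) ≤ ‖h‖ * l2 (volB R) g := by
  have hrR : r ≤ R := by linarith [norm_nonneg h]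
  have hsm : ∀ n, MemLp (s n) 2 (volB R) :=
    fun n => memLp_ball_of_continuous (hs.smooth n).continuous R
  have hum := hs.memLp.mono_measure (volB_mono hrR)
  have h1 : TendstoL2 (volB r) atTop (fun n z => s n (z + h) - s n z)
      (fun z => u (z + h) - u z) :=
    (hs.tendsto.comp_add_ball (fun n => (hsm n).1) hs.memLp.1 hr).sub
      (hs.tendsto.mono_measure (volB_mono hrR))
      (fun n => ((hsm n).comp_add_ball hr).1) (hs.memLp.comp_add_ball hr).1
      (fun n => ((hsm n).mono_measure (volB_mono hrR)).1) hum.1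
  refine le_of_tendsto_of_tendsto' (h1.l2
    (fun n => ((hsm n).comp_add_ball hr).sub ((hsm n).mono_measure (volB_mono hrR)))
    ((hs.memLp.comp_add_ball hr).sub hum))
    ((hs.tendsto_grad.l2 (fun n => memLp_ball_of_continuous (continuous_gradient (hs.smooth n)) R)
      hs.memLp_grad).const_mul ‖h‖) fun n => ?_
  exact _root_.l2_translate_sub_le (hs.smooth n) hr

/-! ### Second order estimates by difference quotients -/

theorem norm_flux_sub_le {A A' : Plane → Matrix (Fin 2) (Fin 2) ℝ} {g : Plane → Plane} {z : Plane}
    {ε : ℝ} (h : ∀ i j, |A' z i j - A z i j| ≤ ε) :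
    ‖flux A' g z - flux A g z‖ ≤ 2 * ε * ‖g z‖ := by
  have hε : 0 ≤ ε := (abs_nonneg _).trans (h 0 0)
  refine abs_le_of_sq_le_sq' ?_ (by positivity) |>.2
  have h1 : ∀ i, (flux A' g z - flux A g z) i ^ 2 ≤ ε ^ 2 * (|g z 0| + |g z 1|) ^ 2 := by
    intro i
    have e : (flux A' g z - flux A g z) i =
        (A' z i 0 - A z i 0) * g z 0 + (A' z i 1 - A z i 1) * g z 1 := by
      simp only [flux, PiLp.sub_apply, Fin.sum_univ_two]; ring
    rw [e, ← mul_pow]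
    refine sq_le_sq.2 ?_
    rw [abs_of_nonneg (a := ε * _) (by positivity), mul_add]
    refine (abs_add_le _ _).trans ?_
    rw [abs_mul, abs_mul]
    exact add_le_add (mul_le_mul_of_nonneg_right (h i 0) (abs_nonneg _))
      (mul_le_mul_of_nonneg_right (h i 1) (abs_nonneg _))
  have h2 : (|g z 0| + |g z 1|) ^ 2 ≤ 2 * ‖g z‖ ^ 2 := by
    rw [norm_sq_plane, ← sq_abs (g z 0), ← sq_abs (g z 1)]
    nlinarith [sq_nonneg (|g z 0| - |g z 1|)]
  rw [norm_sq_plane]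
  calc _ ≤ ε ^ 2 * (|g z 0| + |g z 1|) ^ 2 + ε ^ 2 * (|g z 0| + |g z 1|) ^ 2 :=
        add_le_add (h1 0) (h1 1)
    _ ≤ ε ^ 2 * (2 * ‖g z‖ ^ 2) + ε ^ 2 * (2 * ‖g z‖ ^ 2) := by gcongr
    _ = _ := by ring

/-- The constant in the second order estimate. -/
noncomputable def diffConst (lam K L M : ℝ) : ℝ :=
  ((K + 2 * L) + 2 * M / lam + 2 * M * (K + 2 * L)) / lam + 1

/-- After expansion the hypothesis reads λX² ≤ ayX + by². If X exceeded the claimed multiple of y,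
the summand 1 of `diffConst` would give y ≤ X, and replacing one y by X in the last term contradicts
the rest of the constant. -/
theorem le_diffConst_mul {lam K L M X y : ℝ} (hlam : 0 < lam) (hK : 0 ≤ K) (hL : 0 ≤ L)
    (hM : 0 ≤ M) (hy : 0 ≤ y)
    (h : lam * X ^ 2 ≤ (K + 2 * L) * y * (X + 2 * M * y) + 2 * M / lam * y * X) :
    X ≤ diffConst lam K L M * y := by
  unfold diffConst
  set a := (K + 2 * L) + 2 * M / lam with ha
  set b := 2 * M * (K + 2 * L) with hb
  have ha0 : 0 ≤ a := by positivity
  have hb0 : 0 ≤ b := by positivity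
  have h' : lam * X ^ 2 ≤ a * y * X + b * y ^ 2 := by
    refine h.trans (le_of_eq ?_); rw [ha, hb]; ring
  by_contra! hcon
  have h1 : y ≤ X := by
    have : 0 ≤ (a + b) / lam * y := by positivity
    linarith
  have hX : 0 ≤ X := hy.trans h1
  have h2 : lam * X ^ 2 ≤ (a + b) * y * X := by
    have := mul_le_mul_of_nonneg_left h1 (mul_nonneg hb0 hy)
    nlinarith
  have h3 : (a + b) / lam * y < X := by linarith
  rw [div_mul_eq_mul_div, div_lt_iff₀ hlam] at h3
  rcases eq_or_lt_of_le hX with h0 | h0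
  · rw [← h0] at h3
    nlinarith [mul_nonneg (add_nonneg ha0 hb0) hy]
  · nlinarith [mul_lt_mul_of_pos_right h3 h0]

section DiffQuot

variable {A : Plane → Matrix (Fin 2) (Fin 2) ℝ} {W : Plane → Plane} {V : Plane → ℝ}
  {R r lam K L M : ℝ} {u χ : Plane → ℝ} {g : Plane → Plane} {s : ℕ → Plane → ℝ} {h : Plane}

theorem gradient_comp_add (f : Plane → ℝ) (z h : Plane) :
    gradient (fun y => f (y + h)) z = gradient f (z + h) := by
  ext i
  rw [gradient_apply, gradient_apply, fderiv_comp_add_right]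

theorem gradient_translate_sub {f : Plane → ℝ} (hf : ContDiff ℝ ∞ f) (z h : Plane) :
    gradient (fun y => f (y + h) - f y) z = gradient f (z + h) - gradient f z := by
  rw [gradient_sub' (f := fun y => f (y + h)) (ContDiff.differentiableAt'
    (hf.comp (contDiff_id.add contDiff_const))) hf.differentiableAt', gradient_comp_add]

theorem IsTestOn.translate_sub (hχ : IsTestOn (ball 0 r) χ) (hr : r + ‖h‖ < R) :
    IsTestOn (ball 0 R) (fun z => χ (z + -h) - χ z) := by
  have hc1 : HasCompactSupport fun z => χ (z + -h) := by
    have := hχ.compact.comp_homeomorph (Homeomorph.addRight (-h))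
    exact this
  refine ⟨(hχ.smooth.comp (contDiff_id.add contDiff_const)).sub hχ.smooth, hc1.sub hχ.compact, ?_⟩
  refine (tsupport_sub _ _).trans (union_subset ?_ ?_)
  · have h1 : tsupport (fun z => χ (z + -h)) ⊆ (fun z => z + -h) ⁻¹' tsupport χ := by
      refine closure_minimal (fun z hz => subset_closure hz)
        ((isClosed_tsupport χ).preimage (by fun_prop))
    intro z hz
    have h2 := hχ.subset (h1 hz)
    rw [mem_ball_zero_iff] at h2 ⊢
    have h3 := norm_add_le (z + -h) h
    rw [neg_add_cancel_right] at h3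
    linarith
  · exact hχ.subset.trans (ball_subset_ball (by linarith [norm_nonneg h]))

/-- Discrete integration by parts for the flux. -/
theorem BoundedCoeff.integral_inner_translate (hc : BoundedCoeff A W V R lam K)
    (hu : MemLp u 2 (volB R)) (hg : MemLp g 2 (volB R))
    (heq : ∀ η, IsTestOn (ball 0 R) η → form A W V R u g η (gradient η) = 0)
    (hψ : IsTestOn (ball 0 r) χ) (hr : r + ‖h‖ < R) :
    |∫ z in ball (0 : Plane) r, inner ℝ (flux A g (z + h) - flux A g z) (gradient χ z)| ≤
      l2 (volB R) (lowerOrder W V u g) * (‖h‖ * l2 (volB r) (gradient χ)) := by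
  -- The equation is tested with χ(· - h) - χ, and a change of variables moves the translation onto
  -- the flux.
  have hη := hψ.translate_sub hr
  have hrR : r ≤ R := by linarith [norm_nonneg h]
  have hQ := hc.memLp_flux hg
  have hq := hc.memLp_lower hu hg
  have hk := continuous_gradient hψ.smooth
  have hkm := memLp_ball_of_continuous hk R
  have hkm' : MemLp (fun z => gradient χ (z + -h)) 2 (volB R) :=
    memLp_ball_of_continuous (hk.comp (continuous_add_const (-h))) R
  have hηm := hη.memLp (volB R)
  have e1 := heq _ hη
  rw [hc.form_eq_add hu hg hηm (hη.memLp_gradient _)] at e1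
  simp only [gradient_translate_sub hψ.smooth, inner_sub_right] at e1
  rw [integral_sub (integrable_inner_of_memLp hQ hkm') (integrable_inner_of_memLp hQ hkm)] at e1
  have hz0 : ∀ z, z ∉ ball (0 : Plane) r → gradient χ z = 0 := fun z hz => hψ.gradient_eq_zero hz
  have e3 : ∫ z in ball (0 : Plane) R, inner ℝ (flux A g z) (gradient χ (z + -h)) =
      ∫ z in ball (0 : Plane) r, inner ℝ (flux A g (z + h)) (gradient χ z) := by
    rw [setIntegral_eq_integral_of_forall_compl_eq_zero,
      setIntegral_eq_integral_of_forall_compl_eq_zero,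
      ← integral_add_right_eq_self _ h]
    · simp
    · intro z hz; rw [hz0 z hz, inner_zero_right]
    · intro z hz
      rw [hz0 (z + -h), inner_zero_right]
      intro hz'
      apply hz
      rw [mem_ball_zero_iff] at hz' ⊢
      have h3 := norm_add_le (z + -h) h
      rw [neg_add_cancel_right] at h3
      linarith
  have e4 : ∫ z in ball (0 : Plane) R, inner ℝ (flux A g z) (gradient χ z) =
      ∫ z in ball (0 : Plane) r, inner ℝ (flux A g z) (gradient χ z) := by
    rw [setIntegral_eq_integral_of_forall_compl_eq_zero,
      setIntegral_eq_integral_of_forall_compl_eq_zero]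
    · intro z hz; rw [hz0 z hz, inner_zero_right]
    · intro z hz
      rw [hz0 z fun h' => hz (ball_subset_ball hrR h'), inner_zero_right]
  have hQr := hQ.mono_measure (volB_mono hrR)
  have hkr := hkm.mono_measure (volB_mono hrR)
  have e5 : ∫ z in ball (0 : Plane) r, inner ℝ (flux A g (z + h) - flux A g z) (gradient χ z) =
      - ∫ z in ball (0 : Plane) R, lowerOrder W V u g z * (χ (z + -h) - χ z) := by
    simp only [inner_sub_left]
    rw [integral_sub (integrable_inner_of_memLp (hQ.comp_add_ball hr.le) hkr)
      (integrable_inner_of_memLp hQr hkr), ← e3, ← e4]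
    linarith
  rw [e5, abs_neg]
  refine (abs_integral_mul_le hq hηm).trans (mul_le_mul_of_nonneg_left ?_ (l2_nonneg _))
  -- The lower order term meets only the increment of the test function, which gains a factor |h|
  -- against its gradient.
  have e6 := l2_translate_sub_le hψ.smooth (h := -h) (r := R) (R := R + ‖h‖) (by rw [norm_neg])
  rwa [norm_neg, l2_ball_eq_of_support hz0 (hrR.trans (by linarith [norm_nonneg h]))] at e6

/-- Nirenberg's method. Let d and D be the increments of u and g. The increment of the equation is
tested with χ²d, whose principal contribution is at least λ|χD|². There are three errors: the lower
order terms, handled by `BoundedCoeff.integral_inner_translate`; the gradient of χ, which meets d;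
and the increment of A, of size L|h| because the entries are Lipschitz. All are controlled by |h|
times the H¹ norm, so a quadratic inequality for the norm of χD results. -/
theorem BoundedCoeff.l2_translate_grad_le (hc : BoundedCoeff A W V R lam K)
    (hs : H1Approx R u g s)
    (heq : ∀ η, IsTestOn (ball 0 R) η → form A W V R u g η (gradient η) = 0)
    (hA : ∀ i j, WeakGradientBoundedOn (fun z => A z i j) (ball 0 R) L) (hL : 0 ≤ L)
    (hχ : IsTestOn (ball 0 r) χ) (h0 : ∀ z, 0 ≤ χ z) (h1 : ∀ z, χ z ≤ 1)
    (hM : ∀ z, ‖gradient χ z‖ ≤ M) (hr : r + ‖h‖ < R) :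
    l2 (volB r) (fun z => χ z • (g (z + h) - g z)) ≤
      diffConst lam K L M * (‖h‖ * (l2 (volB R) g + l2 (volB R) u)) := by
  have hlam := hc.lam_pos
  have hM0 : 0 ≤ M := (norm_nonneg _).trans (hM 0)
  have hrR : r ≤ R := by linarith [norm_nonneg h]
  have hvr := volB_mono hrR
  have hsm : ∀ n, MemLp (s n) 2 (volB R) :=
    fun n => memLp_ball_of_continuous (hs.smooth n).continuous R
  have hgm : ∀ n, MemLp (gradient (s n)) 2 (volB R) :=
    fun n => memLp_ball_of_continuous (continuous_gradient (hs.smooth n)) R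
  set D : Plane → Plane := fun z => g (z + h) - g z with hD
  set d : Plane → ℝ := fun z => u (z + h) - u z with hd
  set Dn : ℕ → Plane → Plane := fun n z => gradient (s n) (z + h) - gradient (s n) z with hDn
  set dn : ℕ → Plane → ℝ := fun n z => s n (z + h) - s n z with hdn
  have mD : MemLp D 2 (volB r) := (hs.memLp_grad.comp_add_ball hr.le).sub
    (hs.memLp_grad.mono_measure hvr)
  have md : MemLp d 2 (volB r) := (hs.memLp.comp_add_ball hr.le).sub (hs.memLp.mono_measure hvr)
  have mDn : ∀ n, MemLp (Dn n) 2 (volB r) := fun n => ((hgm n).comp_add_ball hr.le).sub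
    ((hgm n).mono_measure hvr)
  have mdn : ∀ n, MemLp (dn n) 2 (volB r) := fun n => ((hsm n).comp_add_ball hr.le).sub
    ((hsm n).mono_measure hvr)
  have tD : TendstoL2 (volB r) atTop Dn D :=
    (hs.tendsto_grad.comp_add_ball (fun n => (hgm n).1) hs.memLp_grad.1 hr.le).sub
      (hs.tendsto_grad.mono_measure hvr) (fun n => ((hgm n).comp_add_ball hr.le).1)
      (hs.memLp_grad.comp_add_ball hr.le).1 (fun n => ((hgm n).mono_measure hvr).1)
      (hs.memLp_grad.mono_measure hvr).1
  have td : TendstoL2 (volB r) atTop dn d :=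
    (hs.tendsto.comp_add_ball (fun n => (hsm n).1) hs.memLp.1 hr.le).sub
      (hs.tendsto.mono_measure hvr) (fun n => ((hsm n).comp_add_ball hr.le).1)
      (hs.memLp.comp_add_ball hr.le).1 (fun n => ((hsm n).mono_measure hvr).1)
      (hs.memLp.mono_measure hvr).1
  have cχ := hχ.smooth.continuous
  have cg := continuous_gradient hχ.smooth
  have hχ2 : ∀ z, χ z ^ 2 ≤ 1 := fun z => pow_le_one₀ (h0 z) (h1 z)
  -- the two parts of the gradient of the test function
  have mP : ∀ {F : Plane → Plane}, MemLp F 2 (volB r) →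
      MemLp (fun z => χ z ^ 2 • F z) 2 (volB r) := fun {F} hF =>
    hF.of_le ((cχ.pow 2).aestronglyMeasurable.smul hF.1) (ae_of_all _ fun z => by
      rw [norm_smul, Real.norm_of_nonneg (sq_nonneg _)]
      exact mul_le_of_le_one_left (norm_nonneg _) (hχ2 z))
  have bN : ∀ (F : Plane → ℝ) z, ‖(2 * χ z * F z) • gradient χ z‖ ≤ 2 * M * ‖F z‖ := by
    intro F z
    rw [norm_smul, norm_mul, norm_mul, Real.norm_of_nonneg (h0 z), Real.norm_two]
    calc _ ≤ 2 * 1 * ‖F z‖ * M := by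
          gcongr
          · exact h1 z
          · exact hM z
      _ = _ := by ring
  have mN : ∀ {F : Plane → ℝ}, MemLp F 2 (volB r) →
      MemLp (fun z => (2 * χ z * F z) • gradient χ z) 2 (volB r) := fun {F} hF =>
    hF.of_le_mul (((continuous_const.mul cχ).aestronglyMeasurable.mul hF.1).smul
      cg.aestronglyMeasurable) (ae_of_all _ fun z => bN F z)
  have tP : TendstoL2 (volB r) atTop (fun n z => χ z ^ 2 • Dn n z) (fun z => χ z ^ 2 • D z) :=
    tD.of_le 1 (Eventually.of_forall fun n => ae_of_all _ fun z => by
      rw [← smul_sub, norm_smul, Real.norm_of_nonneg (sq_nonneg _)]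
      exact mul_le_mul_of_nonneg_right (hχ2 z) (norm_nonneg _))
  have tN : TendstoL2 (volB r) atTop (fun n z => (2 * χ z * dn n z) • gradient χ z)
      (fun z => (2 * χ z * d z) • gradient χ z) :=
    td.of_le (2 * M) (Eventually.of_forall fun n => ae_of_all _ fun z => by
      rw [← sub_smul, ← mul_sub]
      exact bN (fun z => dn n z - d z) z)
  set k : Plane → Plane := fun z => χ z ^ 2 • D z + (2 * χ z * d z) • gradient χ z with hk
  have mk : MemLp k 2 (volB r) := (mP mD).add (mN md)
  have tk := tP.add tN (fun n => (mP (mDn n)).1) (mP mD).1 (fun n => (mN (mdn n)).1) (mN md).1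
  have hdsm : ∀ n, ContDiff ℝ ∞ (dn n) := fun n =>
    ((hs.smooth n).comp (contDiff_id.add contDiff_const)).sub (hs.smooth n)
  -- Since d need not be smooth, the test functions are χ²dₙ with dₙ the increments of the smooth
  -- approximations; the limit is taken afterwards.
  have hψ : ∀ n, IsTestOn (ball 0 r) (fun z => (χ z * dn n z) * χ z) := fun n =>
    hχ.smul_left (hχ.smooth.mul (hdsm n))
  have hψg : ∀ n, gradient (fun z => (χ z * dn n z) * χ z) =
      fun z => χ z ^ 2 • Dn n z + (2 * χ z * dn n z) • gradient χ z := by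
    intro n
    funext z
    rw [gradient_mul (hχ.smooth.mul (hdsm n)).differentiableAt' hχ.smooth.differentiableAt',
      gradient_mul hχ.smooth.differentiableAt' (hdsm n).differentiableAt',
      show gradient (dn n) z = Dn n z from gradient_translate_sub (hs.smooth n) z h]
    module
  have mT : MemLp (fun z => flux A g (z + h) - flux A g z) 2 (volB r) :=
    ((hc.memLp_flux hs.memLp_grad).comp_add_ball hr.le).sub
      ((hc.memLp_flux hs.memLp_grad).mono_measure hvr)
  have key : |∫ z in ball (0 : Plane) r, inner ℝ (flux A g (z + h) - flux A g z) (k z)| ≤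
      l2 (volB R) (lowerOrder W V u g) * (‖h‖ * l2 (volB r) k) := by
    have mkn : ∀ n, MemLp (fun z => χ z ^ 2 • Dn n z + (2 * χ z * dn n z) • gradient χ z) 2
      (volB r) := fun n => (mP (mDn n)).add (mN (mdn n))
    refine le_of_tendsto_of_tendsto' (tk.inner mT mkn mk).abs
      (((tk.l2 mkn mk).const_mul ‖h‖).const_mul _) fun n => ?_
    have := hc.integral_inner_translate hs.memLp hs.memLp_grad heq (hψ n) hr
    rwa [hψg n] at this
  set X := l2 (volB r) (fun z => χ z • D z) with hX
  set S := l2 (volB R) g + l2 (volB R) u with hS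
  have hg0 : 0 ≤ l2 (volB R) g := l2_nonneg _
  have hu0 : 0 ≤ l2 (volB R) u := l2_nonneg _
  have hd' : l2 (volB r) d ≤ ‖h‖ * S :=
    (hs.l2_translate_sub_le hr.le).trans (mul_le_mul_of_nonneg_left (by linarith) (norm_nonneg _))
  have hq' : l2 (volB R) (lowerOrder W V u g) ≤ K * S := by
    have e1 : l2 (volB R) (lowerOrder W V u g) ≤ K * l2 (volB R) (fun z => ‖g z‖ + ‖u z‖) :=
      l2_le_mul (hs.memLp_grad.norm.add hs.memLp.norm) hc.K_nonneg
        (hc.abs_lower_le.mono fun z hz => by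
          exact (hz u g).trans (mul_le_mul_of_nonneg_left (le_abs_self _) hc.K_nonneg))
    refine e1.trans (mul_le_mul_of_nonneg_left ?_ hc.K_nonneg)
    refine (l2_add_le hs.memLp_grad.norm hs.memLp.norm).trans (le_of_eq ?_)
    rw [l2_norm, l2_norm]
  have mχD : MemLp (fun z => χ z • D z) 2 (volB r) :=
    mD.of_le (cχ.aestronglyMeasurable.smul mD.1) (ae_of_all _ fun z => by
      rw [norm_smul, Real.norm_of_nonneg (h0 z)]
      exact mul_le_of_le_one_left (norm_nonneg _) (h1 z))
  have hk' : l2 (volB r) k ≤ X + 2 * M * (‖h‖ * S) := by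
    refine (l2_add_le (mP mD) (mN md)).trans (add_le_add ?_ ?_)
    · refine l2_mono mχD (ae_of_all _ fun z => ?_)
      rw [norm_smul, norm_smul, Real.norm_of_nonneg (h0 z), Real.norm_of_nonneg (sq_nonneg _)]
      refine mul_le_mul_of_nonneg_right ?_ (norm_nonneg _)
      nlinarith [h0 z, h1 z]
    · refine (l2_le_mul md (by positivity) (ae_of_all _ fun z => bN d z)).trans ?_
      exact mul_le_mul_of_nonneg_left hd' (by positivity)
  have hpt : ∀ᵐ z ∂volB r, lam * ‖χ z • D z‖ ^ 2 ≤
      inner ℝ (flux A g (z + h) - flux A g z) (k z) +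
      (2 * M / lam * (‖χ z • D z‖ * ‖d z‖) + 2 * (L * ‖h‖) * (‖g z‖ * ‖k z‖)) := by
    have hAe : ∀ᵐ z, ∀ i j, z ∈ ball (0 : Plane) r → |A (z + h) i j - A z i j| ≤ L * ‖h‖ :=
      ae_all_iff.2 fun i => ae_all_iff.2 fun j => (hA i j).ae_abs_sub_le hr
    filter_upwards [ae_restrict_of_ae hAe, ae_restrict_mem measurableSet_ball] with z hz hzb
    have hzR : z + h ∈ ball (0 : Plane) R := by
      rw [mem_ball_zero_iff] at hzb ⊢
      linarith [norm_add_le z h]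
    set A' : Plane → Matrix (Fin 2) (Fin 2) ℝ := fun z => A (z + h) with hA'
    have hell : EllipticBoundedOn A' {z} lam := fun y hy => by
      rw [mem_singleton_iff] at hy; rw [hy]; exact hc.elliptic _ hzR
    -- The discrete product rule: the translated matrix acts on the increment D, and the increment
    -- of the matrix acts on g at z.
    have f1 : flux A g (z + h) - flux A g z = flux A' D z + (flux A' g z - flux A g z) := by
      rw [show flux A' D z = flux A g (z + h) - flux A' g z from
        flux_sub A' (fun z => g (z + h)) g z]
      abel
    have f2 := norm_flux_sub_le (g := g) (A := A) (A' := A') (z := z) (fun i j => hz i j hzb)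
    have f3 := hell.le_inner_flux (g := D) (mem_singleton z)
    have f4 := hell.norm_flux_le (g := D) (mem_singleton z)
    have f5 := neg_le_of_abs_le (abs_real_inner_le_norm (flux A' g z - flux A g z) (k z))
    have f6 := neg_le_of_abs_le (abs_real_inner_le_norm (flux A' D z)
      ((2 * χ z * d z) • gradient χ z))
    have f7 : ‖flux A' D z‖ * ‖(2 * χ z * d z) • gradient χ z‖ ≤
        2 * M / lam * (‖χ z • D z‖ * ‖d z‖) := by
      rw [norm_smul, norm_smul, norm_mul, norm_mul, Real.norm_of_nonneg (h0 z), Real.norm_two]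
      calc _ ≤ (lam⁻¹ * ‖D z‖) * (2 * χ z * ‖d z‖ * M) := by
            have := h0 z
            gcongr
            exact hM z
        _ = _ := by rw [div_eq_mul_inv]; ring
    have f8 : ‖flux A' g z - flux A g z‖ * ‖k z‖ ≤ 2 * (L * ‖h‖) * (‖g z‖ * ‖k z‖) := by
      rw [← mul_assoc]; exact mul_le_mul_of_nonneg_right f2 (norm_nonneg _)
    have f9 : inner ℝ (flux A' D z) (k z) = χ z ^ 2 * inner ℝ (flux A' D z) (D z) +
        inner ℝ (flux A' D z) ((2 * χ z * d z) • gradient χ z) := by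
      rw [hk]; simp only [inner_add_right, real_inner_smul_right]
    have f10 := mul_le_mul_of_nonneg_left f3 (sq_nonneg (χ z))
    have f11 : lam * ‖χ z • D z‖ ^ 2 = χ z ^ 2 * (lam * ‖D z‖ ^ 2) := by
      rw [norm_smul, Real.norm_of_nonneg (h0 z)]; ring
    rw [f1, inner_add_left, f9, f11]
    linarith
  have i1 : Integrable (fun z => ‖χ z • D z‖ ^ 2) (volB r) := by
    simpa [sq] using integrable_mul_of_memLp mχD.norm mχD.norm
  have i2 := integrable_mul_of_memLp mχD.norm md.norm
  have mgr := hs.memLp_grad.mono_measure hvr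
  have i3 := integrable_mul_of_memLp mgr.norm mk.norm
  have i4 := integrable_inner_of_memLp mT mk
  have i5 : Integrable (fun z => 2 * M / lam * (‖χ z • D z‖ * ‖d z‖) +
      2 * (L * ‖h‖) * (‖g z‖ * ‖k z‖)) (volB r) :=
    (i2.const_mul (2 * M / lam)).add (i3.const_mul (2 * (L * ‖h‖)))
  have hI := integral_mono_ae (i1.const_mul lam) (i4.add i5) hpt
  simp only [Pi.add_apply] at hI
  rw [integral_const_mul, integral_add i4 i5,
    integral_add (i2.const_mul _) (i3.const_mul _), integral_const_mul, integral_const_mul,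
    ← l2_sq mχD] at hI
  have j2 := (le_abs_self _).trans (abs_integral_mul_le mχD.norm md.norm)
  have j3 := (le_abs_self _).trans (abs_integral_mul_le mgr.norm mk.norm)
  have j4 := (le_abs_self _).trans key
  rw [l2_norm, l2_norm] at j2 j3
  have hgr : l2 (volB r) g ≤ S :=
    (l2_mono_measure hvr hs.memLp_grad).trans (by linarith)
  have hX0 : 0 ≤ X := l2_nonneg _
  have hS0 : 0 ≤ S := by positivity
  have hk0 : 0 ≤ l2 (volB r) k := l2_nonneg _
  have hh := norm_nonneg h
  have hK0 := hc.K_nonneg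
  refine le_diffConst_mul hlam hK0 hL hM0 (by positivity) ?_
  calc lam * X ^ 2 ≤ _ := hI
    _ ≤ K * S * (‖h‖ * (X + 2 * M * (‖h‖ * S))) + (2 * M / lam * (X * (‖h‖ * S)) +
        2 * (L * ‖h‖) * (S * (X + 2 * M * (‖h‖ * S)))) := by
      refine add_le_add (j4.trans ?_) (add_le_add ?_ ?_)
      · gcongr
      · exact mul_le_mul_of_nonneg_left (j2.trans (by gcongr)) (by positivity)
      · exact mul_le_mul_of_nonneg_left (j3.trans (by gcongr)) (by positivity)
    _ = _ := by ring

end DiffQuot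

/-! ### Square-integrable mixed derivatives give Hölder continuity -/

theorem measurePreserving_coord01 :
    MeasurePreserving (fun p : ℝ × ℝ => p.1 • stdVec 0 + p.2 • stdVec 1 : ℝ × ℝ → Plane) := by
  have h1 := (EuclideanSpace.volume_preserving_symm_measurableEquiv_toLp (Fin 2)).symm.comp
    (volume_preserving_finTwoArrow ℝ).symm
  have e : (fun p : ℝ × ℝ => p.1 • stdVec 0 + p.2 • stdVec 1 : ℝ × ℝ → Plane) =
      (MeasurableEquiv.toLp 2 (Fin 2 → ℝ)).symm.symm ∘ MeasurableEquiv.finTwoArrow.symm := by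
    funext p
    ext i
    fin_cases i <;> simp [stdVec, MeasurableEquiv.finTwoArrow, MeasurableEquiv.piFinTwo]
  rw [e]
  exact h1

theorem measurePreserving_coord10 :
    MeasurePreserving (fun p : ℝ × ℝ => p.1 • stdVec 1 + p.2 • stdVec 0 : ℝ × ℝ → Plane) := by
  have h1 := measurePreserving_coord01.comp (Measure.measurePreserving_swap (μ := (volume : Measure ℝ))
    (ν := (volume : Measure ℝ)))
  have e : (fun p : ℝ × ℝ => p.1 • stdVec 1 + p.2 • stdVec 0 : ℝ × ℝ → Plane) =
      (fun p : ℝ × ℝ => p.1 • stdVec 0 + p.2 • stdVec 1) ∘ Prod.swap := by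
    funext p
    simp [add_comm]
  rw [e]
  exact h1

theorem plane_eq_add (z : Plane) : z = z 0 • stdVec 0 + z 1 • stdVec 1 := by
  ext i
  fin_cases i <;> simp [stdVec]

theorem norm_stdVec (i : Fin 2) : ‖stdVec i‖ = 1 := by simp [stdVec]

/-- A compactly supported function is estimated by its mixed derivative on strips. -/
theorem enorm_strip_le {a b : Plane}
    (hP : MeasurePreserving (fun p : ℝ × ℝ => p.1 • a + p.2 • b : ℝ × ℝ → Plane))
    (hb : ∀ s y : ℝ, |y| ≤ ‖s • a + y • b‖) {r : ℝ} {v : Plane → ℝ}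
    (hv : IsTestOn (ball 0 r) v) (x y : ℝ) {t : ℝ} (ht : 0 ≤ t) :
    ‖v ((x + t) • a + y • b) - v (x • a + y • b)‖ₑ ≤
      eLpNorm (fun z => fderiv ℝ (fun w => fderiv ℝ v w a) z b) 2 volume *
        (ENNReal.ofReal t * ENNReal.ofReal (2 * r)) ^ (1 / 2 : ℝ) := by
  set D : Plane → ℝ := fun w => fderiv ℝ v w a with hD
  set m : Plane → ℝ := fun z => fderiv ℝ D z b with hm
  have hDs : ContDiff ℝ ∞ D := (hv.smooth.fderiv_right (m := ∞) (by simp)).clm_apply contDiff_const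
  have hmc : Continuous m := (hDs.continuous_fderiv (by simp)).clm_apply continuous_const
  have hD0 : ∀ z, z ∉ ball (0 : Plane) r → D z = 0 := by
    intro z hz
    have := image_eq_zero_of_notMem_tsupport
      (fun h => hz (hv.subset (tsupport_fderiv_subset ℝ h)))
    rw [hD]; simp only; rw [this]; simp
  -- The derivative in direction a vanishes at the edge y = -r of the strip, so it is the integral
  -- of the mixed derivative across the strip.
  have hD1 : ∀ s y : ℝ, ‖D (s • a + y • b)‖ₑ ≤ ∫⁻ y' in Icc (-r) r, ‖m (s • a + y' • b)‖ₑ := by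
    intro s y
    by_cases hy : |y| < r
    · have hd : ∀ y : ℝ, HasDerivAt (fun y : ℝ => D (s • a + y • b)) (m (s • a + y • b)) y := by
        intro y
        have h1 : HasDerivAt (fun y : ℝ => s • a + y • b) b y := by
          simpa using ((hasDerivAt_id y).smul_const b).const_add (s • a)
        exact (hDs.differentiableAt' (z := s • a + y • b)).hasFDerivAt.comp_hasDerivAt y h1
      have hc : Continuous fun y : ℝ => m (s • a + y • b) := hmc.comp (by fun_prop)
      have h2 := intervalIntegral.integral_eq_sub_of_hasDerivAt (a := -r) (b := y)
        (fun y _ => hd y) (hc.intervalIntegrable _ _)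
      rw [hD0 (s • a + (-r) • b) (by
        rw [mem_ball_zero_iff, not_lt]
        refine le_trans ?_ (hb s (-r))
        rw [abs_neg]; exact le_abs_self r), sub_zero] at h2
      rw [← h2, intervalIntegral.integral_of_le (abs_lt.1 hy).1.le]
      refine (enorm_integral_le_lintegral_enorm _).trans (lintegral_mono_set fun y' hy' => ?_)
      exact ⟨hy'.1.le, hy'.2.trans (abs_lt.1 hy).2.le⟩
    · rw [hD0 _ (by
        rw [mem_ball_zero_iff, not_lt]
        exact (not_lt.1 hy).trans (hb s y))]
      simp
  have hd : ∀ s : ℝ, HasDerivAt (fun s : ℝ => v (s • a + y • b)) (D (s • a + y • b)) s := by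
    intro s
    have h1 : HasDerivAt (fun s : ℝ => s • a + y • b) a s := by
      simpa using ((hasDerivAt_id s).smul_const a).add_const (y • b)
    exact (hv.smooth.differentiableAt' (z := s • a + y • b)).hasFDerivAt.comp_hasDerivAt s h1
  have hc : Continuous fun s : ℝ => D (s • a + y • b) := hDs.continuous.comp (by fun_prop)
  have h2 := intervalIntegral.integral_eq_sub_of_hasDerivAt (a := x) (b := x + t)
    (fun s _ => hd s) (hc.intervalIntegrable _ _)
  set P : ℝ × ℝ → Plane := fun p => p.1 • a + p.2 • b with hPdef
  have hmP : Continuous (m ∘ P) := hmc.comp (by fun_prop)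
  set S : Set (ℝ × ℝ) := Icc x (x + t) ×ˢ Icc (-r) r with hS
  -- A second integration, in direction a, gives the L¹ norm of the mixed derivative over a
  -- rectangle of area 2rt; the Cauchy–Schwarz inequality then produces the exponent 1/2.
  have h3 : ‖v ((x + t) • a + y • b) - v (x • a + y • b)‖ₑ ≤ ∫⁻ p in S, ‖(m ∘ P) p‖ₑ := by
    rw [hS, Measure.volume_eq_prod, ← Measure.prod_restrict, lintegral_prod _
      hmP.enorm.measurable.aemeasurable, ← h2, intervalIntegral.integral_of_le (by linarith)]
    refine (enorm_integral_le_lintegral_enorm _).trans ?_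
    refine (lintegral_mono_set Ioc_subset_Icc_self).trans (lintegral_mono fun s => hD1 s y)
  rw [← eLpNorm_one_eq_lintegral_enorm] at h3
  have h4 := eLpNorm_le_eLpNorm_mul_rpow_measure_univ (μ := volume.restrict S) (p := 1) (q := 2)
    (by norm_num) hmP.aestronglyMeasurable
  refine h3.trans (h4.trans ?_)
  have h5 : (volume.restrict S) univ = ENNReal.ofReal t * ENNReal.ofReal (2 * r) := by
    rw [Measure.restrict_apply_univ, hS, Measure.volume_eq_prod, Measure.prod_prod]
    simp only [Real.volume_Icc]
    congr 2 <;> ring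
  rw [h5]
  have h6 : eLpNorm (m ∘ P) 2 (volume.restrict S) ≤ eLpNorm m 2 volume := by
    rw [← eLpNorm_comp_measurePreserving hmc.aestronglyMeasurable hP]
    exact eLpNorm_mono_measure _ Measure.restrict_le_self
  have h7 : (1 / (1 : ENNReal).toReal - 1 / (2 : ENNReal).toReal : ℝ) = 1 / 2 := by norm_num
  rw [h7]
  exact mul_le_mul' h6 le_rfl

theorem abs_strip_le {a b : Plane}
    (hP : MeasurePreserving (fun p : ℝ × ℝ => p.1 • a + p.2 • b : ℝ × ℝ → Plane))
    (hb : ∀ s y : ℝ, |y| ≤ ‖s • a + y • b‖) {r : ℝ} (hr : 0 ≤ r) {v : Plane → ℝ}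
    (hv : IsTestOn (ball 0 r) v) (x x' y : ℝ)
    (hfin : eLpNorm (fun z => fderiv ℝ (fun w => fderiv ℝ v w a) z b) 2 volume ≠ ⊤) :
    |v (x' • a + y • b) - v (x • a + y • b)| ≤
      l2 volume (fun z => fderiv ℝ (fun w => fderiv ℝ v w a) z b) * √(2 * r * |x' - x|) := by
  wlog hx : x ≤ x' generalizing x x'
  · rw [abs_sub_comm, abs_sub_comm x' x]
    exact this x' x (le_of_not_ge hx)
  have := enorm_strip_le hP hb hv x y (sub_nonneg.2 hx)
  rw [add_sub_cancel] at this
  have h2 := ENNReal.toReal_mono (ENNReal.mul_ne_top hfin (by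
    refine ENNReal.rpow_ne_top_of_nonneg (by norm_num) (ENNReal.mul_ne_top ?_ ?_) <;>
    exact ENNReal.ofReal_ne_top)) this
  rw [toReal_enorm, Real.norm_eq_abs, ENNReal.toReal_mul, ← ENNReal.toReal_rpow,
    ← ENNReal.ofReal_mul (sub_nonneg.2 hx),
    ENNReal.toReal_ofReal (mul_nonneg (sub_nonneg.2 hx) (by linarith)), ← Real.sqrt_eq_rpow] at h2
  rw [abs_of_nonneg (sub_nonneg.2 hx)]
  refine h2.trans (le_of_eq ?_)
  rw [mul_comm (x' - x)]
  rfl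

theorem abs_coord_le_norm_add (s y : ℝ) :
    |y| ≤ ‖s • stdVec 0 + y • stdVec 1‖ ∧ |y| ≤ ‖s • stdVec 1 + y • stdVec 0‖ := by
  constructor
  · refine le_of_eq_of_le ?_ (abs_coord_le _ 1)
    simp [stdVec]
  · refine le_of_eq_of_le ?_ (abs_coord_le _ 0)
    simp [stdVec]

/-- The second derivative `∂_j ∂_i f`. -/
noncomputable def secondDeriv (f : Plane → ℝ) (i j : Fin 2) (z : Plane) : ℝ :=
  gradient (fun y => gradient f y i) z j

theorem fderiv_fderiv_stdVec (f : Plane → ℝ) (i j : Fin 2) :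
    (fun z => fderiv ℝ (fun w => fderiv ℝ f w (stdVec i)) z (stdVec j)) = secondDeriv f i j := by
  funext z
  unfold secondDeriv
  simp only [gradient_apply]

theorem continuous_secondDeriv {f : Plane → ℝ} (hf : ContDiff ℝ ∞ f) (i j : Fin 2) :
    Continuous (secondDeriv f i j) :=
  (contDiff_gradient_apply (contDiff_gradient_apply hf i) j).continuous

theorem IsTestOn.gradient_coord {Ω : Set Plane} {v : Plane → ℝ} (hv : IsTestOn Ω v) (i : Fin 2) :
    IsTestOn Ω (fun z => gradient v z i) := by
  have hs : tsupport (fun z => gradient v z i) ⊆ tsupport (gradient v) :=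
    closure_mono fun z hz hz' => hz (by simp [hz'])
  exact ⟨contDiff_gradient_apply hv.smooth i,
    HasCompactSupport.of_support_subset_isCompact (hasCompactSupport_gradient hv.compact)
      (subset_closure.trans hs),
    (hs.trans (tsupport_gradient_subset v)).trans hv.subset⟩

theorem IsTestOn.secondDeriv {Ω : Set Plane} {v : Plane → ℝ} (hv : IsTestOn Ω v) (i j : Fin 2) :
    IsTestOn Ω (secondDeriv v i j) := (hv.gradient_coord i).gradient_coord j

/-- The points are joined by a path along the first axis and then along the second; each leg is
controlled by one mixed derivative. -/
theorem IsTestOn.abs_sub_le_sqrt {r : ℝ} (hr : 0 ≤ r) {v : Plane → ℝ} (hv : IsTestOn (ball 0 r) v)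
    {B : ℝ} (h01 : l2 volume (_root_.secondDeriv v 0 1) ≤ B)
    (h10 : l2 volume (_root_.secondDeriv v 1 0) ≤ B)
    (z z' : Plane) : |v z' - v z| ≤ 2 * B * √(2 * r * ‖z' - z‖) := by
  have hB : 0 ≤ B := (l2_nonneg _).trans h01
  have e1 := abs_strip_le measurePreserving_coord01 (fun s y => (abs_coord_le_norm_add s y).1) hr hv
    (z 0) (z' 0) (z 1) (by rw [fderiv_fderiv_stdVec]; exact ((hv.secondDeriv 0 1).memLp volume).2.ne)
  have e2 := abs_strip_le measurePreserving_coord10 (fun s y => (abs_coord_le_norm_add s y).2) hr hv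
    (z 1) (z' 1) (z' 0) (by rw [fderiv_fderiv_stdVec]; exact ((hv.secondDeriv 1 0).memLp volume).2.ne)
  rw [fderiv_fderiv_stdVec] at e1 e2
  rw [← plane_eq_add] at e1
  rw [add_comm, ← plane_eq_add, add_comm] at e2
  have e3 : ∀ i : Fin 2, √(2 * r * |z' i - z i|) ≤ √(2 * r * ‖z' - z‖) := by
    intro i
    refine Real.sqrt_le_sqrt (mul_le_mul_of_nonneg_left ?_ (by linarith))
    exact abs_coord_le (z' - z) i
  have e4 := (e1.trans (mul_le_mul_of_nonneg_right h01 (Real.sqrt_nonneg _))).trans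
    (mul_le_mul_of_nonneg_left (e3 0) hB)
  have e5 := (e2.trans (mul_le_mul_of_nonneg_right h10 (Real.sqrt_nonneg _))).trans
    (mul_le_mul_of_nonneg_left (e3 1) hB)
  have := abs_sub_le (v z') (v (z' 0 • stdVec 0 + z 1 • stdVec 1)) (v z)
  linarith

theorem secondDeriv_mul {χ f : Plane → ℝ} (hχ : ContDiff ℝ ∞ χ) (hf : ContDiff ℝ ∞ f)
    (i j : Fin 2) (z : Plane) : secondDeriv (fun y => χ y * f y) i j z =
      χ z * secondDeriv f i j z + gradient f z i * gradient χ z j +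
        (f z * secondDeriv χ i j z + gradient χ z i * gradient f z j) := by
  unfold secondDeriv
  have e : (fun y => gradient (fun y => χ y * f y) y i) =
      fun y => χ y * gradient f y i + f y * gradient χ y i := by
    funext y
    rw [gradient_mul hχ.differentiableAt' hf.differentiableAt']
    simp
  have h1 := contDiff_gradient_apply hf i
  have h2 := contDiff_gradient_apply hχ i
  rw [e, gradient_add' (f := fun y => χ y * gradient f y i) (hχ.mul h1).differentiableAt'
    (hf.mul h2).differentiableAt', gradient_mul hχ.differentiableAt' h1.differentiableAt',
    gradient_mul hf.differentiableAt' h2.differentiableAt']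
  simp

theorem l2_add_four_le {α : Type*} [MeasurableSpace α] {μ : Measure α} {a b c d : α → ℝ} {B : ℝ}
    (ha : MemLp a 2 μ ∧ l2 μ a ≤ B) (hb : MemLp b 2 μ ∧ l2 μ b ≤ B)
    (hc : MemLp c 2 μ ∧ l2 μ c ≤ B) (hd : MemLp d 2 μ ∧ l2 μ d ≤ B) :
    l2 μ (fun z => (a z + b z) + (c z + d z)) ≤ 4 * B := by
  have q1 := l2_add_le (f := fun z => a z + b z) (g := fun z => c z + d z) (ha.1.add hb.1)
    (hc.1.add hd.1)
  have q2 := l2_add_le ha.1 hb.1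
  have q3 := l2_add_le hc.1 hd.1
  linarith [ha.2, hb.2, hc.2, hd.2]

/-- Interior Hölder estimate by the `L²` norms of a function and its derivatives of order two. -/
theorem exists_holder_of_l2 {r₀ r : ℝ} (hr₀ : 0 < r₀) (hr : r₀ < r) : ∃ C : ℝ, 0 ≤ C ∧
    ∀ (f : Plane → ℝ) (B : ℝ), ContDiff ℝ ∞ f → l2 (volB r) f ≤ B →
      l2 (volB r) (gradient f) ≤ B → (∀ i j, l2 (volB r) (secondDeriv f i j) ≤ B) →
      ∀ z ∈ ball (0 : Plane) r₀, ∀ z' ∈ ball (0 : Plane) r₀,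
        |f z' - f z| ≤ C * B * √‖z' - z‖ := by
  let χ : ContDiffBump (0 : Plane) := ⟨r₀, (r₀ + r) / 2, hr₀, by linarith⟩
  have hχt : IsTestOn (ball 0 r) χ := ⟨χ.contDiff, χ.hasCompactSupport, by
    rw [χ.tsupport_eq]; exact closedBall_subset_ball (by change (r₀ + r) / 2 < r; linarith)⟩
  obtain ⟨M₁, hM₁⟩ := (hasCompactSupport_gradient hχt.compact).exists_bound_of_continuous
    (continuous_gradient hχt.smooth)
  have hM₂ : ∀ i j, ∃ M, ∀ z, ‖secondDeriv χ i j z‖ ≤ M := fun i j =>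
    (hχt.secondDeriv i j).compact.exists_bound_of_continuous (hχt.secondDeriv i j).smooth.continuous
  choose M₂ hM₂ using hM₂
  -- The 1 bounds χ itself. Of the second derivatives of χ only the mixed ones enter.
  set M : ℝ := 1 + M₁ + (M₂ 0 1 + M₂ 1 0) with hM
  have hM₁0 : 0 ≤ M₁ := (norm_nonneg _).trans (hM₁ 0)
  have hM₂0 : ∀ i j, 0 ≤ M₂ i j := fun i j => (norm_nonneg _).trans (hM₂ i j 0)
  have hM0 : 0 ≤ M := by linarith [hM₂0 0 1, hM₂0 1 0]
  -- The product rule for a mixed derivative of χf has four terms, each at most MB, and the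
  -- two-legged path contributes the factor 2.
  refine ⟨8 * M * √(2 * r), by positivity, fun f B hf h0 h1 h2 z hz z' hz' => ?_⟩
  have hB : 0 ≤ B := (l2_nonneg _).trans h0
  have hv : IsTestOn (ball 0 r) (fun y => χ y * f y) := by
    have := hχt.smul_left hf
    simpa only [mul_comm] using this
  have mf : MemLp f 2 (volB r) := memLp_ball_of_continuous hf.continuous r
  have mg : ∀ i, MemLp (fun z => gradient f z i) 2 (volB r) := fun i =>
    memLp_ball_of_continuous (contDiff_gradient_apply hf i).continuous r
  have lg : ∀ i, l2 (volB r) (fun z => gradient f z i) ≤ B := fun i =>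
    (l2_mono (memLp_ball_of_continuous (continuous_gradient hf) r)
      (ae_of_all _ fun z => abs_coord_le _ i)).trans h1
  have ms : ∀ i j, MemLp (secondDeriv f i j) 2 (volB r) := fun i j =>
    memLp_ball_of_continuous (continuous_secondDeriv hf i j) r
  have hbound : ∀ i j, M₂ i j ≤ M → l2 volume (secondDeriv (fun y => χ y * f y) i j) ≤ 4 * M * B := by
    intro i j hij
    have e : l2 volume (secondDeriv (fun y => χ y * f y) i j) =
        l2 (volB r) (secondDeriv (fun y => χ y * f y) i j) := by
      unfold l2
      rw [eLpNorm_restrict_eq_of_support_subset]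
      exact (subset_closure.trans (hv.secondDeriv i j).subset)
    have c1 := hχt.smooth.continuous
    have p : ∀ {a b : Plane → ℝ}, Continuous a → (∀ z, ‖a z‖ ≤ M) → MemLp b 2 (volB r) →
        l2 (volB r) b ≤ B → MemLp (fun z => a z * b z) 2 (volB r) ∧
          l2 (volB r) (fun z => a z * b z) ≤ M * B := by
      intro a b ha haM hb hbB
      have hle : ∀ z, ‖a z * b z‖ ≤ M * ‖b z‖ := fun z => by
        rw [norm_mul]; exact mul_le_mul_of_nonneg_right (haM z) (norm_nonneg _)
      exact ⟨hb.of_le_mul (ha.aestronglyMeasurable.mul hb.1) (ae_of_all _ hle),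
        (l2_le_mul hb hM0 (ae_of_all _ hle)).trans (mul_le_mul_of_nonneg_left hbB hM0)⟩
    have bg : ∀ k z, ‖gradient χ z k‖ ≤ M := fun k z =>
      ((abs_coord_le _ k).trans (hM₁ z)).trans (by linarith [hM₂0 0 1, hM₂0 1 0])
    have cg : ∀ k, Continuous fun z => gradient χ z k := fun k =>
      (contDiff_gradient_apply hχt.smooth k).continuous
    have p1 := p c1 (fun z => by
      rw [Real.norm_of_nonneg χ.nonneg]
      exact χ.le_one.trans (by linarith [hM₂0 0 1, hM₂0 1 0])) (ms i j) (h2 i j)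
    have p2 := p (cg j) (bg j) (mg i) (lg i)
    have p3 := p (continuous_secondDeriv hχt.smooth i j) (fun z => (hM₂ i j z).trans hij) mf h0
    have p4 := p (cg i) (bg i) (mg j) (lg j)
    rw [e]
    have e2 : secondDeriv (fun y => χ y * f y) i j = fun z =>
        (χ z * secondDeriv f i j z + gradient χ z j * gradient f z i) +
        (secondDeriv χ i j z * f z + gradient χ z i * gradient f z j) := by
      funext z
      rw [secondDeriv_mul hχt.smooth hf]; ring
    rw [e2]
    exact (l2_add_four_le p1 p2 p3 p4).trans (le_of_eq (by ring))
  have hfin := hv.abs_sub_le_sqrt (by linarith) (hbound 0 1 (by linarith [hM₂0 1 0]))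
    (hbound 1 0 (by linarith [hM₂0 0 1])) z z'
  have hone : ∀ w ∈ ball (0 : Plane) r₀, χ w = 1 := fun w hw =>
    χ.one_of_mem_closedBall (ball_subset_closedBall hw)
  rw [hone z hz, hone z' hz', one_mul, one_mul, Real.sqrt_mul (by linarith)] at hfin
  exact hfin.trans (le_of_eq (by ring))

/-! ### Hölder regularity of solutions -/

/-- Fatou's lemma; it lets bounds for difference quotients pass to derivatives. -/
theorem l2_le_of_tendsto_ae {α E : Type*} [MeasurableSpace α] [NormedAddCommGroup E]
    {μ : Measure α} {s : ℕ → α → E} {f : α → E} {C : ℝ} (hs : ∀ n, MemLp (s n) 2 μ)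
    (hlim : ∀ᵐ z ∂μ, Tendsto (fun n => s n z) atTop (𝓝 (f z)))
    (hC : ∀ᶠ n in atTop, l2 μ (s n) ≤ C) : l2 μ f ≤ C := by
  have hC0 : 0 ≤ C := by
    obtain ⟨n, hn⟩ := hC.exists
    exact (l2_nonneg _).trans hn
  have h1 := Lp.eLpNorm_lim_le_liminf_eLpNorm (p := 2) (fun n => (hs n).1) f hlim
  have h2 : liminf (fun n => eLpNorm (s n) 2 μ) atTop ≤ ENNReal.ofReal C := by
    refine liminf_le_of_frequently_le' (hC.frequently.mono fun n hn => ?_)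
    rw [← ENNReal.ofReal_toReal (hs n).2.ne]
    exact ENNReal.ofReal_le_ofReal hn
  have h3 := ENNReal.toReal_mono ENNReal.ofReal_ne_top (h1.trans h2)
  rwa [ENNReal.toReal_ofReal hC0] at h3

theorem integrableOn_of_memLp_ball {E : Type*} [NormedAddCommGroup E] {f : Plane → E} {R : ℝ}
    (hf : MemLp f 2 (volB R)) : IntegrableOn f (ball 0 R) := by
  have : IsFiniteMeasure (volB R) := ⟨by
    rw [Measure.restrict_apply_univ]; exact measure_ball_lt_top⟩
  exact hf.integrable (by norm_num)

theorem H1Approx.hasWeakGradientOn {R : ℝ} {u : Plane → ℝ} {g : Plane → Plane}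
    {s : ℕ → Plane → ℝ} (h : H1Approx R u g s) : HasWeakGradientOn u g (ball 0 R) := by
  refine ⟨(integrableOn_of_memLp_ball h.memLp).locallyIntegrableOn,
    (integrableOn_of_memLp_ball h.memLp_grad).locallyIntegrableOn, fun η hη i => ?_⟩
  have hsm : ∀ n, MemLp (s n) 2 (volB R) :=
    fun n => memLp_ball_of_continuous (h.smooth n).continuous R
  have coord : ∀ {G : Plane → Plane}, MemLp G 2 (volB R) → MemLp (fun z => G z i) 2 (volB R) :=
    fun {G} hG => hG.of_le
      ((EuclideanSpace.proj i : Plane →L[ℝ] ℝ).continuous.comp_aestronglyMeasurable hG.1)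
      (ae_of_all _ fun z => abs_coord_le _ i)
  have hgm : ∀ n, MemLp (fun z => gradient (s n) z i) 2 (volB R) := fun n =>
    coord (memLp_ball_of_continuous (continuous_gradient (h.smooth n)) R)
  have t1 := h.tendsto.mul (coord (hη.memLp_gradient _)) hsm h.memLp
  have t2 : TendstoL2 (volB R) atTop (fun n z => gradient (s n) z i) (fun z => g z i) :=
    h.tendsto_grad.of_le 1 (Eventually.of_forall fun n => ae_of_all _ fun z => by
      rw [one_mul]; exact abs_coord_le (gradient (s n) z - g z) i)
  have t3 := (t2.mul (hη.memLp _) hgm (coord h.memLp_grad)).neg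
  simp only [mul_comm (gradient η _ i), mul_comm (η _)] at t1 t3
  exact tendsto_nhds_unique t1 (t3.congr fun n => (hη.integral_mul_gradient (h.smooth n) i).symm)

theorem H1Approx.memW12Loc {R : ℝ} {u : Plane → ℝ} {g : Plane → Plane}
    {s : ℕ → Plane → ℝ} (h : H1Approx R u g s) : MemW12Loc u g (ball 0 R) := by
  refine ⟨h.hasWeakGradientOn, ?_, ?_⟩
  · exact IntegrableOn.locallyIntegrableOn ((memLp_two_iff_integrable_sq h.memLp.1).1 h.memLp)
  · exact IntegrableOn.locallyIntegrableOn
      ((memLp_two_iff_integrable_sq_norm h.memLp_grad.1).1 h.memLp_grad)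

/-- Mollifications of a function on the ball of radius `R`. -/
noncomputable def ballMoll (R : ℝ) (u : Plane → ℝ) (n : ℕ) : Plane → ℝ :=
  moll n ((ball 0 R).indicator u)

/-- The limit of the mollifications. -/
noncomputable def ballRep (R : ℝ) (u : Plane → ℝ) (z : Plane) : ℝ :=
  limUnder atTop fun n => ballMoll R u n z

theorem ae_tendsto_ballMoll {R : ℝ} {u : Plane → ℝ} (hu : MemLp u 2 (volB R)) :
    ∀ᵐ z, Tendsto (fun n => ballMoll R u n z) atTop (𝓝 ((ball 0 R).indicator u z)) :=
  ae_tendsto_moll ((integrable_indicator_iff measurableSet_ball).2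
    (integrableOn_of_memLp_ball hu)).locallyIntegrable

theorem ballRep_ae_eq {R : ℝ} {u : Plane → ℝ} (hu : MemLp u 2 (volB R)) :
    ballRep R u =ᵐ[volB R] u := by
  filter_upwards [ae_restrict_of_ae (ae_tendsto_ballMoll hu), ae_restrict_mem measurableSet_ball]
    with z hz hzb
  rw [indicator_of_mem hzb] at hz
  exact hz.limUnder_eq

theorem contDiff_ballMoll {R : ℝ} {u : Plane → ℝ} (hu : MemLp u 2 (volB R)) (n : ℕ) :
    ContDiff ℝ ∞ (ballMoll R u n) :=
  contDiff_moll ((integrable_indicator_iff measurableSet_ball).2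
    (integrableOn_of_memLp_ball hu)).locallyIntegrable n

theorem l2_moll_indicator_le {E : Type*} [NormedAddCommGroup E] [NormedSpace ℝ E] {f : Plane → E}
    {r R : ℝ} (hf : MemLp f 2 (volB R)) (n : ℕ) :
    l2 (volB r) (moll n ((ball 0 R).indicator f)) ≤ l2 (volB R) f := by
  have hF : MemLp ((ball (0 : Plane) R).indicator f) 2 volume :=
    (memLp_indicator_iff_restrict measurableSet_ball).2 hf
  refine (l2_mono_measure Measure.restrict_le_self (memLp_moll hF n)).trans
    ((l2_moll_le hF n).trans (le_of_eq ?_))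
  unfold l2
  rw [eLpNorm_indicator_eq_eLpNorm_restrict measurableSet_ball]

/-- A sequence with a common Hölder bound that converges almost everywhere is Cauchy at every point
of the ball, by comparison with a nearby point of the dense set of convergence. The pointwise limit
inherits the bound, which is how a continuous representative arises. -/
theorem abs_sub_limUnder_le {f : ℕ → Plane → ℝ} {r B : ℝ}
    (hf : ∀ᶠ n in atTop, ∀ z ∈ ball (0 : Plane) r, ∀ z' ∈ ball (0 : Plane) r,
      |f n z' - f n z| ≤ B * √‖z' - z‖)
    (hlim : ∀ᵐ z, ∃ c, Tendsto (fun n => f n z) atTop (𝓝 c)) {z z' : Plane}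
    (hz : z ∈ ball (0 : Plane) r) (hz' : z' ∈ ball (0 : Plane) r) :
    |limUnder atTop (fun n => f n z') - limUnder atTop (fun n => f n z)| ≤ B * √‖z' - z‖ := by
  have key : ∀ z ∈ ball (0 : Plane) r, ∃ c, Tendsto (fun n => f n z) atTop (𝓝 c) := by
    intro z hz
    refine cauchySeq_tendsto_of_complete (Metric.cauchySeq_iff'.2 fun ε hε => ?_)
    have hcont : ContinuousAt (fun y : Plane => B * √‖y - z‖) z := by fun_prop
    have h1 : ∀ᶠ y in 𝓝 z, B * √‖y - z‖ < ε / 3 := by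
      refine hcont.eventually_lt continuousAt_const ?_
      simp only [sub_self, norm_zero, Real.sqrt_zero, mul_zero]; positivity
    obtain ⟨y, ⟨c, hy⟩, hy1, hyr⟩ := (Measure.dense_of_ae hlim).inter_nhds_nonempty
      (h1.and (isOpen_ball.mem_nhds hz))
    obtain ⟨N₀, hN₀⟩ := eventually_atTop.1 hf
    obtain ⟨N₁, hN₁⟩ := Metric.cauchySeq_iff'.1 hy.cauchySeq (ε / 6) (by positivity)
    refine ⟨max N₀ N₁, fun n hn => ?_⟩
    have a1 := hN₀ n (le_trans (le_max_left _ _) hn) z hz y hyr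
    have a2 := hN₀ _ (le_max_left N₀ N₁) z hz y hyr
    have a3 := hN₁ n (le_trans (le_max_right _ _) hn)
    have a4 := hN₁ _ (le_max_right N₀ N₁)
    rw [Real.dist_eq] at a3 a4 ⊢
    rw [abs_le] at a1 a2
    rw [abs_lt] at a3 a4 ⊢
    constructor <;> linarith
  obtain ⟨c, hc⟩ := key z hz
  obtain ⟨c', hc'⟩ := key z' hz'
  rw [hc.limUnder_eq, hc'.limUnder_eq]
  exact le_of_tendsto (hc'.sub hc).abs (hf.mono fun n hn => hn z hz z' hz')

section Regularity

variable {A : Plane → Matrix (Fin 2) (Fin 2) ℝ} {W : Plane → Plane} {V : Plane → ℝ}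
  {R lam K L : ℝ}

theorem BoundedCoeff.exists_l2_translate_le (hc : BoundedCoeff A W V R lam K)
    (hA : ∀ i j, WeakGradientBoundedOn (fun z => A z i j) (ball 0 R) L) (hL : 0 ≤ L)
    {r : ℝ} (hr0 : 0 < r) (hr : r < R) : ∃ C δ : ℝ, 0 ≤ C ∧ 0 < δ ∧ r + δ < R ∧
      ∀ (u : Plane → ℝ) (g : Plane → Plane) (s : ℕ → Plane → ℝ), H1Approx R u g s →
      (∀ η, IsTestOn (ball 0 R) η → form A W V R u g η (gradient η) = 0) →
      ∀ h : Plane, ‖h‖ < δ → l2 (volB r) (fun z => g (z + h) - g z) ≤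
        C * (‖h‖ * (l2 (volB R) g + l2 (volB R) u)) := by
  obtain ⟨r', hrr', hr'R⟩ := exists_between hr
  let χ : ContDiffBump (0 : Plane) := ⟨r, (r + r') / 2, hr0, by linarith⟩
  have hχt : IsTestOn (ball 0 r') χ := ⟨χ.contDiff, χ.hasCompactSupport, by
    rw [χ.tsupport_eq]; exact closedBall_subset_ball (by change (r + r') / 2 < r'; linarith)⟩
  obtain ⟨M, hM⟩ := (hasCompactSupport_gradient hχt.compact).exists_bound_of_continuous
    (continuous_gradient hχt.smooth)
  have hM0 : 0 ≤ M := (norm_nonneg _).trans (hM 0)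
  have hlam := hc.lam_pos
  have hK := hc.K_nonneg
  refine ⟨diffConst lam K L M, R - r', by unfold diffConst; positivity, by linarith, by linarith,
    fun u g s hs heq h hh => ?_⟩
  have hhR : r' + ‖h‖ < R := by linarith
  refine le_trans ?_ (hc.l2_translate_grad_le hs heq hA hL hχt (fun z => χ.nonneg)
    (fun z => χ.le_one) hM hhR)
  have e : l2 (volB r) (fun z => g (z + h) - g z) =
      l2 (volB r) (fun z => χ z • (g (z + h) - g z)) := by
    refine l2_congr ?_
    filter_upwards [ae_restrict_mem measurableSet_ball] with z hz
    rw [χ.one_of_mem_closedBall (ball_subset_closedBall hz), one_smul]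
  rw [e]
  have hmem : MemLp (fun z => g (z + h) - g z) 2 (volB r') :=
    (hs.memLp_grad.comp_add_ball hhR.le).sub (hs.memLp_grad.mono_measure (volB_mono hr'R.le))
  refine l2_mono_measure (volB_mono hrr'.le) (hmem.of_le
    (hχt.smooth.continuous.aestronglyMeasurable.smul hmem.1) (ae_of_all _ fun z => ?_))
  rw [norm_smul, Real.norm_of_nonneg χ.nonneg]
  exact mul_le_of_le_one_left (norm_nonneg _) χ.le_one

theorem tendsto_secondDeriv {f : Plane → ℝ} (hf : ContDiff ℝ ∞ f) (i j : Fin 2) (z : Plane)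
    {t : ℕ → ℝ} (ht : Tendsto t atTop (𝓝[≠] 0)) :
    Tendsto (fun k => (t k)⁻¹ * (gradient f (z + t k • stdVec j) i - gradient f z i)) atTop
      (𝓝 (secondDeriv f i j z)) := by
  have hd := (contDiff_gradient_apply hf i).differentiableAt' (z := z)
  have h1 : HasDerivAt (fun σ : ℝ => z + σ • stdVec j) (stdVec j) 0 := by
    simpa using ((hasDerivAt_id (0 : ℝ)).smul_const (stdVec j)).const_add z
  have h2 : HasDerivAt (fun σ : ℝ => gradient f (z + σ • stdVec j) i) (secondDeriv f i j z) 0 := by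
    have h3 : HasFDerivAt (fun y => gradient f y i) (fderiv ℝ (fun y => gradient f y i) z)
        (z + (0 : ℝ) • stdVec j) := by simpa using hd.hasFDerivAt
    unfold secondDeriv
    rw [gradient_apply]
    exact h3.comp_hasDerivAt 0 h1
  have h4 := h2.tendsto_slope_zero.comp ht
  refine h4.congr fun k => ?_
  simp

/-- Mollification commutes with translations and contracts L², so increments of the mollified
gradient inherit the bound for increments of g, and Fatou lets the step tend to zero. Only
mollifications are differentiated twice, so no second weak derivatives of u have to be constructed.
-/
theorem BoundedCoeff.exists_l2_secondDeriv_le (hc : BoundedCoeff A W V R lam K)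
    (hA : ∀ i j, WeakGradientBoundedOn (fun z => A z i j) (ball 0 R) L) (hL : 0 ≤ L)
    {r : ℝ} (hr0 : 0 < r) (hr : r < R) : ∃ C : ℝ, 1 ≤ C ∧
      ∀ (u : Plane → ℝ) (g : Plane → Plane) (s : ℕ → Plane → ℝ), H1Approx R u g s →
      (∀ η, IsTestOn (ball 0 R) η → form A W V R u g η (gradient η) = 0) →
      ∀ᶠ n in atTop, l2 (volB r) (gradient (ballMoll R u n)) ≤ l2 (volB R) g ∧
        ∀ i j, l2 (volB r) (secondDeriv (ballMoll R u n) i j) ≤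
          C * (l2 (volB R) g + l2 (volB R) u) := by
  obtain ⟨r₁, hrr₁, hr₁R⟩ := exists_between hr
  obtain ⟨C, δ, hC, hδ, hδR, hmain⟩ := hc.exists_l2_translate_le hA hL (hr0.trans hrr₁) hr₁R
  -- With a constant at least 1 the same bound later also covers the norms of the function and of
  -- its gradient.
  refine ⟨C + 1, by linarith, fun u g s hs heq => ?_⟩
  filter_upwards [eventually_one_div_lt (sub_pos.2 hrr₁)] with n hn
  have hfi := integrableOn_of_memLp_ball hs.memLp
  have hgi := integrableOn_of_memLp_ball hs.memLp_grad
  have hG : LocallyIntegrable ((ball (0 : Plane) R).indicator g) :=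
    ((integrable_indicator_iff measurableSet_ball).2 hgi).locallyIntegrable
  have hgr : ∀ z, ‖z‖ < r + δ → gradient (ballMoll R u n) z = moll n ((ball 0 R).indicator g) z :=
    fun z hz => gradient_moll hs.hasWeakGradientOn hfi hgi (by linarith)
  have hf := contDiff_ballMoll hs.memLp n
  have hS : 0 ≤ l2 (volB R) g + l2 (volB R) u := add_nonneg (l2_nonneg _) (l2_nonneg _)
  constructor
  · refine le_of_eq_of_le (l2_congr ?_) (l2_moll_indicator_le hs.memLp_grad n (r := r))
    filter_upwards [ae_restrict_mem measurableSet_ball] with z hz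
    exact hgr z (by linarith [mem_ball_zero_iff.1 hz])
  intro i j
  have htr : ∀ h : Plane, ‖h‖ < δ →
      l2 (volB r) (fun z => gradient (ballMoll R u n) (z + h) - gradient (ballMoll R u n) z) ≤
        C * (‖h‖ * (l2 (volB R) g + l2 (volB R) u)) := by
    intro h hh
    have hD : MemLp (fun z => g (z + h) - g z) 2 (volB r₁) :=
      (hs.memLp_grad.comp_add_ball (by linarith)).sub
        (hs.memLp_grad.mono_measure (volB_mono hr₁R.le))
    refine le_trans ?_ (hmain u g s hs heq h hh)
    refine le_of_eq_of_le (l2_congr ?_) (l2_moll_indicator_le hD n (r := r))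
    filter_upwards [ae_restrict_mem measurableSet_ball] with z hz
    rw [mem_ball_zero_iff] at hz
    have hGh : LocallyIntegrable (fun y => (ball (0 : Plane) R).indicator g (y + h)) :=
      (((integrable_indicator_iff measurableSet_ball).2 hgi).comp_add_right h).locallyIntegrable
    rw [hgr z (by linarith), hgr (z + h) (by linarith [norm_add_le z h]), ← moll_comp_add,
      ← moll_sub hGh hG]
    refine moll_congr_on (ae_of_all _ fun y hy => ?_)
    have hy1 : ‖y‖ < r₁ := by
      have := norm_add_le (y - z) z
      rw [sub_add_cancel, ← dist_eq_norm] at this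
      linarith
    rw [indicator_of_mem (mem_ball_zero_iff.2 hy1),
      indicator_of_mem (mem_ball_zero_iff.2 (by linarith [norm_add_le y h])),
      indicator_of_mem (mem_ball_zero_iff.2 (by linarith [norm_add_le y h]))]
  have ht : Tendsto (fun k : ℕ => 1 / ((k : ℝ) + 1)) atTop (𝓝[≠] 0) :=
    tendsto_nhdsWithin_iff.2 ⟨tendsto_one_div_add_atTop_nhds_zero_nat,
      Eventually.of_forall fun k => by
        rw [mem_compl_iff, mem_singleton_iff]; positivity⟩
  have hgc := continuous_gradient hf
  have hgic := (contDiff_gradient_apply hf i).continuous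
  refine l2_le_of_tendsto_ae (fun k => memLp_ball_of_continuous (by
      exact continuous_const.mul ((hgic.comp (continuous_add_const _)).sub hgic)) r)
    (ae_of_all _ fun z => tendsto_secondDeriv hf i j z ht) ?_
  filter_upwards [eventually_one_div_lt hδ] with k hk
  have hk0 : (0 : ℝ) < 1 / ((k : ℝ) + 1) := by positivity
  set t := 1 / ((k : ℝ) + 1)
  have hnt : ‖t • stdVec j‖ = t := by rw [norm_smul, norm_stdVec, mul_one, Real.norm_of_nonneg hk0.le]
  have h1 := htr (t • stdVec j) (by rwa [hnt])
  rw [hnt] at h1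
  have h2 := l2_le_mul (μ := volB r) (f := fun z => t⁻¹ * (gradient (ballMoll R u n)
      (z + t • stdVec j) i - gradient (ballMoll R u n) z i))
    (g := fun z => gradient (ballMoll R u n) (z + t • stdVec j) - gradient (ballMoll R u n) z)
    (memLp_ball_of_continuous ((hgc.comp (continuous_add_const _)).sub hgc) r)
    (inv_nonneg.2 hk0.le) (ae_of_all _ fun z => by
      rw [norm_mul, Real.norm_of_nonneg (inv_nonneg.2 hk0.le)]
      exact mul_le_mul_of_nonneg_left (abs_coord_le (_ - _) i) (inv_nonneg.2 hk0.le))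
  refine h2.trans ((mul_le_mul_of_nonneg_left h1 (inv_nonneg.2 hk0.le)).trans ?_)
  have e : t⁻¹ * (C * (t * (l2 (volB R) g + l2 (volB R) u))) =
      C * (l2 (volB R) g + l2 (volB R) u) := by field_simp
  rw [e]
  nlinarith

/-- Solutions are locally Hölder continuous, with an estimate by the `H¹` norm. -/
theorem BoundedCoeff.exists_holder (hc : BoundedCoeff A W V R lam K)
    (hA : ∀ i j, WeakGradientBoundedOn (fun z => A z i j) (ball 0 R) L) (hL : 0 ≤ L)
    {r : ℝ} (hr0 : 0 < r) (hr : r < R) : ∃ C : ℝ, 0 ≤ C ∧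
      ∀ (u : Plane → ℝ) (g : Plane → Plane) (s : ℕ → Plane → ℝ), H1Approx R u g s →
      (∀ η, IsTestOn (ball 0 R) η → form A W V R u g η (gradient η) = 0) →
      ∀ z ∈ ball (0 : Plane) r, ∀ z' ∈ ball (0 : Plane) r,
        |ballRep R u z' - ballRep R u z| ≤
          C * (l2 (volB R) g + l2 (volB R) u) * √‖z' - z‖ := by
  obtain ⟨r₁, hrr₁, hr₁R⟩ := exists_between hr
  obtain ⟨C₁, hC₁, h1⟩ := hc.exists_l2_secondDeriv_le hA hL (hr0.trans hrr₁) hr₁R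
  obtain ⟨C₂, hC₂, h2⟩ := exists_holder_of_l2 hr0 hrr₁
  refine ⟨C₂ * C₁, by positivity, fun u g s hs heq z hz z' hz' => ?_⟩
  refine abs_sub_limUnder_le (f := ballMoll R u) ?_ ((ae_tendsto_ballMoll hs.memLp).mono
    fun z hz => ⟨_, hz⟩) hz hz'
  filter_upwards [h1 u g s hs heq] with n hn
  have hg0 : 0 ≤ l2 (volB R) g := l2_nonneg _
  have hu0 : 0 ≤ l2 (volB R) u := l2_nonneg _
  rw [mul_assoc C₂]
  refine h2 _ _ (contDiff_ballMoll hs.memLp n) ?_ ?_ hn.2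
  · refine (l2_moll_indicator_le hs.memLp n).trans ?_
    nlinarith
  · refine hn.1.trans ?_
    nlinarith

theorem BoundedCoeff.continuousOn_ballRep (hc : BoundedCoeff A W V R lam K)
    (hA : ∀ i j, WeakGradientBoundedOn (fun z => A z i j) (ball 0 R) L) (hL : 0 ≤ L)
    {u : Plane → ℝ} {g : Plane → Plane} {s : ℕ → Plane → ℝ} (hs : H1Approx R u g s)
    (heq : ∀ η, IsTestOn (ball 0 R) η → form A W V R u g η (gradient η) = 0) :
    ContinuousOn (ballRep R u) (ball 0 R) := by
  intro z hz
  rw [mem_ball_zero_iff] at hz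
  obtain ⟨r, hzr, hrR⟩ := exists_between hz
  obtain ⟨C, hC, h1⟩ := hc.exists_holder hA hL ((norm_nonneg z).trans_lt hzr) hrR
  have hzr' : z ∈ ball (0 : Plane) r := mem_ball_zero_iff.2 hzr
  refine ContinuousAt.continuousWithinAt ?_
  rw [ContinuousAt, tendsto_iff_dist_tendsto_zero]
  have hcont : Tendsto (fun y : Plane => C * (l2 (volB R) g + l2 (volB R) u) * √‖y - z‖) (𝓝 z)
      (𝓝 0) := by
    have : ContinuousAt (fun y : Plane => C * (l2 (volB R) g + l2 (volB R) u) * √‖y - z‖) z := by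
      fun_prop
    simpa [ContinuousAt] using this
  refine squeeze_zero' (Eventually.of_forall fun _ => dist_nonneg) ?_ hcont
  filter_upwards [isOpen_ball.mem_nhds hzr'] with y hy
  exact h1 u g s hs heq z hzr' y hy

end Regularity

/-! ### Continuous solutions between explicit barriers -/

theorem le_on_ball_of_ae_le {f h : Plane → ℝ} {R : ℝ} (hf : ContinuousOn f (ball 0 R))
    (hh : ContinuousOn h (ball 0 R)) (hle : ∀ᵐ z ∂volB R, f z ≤ h z) :
    ∀ z ∈ ball (0 : Plane) R, f z ≤ h z := by
  by_contra! hcon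
  obtain ⟨z, hz, hlt⟩ := hcon
  have hev : ∀ᶠ y in 𝓝 z, h y < f y :=
    (hh.continuousAt (isOpen_ball.mem_nhds hz)).eventually_lt
      (hf.continuousAt (isOpen_ball.mem_nhds hz)) hlt
  obtain ⟨y, hy1, hy2, hy3⟩ := (Measure.dense_of_ae
    ((ae_restrict_iff' measurableSet_ball).1 hle)).inter_nhds_nonempty
      (hev.and (isOpen_ball.mem_nhds hz))
  exact absurd (hy1 hy3) (not_le.2 hy2)

theorem H1Approx.congr_ae {R : ℝ} {u u' : Plane → ℝ} {g : Plane → Plane} {s : ℕ → Plane → ℝ}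
    (h : H1Approx R u g s) (he : u' =ᵐ[volB R] u) : H1Approx R u' g s :=
  ⟨(memLp_congr_ae he).2 h.memLp, h.memLp_grad, h.smooth,
    h.tendsto.congr' (Eventually.of_forall fun _ => EventuallyEq.rfl) he.symm, h.tendsto_grad⟩

section

variable {A : Plane → Matrix (Fin 2) (Fin 2) ℝ} {W : Plane → Plane} {V : Plane → ℝ}
  {R lam K L : ℝ}

theorem form_congr_ae {u u' v : Plane → ℝ} {g k : Plane → Plane} (he : u' =ᵐ[volB R] u) :
    form A W V R u' g v k = form A W V R u g v k := by
  unfold form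
  refine integral_congr_ae ?_
  filter_upwards [he] with z hz
  rw [lowerOrder_congr hz rfl]

theorem boundedCoeff_of_weakGradientBounded (hlam : 0 < lam) (hK : 0 ≤ K)
    (hell : EllipticBoundedOn A (ball 0 R) lam)
    (hA : ∀ i j, WeakGradientBoundedOn (fun z => A z i j) (ball 0 R) L)
    (hW : EssBoundedOn W (ball 0 R) K) (hV : EssBoundedOn V (ball 0 R) K) :
    BoundedCoeff A W V R lam K where
  lam_pos := hlam
  K_nonneg := hK
  elliptic := hell
  meas := fun i j => by
    obtain ⟨g, hg, -⟩ := hA i j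
    exact hg.1.aestronglyMeasurable
  drift := hW
  potential := hV

/-- The continuous representative of a solution is a solution. -/
theorem BoundedCoeff.isWeakSolution_ballRep (hc : BoundedCoeff A W V R lam K)
    (hA : ∀ i j, WeakGradientBoundedOn (fun z => A z i j) (ball 0 R) L) (hL : 0 ≤ L)
    {u : Plane → ℝ} {g : Plane → Plane} {s : ℕ → Plane → ℝ} (hs : H1Approx R u g s)
    (heq : ∀ η, IsTestOn (ball 0 R) η → form A W V R u g η (gradient η) = 0) :
    ContinuousOn (ballRep R u) (ball 0 R) ∧ IsWeakSolution A W V (ball 0 R) (ballRep R u) := by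
  have hae := ballRep_ae_eq hs.memLp
  refine ⟨hc.continuousOn_ballRep hA hL hs heq, g, (hs.congr_ae hae).memW12Loc, fun η hη => ?_⟩
  rw [weakForm_eq_form, form_congr_ae hae]
  exact heq η hη

theorem essBoundedOn_of_parts {P N : ℝ} (hP : EssBoundedOn (fun z => max (V z) 0) (ball 0 R) P)
    (hN : EssBoundedOn (fun z => max (-V z) 0) (ball 0 R) N) :
    EssBoundedOn V (ball 0 R) (P + N) ∧ (∀ᵐ z ∂volB R, V z ≤ P) ∧ ∀ᵐ z ∂volB R, -N ≤ V z := by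
  have e : ∀ z, max (V z) 0 - max (-V z) 0 = V z := fun z => by
    rcases le_total (V z) 0 with h | h
    · rw [max_eq_right h, max_eq_left (by linarith)]; ring
    · rw [max_eq_left h, max_eq_right (by linarith)]; ring
  refine ⟨⟨?_, ?_⟩, ?_, ?_⟩
  · exact (hP.1.sub hN.1).congr (ae_of_all _ e)
  · filter_upwards [hP.2, hN.2] with z h1 h2
    rw [← e z]
    exact (norm_sub_le _ _).trans (add_le_add h1 h2)
  · filter_upwards [hP.2] with z h1
    exact (le_max_left _ _).trans ((le_abs_self _).trans h1)
  · filter_upwards [hN.2] with z h1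
    linarith [(le_max_left (-V z) 0).trans ((le_abs_self _).trans h1)]

end

theorem exp_le_exp_mul_paraboloid {m a : ℝ} (ha : 0 ≤ a) {z : Plane} (hz : z ∈ ball (0 : Plane) m) :
    Real.exp (a * z 0) ≤ Real.exp (a * m) * (m ^ 2 + 1 - ‖z‖ ^ 2) := by
  rw [mem_ball_zero_iff] at hz
  have h1 : z 0 ≤ m := (le_abs_self _).trans ((abs_coord_le z 0).trans hz.le)
  have h2 : (1 : ℝ) ≤ m ^ 2 + 1 - ‖z‖ ^ 2 := by nlinarith [norm_nonneg z]
  calc Real.exp (a * z 0) ≤ Real.exp (a * m) :=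
        Real.exp_le_exp.2 (mul_le_mul_of_nonneg_left h1 ha)
    _ ≤ _ := le_mul_of_one_le_right (Real.exp_nonneg _) h2

/-- Existence of a positive solution between exponential and paraboloid for a small negative part
of the potential. -/
theorem exists_solution_between_barriers {lam : ℝ} (hlam : 0 < lam) {m K : ℝ}
    {A : Plane → Matrix (Fin 2) (Fin 2) ℝ} {W : Plane → Plane} {V : Plane → ℝ}
    (hm : 1 < m) (hK : 1 ≤ K) (hell : EllipticBoundedOn A (ball 0 m) lam)
    (hA : ∀ i j, WeakGradientBoundedOn (fun z => A z i j) (ball 0 m) (lam / (4 * m)))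
    (hP : EssBoundedOn (fun z => max (V z) 0) (ball 0 m) (K ^ 2))
    (hN : EssBoundedOn (fun z => max (-V z) 0) (ball 0 m) (lam / (m ^ 2 + 1)))
    (hW : EssBoundedOn W (ball 0 m) (lam / (2 * m))) :
    IsWeakSupersolution A W V (ball 0 m) (fun z => m ^ 2 + 1 - ‖z‖ ^ 2) ∧
    IsWeakSubsolution A W V (ball 0 m) (fun z => Real.exp ((1 + 1 / lam) * K * z 0)) ∧
    ∃ φ : Plane → ℝ, PosContOn φ (ball 0 m) ∧ IsWeakSolution A W V (ball 0 m) φ ∧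
      ∀ z ∈ ball (0 : Plane) m,
        Real.exp ((1 + 1 / lam) * K * z 0) ≤ φ z ∧
        φ z ≤ Real.exp ((1 + 1 / lam) * K * m) * (m ^ 2 + 1 - ‖z‖ ^ 2) := by
  obtain ⟨hV, hVP, hVN⟩ := essBoundedOn_of_parts hP hN
  have hm0 : 0 < m := by linarith
  have l1 : lam / (4 * m) ≤ lam / 4 := by
    gcongr; linarith
  have l2 : lam / (2 * m) ≤ lam / 2 := by
    gcongr; linarith
  have l3 : lam / (m ^ 2 + 1) ≤ lam := div_le_self hlam.le (by nlinarith)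
  have hL : 0 ≤ lam / (4 * m) := by positivity
  have hc : BoundedCoeff A W V m lam (K ^ 2 + lam) :=
    boundedCoeff_of_weakGradientBounded hlam (by positivity) hell hA
      (hW.mono subset_rfl (by nlinarith)) (hV.mono subset_rfl (by linarith))
  set c : ℝ := (1 + 1 / lam) * K with hcdef
  have hc0 : 0 ≤ c := by positivity
  -- Since m > 1 and K ≥ 1, the first order terms are at most λc = (λ + 1)K ≤ (λ + 1)K². Together
  -- with K² this stays below λc² = (λ + 2 + 1/λ)K², which is the reason for 1 + 1/λ.
  have hcb : 2 * (lam / (4 * m)) * c + lam / (2 * m) * c + K ^ 2 ≤ lam * c ^ 2 := by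
    have e1 : lam * c ^ 2 = (lam + 2 + 1 / lam) * K ^ 2 := by rw [hcdef]; field_simp; ring
    have e2 : lam * c = (lam + 1) * K := by rw [hcdef]; field_simp
    have e3 : 0 ≤ 1 / lam * K ^ 2 := by positivity
    have e4 := mul_le_mul_of_nonneg_right l1 hc0
    have e5 := mul_le_mul_of_nonneg_right l2 hc0
    have e6 : (lam + 1) * K ≤ (lam + 1) * K ^ 2 := by
      refine mul_le_mul_of_nonneg_left ?_ (by linarith)
      nlinarith
    rw [e1]
    nlinarith
  have hsup : ∀ η, IsTestOn (ball 0 m) η → (∀ z, 0 ≤ η z) →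
      0 ≤ form A W V m (fun y => m ^ 2 + 1 - ‖y‖ ^ 2) (gradient (fun y => m ^ 2 + 1 - ‖y‖ ^ 2)) η
      (gradient η) := fun η hη h0 => hc.form_paraboloid_nonneg hm hA hW.2 hVN hη h0
  have hsub : ∀ η, IsTestOn (ball 0 m) η → (∀ z, 0 ≤ η z) →
      form A W V m (fun y => Real.exp (c * y 0)) (gradient (fun y => Real.exp (c * y 0))) η
      (gradient η) ≤ 0 := fun η hη h0 => hc.form_exp_nonpos hA hc0 hW.2 hVP hcb hη h0
  refine ⟨⟨_, memW12Loc_of_contDiff (contDiff_const_sub_norm_sq (m ^ 2 + 1)) _, fun η hη h0 => by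
      rw [weakForm_eq_form]; exact hsup η hη h0⟩,
    ⟨_, memW12Loc_of_contDiff (contDiff_exp_coord c) _, fun η hη h0 => by
      rw [weakForm_eq_form]; exact hsub η hη h0⟩, ?_⟩
  -- The paraboloid is at least 1 in the ball, so the factor e^{cm} lifts it above the exponential.
  have hap := (H1Approx.of_contDiff (contDiff_const_sub_norm_sq (m ^ 2 + 1)) m).const_mul
    (Real.exp (c * m))
  obtain ⟨u, g, s, hs, heq, hbd⟩ := exists_solution_between hc (contDiff_exp_coord c) hsub hap
    (fun η hη h0 => by
      rw [form_smul_left]; exact mul_nonneg (Real.exp_nonneg _) (hsup η hη h0))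
    (Eventually.of_forall fun n z hz => exp_le_exp_mul_paraboloid hc0 hz)
  obtain ⟨hcont, hsol⟩ := hc.isWeakSolution_ballRep hA hL hs heq
  have hae := ballRep_ae_eq hs.memLp
  have b1 := le_on_ball_of_ae_le (contDiff_exp_coord c).continuous.continuousOn hcont (by
    filter_upwards [hbd, hae] with z hz he
    rw [he]; exact hz.1)
  have b2 := le_on_ball_of_ae_le hcont (continuous_const.mul
    (contDiff_const_sub_norm_sq (m ^ 2 + 1)).continuous).continuousOn (by
    filter_upwards [hbd, hae] with z hz he
    rw [he]; exact hz.2)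
  exact ⟨ballRep m u, ⟨hcont, fun z hz => (Real.exp_pos _).trans_le (b1 z hz)⟩, hsol,
    fun z hz => ⟨b1 z hz, b2 z hz⟩⟩

/-! ### Energy estimates for continuous solutions -/

/-- Products of uniformly convergent scalar functions and `L²`-convergent functions converge. -/
theorem TendstoL2.smul_uniform {α E ι : Type*} [MeasurableSpace α] [NormedAddCommGroup E]
    [NormedSpace ℝ E] {μ : Measure α} {l : Filter ι} {a : ι → α → ℝ} {b : α → ℝ}
    {s : ι → α → E} {f : α → E} {C : ℝ} (h : TendstoL2 μ l s f)
    (hs : ∀ n, MemLp (s n) 2 μ) (hf : MemLp f 2 μ)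
    (has : ∀ n, MemLp (fun z => a n z • s n z) 2 μ) (hbf : MemLp (fun z => b z • f z) 2 μ)
    (hC : ∀ᵐ z ∂μ, |b z| ≤ C)
    (hab : ∀ ε > 0, ∀ᶠ n in l, ∀ᵐ z ∂μ, |a n z - b z| ≤ ε) :
    TendstoL2 μ l (fun n z => a n z • s n z) (fun z => b z • f z) := by
  refine TendstoL2.of_l2 has hbf (Metric.tendsto_nhds.2 fun ε hε => ?_)
  have hf0 : 0 ≤ _root_.l2 μ f := l2_nonneg _
  -- The bound 1 keeps the multipliers below |C| + 1; the other bound makes the term (aₙ - b)f cost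
  -- at most ε/2.
  set δ := min 1 (ε / (2 * (_root_.l2 μ f + 1))) with hδ
  have hδ0 : 0 < δ := by positivity
  have h1 : ∀ᶠ n in l, (|C| + 1) * _root_.l2 μ (fun z => s n z - f z) < ε / 2 := by
    have := h.l2_sub.const_mul (|C| + 1)
    rw [mul_zero] at this
    exact this.eventually (gt_mem_nhds (by positivity))
  filter_upwards [h1, hab δ hδ0] with n h1 h2
  rw [Real.dist_eq, sub_zero, abs_of_nonneg (l2_nonneg _)]
  have hsf : MemLp (fun z => s n z - f z) 2 μ := (hs n).sub hf
  have hle : ∀ᵐ z ∂μ, ‖a n z • s n z - b z • f z‖ ≤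
      1 * ‖(|C| + 1) * ‖s n z - f z‖ + δ * ‖f z‖‖ := by
    filter_upwards [hC, h2] with z hz1 hz2
    rw [one_mul, Real.norm_of_nonneg (by positivity)]
    have e : a n z • s n z - b z • f z = a n z • (s n z - f z) + (a n z - b z) • f z := by module
    rw [e]
    refine (norm_add_le _ _).trans ?_
    rw [norm_smul, norm_smul, Real.norm_eq_abs, Real.norm_eq_abs]
    refine add_le_add (mul_le_mul_of_nonneg_right ?_ (norm_nonneg _))
      (mul_le_mul_of_nonneg_right hz2 (norm_nonneg _))
    have h3 : |a n z| ≤ |a n z - b z| + |b z| := by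
      simpa using abs_add_le (a n z - b z) (b z)
    have h4 : δ ≤ 1 := min_le_left _ _
    linarith [le_abs_self C]
  have m1 : MemLp (fun z => (|C| + 1) * ‖s n z - f z‖) 2 μ := hsf.norm.const_mul _
  have m2 : MemLp (fun z => δ * ‖f z‖) 2 μ := hf.norm.const_mul _
  have h5 := l2_le_mul (m1.add m2) zero_le_one hle
  have h6 := l2_add_le m1 m2
  have h7 : _root_.l2 μ (fun z => (|C| + 1) * ‖s n z - f z‖) ≤
      (|C| + 1) * _root_.l2 μ (fun z => s n z - f z) :=
    l2_le_mul hsf (by positivity) (ae_of_all _ fun z => by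
      rw [Real.norm_of_nonneg (by positivity)])
  have h8 : _root_.l2 μ (fun z => δ * ‖f z‖) ≤ δ * _root_.l2 μ f :=
    l2_le_mul hf hδ0.le (ae_of_all _ fun z => by
      rw [Real.norm_of_nonneg (by positivity)])
  have h9 : δ * _root_.l2 μ f ≤ ε / 2 := by
    have : δ ≤ ε / (2 * (_root_.l2 μ f + 1)) := min_le_right _ _
    calc δ * _root_.l2 μ f ≤ ε / (2 * (_root_.l2 μ f + 1)) * (_root_.l2 μ f + 1) := by
          gcongr; linarith
      _ = ε / 2 := by field_simp
  rw [one_mul] at h5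
  refine h5.trans_lt (h6.trans_lt ?_)
  linarith

theorem TendstoL2.of_uniform {ι : Type*} {l : Filter ι} {r : ℝ} {s : ι → Plane → ℝ}
    {f : Plane → ℝ} (hs : ∀ n, MemLp (s n) 2 (volB r)) (hf : MemLp f 2 (volB r)) {C : ℝ}
    (hC : ∀ᵐ z ∂volB r, |f z| ≤ C)
    (h : ∀ ε > 0, ∀ᶠ n in l, ∀ᵐ z ∂volB r, |s n z - f z| ≤ ε) :
    TendstoL2 (volB r) l s f := by
  have h1 : MemLp (fun _ : Plane => (1 : ℝ)) 2 (volB r) := memLp_ball_of_continuous continuous_const r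
  have := TendstoL2.smul_uniform (a := s) (b := f) (TendstoL2.const (μ := volB r) (l := l)
    (fun _ : Plane => (1 : ℝ))) (fun _ => h1) h1 (by simpa using hs) (by simpa using hf) hC h
  simpa using this

theorem exists_abs_le_closedBall {u : Plane → ℝ} {r R : ℝ} (hu : ContinuousOn u (ball 0 R))
    (hr : r < R) : ∃ B, 0 ≤ B ∧ ∀ z ∈ closedBall (0 : Plane) r, |u z| ≤ B := by
  obtain ⟨B, hB⟩ := (isCompact_closedBall (0 : Plane) r).exists_bound_of_continuousOn
    (hu.mono (closedBall_subset_ball hr))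
  exact ⟨max B 0, le_max_right _ _, fun z hz => (hB z hz).trans (le_max_left _ _)⟩

theorem aestronglyMeasurable_of_continuousOn_ball {u : Plane → ℝ} {r R : ℝ}
    (hu : ContinuousOn u (ball 0 R)) (hr : r ≤ R) : AEStronglyMeasurable u (volB r) :=
  (hu.mono (ball_subset_ball hr)).aestronglyMeasurable measurableSet_ball

/-- `u` is continuous and locally approximated by smooth functions, uniformly and in `H¹`, with
gradient `g`. -/
structure LocApprox (R : ℝ) (u : Plane → ℝ) (g : Plane → Plane) : Prop where
  cont : ContinuousOn u (ball 0 R)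
  approx : ∀ r < R, ∃ s : ℕ → Plane → ℝ, H1Approx r u g s ∧
    ∀ ε > 0, ∀ᶠ n in atTop, ∀ z ∈ closedBall (0 : Plane) r, |s n z - u z| ≤ ε

theorem ae_ball_of_forall_closedBall {r : ℝ} {p : Plane → Prop}
    (h : ∀ z ∈ closedBall (0 : Plane) r, p z) : ∀ᵐ z ∂volB r, p z :=
  (ae_restrict_mem measurableSet_ball).mono fun z hz => h z (ball_subset_closedBall hz)

theorem LocApprox.of_memW12Loc {R : ℝ} {u : Plane → ℝ} {g : Plane → Plane}
    (h : MemW12Loc u g (ball 0 R)) (hu : ContinuousOn u (ball 0 R)) : LocApprox R u g := by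
  refine ⟨hu, fun r hr => ?_⟩
  obtain ⟨s, hs, h1, h2⟩ := exists_smooth_approx h hu hr
  obtain ⟨B, -, hB⟩ := exists_abs_le_closedBall hu hr
  exact ⟨s, ⟨(h.memLp hr).1, (h.memLp hr).2, hs,
    TendstoL2.of_uniform (fun n => memLp_ball_of_continuous (hs n).continuous r) (h.memLp hr).1
      (ae_ball_of_forall_closedBall hB)
      (fun ε hε => (h1 ε hε).mono fun n hn => ae_ball_of_forall_closedBall hn), h2⟩, h1⟩

theorem LocApprox.mono {R R' : ℝ} {u : Plane → ℝ} {g : Plane → Plane} (h : LocApprox R u g)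
    (hR : R' ≤ R) : LocApprox R' u g :=
  ⟨h.cont.mono (ball_subset_ball hR), fun r hr => h.approx r (hr.trans_le hR)⟩

theorem LocApprox.add {R : ℝ} {u v : Plane → ℝ} {g k : Plane → Plane} (h : LocApprox R u g)
    (h' : LocApprox R v k) : LocApprox R (fun z => u z + v z) (fun z => g z + k z) := by
  refine ⟨h.cont.add h'.cont, fun r hr => ?_⟩
  obtain ⟨s, hs, hs'⟩ := h.approx r hr
  obtain ⟨t, ht, ht'⟩ := h'.approx r hr
  refine ⟨_, hs.add ht, fun ε hε => ?_⟩
  filter_upwards [hs' (ε / 2) (by positivity), ht' (ε / 2) (by positivity)] with n h1 h2 z hz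
  have e : s n z + t n z - (u z + v z) = (s n z - u z) + (t n z - v z) := by ring
  rw [e]
  linarith [abs_add_le (s n z - u z) (t n z - v z), h1 z hz, h2 z hz]

theorem LocApprox.const_mul {R : ℝ} {u : Plane → ℝ} {g : Plane → Plane} (h : LocApprox R u g)
    (c : ℝ) : LocApprox R (fun z => c * u z) (fun z => c • g z) := by
  refine ⟨continuousOn_const.mul h.cont, fun r hr => ?_⟩
  obtain ⟨s, hs, hs'⟩ := h.approx r hr
  refine ⟨_, hs.const_mul c, fun ε hε => ?_⟩
  filter_upwards [hs' (ε / (|c| + 1)) (by positivity)] with n h1 z hz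
  rw [← mul_sub, abs_mul]
  calc |c| * |s n z - u z| ≤ (|c| + 1) * (ε / (|c| + 1)) := by
        gcongr
        · linarith
        · exact h1 z hz
    _ = ε := by field_simp

theorem LocApprox.of_contDiff {f : Plane → ℝ} (hf : ContDiff ℝ ∞ f) (R : ℝ) :
    LocApprox R f (gradient f) :=
  ⟨hf.continuous.continuousOn, fun r _ => ⟨_, H1Approx.of_contDiff hf r, fun ε hε =>
    Eventually.of_forall fun n z _ => by simpa using hε.le⟩⟩

theorem LocApprox.memLp {R r : ℝ} {u : Plane → ℝ} {g : Plane → Plane} (h : LocApprox R u g)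
    (hr : r < R) : MemLp u 2 (volB r) ∧ MemLp g 2 (volB r) := by
  obtain ⟨s, hs, -⟩ := h.approx r hr
  exact ⟨hs.memLp, hs.memLp_grad⟩

/-- Uniform convergence is preserved by composition with a continuous function. -/
theorem uniform_comp {α ι : Type*} {l : Filter ι} {S : Set α} {s : ι → α → ℝ} {u : α → ℝ} {B : ℝ}
    {F : ℝ → ℝ} (hF : Continuous F) (hB : ∀ z ∈ S, |u z| ≤ B)
    (h : ∀ ε > 0, ∀ᶠ n in l, ∀ z ∈ S, |s n z - u z| ≤ ε) :
    ∀ ε > 0, ∀ᶠ n in l, ∀ z ∈ S, |F (s n z) - F (u z)| ≤ ε := by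
  intro ε hε
  have hu := (isCompact_Icc (a := -(B + 1)) (b := B + 1)).uniformContinuousOn_of_continuous
    hF.continuousOn
  obtain ⟨δ, hδ, hδ'⟩ := Metric.uniformContinuousOn_iff.1 hu ε hε
  filter_upwards [h (min 1 (δ / 2)) (by positivity)] with n hn z hz
  have h1 := abs_le.1 (hB z hz)
  have h2 := hn z hz
  have h3 := abs_le.1 (h2.trans (min_le_left _ _))
  refine (hδ' (s n z) ⟨by linarith, by linarith⟩ (u z) ⟨by linarith, by linarith⟩ ?_).le
  rw [Real.dist_eq]
  linarith [h2.trans (min_le_right _ _)]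

/-! ### Solutions and supersolutions on all smaller balls -/

section Solutions

variable {A : Plane → Matrix (Fin 2) (Fin 2) ℝ} {W : Plane → Plane} {V : Plane → ℝ}
  {R r lam K L : ℝ} {u : Plane → ℝ} {g : Plane → Plane}

/-- `u` is locally a solution in the ball of radius `R`. -/
def IsSol (A : Plane → Matrix (Fin 2) (Fin 2) ℝ) (W : Plane → Plane) (V : Plane → ℝ) (R : ℝ)
    (u : Plane → ℝ) (g : Plane → Plane) : Prop :=
  ∀ r < R, ∀ η, IsTestOn (ball 0 r) η → form A W V r u g η (gradient η) = 0

/-- `u` is locally a supersolution in the ball of radius `R`. -/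
def IsSup (A : Plane → Matrix (Fin 2) (Fin 2) ℝ) (W : Plane → Plane) (V : Plane → ℝ) (R : ℝ)
    (u : Plane → ℝ) (g : Plane → Plane) : Prop :=
  ∀ r < R, ∀ η, IsTestOn (ball 0 r) η → (∀ z, 0 ≤ η z) → 0 ≤ form A W V r u g η (gradient η)

theorem form_eq_of_isTestOn {η : Plane → ℝ} (hη : IsTestOn (ball 0 r) η) (hr : r ≤ R) :
    form A W V R u g η (gradient η) = form A W V r u g η (gradient η) := by
  have h0 : ∀ ρ, r ≤ ρ → form A W V ρ u g η (gradient η) =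
      ∫ z, (inner ℝ (flux A g z) (gradient η z) + lowerOrder W V u g z * η z) := by
    intro ρ hρ
    refine setIntegral_eq_integral_of_forall_compl_eq_zero fun z hz => ?_
    have hz' : z ∉ ball (0 : Plane) r := fun h => hz (ball_subset_ball hρ h)
    rw [hη.eq_zero hz', hη.gradient_eq_zero hz', inner_zero_right, mul_zero, add_zero]
  rw [h0 R hr, h0 r le_rfl]

/-- A compact support leaves room before the boundary, so information on all smaller balls suffices
for the full ball. -/
theorem IsTestOn.exists_lt {η : Plane → ℝ} (hη : IsTestOn (ball 0 R) η) :
    ∃ r < R, IsTestOn (ball 0 r) η := by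
  rcases (tsupport η).eq_empty_or_nonempty with h | h
  · exact ⟨R - 1, by linarith, hη.smooth, hη.compact, by rw [h]; exact empty_subset _⟩
  · obtain ⟨z, hz, hmax⟩ := hη.compact.isCompact.exists_isMaxOn h continuous_norm.continuousOn
    obtain ⟨r, h1, h2⟩ := exists_between (mem_ball_zero_iff.1 (hη.subset hz))
    exact ⟨r, h2, hη.smooth, hη.compact, fun y hy => mem_ball_zero_iff.2 ((hmax hy).trans_lt h1)⟩

theorem isSol_of_form_eq_zero
    (h : ∀ η, IsTestOn (ball 0 R) η → form A W V R u g η (gradient η) = 0) : IsSol A W V R u g :=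
  fun r hr η hη => by
    rw [← form_eq_of_isTestOn hη hr.le]; exact h η (hη.mono (ball_subset_ball hr.le))

theorem isSup_of_form_nonneg
    (h : ∀ η, IsTestOn (ball 0 R) η → (∀ z, 0 ≤ η z) → 0 ≤ form A W V R u g η (gradient η)) :
    IsSup A W V R u g :=
  fun r hr η hη h0 => by
    rw [← form_eq_of_isTestOn hη hr.le]; exact h η (hη.mono (ball_subset_ball hr.le)) h0

theorem IsSol.isSup (h : IsSol A W V R u g) : IsSup A W V R u g :=
  fun r hr η hη _ => (h r hr η hη).ge

end Solutions

/-- Uniform approximation gives the chain rule for every smooth F: on a smaller ball u and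
eventually its approximations take values in one compact interval, where F' is bounded and uniformly
continuous. No growth condition on F is needed. -/
theorem LocApprox.comp {R : ℝ} {u : Plane → ℝ} {g : Plane → Plane} (hu : LocApprox R u g)
    {F : ℝ → ℝ} (hF : ContDiff ℝ ∞ F) :
    LocApprox R (fun z => F (u z)) (fun z => deriv F (u z) • g z) := by
  refine ⟨hF.continuous.comp_continuousOn hu.cont, fun r hr => ?_⟩
  obtain ⟨s, hs, hsu⟩ := hu.approx r hr
  obtain ⟨B, hB0, hB⟩ := exists_abs_le_closedBall hu.cont hr
  have hF' : Continuous (deriv F) := hF.continuous_deriv (by simp)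
  have cs : ∀ n, Continuous (s n) := fun n => (hs.smooth n).continuous
  obtain ⟨M₁, hM₁⟩ := (isCompact_Icc (a := -B) (b := B)).exists_bound_of_continuousOn
    hF.continuous.continuousOn
  obtain ⟨M₂, hM₂⟩ := (isCompact_Icc (a := -B) (b := B)).exists_bound_of_continuousOn
    hF'.continuousOn
  have hFu : ∀ᵐ z ∂volB r, |F (u z)| ≤ M₁ := ae_ball_of_forall_closedBall fun z hz =>
    hM₁ _ (abs_le.1 (hB z hz))
  have hFu' : ∀ᵐ z ∂volB r, |deriv F (u z)| ≤ M₂ := ae_ball_of_forall_closedBall fun z hz =>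
    hM₂ _ (abs_le.1 (hB z hz))
  have um := aestronglyMeasurable_of_continuousOn_ball hu.cont hr.le
  have mFu : AEStronglyMeasurable (fun z => F (u z)) (volB r) :=
    hF.continuous.comp_aestronglyMeasurable um
  have mFu' : AEStronglyMeasurable (fun z => deriv F (u z)) (volB r) :=
    hF'.comp_aestronglyMeasurable um
  have unif := uniform_comp hF.continuous hB hsu
  have unif' := uniform_comp hF' hB hsu
  have m1 := memLp_ball_of_bound mFu hFu
  have m2 : MemLp (fun z => deriv F (u z) • g z) 2 (volB r) :=
    hs.memLp_grad.of_le_mul (mFu'.smul hs.memLp_grad.1) (hFu'.mono fun z hz => by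
      rw [norm_smul]; exact mul_le_mul_of_nonneg_right hz (norm_nonneg _))
  have hgr : ∀ n, gradient (fun z => F (s n z)) = fun z => deriv F (s n z) • gradient (s n) z :=
    fun n => funext fun z => gradient_comp' ((hF.differentiable (by simp)) (s n z)).hasDerivAt
      (hs.smooth n).differentiableAt'
  refine ⟨fun n z => F (s n z), ⟨m1, m2, fun n => hF.comp (hs.smooth n), ?_, ?_⟩, unif⟩
  · exact TendstoL2.of_uniform (fun n => memLp_ball_of_continuous (hF.continuous.comp (cs n)) r) m1
      hFu fun ε hε => (unif ε hε).mono fun n hn => ae_ball_of_forall_closedBall hn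
  · simp only [hgr]
    exact hs.tendsto_grad.smul_uniform (fun n => memLp_ball_of_continuous
      (continuous_gradient (hs.smooth n)) r) hs.memLp_grad (fun n => memLp_ball_of_continuous
      ((hF'.comp (cs n)).smul (continuous_gradient (hs.smooth n))) r) m2 hFu'
      fun ε hε => (unif' ε hε).mono fun n hn => ae_ball_of_forall_closedBall hn

/-- Testing the equation with `η² v` for a Sobolev function `v`. -/
theorem BoundedCoeff.form_sq_mul_eq_zero {A : Plane → Matrix (Fin 2) (Fin 2) ℝ} {W : Plane → Plane}
    {V : Plane → ℝ} {r lam K : ℝ} {u v : Plane → ℝ} {g k : Plane → Plane} {t : ℕ → Plane → ℝ}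
    (hc : BoundedCoeff A W V r lam K) (hu : MemLp u 2 (volB r)) (hg : MemLp g 2 (volB r))
    (heq : ∀ η, IsTestOn (ball 0 r) η → form A W V r u g η (gradient η) = 0)
    (hv : H1Approx r v k t) {η : Plane → ℝ} (hη : IsTestOn (ball 0 r) η) :
    MemLp (fun z => (η z * η z) • v z) 2 (volB r) ∧
    MemLp (fun z => v z • ((2 * η z) • gradient η z) + (η z * η z) • k z) 2 (volB r) ∧
    form A W V r u g (fun z => (η z * η z) • v z)
      (fun z => v z • ((2 * η z) • gradient η z) + (η z * η z) • k z) = 0 := by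
  have cη := hη.smooth.continuous
  have cη2 : Continuous fun z => η z * η z := cη.mul cη
  have cp : Continuous fun z => (2 * η z) • gradient η z :=
    (continuous_const.mul cη).smul (continuous_gradient hη.smooth)
  obtain ⟨B₁, hB₁⟩ := hη.compact.exists_bound_of_continuous cη
  obtain ⟨M₁, hM₁⟩ := (hasCompactSupport_gradient hη.compact).exists_bound_of_continuous
    (continuous_gradient hη.smooth)
  have hB10 : 0 ≤ B₁ := (norm_nonneg _).trans (hB₁ 0)
  obtain ⟨B, hB⟩ : ∃ B, ∀ z, ‖η z * η z‖ ≤ B := ⟨B₁ * B₁, fun z => by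
    rw [norm_mul]; exact mul_le_mul (hB₁ z) (hB₁ z) (norm_nonneg _) hB10⟩
  obtain ⟨M, hM⟩ : ∃ M, ∀ z, ‖(2 * η z) • gradient η z‖ ≤ M := ⟨2 * B₁ * M₁, fun z => by
    rw [norm_smul, norm_mul, Real.norm_two]
    exact mul_le_mul (mul_le_mul_of_nonneg_left (hB₁ z) zero_le_two) (hM₁ z) (norm_nonneg _)
      (by positivity)⟩
  have b1 : ∀ {E : Type} [NormedAddCommGroup E] [NormedSpace ℝ E] (w : Plane → E) z,
      ‖(η z * η z) • w z‖ ≤ B * ‖w z‖ := fun w z => by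
    rw [norm_smul]; exact mul_le_mul_of_nonneg_right (hB z) (norm_nonneg _)
  have b2 : ∀ (w : Plane → ℝ) z, ‖w z • ((2 * η z) • gradient η z)‖ ≤ M * ‖w z‖ := fun w z => by
    rw [norm_smul, mul_comm]; exact mul_le_mul_of_nonneg_right (hM z) (norm_nonneg _)
  have m1 : MemLp (fun z => (η z * η z) • v z) 2 (volB r) :=
    hv.memLp.of_le_mul (cη2.aestronglyMeasurable.smul hv.memLp.1) (ae_of_all _ (b1 v))
  have m2 : MemLp (fun z => v z • ((2 * η z) • gradient η z)) 2 (volB r) :=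
    hv.memLp.of_le_mul (hv.memLp.1.smul cp.aestronglyMeasurable) (ae_of_all _ (b2 v))
  have m3 : MemLp (fun z => (η z * η z) • k z) 2 (volB r) :=
    hv.memLp_grad.of_le_mul (cη2.aestronglyMeasurable.smul hv.memLp_grad.1) (ae_of_all _ (b1 k))
  have t1 : TendstoL2 (volB r) atTop (fun n z => (η z * η z) • t n z)
      (fun z => (η z * η z) • v z) :=
    hv.tendsto.of_le B (Eventually.of_forall fun n => ae_of_all _ fun z => by
      rw [← smul_sub]; exact b1 (fun z => t n z - v z) z)
  have t2 : TendstoL2 (volB r) atTop (fun n z => t n z • ((2 * η z) • gradient η z))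
      (fun z => v z • ((2 * η z) • gradient η z)) :=
    hv.tendsto.of_le M (Eventually.of_forall fun n => ae_of_all _ fun z => by
      rw [← sub_smul]; exact b2 (fun z => t n z - v z) z)
  have t3 : TendstoL2 (volB r) atTop (fun n z => (η z * η z) • gradient (t n) z)
      (fun z => (η z * η z) • k z) :=
    hv.tendsto_grad.of_le B (Eventually.of_forall fun n => ae_of_all _ fun z => by
      rw [← smul_sub]; exact b1 (fun z => gradient (t n) z - k z) z)
  have ct : ∀ n, Continuous (t n) := fun n => (hv.smooth n).continuous
  have c2 : ∀ n, Continuous fun z => t n z • ((2 * η z) • gradient η z) := fun n => (ct n).smul cp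
  have c3 : ∀ n, Continuous fun z => (η z * η z) • gradient (t n) z := fun n =>
    cη2.smul (continuous_gradient (hv.smooth n))
  have hlim := hc.tendsto_form_right (vs := fun n z => (η z * η z) • t n z)
    (ks := fun n z => t n z • ((2 * η z) • gradient η z) + (η z * η z) • gradient (t n) z)
    (v := fun z => (η z * η z) • v z)
    (k := fun z => v z • ((2 * η z) • gradient η z) + (η z * η z) • k z) hu hg
    (fun n => memLp_ball_of_continuous (cη2.smul (ct n)) r)
    (fun n => memLp_ball_of_continuous ((c2 n).add (c3 n)) r) m1 (m2.add m3) t1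
    (t2.add t3 (fun n => (c2 n).aestronglyMeasurable) m2.1
      (fun n => (c3 n).aestronglyMeasurable) m3.1)
  have m23 : MemLp (fun z => v z • ((2 * η z) • gradient η z) + (η z * η z) • k z) 2 (volB r) :=
    m2.add m3
  refine ⟨m1, m23, ?_⟩
  refine tendsto_nhds_unique hlim ?_
  refine tendsto_const_nhds.congr fun n => ?_
  symm
  have hψ : IsTestOn (ball 0 r) (fun z => (t n z * η z) * η z) :=
    hη.smul_left ((hv.smooth n).mul hη.smooth)
  rw [← heq _ hψ]
  congr 1
  · funext z; simp only [smul_eq_mul]; ring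
  · funext z
    rw [gradient_mul (f := fun z => t n z * η z) ((hv.smooth n).mul hη.smooth).differentiableAt'
      hη.smooth.differentiableAt', gradient_mul (hv.smooth n).differentiableAt'
        hη.smooth.differentiableAt']
    module

/-! ### Caccioppoli inequalities -/

theorem exists_cutoff {a r : ℝ} (ha : 0 < a) (har : a < r) : ∃ (η : Plane → ℝ) (M : ℝ),
    IsTestOn (ball 0 r) η ∧ (∀ z, 0 ≤ η z) ∧ (∀ z, η z ≤ 1) ∧
    (∀ z ∈ closedBall (0 : Plane) a, η z = 1) ∧ 0 ≤ M ∧ ∀ z, ‖gradient η z‖ ≤ M := by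
  let χ : ContDiffBump (0 : Plane) := ⟨a, (a + r) / 2, ha, by linarith⟩
  have hχt : IsTestOn (ball 0 r) χ := ⟨χ.contDiff, χ.hasCompactSupport, by
    rw [χ.tsupport_eq]; exact closedBall_subset_ball (by change (a + r) / 2 < r; linarith)⟩
  obtain ⟨M, hM⟩ := (hasCompactSupport_gradient hχt.compact).exists_bound_of_continuous
    (continuous_gradient hχt.smooth)
  exact ⟨χ, M, hχt, fun z => χ.nonneg, fun z => χ.le_one, fun z hz => χ.one_of_mem_closedBall hz,
    (norm_nonneg _).trans (hM 0), hM⟩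

/-- The constant in the energy estimates. -/
noncomputable def energyConst (lam K M : ℝ) : ℝ := 4 * M ^ 2 / lam ^ 3 + K ^ 2 / lam + K

theorem energyConst_nonneg {lam K M : ℝ} (hlam : 0 < lam) (hK : 0 ≤ K) :
    0 ≤ energyConst lam K M := by unfold energyConst; positivity

/-- Young's inequality is applied twice with weight λ/4, so that half of the ellipticity absorbs all
terms linear in x; `energyConst` collects what remains. -/
theorem energy_ineq {lam K M x y : ℝ} (hlam : 0 < lam) :
    2 * lam⁻¹ * M * x * y + K * (x + y) * y ≤ lam / 2 * x ^ 2 + energyConst lam K M * y ^ 2 := by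
  have key : ∀ a : ℝ, a * x ≤ lam / 4 * x ^ 2 + a ^ 2 / lam := by
    intro a
    have h1 : 0 ≤ (lam * x / 2 - a) ^ 2 / lam := by positivity
    have h2 : (lam * x / 2 - a) ^ 2 / lam = lam / 4 * x ^ 2 + a ^ 2 / lam - a * x := by
      field_simp; ring
    linarith
  have k1 := key (2 * lam⁻¹ * M * y)
  have k2 := key (K * y)
  have e1 : (2 * lam⁻¹ * M * y) ^ 2 / lam + (K * y) ^ 2 / lam + K * y ^ 2 =
      energyConst lam K M * y ^ 2 := by
    unfold energyConst; field_simp; ring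
  nlinarith

section Energy

variable {A : Plane → Matrix (Fin 2) (Fin 2) ℝ} {W : Plane → Plane} {V : Plane → ℝ}
  {R r a lam K L : ℝ} {u : Plane → ℝ} {g : Plane → Plane}

/-- Pointwise lower bound for the energy density tested with `η² v`, where `k` is a nonnegative
multiple of the gradient. -/
theorem BoundedCoeff.ae_density_le (hc : BoundedCoeff A W V r lam K) :
    ∀ᵐ z ∂volB r, ∀ (u : Plane → ℝ) (g : Plane → Plane) (η p M : ℝ) (q : Plane),
      0 ≤ η → η ≤ 1 → ‖q‖ ≤ M →
      lam / 2 * (η * ‖p • g z‖) ^ 2 - energyConst lam K M * (p * u z) ^ 2 ≤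
        inner ℝ (flux A g z) ((p ^ 2 * u z) • ((2 * η) • q) + (η * η * p ^ 2) • g z) -
        |lowerOrder W V u g z * ((η * η) * (p ^ 2 * u z))| := by
  filter_upwards [hc.abs_lower_le, ae_restrict_mem measurableSet_ball] with z h1 hz u g η p M q h0 hη hq
  have hlam := hc.lam_pos
  have hK := hc.K_nonneg
  have e1 := hc.elliptic.le_inner_flux (g := g) hz
  have e2 := hc.elliptic.norm_flux_le (g := g) hz
  have e3 := h1 u g
  set x := η * ‖p • g z‖ with hx
  have hx' : x = η * |p| * ‖g z‖ := by rw [hx, norm_smul, Real.norm_eq_abs]; ring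
  set y := |p * u z| with hy
  have hy' : y = |p| * |u z| := by rw [hy, abs_mul]
  have hM : 0 ≤ M := (norm_nonneg q).trans hq
  have en := energy_ineq (K := K) (M := M) (x := x) (y := y) hlam
  rw [hy, sq_abs] at en
  rw [← hy] at en
  have f1 : inner ℝ (flux A g z) ((p ^ 2 * u z) • ((2 * η) • q)) ≥ -(2 * lam⁻¹ * M * x * y) := by
    refine neg_le_of_abs_le ((abs_real_inner_le_norm _ _).trans ?_)
    rw [norm_smul, norm_smul, norm_mul, norm_mul, Real.norm_two, Real.norm_of_nonneg h0, norm_pow,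
      Real.norm_eq_abs, Real.norm_eq_abs]
    calc _ ≤ (lam⁻¹ * ‖g z‖) * (|p| ^ 2 * |u z| * (2 * η * M)) := by gcongr
      _ = _ := by rw [hx', hy']; ring
  have f2 : inner ℝ (flux A g z) ((η * η * p ^ 2) • g z) ≥ lam * x ^ 2 := by
    rw [real_inner_smul_right, hx', mul_pow, mul_pow, sq_abs]
    have : 0 ≤ η * η * p ^ 2 := by positivity
    nlinarith [mul_le_mul_of_nonneg_left e1 this]
  have f3 : |lowerOrder W V u g z * ((η * η) * (p ^ 2 * u z))| ≤ K * (x + y) * y := by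
    rw [abs_mul, abs_mul, abs_mul, abs_mul, abs_of_nonneg h0, abs_pow]
    have g1 : η * |p| * ‖g z‖ + η * |p| * |u z| ≤ x + y := by
      rw [hx', hy']
      have : η * |p| * |u z| ≤ |p| * |u z| := by
        rw [mul_assoc]; exact mul_le_of_le_one_left (by positivity) hη
      linarith
    calc |lowerOrder W V u g z| * (η * η * (|p| ^ 2 * |u z|))
        ≤ (K * (‖g z‖ + |u z|)) * (η * η * (|p| ^ 2 * |u z|)) :=
          mul_le_mul_of_nonneg_right e3 (by positivity)
      _ = K * (η * |p| * ‖g z‖ + η * |p| * |u z|) * (η * y) := by rw [hy']; ring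
      _ ≤ K * (x + y) * (1 * y) := by
        have : 0 ≤ x + y := by positivity
        gcongr
      _ = _ := by ring
  rw [inner_add_right]
  linarith

theorem l2_le_of_density (ha : a ≤ r) {η : Plane → ℝ} (hη1 : ∀ z ∈ closedBall (0 : Plane) a, η z = 1)
    {G : Plane → Plane} (hG : MemLp (fun z => η z * ‖G z‖) 2 (volB r)) {B : ℝ} (hB : 0 ≤ B)
    (h : ∫ z in ball (0 : Plane) r, (η z * ‖G z‖) ^ 2 ≤ B ^ 2) : l2 (volB a) G ≤ B := by
  have e : l2 (volB a) G = l2 (volB a) (fun z => η z * ‖G z‖) := by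
    rw [← l2_norm]
    refine l2_congr (ae_ball_of_forall_closedBall fun z hz => ?_)
    simp only
    rw [hη1 z hz, one_mul]
  rw [e]
  refine (l2_mono_measure (volB_mono ha) hG).trans ?_
  refine abs_le_of_sq_le_sq' ?_ hB |>.2
  rw [l2_sq hG]
  simpa only [Real.norm_eq_abs, sq_abs] using h

theorem memLp_mul_norm {η : Plane → ℝ} (h0 : ∀ z, 0 ≤ η z) (h1 : ∀ z, η z ≤ 1)
    (hη : Continuous η) {G : Plane → Plane} (hG : MemLp G 2 (volB r)) :
    MemLp (fun z => η z * ‖G z‖) 2 (volB r) :=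
  hG.of_le (hη.aestronglyMeasurable.mul hG.1.norm) (ae_of_all _ fun z => by
    rw [norm_mul, norm_norm, Real.norm_of_nonneg (h0 z)]
    exact mul_le_of_le_one_left (norm_nonneg _) (h1 z))

theorem integrable_sq {α : Type*} [MeasurableSpace α] {μ : Measure α} {f : α → ℝ}
    (hf : MemLp f 2 μ) : Integrable (fun z => f z ^ 2) μ := by
  simpa only [sq] using integrable_mul_of_memLp hf hf

/-- The Caccioppoli inequality. -/
theorem BoundedCoeff.exists_caccioppoli (hc : BoundedCoeff A W V r lam K) (ha : 0 < a)
    (har : a < r) : ∃ C : ℝ, 0 ≤ C ∧ ∀ R > r, ∀ (u : Plane → ℝ) (g : Plane → Plane),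
      LocApprox R u g → IsSol A W V R u g → l2 (volB a) g ≤ C * l2 (volB r) u := by
  obtain ⟨η, M, hη, h0, h1, hη1, hM0, hM⟩ := exists_cutoff ha har
  have hlam := hc.lam_pos
  have hE := energyConst_nonneg (M := M) hlam hc.K_nonneg
  refine ⟨√(2 / lam * energyConst lam K M), Real.sqrt_nonneg _, fun R hR u g hu hsol => ?_⟩
  obtain ⟨s, hs, -⟩ := hu.approx r hR
  obtain ⟨m1, m2, hform⟩ := hc.form_sq_mul_eq_zero hs.memLp hs.memLp_grad (hsol r hR) hs hη
  have mG := memLp_mul_norm h0 h1 hη.smooth.continuous hs.memLp_grad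
  have i1 := (integrable_sq mG).const_mul (lam / 2)
  have i2 := (integrable_sq hs.memLp).const_mul (energyConst lam K M)
  have hI := integral_mono_ae (i1.sub i2) (hc.integrable_form hs.memLp hs.memLp_grad m1 m2) (by
    filter_upwards [hc.ae_density_le] with z hz
    -- The choice p = 1 corresponds to the test function η²u.
    have := hz u g (η z) 1 M (gradient η z) (h0 z) (h1 z) (hM z)
    simp only [one_smul, one_pow, one_mul, mul_one] at this
    simp only [Pi.sub_apply, smul_eq_mul]
    linarith [neg_abs_le (lowerOrder W V u g z * (η z * η z * u z))])
  rw [show ∫ z in ball (0 : Plane) r, _ = (0 : ℝ) from hform, integral_sub' i1 i2,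
    integral_const_mul, integral_const_mul] at hI
  refine l2_le_of_density har.le hη1 mG (mul_nonneg (Real.sqrt_nonneg _) (l2_nonneg _)) ?_
  rw [mul_pow, Real.sq_sqrt (by positivity), l2_sq hs.memLp]
  simp only [Real.norm_eq_abs, sq_abs]
  have h3 := mul_le_mul_of_nonneg_left (sub_nonpos.1 hI) (a := 2 / lam) (by positivity)
  calc _ = 2 / lam * (lam / 2 * ∫ z in ball (0 : Plane) r, (η z * ‖g z‖) ^ 2) := by
        field_simp
    _ ≤ _ := h3
    _ = _ := by ring

/-- A function smooth away from zero agrees with a globally smooth function on `(c, ∞)`. -/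
theorem exists_smooth_extension {f : ℝ → ℝ} (hf : ∀ t ≠ 0, ContDiffAt ℝ ∞ f t) {c : ℝ}
    (hc : 0 < c) : ∃ F : ℝ → ℝ, ContDiff ℝ ∞ F ∧ ∀ t > c, F =ᶠ[𝓝 t] f := by
  -- The cutoff vanishes for t ≤ c/2, which removes the singularity at zero, and equals one for t ≥
  -- c.
  refine ⟨fun t => Real.smoothTransition (2 * t / c - 1) * f t, ?_, fun t ht => ?_⟩
  · rw [contDiff_iff_contDiffAt]
    intro t
    by_cases ht : t = 0
    · refine contDiffAt_const (c := (0 : ℝ)) |>.congr_of_eventuallyEq ?_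
      have : ∀ᶠ s in 𝓝 t, s < c / 2 := by
        rw [ht]; exact gt_mem_nhds (by positivity)
      filter_upwards [this] with s hs
      rw [Real.smoothTransition.zero_of_nonpos, zero_mul]
      rw [sub_nonpos, div_le_one hc]; linarith
    · exact (Real.smoothTransition.contDiffAt.comp t (by fun_prop)).mul (hf t ht)
  · filter_upwards [lt_mem_nhds ht] with s hs
    rw [Real.smoothTransition.one_of_one_le, one_mul]
    rw [le_sub_iff_add_le, le_div_iff₀ hc]; linarith

theorem exists_lower_bound_closedBall {u : Plane → ℝ} {r R : ℝ} (hu : ContinuousOn u (ball 0 R))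
    (hpos : ∀ z ∈ ball (0 : Plane) R, 0 < u z) (hr : r < R) :
    ∃ c > 0, ∀ z ∈ closedBall (0 : Plane) r, c < u z := by
  rcases (closedBall (0 : Plane) r).eq_empty_or_nonempty with h | h
  · exact ⟨1, one_pos, fun z hz => by rw [h] at hz; exact absurd hz (notMem_empty z)⟩
  · obtain ⟨z, hz, hmin⟩ := (isCompact_closedBall (0 : Plane) r).exists_isMinOn h
      (hu.mono (closedBall_subset_ball hr))
    have := hpos z (closedBall_subset_ball hr hz)
    exact ⟨u z / 2, by positivity, fun y hy => by linarith [isMinOn_iff.1 hmin y hy]⟩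

/-- The logarithmic gradient estimate for positive solutions. -/
theorem BoundedCoeff.exists_log_caccioppoli (hc : BoundedCoeff A W V r lam K) (ha : 0 < a)
    (har : a < r) : ∃ C : ℝ, 0 ≤ C ∧ ∀ R > r, ∀ (u : Plane → ℝ) (g : Plane → Plane),
      LocApprox R u g → IsSol A W V R u g → (∀ z ∈ ball (0 : Plane) R, 0 < u z) →
      l2 (volB a) (fun z => (u z)⁻¹ • g z) ≤ C := by
  obtain ⟨η, M, hη, h0, h1, hη1, hM0, hM⟩ := exists_cutoff ha har
  have hlam := hc.lam_pos
  have hE := energyConst_nonneg (M := M) hlam hc.K_nonneg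
  set T : ℝ := ∫ z in ball (0 : Plane) r, (1 : ℝ) with hT
  have hT0 : 0 ≤ T := integral_nonneg fun _ => zero_le_one
  refine ⟨√(2 / lam * (energyConst lam K M * T)), Real.sqrt_nonneg _, fun R hR u g hu hsol hpos => ?_⟩
  obtain ⟨s, hs, -⟩ := hu.approx r hR
  obtain ⟨c, hc0, hcu⟩ := exists_lower_bound_closedBall hu.cont hpos hR
  -- On the closed ball u stays above c, so 1/t may be replaced by a globally smooth function, to
  -- which the chain rule applies.
  obtain ⟨F, hF, hFinv⟩ := exists_smooth_extension (f := fun t : ℝ => t⁻¹)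
    (fun t ht => contDiffAt_inv ℝ ht) hc0
  obtain ⟨s', hs', -⟩ := (hu.comp hF).approx r hR
  obtain ⟨m1, m2, hform⟩ := hc.form_sq_mul_eq_zero hs.memLp hs.memLp_grad (hsol r hR) hs' hη
  have hFu : ∀ z ∈ closedBall (0 : Plane) r, F (u z) = (u z)⁻¹ ∧ deriv F (u z) = -((u z)⁻¹) ^ 2 := by
    intro z hz
    have := hFinv (u z) (hcu z hz)
    refine ⟨this.eq_of_nhds, ?_⟩
    rw [this.deriv_eq, deriv_inv, inv_pow]
  have hGe : (fun z => (u z)⁻¹ • g z) =ᵐ[volB r] fun z => (F (u z)) • g z :=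
    ae_ball_of_forall_closedBall fun z hz => by simp only [(hFu z hz).1]
  have mG' : MemLp (fun z => (u z)⁻¹ • g z) 2 (volB r) := by
    refine (memLp_congr_ae hGe).2 (hs.memLp_grad.of_le_mul (c := c⁻¹)
      (hs'.memLp.1.smul hs.memLp_grad.1) (ae_ball_of_forall_closedBall fun z hz => ?_))
    have := hcu z hz
    rw [norm_smul, (hFu z hz).1, norm_inv, Real.norm_of_nonneg (hc0.le.trans this.le)]
    gcongr
  have mG := memLp_mul_norm h0 h1 hη.smooth.continuous mG'
  have i1 := (integrable_sq mG).const_mul (lam / 2)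
  have i2 : Integrable (fun _ : Plane => energyConst lam K M * (1 : ℝ)) (volB r) := by
    have : IsFiniteMeasure (volB r) := ⟨by
      rw [Measure.restrict_apply_univ]; exact measure_ball_lt_top⟩
    exact integrable_const _
  have hI := integral_mono_ae (i1.sub i2)
    (hc.integrable_form hs.memLp hs.memLp_grad m1 m2).neg (by
    filter_upwards [hc.ae_density_le, ae_restrict_mem measurableSet_ball] with z hz hzb
    have hzc := ball_subset_closedBall hzb
    have hu0 := hc0.trans (hcu z hzc)
    -- The choice p = 1/u corresponds to the test function η²/u. The gradient of 1/u is -g/u², so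
    -- the density appears with the opposite sign and ∇η is replaced by -∇η. Since pu = 1, the error
    -- term no longer depends on u.
    have := hz u g (η z) (u z)⁻¹ M (-gradient η z) (h0 z) (h1 z) (by rw [norm_neg]; exact hM z)
    have e1 : (u z)⁻¹ ^ 2 * u z = (u z)⁻¹ := by field_simp
    rw [e1, inv_mul_cancel₀ hu0.ne', one_pow] at this
    simp only [Pi.sub_apply, Pi.neg_apply, smul_eq_mul]
    rw [(hFu z hzc).1, (hFu z hzc).2]
    have e2 : (u z)⁻¹ • (2 * η z) • gradient η z + (η z * η z) • -(u z)⁻¹ ^ 2 • g z =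
        -((u z)⁻¹ • (2 * η z) • -gradient η z + (η z * η z * (u z)⁻¹ ^ 2) • g z) := by module
    rw [e2, inner_neg_right]
    linarith [le_abs_self (lowerOrder W V u g z * (η z * η z * (u z)⁻¹))])
  have e0 : ∫ z in ball (0 : Plane) r, _ = (0 : ℝ) := hform
  rw [integral_neg', e0, neg_zero, integral_sub' i1 i2, integral_const_mul, integral_const_mul,
    ← hT] at hI
  refine l2_le_of_density har.le hη1 mG (Real.sqrt_nonneg _) ?_
  rw [Real.sq_sqrt (by positivity)]
  have h3 := mul_le_mul_of_nonneg_left (sub_nonpos.1 hI) (a := 2 / lam) (by positivity)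
  calc _ = 2 / lam * (lam / 2 * ∫ z in ball (0 : Plane) r, (η z * ‖(u z)⁻¹ • g z‖) ^ 2) := by
        field_simp
    _ ≤ _ := h3

end Energy

/-! ### Small oscillation on circles -/

/-- Polar coordinates in the plane. -/
noncomputable def polarPoint (ρ θ : ℝ) : Plane :=
  (ρ * Real.cos θ) • stdVec 0 + (ρ * Real.sin θ) • stdVec 1

theorem norm_polarPoint {ρ : ℝ} (hρ : 0 ≤ ρ) (θ : ℝ) : ‖polarPoint ρ θ‖ = ρ := by
  rw [← sq_eq_sq₀ (norm_nonneg _) hρ, norm_sq_plane]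
  have e0 : polarPoint ρ θ 0 = ρ * Real.cos θ := by simp [polarPoint, stdVec]
  have e1 : polarPoint ρ θ 1 = ρ * Real.sin θ := by simp [polarPoint, stdVec]
  rw [e0, e1]
  linear_combination ρ ^ 2 * Real.sin_sq_add_cos_sq θ

theorem exists_polarPoint_eq (z : Plane) : ∃ θ ∈ Icc (-Real.pi) Real.pi, z = polarPoint ‖z‖ θ := by
  set w : ℂ := ⟨z 0, z 1⟩ with hw
  have hn : ‖w‖ = ‖z‖ := by
    rw [← sq_eq_sq₀ (norm_nonneg _) (norm_nonneg _), norm_sq_plane, ← Complex.normSq_eq_norm_sq,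
      Complex.normSq_apply]
    ring
  refine ⟨w.arg, ⟨(Complex.neg_pi_lt_arg w).le, Complex.arg_le_pi w⟩, ?_⟩
  have h1 := Complex.norm_mul_cos_arg w
  have h2 := Complex.norm_mul_sin_arg w
  rw [← hn, polarPoint, h1, h2]
  exact plane_eq_add z

theorem hasDerivAt_polarPoint (ρ θ : ℝ) :
    HasDerivAt (polarPoint ρ) (polarPoint ρ (θ + Real.pi / 2)) θ := by
  have h1 := ((Real.hasDerivAt_cos θ).const_mul ρ).smul_const (stdVec 0)
  have h2 := ((Real.hasDerivAt_sin θ).const_mul ρ).smul_const (stdVec 1)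
  have h3 := h1.add h2
  rw [polarPoint, Real.cos_add_pi_div_two, Real.sin_add_pi_div_two]
  exact h3

theorem continuous_polarPoint (ρ : ℝ) : Continuous (polarPoint ρ) := by
  unfold polarPoint; fun_prop

/-- Polar coordinates with Jacobian ρ; an inequality suffices because the annulus is only part of
the ball. -/
theorem lintegral_polar_le {Φ : Plane → ENNReal} (hΦ : Measurable Φ) {a b : ℝ} (ha : 0 ≤ a) :
    ∫⁻ ρ in Ioo a b, ∫⁻ θ in Ioo (-Real.pi) Real.pi, ENNReal.ofReal ρ * Φ (polarPoint ρ θ) ≤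
      ∫⁻ z in ball (0 : Plane) b, Φ z := by
  have hm : Measurable ((ball (0 : Plane) b).indicator Φ) := hΦ.indicator measurableSet_ball
  rw [← lintegral_indicator measurableSet_ball, ← measurePreserving_coord01.lintegral_comp hm,
    ← lintegral_comp_polarCoord_symm]
  have hP : Measurable fun p : ℝ × ℝ => polarPoint p.1 p.2 := by
    refine Continuous.measurable ?_
    unfold polarPoint; fun_prop
  have hmeas : Measurable fun p : ℝ × ℝ => ENNReal.ofReal p.1 * Φ (polarPoint p.1 p.2) :=
    (ENNReal.measurable_ofReal.comp measurable_fst).mul (hΦ.comp hP)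
  rw [← lintegral_prod _ hmeas.aemeasurable (μ := volume.restrict (Ioo a b))
    (ν := volume.restrict (Ioo (-Real.pi) Real.pi)), Measure.prod_restrict,
    ← Measure.volume_eq_prod]
  have hsub : Ioo a b ×ˢ Ioo (-Real.pi) Real.pi ⊆ polarCoord.target := by
    rintro ⟨ρ, θ⟩ ⟨h1, h2⟩
    exact ⟨ha.trans_lt h1.1, h2⟩
  refine le_trans ?_ (lintegral_mono_set hsub)
  refine setLIntegral_mono' (measurableSet_Ioo.prod measurableSet_Ioo) ?_
  rintro ⟨ρ, θ⟩ ⟨h1, h2⟩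
  have e : (polarCoord.symm (ρ, θ)).1 • stdVec 0 + (polarCoord.symm (ρ, θ)).2 • stdVec 1 =
      polarPoint ρ θ := rfl
  simp only [smul_eq_mul]
  rw [e, indicator_of_mem]
  rw [mem_ball_zero_iff, norm_polarPoint (ha.trans h1.1.le)]
  exact h1.2

/-- The fundamental theorem of calculus along an arc, traversed with speed ρ; the full turn bounds
every arc. -/
theorem enorm_circle_sub_le {f : Plane → ℝ} (hf : ContDiff ℝ ∞ f) {ρ : ℝ} (hρ : 0 ≤ ρ) {θ θ' : ℝ}
    (hθ : θ ∈ Icc (-Real.pi) Real.pi) (hθ' : θ' ∈ Icc (-Real.pi) Real.pi) :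
    ‖f (polarPoint ρ θ') - f (polarPoint ρ θ)‖ₑ ≤
      ∫⁻ τ in Ioo (-Real.pi) Real.pi, ENNReal.ofReal ρ * ‖gradient f (polarPoint ρ τ)‖ₑ := by
  have hd : ∀ τ : ℝ, HasDerivAt (fun τ => f (polarPoint ρ τ))
      (fderiv ℝ f (polarPoint ρ τ) (polarPoint ρ (τ + Real.pi / 2))) τ := fun τ =>
    (hf.differentiableAt' (z := polarPoint ρ τ)).hasFDerivAt.comp_hasDerivAt τ
      (hasDerivAt_polarPoint ρ τ)
  have hcont : Continuous fun τ => fderiv ℝ f (polarPoint ρ τ) (polarPoint ρ (τ + Real.pi / 2)) :=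
    ((hf.continuous_fderiv (by simp)).comp (continuous_polarPoint ρ)).clm_apply
      ((continuous_polarPoint ρ).comp (by fun_prop))
  have h2 := intervalIntegral.integral_eq_sub_of_hasDerivAt (a := θ) (b := θ')
    (fun τ _ => hd τ) (hcont.intervalIntegrable _ _)
  rw [← h2, ← ofReal_norm, intervalIntegral.norm_intervalIntegral_eq, ofReal_norm]
  refine (enorm_integral_le_lintegral_enorm _).trans ?_
  rw [setLIntegral_congr Ioo_ae_eq_Ioc]
  refine (lintegral_mono_set (t := Ioc (-Real.pi) Real.pi) ?_).trans (lintegral_mono fun τ => ?_)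
  · rw [uIoc]
    exact Ioc_subset_Ioc (le_min hθ.1 hθ'.1) (max_le hθ.2 hθ'.2)
  · rw [← ofReal_norm, ← ofReal_norm, ← ENNReal.ofReal_mul hρ]
    refine ENNReal.ofReal_le_ofReal (((fderiv ℝ f _).le_opNorm _).trans ?_)
    rw [norm_polarPoint hρ, norm_gradient, mul_comm]

/-- On some circle the oscillation is bounded by the energy. -/
theorem exists_circle_osc_le {a b : ℝ} (ha : 0 < a) (hab : a < b) : ∃ C : ℝ, 0 ≤ C ∧
    ∀ f : Plane → ℝ, ContDiff ℝ ∞ f → ∃ ρ ∈ Ioo a b, ∀ z z' : Plane, ‖z‖ = ρ → ‖z'‖ = ρ →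
      |f z' - f z| ≤ C * l2 (volB b) (gradient f) := by
  set C : ENNReal := (ENNReal.ofReal b / ENNReal.ofReal (b - a)) ^ (1 / 2 : ℝ) *
    (ENNReal.ofReal (2 * Real.pi)) ^ (1 / 2 : ℝ) with hC
  have hba : ENNReal.ofReal (b - a) ≠ 0 := by
    rw [Ne, ENNReal.ofReal_eq_zero, not_le]; linarith
  have hCfin : C ≠ ⊤ := by
    refine ENNReal.mul_ne_top ?_ ?_ <;> refine ENNReal.rpow_ne_top_of_nonneg (by norm_num) ?_
    · exact ENNReal.div_ne_top ENNReal.ofReal_ne_top hba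
    · exact ENNReal.ofReal_ne_top
  refine ⟨C.toReal, ENNReal.toReal_nonneg, fun f hf => ?_⟩
  have hg := continuous_gradient hf
  set T := ∫⁻ z in ball (0 : Plane) b, ‖gradient f z‖ₑ ^ 2 with hT
  have hmem := memLp_ball_of_continuous hg b
  have hTe : eLpNorm (gradient f) 2 (volB b) = T ^ (1 / 2 : ℝ) := eLpNorm_two_eq _ _
  have hTfin : T ≠ ⊤ := by
    intro h
    rw [h, ENNReal.top_rpow_of_pos (by norm_num)] at hTe
    exact hmem.2.ne hTe
  have hpol := lintegral_polar_le (Φ := fun z => ‖gradient f z‖ₑ ^ 2)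
    (hg.enorm.measurable.pow_const 2) ha.le (b := b)
  have hvol : volume (Ioo a b) = ENNReal.ofReal (b - a) := Real.volume_Ioo
  have hmeas : Measurable fun ρ => ∫⁻ θ in Ioo (-Real.pi) Real.pi,
      ENNReal.ofReal ρ * ‖gradient f (polarPoint ρ θ)‖ₑ ^ 2 := by
    refine Measurable.lintegral_prod_right' (f := fun p : ℝ × ℝ =>
      ENNReal.ofReal p.1 * ‖gradient f (polarPoint p.1 p.2)‖ₑ ^ 2) ?_
    have hp : Continuous fun p : ℝ × ℝ => polarPoint p.1 p.2 := by
      unfold polarPoint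
      fun_prop
    exact (ENNReal.measurable_ofReal.comp measurable_fst).mul
      ((hg.comp hp).enorm.measurable.pow_const 2)
  -- The Courant–Lebesgue argument: some radius is no worse than the average over (a, b), so the
  -- energy on its circle is at most the total energy divided by b - a.
  obtain ⟨ρ, hρ, hle⟩ := exists_le_setLAverage (μ := volume) (s := Ioo a b)
    (f := fun ρ => ∫⁻ θ in Ioo (-Real.pi) Real.pi,
      ENNReal.ofReal ρ * ‖gradient f (polarPoint ρ θ)‖ₑ ^ 2)
    (by rw [hvol]; exact hba) (by rw [hvol]; exact ENNReal.ofReal_ne_top) hmeas.aemeasurable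
  rw [setLAverage_eq, hvol] at hle
  have hρ0 : 0 ≤ ρ := ha.le.trans hρ.1.le
  refine ⟨ρ, hρ, fun z z' hz hz' => ?_⟩
  obtain ⟨θ, hθ, hzθ⟩ := exists_polarPoint_eq z
  obtain ⟨θ', hθ', hzθ'⟩ := exists_polarPoint_eq z'
  rw [hz] at hzθ
  rw [hz'] at hzθ'
  have h1 := enorm_circle_sub_le hf hρ0 hθ hθ'
  rw [← hzθ, ← hzθ'] at h1
  set ψ : ℝ → ℝ := fun τ => ρ * ‖gradient f (polarPoint ρ τ)‖ with hψ
  have hψc : Continuous ψ := continuous_const.mul (hg.comp (continuous_polarPoint ρ)).norm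
  have hψe : ∀ τ, ‖ψ τ‖ₑ = ENNReal.ofReal ρ * ‖gradient f (polarPoint ρ τ)‖ₑ := by
    intro τ
    rw [hψ]; simp only
    rw [enorm_mul, enorm_norm, Real.enorm_eq_ofReal hρ0]
  have h2 := eLpNorm_le_eLpNorm_mul_rpow_measure_univ
    (μ := volume.restrict (Ioo (-Real.pi) Real.pi)) (p := 1) (q := 2) (by norm_num)
    hψc.aestronglyMeasurable
  rw [eLpNorm_one_eq_lintegral_enorm, eLpNorm_two_eq, Measure.restrict_apply_univ,
    Real.volume_Ioo, sub_neg_eq_add, ← two_mul] at h2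
  simp only [hψe] at h2
  -- The arc length bound contains ρ², the Jacobian provides one factor ρ, and the other is at most
  -- b.
  have h3 : ∫⁻ τ in Ioo (-Real.pi) Real.pi, (ENNReal.ofReal ρ * ‖gradient f (polarPoint ρ τ)‖ₑ) ^ 2 ≤
      (ENNReal.ofReal b / ENNReal.ofReal (b - a)) * T := by
    calc _ = ENNReal.ofReal ρ * ∫⁻ τ in Ioo (-Real.pi) Real.pi,
          ENNReal.ofReal ρ * ‖gradient f (polarPoint ρ τ)‖ₑ ^ 2 := by
          rw [← lintegral_const_mul' _ _ ENNReal.ofReal_ne_top]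
          congr 1; ext τ; ring
      _ ≤ ENNReal.ofReal b * (T / ENNReal.ofReal (b - a)) :=
          mul_le_mul' (ENNReal.ofReal_le_ofReal hρ.2.le)
            (hle.trans (ENNReal.div_le_div_right hpol _))
      _ = _ := by simp only [div_eq_mul_inv]; ring
  have h4 : ‖f z' - f z‖ₑ ≤ C * eLpNorm (gradient f) 2 (volB b) := by
    refine h1.trans (h2.trans ?_)
    have e7 : (1 / (1 : ENNReal).toReal - 1 / (2 : ENNReal).toReal : ℝ) = 1 / 2 := by norm_num
    rw [e7, hTe]
    calc _ ≤ ((ENNReal.ofReal b / ENNReal.ofReal (b - a)) * T) ^ (1 / 2 : ℝ) *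
          ENNReal.ofReal (2 * Real.pi) ^ (1 / 2 : ℝ) :=
          mul_le_mul' (ENNReal.rpow_le_rpow h3 (by norm_num)) le_rfl
      _ = _ := by rw [ENNReal.mul_rpow_of_nonneg _ _ (by norm_num), hC]; ring
  have h5 := ENNReal.toReal_mono (ENNReal.mul_ne_top hCfin hmem.2.ne) h4
  rwa [toReal_enorm, ENNReal.toReal_mul, Real.norm_eq_abs] at h5

/-- Positive solutions are comparable to constants on a circle. -/
theorem BoundedCoeff.exists_circle_harnack {A : Plane → Matrix (Fin 2) (Fin 2) ℝ}
    {W : Plane → Plane} {V : Plane → ℝ} {r a lam K : ℝ} (hc : BoundedCoeff A W V r lam K)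
    (ha : 0 < a) (har : a < r) : ∃ C : ℝ, 0 < C ∧ ∀ R > r, ∀ (u : Plane → ℝ) (g : Plane → Plane),
      LocApprox R u g → IsSol A W V R u g → (∀ z ∈ ball (0 : Plane) R, 0 < u z) →
      ∃ ρ ∈ Ioo a r, ∀ z z' : Plane, ‖z‖ = ρ → ‖z'‖ = ρ → u z' ≤ C * u z := by
  obtain ⟨b, hab, hbr⟩ := exists_between har
  obtain ⟨C₁, hC₁, h1⟩ := hc.exists_log_caccioppoli (ha.trans hab) hbr
  obtain ⟨C₂, hC₂, h2⟩ := exists_circle_osc_le ha hab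
  -- The oscillation bound holds for a smooth approximation of log u: its gradient norm exceeds the
  -- limit by less than 1, and replacing it by log u costs 1 at each of the two points.
  refine ⟨Real.exp (C₂ * (C₁ + 1) + 2), Real.exp_pos _, fun R hR u g hu hsol hpos => ?_⟩
  have hl := h1 R hR u g hu hsol hpos
  have hbR : b < R := hbr.trans hR
  obtain ⟨c, hc0, hcu⟩ := exists_lower_bound_closedBall hu.cont hpos hbR
  obtain ⟨F, hF, hFlog⟩ := exists_smooth_extension (f := Real.log)
    (fun t ht => Real.contDiffAt_log.2 ht) hc0
  obtain ⟨s, hs, hsu⟩ := (hu.comp hF).approx b hbR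
  have hFu : ∀ z ∈ closedBall (0 : Plane) b, F (u z) = Real.log (u z) ∧
      deriv F (u z) = (u z)⁻¹ := by
    intro z hz
    have := hFlog (u z) (hcu z hz)
    exact ⟨this.eq_of_nhds, by rw [this.deriv_eq, Real.deriv_log]⟩
  have hlim := hs.tendsto_grad.l2 (fun n => memLp_ball_of_continuous
    (continuous_gradient (hs.smooth n)) b) hs.memLp_grad
  have e : l2 (volB b) (fun z => deriv F (u z) • g z) ≤ C₁ := by
    refine le_of_eq_of_le (l2_congr ?_) hl
    exact ae_ball_of_forall_closedBall fun z hz => by simp only [(hFu z hz).2]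
  obtain ⟨n, hn1, hn2⟩ := ((hlim.eventually (gt_mem_nhds (e.trans_lt (lt_add_one C₁)))).and
    (hsu 1 one_pos)).exists
  obtain ⟨ρ, hρ, hosc⟩ := h2 (s n) (hs.smooth n)
  refine ⟨ρ, ⟨hρ.1, hρ.2.trans hbr⟩, fun z z' hz hz' => ?_⟩
  have hzb : z ∈ closedBall (0 : Plane) b := by
    rw [mem_closedBall_zero_iff, hz]; exact hρ.2.le
  have hzb' : z' ∈ closedBall (0 : Plane) b := by
    rw [mem_closedBall_zero_iff, hz']; exact hρ.2.le
  have hu0 := hc0.trans (hcu z hzb)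
  have hu0' := hc0.trans (hcu z' hzb')
  have k1 := hosc z z' hz hz'
  have k2 := hn2 z hzb
  have k3 := hn2 z' hzb'
  rw [(hFu z hzb).1] at k2
  rw [(hFu z' hzb').1] at k3
  have k4 : C₂ * l2 (volB b) (gradient (s n)) ≤ C₂ * (C₁ + 1) :=
    mul_le_mul_of_nonneg_left hn1.le hC₂
  rw [abs_le] at k1 k2 k3
  have k5 : Real.log (u z') ≤ (C₂ * (C₁ + 1) + 2) + Real.log (u z) := by linarith
  calc u z' = Real.exp (Real.log (u z')) := (Real.exp_log hu0').symm
    _ ≤ Real.exp ((C₂ * (C₁ + 1) + 2) + Real.log (u z)) := Real.exp_le_exp.2 k5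
    _ = _ := by rw [Real.exp_add, Real.exp_log hu0]

/-! ### Comparison principles and the Harnack inequality -/

section Comparison

variable {A : Plane → Matrix (Fin 2) (Fin 2) ℝ} {W : Plane → Plane} {V : Plane → ℝ}
  {R r a ρ lam K L : ℝ}

/-- Comparison when the potential is large. -/
theorem BoundedCoeff.nonpos_of_form_nonpos {K' : ℝ} (hc : BoundedCoeff A W V ρ lam K)
    (hW : ∀ᵐ z ∂volB ρ, ‖W z‖ ≤ K') (hV : ∀ᵐ z ∂volB ρ, K' ^ 2 / (4 * lam) + 1 ≤ V z)
    (hρ : ρ < R) {w : Plane → ℝ} {g : Plane → Plane} (hw : LocApprox R w g)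
    (hform : ∀ η, IsTestOn (ball 0 ρ) η → (∀ z, 0 ≤ η z) → form A W V ρ w g η (gradient η) ≤ 0)
    (hbd : ∀ z : Plane, ‖z‖ = ρ → w z ≤ 0) : ∀ z ∈ ball (0 : Plane) ρ, w z ≤ 0 := by
  obtain ⟨s, hs, hsw⟩ := hw.approx ρ hρ
  have hcont : ContinuousOn w (closedBall 0 ρ) := hw.cont.mono (closedBall_subset_ball hρ)
  have hV0 : ∀ᵐ z ∂volB ρ, 0 ≤ V z := hV.mono fun z hz => by
    have : 0 ≤ K' ^ 2 / (4 * lam) := by have := hc.lam_pos; positivity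
    linarith
  -- Boundary values of w are only nonpositive. Subtracting ε makes the approximations negative off
  -- a compact set; this is harmless because positive constants are supersolutions when V ≥ 0.
  have key : ∀ ε > 0, ∀ z ∈ ball (0 : Plane) ρ, w z ≤ ε := by
    intro ε hε
    have hε1 := H1Approx.of_contDiff (contDiff_const (c := ε)) ρ
    have hae := ae_nonpos_of_form_nonpos hc hW hV (hs.sub hε1) ?_ ?_
    · refine le_on_ball_of_ae_le (hcont.mono ball_subset_closedBall) continuousOn_const ?_
      exact hae.mono fun z hz => by linarith
    · filter_upwards [hsw (ε / 2) (by positivity)] with n hn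
      refine ⟨closedBall 0 ρ ∩ w ⁻¹' Ici (ε / 2), ?_, ?_, ?_⟩
      · exact (isCompact_closedBall _ _).of_isClosed_subset
          (hcont.preimage_isClosed_of_isClosed isClosed_closedBall isClosed_Ici) inter_subset_left
      · rintro z ⟨hz, hz'⟩
        rw [mem_ball_zero_iff]
        refine lt_of_le_of_ne (mem_closedBall_zero_iff.1 hz) fun h => ?_
        have := hbd z h
        rw [mem_preimage, mem_Ici] at hz'
        linarith
      · intro z hz hzK
        have h1 : w z < ε / 2 := by
          by_contra! h
          exact hzK ⟨ball_subset_closedBall hz, h⟩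
        linarith [(abs_le.1 (hn z (ball_subset_closedBall hz))).2]
    · intro η hη h0
      rw [hc.form_sub_left hs.memLp hs.memLp_grad hε1.memLp hε1.memLp_grad (hη.memLp _)
        (hη.memLp_gradient _)]
      have h1 : 0 ≤ form A W V ρ (fun _ => ε) (gradient fun _ => ε) η (gradient η) := by
        refine integral_nonneg_of_ae ?_
        filter_upwards [hV0] with z hz
        have e1 : gradient (fun _ : Plane => ε) z = 0 := gradient_fun_const z ε
        have e2 : flux A (gradient fun _ => ε) z = 0 := by
          ext i; simp [flux, e1]
        rw [e2, inner_zero_left, zero_add, lowerOrder, e1, inner_zero_right, zero_add]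
        exact mul_nonneg (mul_nonneg hz hε.le) (h0 z)
      linarith [hform η hη h0]
  exact fun z hz => le_of_forall_pos_le_add fun ε hε => by linarith [key ε hε z hz]

theorem BoundedCoeff.form_add_smul_left (hc : BoundedCoeff A W V R lam K)
    {u u' v : Plane → ℝ} {g g' k : Plane → Plane} (b : ℝ)
    (hu : MemLp u 2 (volB R)) (hg : MemLp g 2 (volB R)) (hu' : MemLp u' 2 (volB R))
    (hg' : MemLp g' 2 (volB R)) (hv : MemLp v 2 (volB R)) (hk : MemLp k 2 (volB R)) :
    form A W V R (fun z => u z + b * u' z) (fun z => g z + b • g' z) v k =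
      form A W V R u g v k + b * form A W V R u' g' v k := by
  have m1 : MemLp (fun z => b * u' z) 2 (volB R) := hu'.const_mul b
  have m2 : MemLp (fun z => b • g' z) 2 (volB R) := hg'.const_smul b
  rw [hc.form_add_left hu hg m1 m2 hv hk, form_smul_left]

theorem BoundedCoeff.form_smul_add_smul_left (hc : BoundedCoeff A W V R lam K)
    {u u' v : Plane → ℝ} {g g' k : Plane → Plane} (a b : ℝ)
    (hu : MemLp u 2 (volB R)) (hg : MemLp g 2 (volB R)) (hu' : MemLp u' 2 (volB R))
    (hg' : MemLp g' 2 (volB R)) (hv : MemLp v 2 (volB R)) (hk : MemLp k 2 (volB R)) :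
    form A W V R (fun z => a * u z + b * u' z) (fun z => a • g z + b • g' z) v k =
      a * form A W V R u g v k + b * form A W V R u' g' v k := by
  have m1 : MemLp (fun z => a * u z) 2 (volB R) := hu.const_mul a
  have m2 : MemLp (fun z => a • g z) 2 (volB R) := hg.const_smul a
  rw [hc.form_add_smul_left b m1 m2 hu' hg' hv hk, form_smul_left]

theorem exists_exponent (hlam : 0 < lam) {D p : ℝ} (hp : 0 ≤ p) :
    ∃ c, 0 ≤ c ∧ D * c + p ≤ lam * c ^ 2 := by
  -- For c ≥ 1 and p ≥ 0 one has Dc + p ≤ (D + p)c, and the second bound on c makes this at most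
  -- λc².
  refine ⟨max 1 ((D + p) / lam), by positivity, ?_⟩
  set c := max 1 ((D + p) / lam)
  have h1 : 1 ≤ c := le_max_left _ _
  have h2 : D + p ≤ c * lam := (div_le_iff₀ hlam).1 (le_max_right _ _)
  nlinarith

/-- Exponentials are subsolutions, even after adding a constant to the potential. -/
theorem BoundedCoeff.exists_exp_form_nonpos (hc : BoundedCoeff A W V R lam K)
    (hA : ∀ i j, WeakGradientBoundedOn (fun z => A z i j) (ball 0 R) L) {μ : ℝ}
    (hμ : 0 ≤ μ) : ∃ c : ℝ, 0 ≤ c ∧ ∀ η, IsTestOn (ball 0 R) η → (∀ z, 0 ≤ η z) →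
      form A W (fun z => V z + μ) R (fun y => Real.exp (c * y 0))
        (gradient (fun y => Real.exp (c * y 0))) η (gradient η) ≤ 0 := by
  have hK := hc.K_nonneg
  obtain ⟨c, hc0, hcc⟩ := exists_exponent hc.lam_pos (D := 2 * L + K) (p := K + μ)
    (by positivity)
  refine ⟨c, hc0, fun η hη h0 => ?_⟩
  refine (hc.add_const hμ).form_exp_nonpos hA hc0 hc.drift.2 (p := K + μ) ?_ (by linarith) hη h0
  exact hc.potential.2.mono fun z hz => by linarith [(abs_le.1 hz).2]

theorem exp_coord_bounds {c : ℝ} (hc : 0 ≤ c) {z : Plane} {ρ : ℝ} (hz : ‖z‖ ≤ ρ) :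
    Real.exp (-(c * ρ)) ≤ Real.exp (c * z 0) ∧ Real.exp (c * z 0) ≤ Real.exp (c * ρ) := by
  have h := abs_le.1 ((abs_coord_le z 0).trans hz)
  constructor <;> refine Real.exp_le_exp.2 ?_ <;> nlinarith

/-- Comparison in the presence of a positive supersolution. -/
theorem BoundedCoeff.nonneg_of_form_nonneg (hc : BoundedCoeff A W V ρ lam K) (hρ0 : 0 ≤ ρ)
    (hA : ∀ i j, WeakGradientBoundedOn (fun z => A z i j) (ball 0 ρ) L)
    (hρ : ρ < R) {φ d : Plane → ℝ} {gφ gd : Plane → Plane} (hφ : LocApprox R φ gφ)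
    (hφ0 : ∀ z ∈ ball (0 : Plane) R, 0 < φ z)
    (hφs : ∀ η, IsTestOn (ball 0 ρ) η → (∀ z, 0 ≤ η z) → 0 ≤ form A W V ρ φ gφ η (gradient η))
    (hd : LocApprox R d gd)
    (hds : ∀ η, IsTestOn (ball 0 ρ) η → (∀ z, 0 ≤ η z) → 0 ≤ form A W V ρ d gd η (gradient η))
    (hbd : ∀ z : Plane, ‖z‖ = ρ → 0 ≤ d z) : ∀ z ∈ closedBall (0 : Plane) ρ, 0 ≤ d z := by
  have hsub : closedBall (0 : Plane) ρ ⊆ ball 0 R := closedBall_subset_ball hρ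
  have hφc : ContinuousOn φ (closedBall 0 ρ) := hφ.cont.mono hsub
  have hdc : ContinuousOn d (closedBall 0 ρ) := hd.cont.mono hsub
  have hφp : ∀ z ∈ closedBall (0 : Plane) ρ, 0 < φ z := fun z hz => hφ0 z (hsub hz)
  obtain ⟨z₀, hz₀, hmin⟩ := (isCompact_closedBall (0 : Plane) ρ).exists_isMinOn
    ⟨0, mem_closedBall_self hρ0⟩ (hdc.div hφc fun z hz => (hφp z hz).ne')
  -- This is the least t with d + tφ ≥ 0 on the closed ball, and the claim amounts to t ≤ 0. If t >
  -- 0, then d + tφ is a nonnegative supersolution that vanishes at z₀ and is at least tb on the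
  -- sphere, for b a lower bound of φ.
  set t := -(d z₀ / φ z₀) with ht
  have hmin' : ∀ z ∈ closedBall (0 : Plane) ρ, 0 ≤ d z + t * φ z := by
    intro z hz
    have h1 : d z₀ / φ z₀ ≤ d z / φ z := hmin hz
    rw [le_div_iff₀ (hφp z hz)] at h1
    rw [ht]; linarith
  by_cases ht0 : t ≤ 0
  · intro z hz
    have := hmin' z hz
    nlinarith [hφp z hz]
  exfalso
  push Not at ht0
  have hzero : d z₀ + t * φ z₀ = 0 := by
    rw [ht]; field_simp [(hφp z₀ hz₀).ne']; ring
  set μ := shift lam K with hμ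
  have hμ0 : 0 < μ := shift_pos hc.lam_pos hc.K_nonneg
  obtain ⟨c, hc0, hexp⟩ := hc.exists_exp_form_nonpos hA hμ0.le
  obtain ⟨b, hb, hbφ⟩ := exists_lower_bound_closedBall hφ.cont hφ0 hρ
  -- A strong minimum principle by barrier: δ is chosen so that δE ≤ tb on the sphere. As d + tφ is
  -- nonnegative, it remains a supersolution after μ is added to the potential, while E remains a
  -- subsolution. Comparison for the large potential gives δE ≤ d + tφ, which fails at z₀.
  set δ := t * b * Real.exp (-(c * ρ)) with hδ
  have hδ0 : 0 < δ := by positivity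
  set E : Plane → ℝ := fun y => Real.exp (c * y 0) with hE
  have he := hd.add (hφ.const_mul t)
  have hw := ((LocApprox.of_contDiff (contDiff_exp_coord c) R).const_mul δ).add (he.const_mul (-1))
  have hc' := hc.add_const hμ0.le
  have mE := memLp_ball_of_continuous (contDiff_exp_coord c).continuous ρ
  have mE' := memLp_ball_of_continuous (continuous_gradient (contDiff_exp_coord c)) ρ
  have md := hd.memLp hρ
  have mφ := hφ.memLp hρ
  have me := he.memLp hρ
  have hle := hc'.nonpos_of_form_nonpos hc.drift.2 hc.le_add_shift' hρ hw ?_ ?_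
  · have hz₀' : z₀ ∈ ball (0 : Plane) ρ := by
      rw [mem_ball_zero_iff]
      refine lt_of_le_of_ne (mem_closedBall_zero_iff.1 hz₀) fun h => ?_
      have h1 := hbd z₀ h
      have h2 := mul_pos ht0 (hφp z₀ hz₀)
      linarith
    have h3 := hle z₀ hz₀'
    rw [hzero] at h3
    have h4 := mul_pos hδ0 (Real.exp_pos (c * z₀ 0))
    linarith
  · intro η hη h0
    have mη := hη.memLp (volB ρ)
    have mη' := hη.memLp_gradient (volB ρ)
    rw [hc'.form_smul_add_smul_left δ (-1) mE mE' me.1 me.2 mη mη',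
      hc.form_add_const μ me.1 me.2 mη mη', hc.form_add_smul_left t md.1 md.2 mφ.1 mφ.2 mη mη']
    have h1 := mul_nonpos_of_nonneg_of_nonpos hδ0.le (hexp η hη h0)
    have h2 := hds η hη h0
    have h3 := mul_nonneg ht0.le (hφs η hη h0)
    have h4 : 0 ≤ μ * ∫ z in ball (0 : Plane) ρ, (d z + t * φ z) * η z :=
      mul_nonneg hμ0.le (setIntegral_nonneg measurableSet_ball fun z hz =>
        mul_nonneg (hmin' z (ball_subset_closedBall hz)) (h0 z))
    linarith
  · intro z hz
    have h1 := (exp_coord_bounds hc0 hz.le).2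
    have h2 : δ * Real.exp (c * z 0) ≤ t * b := by
      calc δ * Real.exp (c * z 0) ≤ δ * Real.exp (c * ρ) := by gcongr
        _ = t * b := by rw [hδ, mul_assoc, ← Real.exp_add]; simp
    have h3 := hbφ z (mem_closedBall_zero_iff.2 hz.le)
    have h4 := hbd z hz
    have h5 : t * b ≤ t * φ z := by gcongr
    linarith

/-- Harnack's inequality for positive solutions, given a positive supersolution. -/
theorem BoundedCoeff.exists_harnack {R₂ : ℝ} (hc : BoundedCoeff A W V r lam K) (ha : 0 < a)
    (har : a < r) (hA : ∀ i j, WeakGradientBoundedOn (fun z => A z i j) (ball 0 r) L)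
    (hR₂ : r < R₂) {φ : Plane → ℝ} {gφ : Plane → Plane} (hφ : LocApprox R₂ φ gφ)
    (hφ0 : ∀ z ∈ ball (0 : Plane) R₂, 0 < φ z) (hφs : IsSup A W V R₂ φ gφ) :
    ∃ C : ℝ, 0 < C ∧ ∀ R > r, ∀ (u : Plane → ℝ) (g : Plane → Plane),
      LocApprox R u g → IsSol A W V R u g → (∀ z ∈ ball (0 : Plane) R, 0 < u z) →
      ∀ z ∈ closedBall (0 : Plane) a, ∀ z' ∈ closedBall (0 : Plane) a, u z ≤ C * u z' := by
  obtain ⟨C₁, hC₁, hcirc⟩ := hc.exists_circle_harnack ha har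
  obtain ⟨b, hb, hbφ⟩ := exists_lower_bound_closedBall hφ.cont hφ0 hR₂
  obtain ⟨B, hB0, hBφ⟩ := exists_abs_le_closedBall hφ.cont hR₂
  obtain ⟨c, hc0, hexp⟩ := hc.exists_exp_form_nonpos hA le_rfl
  have hexp' : ∀ ρ ≤ r, ∀ η, IsTestOn (ball 0 ρ) η → (∀ z, 0 ≤ η z) →
      form A W V ρ (fun y => Real.exp (c * y 0)) (gradient (fun y => Real.exp (c * y 0))) η
        (gradient η) ≤ 0 := by
    intro ρ hρ η hη h0
    rw [← form_eq_of_isTestOn hη hρ]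
    simpa using hexp η (hη.mono (ball_subset_ball hρ)) h0
  have hB : 0 < B := hb.trans_le ((hbφ 0 (mem_closedBall_self (ha.trans har).le)).le.trans
    ((le_abs_self _).trans (hBφ 0 (mem_closedBall_self (ha.trans har).le))))
  refine ⟨C₁ * B / b * (C₁ * Real.exp (c * r) * Real.exp (c * r)), by positivity,
    fun R hR u g hu hsol hpos z hz z' hz' => ?_⟩
  -- The radius depends on u; all constants are expressed through r and data independent of u.
  obtain ⟨ρ, ⟨haρ, hρr⟩, hρ⟩ := hcirc R hR u g hu hsol hpos
  have hρ0 : 0 ≤ ρ := ha.le.trans haρ.le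
  have hcρ := hc.mono hρr.le
  have hAρ : ∀ i j, WeakGradientBoundedOn (fun z => A z i j) (ball 0 ρ) L := fun i j => by
    obtain ⟨G, hG, hGb⟩ := hA i j
    exact ⟨G, hG.mono (ball_subset_ball hρr.le), hGb.mono (ball_subset_ball hρr.le) le_rfl⟩
  have hρR : ρ < R := hρr.trans hR
  have hρR₂ : ρ < R₂ := hρr.trans hR₂
  have hsub : closedBall (0 : Plane) a ⊆ closedBall 0 ρ := closedBall_subset_closedBall haρ.le
  set z₀ := polarPoint ρ 0 with hz₀
  have hnz₀ : ‖z₀‖ = ρ := norm_polarPoint hρ0 0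
  set M := u z₀ with hM
  have hM0 : 0 < M := hpos z₀ (mem_ball_zero_iff.2 (hnz₀.trans_lt hρR))
  have mu := hu.memLp hρR
  -- On the circle u ≤ C₁M and φ > b, so (C₁M/b)φ - u is a supersolution with nonnegative boundary
  -- values.
  have upper : ∀ y ∈ closedBall (0 : Plane) ρ, u y ≤ C₁ * M / b * φ y := by
    have hR' : ρ < min R R₂ := lt_min hρR hρR₂
    have hd := ((hφ.const_mul (C₁ * M / b)).mono (min_le_right R R₂)).add
      ((hu.const_mul (-1)).mono (min_le_left R R₂))
    have mφ := hφ.memLp hρR₂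
    have := hcρ.nonneg_of_form_nonneg hρ0 hAρ hR' (hφ.mono (min_le_right _ _))
      (fun y hy => hφ0 y (ball_subset_ball (min_le_right _ _) hy)) (hφs ρ hρR₂) hd ?_ ?_
    · intro y hy
      linarith [this y hy]
    · intro η hη h0
      rw [hcρ.form_smul_add_smul_left _ (-1) mφ.1 mφ.2 mu.1 mu.2 (hη.memLp _)
        (hη.memLp_gradient _), hsol ρ hρR η hη, mul_zero, add_zero]
      exact mul_nonneg (by positivity) (hφs ρ hρR₂ η hη h0)
    · intro y hy
      have h1 := hρ z₀ y hnz₀ hy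
      have h2 := (hbφ y (mem_closedBall_zero_iff.2 (hy.le.trans hρr.le))).le
      have h3 : C₁ * M / b * b ≤ C₁ * M / b * φ y := by gcongr
      rw [div_mul_cancel₀ _ hb.ne'] at h3
      linarith
  set δ := M / (C₁ * Real.exp (c * r)) with hδ
  have hδ0 : 0 < δ := by positivity
  -- Here u itself is the positive supersolution behind the comparison; on the circle u ≥ M/C₁, and
  -- δ brings the exponential below this value.
  have lower : ∀ y ∈ closedBall (0 : Plane) ρ, δ * Real.exp (c * y 0) ≤ u y := by
    have hd := hu.add ((LocApprox.of_contDiff (contDiff_exp_coord c) R).const_mul (-δ))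
    have mE := memLp_ball_of_continuous (contDiff_exp_coord c).continuous ρ
    have mE' := memLp_ball_of_continuous (continuous_gradient (contDiff_exp_coord c)) ρ
    have := hcρ.nonneg_of_form_nonneg hρ0 hAρ hρR hu hpos (hsol.isSup ρ hρR) hd ?_ ?_
    · intro y hy
      linarith [this y hy]
    · intro η hη h0
      rw [hcρ.form_add_smul_left _ mu.1 mu.2 mE mE' (hη.memLp _) (hη.memLp_gradient _), hsol ρ hρR η hη, zero_add]
      exact mul_nonneg_of_nonpos_of_nonpos (by linarith) (hexp' ρ hρr.le η hη h0)
    · intro y hy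
      have h1 := hρ y z₀ hy hnz₀
      have h2 := (exp_coord_bounds hc0 (hy.le.trans hρr.le)).2
      have h3 : δ * Real.exp (c * y 0) ≤ M / C₁ := by
        calc δ * Real.exp (c * y 0) ≤ δ * Real.exp (c * r) := by gcongr
          _ = M / C₁ := by rw [hδ]; field_simp
      have h4 : M / C₁ ≤ u y := by rw [div_le_iff₀ hC₁]; linarith
      linarith
  have hu1 := upper z (hsub hz)
  have hl1 := lower z' (hsub hz')
  have hzr : z ∈ closedBall (0 : Plane) r := closedBall_subset_closedBall har.le hz
  have hφz : φ z ≤ B := (le_abs_self _).trans (hBφ z hzr)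
  have hφz0 := (hφ0 z (closedBall_subset_ball hR₂ hzr)).le
  have hex := (exp_coord_bounds hc0 ((mem_closedBall_zero_iff.1 hz').trans har.le)).1
  have hl2 : M ≤ C₁ * Real.exp (c * r) * Real.exp (c * r) * u z' := by
    have h1 : δ * Real.exp (-(c * r)) ≤ u z' := (by gcongr : _ ≤ _).trans hl1
    have h2 : M = C₁ * Real.exp (c * r) * Real.exp (c * r) * (δ * Real.exp (-(c * r))) := by
      rw [hδ, Real.exp_neg]; field_simp
    rw [h2]
    gcongr
  calc u z ≤ C₁ * M / b * φ z := hu1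
    _ ≤ C₁ * (C₁ * Real.exp (c * r) * Real.exp (c * r) * u z') / b * B := by
        refine mul_le_mul ?_ hφz hφz0 ?_
        · gcongr
        · have := hpos z' (mem_ball_zero_iff.2 (((mem_closedBall_zero_iff.1 hz').trans_lt har).trans hR))
          positivity
    _ = _ := by field_simp

end Comparison

/-! ### Interior estimates for positive solutions -/

theorem WeakGradientBoundedOn.mono {f : Plane → ℝ} {Ω Ω' : Set Plane} {C : ℝ}
    (h : WeakGradientBoundedOn f Ω C) (hΩ : Ω' ⊆ Ω) : WeakGradientBoundedOn f Ω' C := by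
  obtain ⟨g, hg, hb⟩ := h
  exact ⟨g, hg.mono hΩ, hb.mono hΩ le_rfl⟩

theorem H1Approx.congr_grad {R : ℝ} {u : Plane → ℝ} {g g' : Plane → Plane} {s : ℕ → Plane → ℝ}
    (h : H1Approx R u g s) (he : g' =ᵐ[volB R] g) : H1Approx R u g' s :=
  ⟨h.memLp, (memLp_congr_ae he).2 h.memLp_grad, h.smooth, h.tendsto,
    h.tendsto_grad.congr' (Eventually.of_forall fun _ => EventuallyEq.rfl) he.symm⟩

section

variable {A : Plane → Matrix (Fin 2) (Fin 2) ℝ} {W : Plane → Plane} {V : Plane → ℝ}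
  {R r a m lam K L : ℝ}

theorem form_congr_ae_grad {u v : Plane → ℝ} {g g' k : Plane → Plane} (he : g' =ᵐ[volB R] g) :
    form A W V R u g' v k = form A W V R u g v k := by
  unfold form
  refine integral_congr_ae ?_
  filter_upwards [he] with z hz
  rw [lowerOrder_congr rfl hz, flux_congr hz]

/-- Below a positive supersolution there are positive solutions in smaller balls. -/
theorem BoundedCoeff.exists_pos_solution (hc : BoundedCoeff A W V m lam K)
    (hA : ∀ i j, WeakGradientBoundedOn (fun z => A z i j) (ball 0 m) L) (hL : 0 ≤ L)
    {φ : Plane → ℝ} {gφ : Plane → Plane} (hφ : LocApprox m φ gφ)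
    (hφ0 : ∀ z ∈ ball (0 : Plane) m, 0 < φ z) (hφs : IsSup A W V m φ gφ) (hR0 : 0 < R)
    (hR : R < m) : ∃ (u : Plane → ℝ) (g : Plane → Plane), MemLp u 2 volume ∧ MemLp g 2 volume ∧
      LocApprox R u g ∧ IsSol A W V R u g ∧ (∀ z ∈ ball (0 : Plane) R, 0 < u z) ∧ u 0 = 1 := by
  have hcR := hc.mono hR.le
  have hAR : ∀ i j, WeakGradientBoundedOn (fun z => A z i j) (ball 0 R) L := fun i j =>
    (hA i j).mono (ball_subset_ball hR.le)
  obtain ⟨b, hb, hbφ⟩ := exists_lower_bound_closedBall hφ.cont hφ0 hR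
  obtain ⟨t, ht, htφ⟩ := hφ.approx R hR
  obtain ⟨c, hc0, hexp⟩ := hcR.exists_exp_form_nonpos hAR le_rfl
  simp only [add_zero] at hexp
  -- The lower barrier is then at most b/2 in the ball, whereas φ > b and its approximations are
  -- eventually within b/2 of φ.
  set δ := b / 2 * Real.exp (-(c * R)) with hδ
  have hδ0 : 0 < δ := by positivity
  have hgr : gradient (fun y : Plane => δ * Real.exp (c * y 0)) =
      fun z => δ • gradient (fun y : Plane => Real.exp (c * y 0)) z := funext fun z =>
    gradient_const_mul' δ (contDiff_exp_coord c).differentiableAt'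
  have hsm : ContDiff ℝ ∞ fun y : Plane => δ * Real.exp (c * y 0) :=
    contDiff_const.mul (contDiff_exp_coord c)
  obtain ⟨u, g, s, hs, heq, hbd⟩ := exists_solution_between hcR hsm (fun η hη h0 => by
      rw [hgr, form_smul_left]
      exact mul_nonpos_of_nonneg_of_nonpos hδ0.le (hexp η hη h0)) ht
    (fun η hη h0 => hφs R hR η hη h0) (by
      filter_upwards [htφ (b / 2) (by positivity)] with n hn z hz
      have hz' := ball_subset_closedBall hz
      have h1 := (exp_coord_bounds hc0 (mem_ball_zero_iff.1 hz).le).2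
      have h2 := abs_le.1 (hn z hz')
      have h3 := hbφ z hz'
      have h4 : δ * Real.exp (c * z 0) ≤ b / 2 := by
        calc δ * Real.exp (c * z 0) ≤ δ * Real.exp (c * R) := by gcongr
          _ = b / 2 := by rw [hδ, mul_assoc, ← Real.exp_add]; simp
      linarith)
  have hcont := hcR.continuousOn_ballRep hAR hL hs heq
  have hae := ballRep_ae_eq hs.memLp
  have hpos : ∀ z ∈ ball (0 : Plane) R, 0 < ballRep R u z := by
    have := le_on_ball_of_ae_le hsm.continuous.continuousOn hcont (by
      filter_upwards [hbd, hae] with z hz he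
      rw [he]; exact hz.1)
    exact fun z hz => (mul_pos hδ0 (Real.exp_pos _)).trans_le (this z hz)
  have h00 := hpos 0 (mem_ball_self hR0)
  -- Extension by zero makes the function and its gradient square-integrable on the whole plane, so
  -- that solutions on different balls can later be compared in the same L² spaces.
  set v : Plane → ℝ := (ball 0 R).indicator (ballRep R u) with hv
  set k : Plane → Plane := (ball 0 R).indicator g with hk
  have hkg : k =ᵐ[volB R] g := indicator_ae_eq_restrict measurableSet_ball
  have hvb : v =ᵐ[volB R] ballRep R u := indicator_ae_eq_restrict measurableSet_ball
  have hvu := hvb.trans hae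
  have hvin : ∀ z ∈ ball (0 : Plane) R, v z = ballRep R u z := fun z hz => indicator_of_mem hz _
  have hvk : H1Approx R v k s := (hs.congr_ae hvu).congr_grad hkg
  have hvc : ContinuousOn v (ball 0 R) := hcont.congr hvin
  have mv : MemLp v 2 volume := (memLp_indicator_iff_restrict measurableSet_ball).2
    ((memLp_congr_ae hae).2 hs.memLp)
  have mk : MemLp k 2 volume := (memLp_indicator_iff_restrict measurableSet_ball).2 hs.memLp_grad
  have mk' : MemLp (fun z => (v 0)⁻¹ • k z) 2 volume := mk.const_smul (v 0)⁻¹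
  have hv0 : 0 < v 0 := by rw [hvin 0 (mem_ball_self hR0)]; exact h00
  refine ⟨fun z => (v 0)⁻¹ * v z, fun z => (v 0)⁻¹ • k z, mv.const_mul _, mk',
    (LocApprox.of_memW12Loc hvk.memW12Loc hvc).const_mul _,
    isSol_of_form_eq_zero fun η hη => ?_, fun z hz => ?_, inv_mul_cancel₀ hv0.ne'⟩
  · rw [form_smul_left, form_congr_ae hvu, form_congr_ae_grad hkg, heq η hη, mul_zero]
  · exact mul_pos (inv_pos.2 hv0) ((hpos z hz).trans_eq (hvin z hz).symm)

theorem ballRep_eq_of_continuousOn {u : Plane → ℝ} (hm : MemLp u 2 (volB R))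
    (hu : ContinuousOn u (ball 0 R)) (hu' : ContinuousOn (ballRep R u) (ball 0 R)) :
    ∀ z ∈ ball (0 : Plane) R, ballRep R u z = u z := fun z hz =>
  le_antisymm (le_on_ball_of_ae_le hu' hu ((ballRep_ae_eq hm).mono fun _ h => h.le) z hz)
    (le_on_ball_of_ae_le hu hu' ((ballRep_ae_eq hm).mono fun _ h => h.ge) z hz)

theorem l2_le_of_abs_le {f : Plane → ℝ} {C : ℝ} (hC : 0 ≤ C) (h : ∀ᵐ z ∂volB r, |f z| ≤ C) :
    l2 (volB r) f ≤ C * l2 (volB r) (fun _ : Plane => (1 : ℝ)) :=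
  l2_le_mul (memLp_ball_of_continuous continuous_const r) hC
    (h.mono fun z hz => by rw [norm_one, mul_one]; exact hz)

/-- Two-sided bounds and Hölder estimates for normalised positive solutions. -/
theorem BoundedCoeff.exists_interior_bounds (hc : BoundedCoeff A W V m lam K)
    (hA : ∀ i j, WeakGradientBoundedOn (fun z => A z i j) (ball 0 m) L) (hL : 0 ≤ L)
    {φ : Plane → ℝ} {gφ : Plane → Plane} (hφ : LocApprox m φ gφ)
    (hφ0 : ∀ z ∈ ball (0 : Plane) m, 0 < φ z) (hφs : IsSup A W V m φ gφ) (ha : 0 < a)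
    (ham : a < m) : ∃ r < m, ∃ C > 0, ∀ R > r, ∀ (u : Plane → ℝ) (g : Plane → Plane),
      LocApprox R u g → IsSol A W V R u g → (∀ z ∈ ball (0 : Plane) R, 0 < u z) → u 0 = 1 →
      (∀ z ∈ ball (0 : Plane) a, u z ≤ C ∧ 1 ≤ C * u z) ∧
      ∀ z ∈ ball (0 : Plane) a, ∀ z' ∈ ball (0 : Plane) a, |u z' - u z| ≤ C * √‖z' - z‖ := by
  -- Nested radii a < b₁ < b₂ < r: Harnack gives bounds up to b₂, Caccioppoli the gradient norm on
  -- b₁, and the Hölder estimate descends from b₁ to a.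
  obtain ⟨b₁, h1, h1m⟩ := exists_between ham
  obtain ⟨b₂, h2, h2m⟩ := exists_between h1m
  obtain ⟨r, h3, hrm⟩ := exists_between h2m
  have hb₁ := ha.trans h1
  have hb₂ := hb₁.trans h2
  have hAm : ∀ {ρ : ℝ}, ρ < m → ∀ i j, WeakGradientBoundedOn (fun z => A z i j) (ball 0 ρ) L :=
    fun hρ i j => (hA i j).mono (ball_subset_ball hρ.le)
  obtain ⟨C₁, hC₁, harn⟩ := (hc.mono hrm.le).exists_harnack hb₂ h3 (hAm hrm) hrm hφ hφ0 hφs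
  obtain ⟨C₂, hC₂, hcac⟩ := (hc.mono h2m.le).exists_caccioppoli hb₁ h2
  obtain ⟨C₃, hC₃, hhol⟩ := (hc.mono h1m.le).exists_holder (hAm h1m) hL ha h1
  set N := C₁ * l2 (volB b₂) (fun _ : Plane => (1 : ℝ)) with hN
  have hN0 : 0 ≤ N := mul_nonneg hC₁.le (l2_nonneg _)
  refine ⟨r, hrm, max C₁ (C₃ * (C₂ * N + N)), lt_max_of_lt_left hC₁,
    fun R hR u g hu hsol hpos h0 => ?_⟩
  have h2R : b₂ < R := h3.trans hR
  have h1R : b₁ < R := h2.trans h2R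
  have bd : ∀ z ∈ closedBall (0 : Plane) b₂, u z ≤ C₁ ∧ 1 ≤ C₁ * u z := fun z hz => by
    have e1 := harn R hR u g hu hsol hpos z hz 0 (mem_closedBall_self hb₂.le)
    have e2 := harn R hR u g hu hsol hpos 0 (mem_closedBall_self hb₂.le) z hz
    rw [h0] at e1 e2
    exact ⟨by linarith, e2⟩
  have hnu : l2 (volB b₂) u ≤ N := l2_le_of_abs_le hC₁.le (ae_ball_of_forall_closedBall fun z hz => by
    rw [abs_of_pos (hpos z (closedBall_subset_ball h2R hz))]
    exact (bd z hz).1)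
  have hnu' : l2 (volB b₁) u ≤ N := (l2_mono_measure (volB_mono h2.le) (hu.memLp h2R).1).trans hnu
  have hng : l2 (volB b₁) g ≤ C₂ * N := (hcac R h2R u g hu hsol).trans (by gcongr)
  obtain ⟨s, hs, -⟩ := hu.approx b₁ h1R
  have heq : ∀ η, IsTestOn (ball 0 b₁) η → form A W V b₁ u g η (gradient η) = 0 :=
    hsol b₁ h1R
  have hrep := ballRep_eq_of_continuousOn hs.memLp (hu.cont.mono (ball_subset_ball h1R.le))
    ((hc.mono h1m.le).continuousOn_ballRep (hAm h1m) hL hs heq)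
  have hsub : ball (0 : Plane) a ⊆ ball 0 b₁ := ball_subset_ball h1.le
  have hsub' : ball (0 : Plane) a ⊆ closedBall 0 b₂ :=
    (ball_subset_ball (h1.trans h2).le).trans ball_subset_closedBall
  refine ⟨fun z hz => ?_, fun z hz z' hz' => ?_⟩
  · obtain ⟨e1, e2⟩ := bd z (hsub' hz)
    refine ⟨e1.trans (le_max_left _ _), e2.trans ?_⟩
    exact mul_le_mul_of_nonneg_right (le_max_left _ _)
      (hpos z (ball_subset_ball h1R.le (hsub hz))).le
  · have e1 := hhol u g s hs heq z hz z' hz'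
    rw [hrep z (hsub hz), hrep z' (hsub hz')] at e1
    refine e1.trans (mul_le_mul_of_nonneg_right ?_ (Real.sqrt_nonneg _))
    exact (by gcongr : _ ≤ C₃ * (C₂ * N + N)).trans (le_max_right _ _)

end

/-- Pointwise convergence of uniformly Hölder continuous functions is uniform. -/
theorem uniform_of_holder {ι : Type*} {l : Filter ι} [l.NeBot] {s : ι → Plane → ℝ} {f : Plane → ℝ}
    {a C : ℝ} (hC : 0 < C) (h : ∀ᶠ n in l, ∀ z ∈ ball (0 : Plane) a, ∀ z' ∈ ball (0 : Plane) a,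
      |s n z' - s n z| ≤ C * √‖z' - z‖)
    (hlim : ∀ z ∈ ball (0 : Plane) a, Tendsto (fun n => s n z) l (𝓝 (f z))) :
    (∀ z ∈ ball (0 : Plane) a, ∀ z' ∈ ball (0 : Plane) a, |f z' - f z| ≤ C * √‖z' - z‖) ∧
    ∀ ε > 0, ∀ᶠ n in l, ∀ z ∈ ball (0 : Plane) a, |s n z - f z| ≤ ε := by
  have hf : ∀ z ∈ ball (0 : Plane) a, ∀ z' ∈ ball (0 : Plane) a,
      |f z' - f z| ≤ C * √‖z' - z‖ := fun z hz z' hz' =>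
    le_of_tendsto ((hlim z' hz').sub (hlim z hz)).abs (h.mono fun n hn => hn z hz z' hz')
  refine ⟨hf, fun ε hε => ?_⟩
  set δ := (ε / (3 * C)) ^ 2 with hδ
  have hδ0 : 0 < δ := by positivity
  have hδC : ∀ y : Plane, ‖y‖ < δ → C * √‖y‖ ≤ ε / 3 := fun y hy => by
    have : √‖y‖ ≤ ε / (3 * C) := Real.sqrt_le_iff.2 ⟨by positivity, hy.le⟩
    calc C * √‖y‖ ≤ C * (ε / (3 * C)) := by gcongr
      _ = ε / 3 := by field_simp
  have htb : TotallyBounded (ball (0 : Plane) a) := (isCompact_closedBall (0 : Plane) a).totallyBounded.subset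
    ball_subset_closedBall
  obtain ⟨t, hta, htf, hcov⟩ := Metric.finite_approx_of_totallyBounded htb δ hδ0
  have hev : ∀ᶠ n in l, ∀ y ∈ t, |s n y - f y| < ε / 3 := by
    rw [Filter.eventually_all_finite htf]
    intro y hy
    have := Metric.tendsto_nhds.1 (hlim y (hta hy)) (ε / 3) (by positivity)
    simpa only [Real.dist_eq] using this
  filter_upwards [h, hev] with n h1 h2 z hz
  obtain ⟨y, hy, hzy⟩ := mem_iUnion₂.1 (hcov hz)
  rw [mem_ball, dist_eq_norm] at hzy
  have e1 := (h1 y (hta hy) z hz).trans (hδC _ hzy)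
  have e2 := (hf y (hta hy) z hz).trans (hδC _ hzy)
  have e3 := h2 y hy
  rw [abs_le] at e1 e2 ⊢
  rw [abs_lt] at e3
  constructor <;> linarith

/-! ### Limits of positive solutions -/

/-- Completeness of L², formulated for filters so that it applies along an ultrafilter. -/
theorem exists_tendstoL2_of_cauchy {α E ι : Type*} [MeasurableSpace α] [NormedAddCommGroup E]
    [CompleteSpace E] {μ : Measure α} {l : Filter ι} [l.NeBot] {s : ι → α → E}
    (hs : ∀ n, MemLp (s n) 2 μ)
    (h : ∀ ε > 0, ∃ p : ι → Prop, (∀ᶠ n in l, p n) ∧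
      ∀ n k, p n → p k → l2 μ (fun z => s n z - s k z) < ε) :
    ∃ f, MemLp f 2 μ ∧ TendstoL2 μ l s f := by
  have hcau : Cauchy (map (fun n => (hs n).toLp (s n)) l) := by
    refine Metric.cauchy_iff.2 ⟨inferInstance, fun ε hε => ?_⟩
    obtain ⟨p, hp, hpε⟩ := h ε hε
    refine ⟨(fun n => (hs n).toLp (s n)) '' {n | p n}, image_mem_map hp, ?_⟩
    rintro _ ⟨n, hn, rfl⟩ _ ⟨k, hk, rfl⟩
    rw [dist_eq_norm]
    have h1 : l2 μ (s n - s k) < ε := hpε n k hn hk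
    rwa [l2_eq_norm_toLp ((hs n).sub (hs k)), MemLp.toLp_sub] at h1
  obtain ⟨f, hf⟩ := cauchy_iff_exists_le_nhds.1 hcau
  refine ⟨f, Lp.memLp f, (TendstoL2.of_tendsto_Lp hf).congr' (Eventually.of_forall fun n => ?_)
    EventuallyEq.rfl⟩
  exact (hs n).coeFn_toLp

/-- Local `L²` limits on an exhausting family of balls are restrictions of one function. -/
theorem exists_patched_limit {l : Filter ℕ} [l.NeBot] {gs : ℕ → Plane → Plane} {m : ℝ}
    (hm : 0 < m) (hgs : ∀ n, MemLp (gs n) 2 volume)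
    (h : ∀ a, 0 < a → a < m → ∃ G, MemLp G 2 (volB a) ∧ TendstoL2 (volB a) l gs G) :
    ∃ g, ∀ a < m, MemLp g 2 (volB a) ∧ TendstoL2 (volB a) l gs g := by
  obtain ⟨ρ, hmono, hρ, hlim⟩ := exists_seq_strictMono_tendsto' hm
  choose G hG hGl using fun j => h (ρ j) (hρ j).1 (hρ j).2
  have hex : ∀ a < m, ∃ j, a < ρ j := fun a ha => (hlim.eventually (lt_mem_nhds ha)).exists
  classical
  -- At z the limit for the first radius exceeding |z| is used; limits for different radii agree
  -- almost everywhere on the smaller ball.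
  set g : Plane → Plane := fun z => if hz : ∃ j, ‖z‖ < ρ j then G (Nat.find hz) z else 0 with hg
  have hagree : ∀ i j, i ≤ j → ∀ᵐ z ∂volB (ρ i), G i z = G j z := fun i j hij => by
    have hle := volB_mono (hmono.monotone hij)
    exact TendstoL2.ae_unique (fun n => (hgs n).1.mono_measure Measure.restrict_le_self)
      (hG i).1 ((hG j).1.mono_measure hle) (hGl i) ((hGl j).mono_measure hle)
  have hgG : ∀ j, g =ᵐ[volB (ρ j)] G j := fun j => by
    have hall : ∀ᵐ z, ∀ i, i ≤ j → z ∈ ball (0 : Plane) (ρ i) → G i z = G j z := by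
      rw [ae_all_iff]
      intro i
      by_cases hij : i ≤ j
      · filter_upwards [(ae_restrict_iff' measurableSet_ball).1 (hagree i j hij)] with z hz _ using hz
      · exact ae_of_all _ fun z h => absurd h hij
    filter_upwards [ae_restrict_of_ae hall, ae_restrict_mem measurableSet_ball] with z hz hzj
    have hz' : ∃ j, ‖z‖ < ρ j := ⟨j, mem_ball_zero_iff.1 hzj⟩
    rw [hg]
    simp only [dif_pos hz']
    exact hz _ (Nat.find_min' hz' (mem_ball_zero_iff.1 hzj))
      (mem_ball_zero_iff.2 (Nat.find_spec hz'))
  refine ⟨g, fun a ha => ?_⟩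
  obtain ⟨j, hj⟩ := hex a ha
  have hle := volB_mono hj.le
  exact ⟨((memLp_congr_ae (hgG j)).2 (hG j)).mono_measure hle,
    ((hGl j).congr' (Eventually.of_forall fun _ => EventuallyEq.rfl) (hgG j).symm).mono_measure hle⟩

theorem locallyIntegrableOn_ball {E : Type*} [NormedAddCommGroup E] {f : Plane → E} {m : ℝ}
    (h : ∀ a < m, IntegrableOn f (ball 0 a)) : LocallyIntegrableOn f (ball 0 m) := by
  intro z hz
  obtain ⟨a, h1, h2⟩ := exists_between (mem_ball_zero_iff.1 hz)
  exact ⟨ball 0 a, mem_nhdsWithin_of_mem_nhds (isOpen_ball.mem_nhds (mem_ball_zero_iff.2 h1)), h a h2⟩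

section

variable {A : Plane → Matrix (Fin 2) (Fin 2) ℝ} {W : Plane → Plane} {V : Plane → ℝ}
  {m lam K L : ℝ}

/-- Gradients of locally uniformly convergent solutions converge in `L²`. -/
theorem BoundedCoeff.exists_tendstoL2_grad (hc : BoundedCoeff A W V m lam K) {l : Filter ℕ}
    [l.NeBot] {us : ℕ → Plane → ℝ} {gs : ℕ → Plane → Plane} {Rs : ℕ → ℝ} {φ : Plane → ℝ}
    (hgs : ∀ n, MemLp (gs n) 2 volume) (hRs : ∀ r < m, ∀ᶠ n in l, r < Rs n)
    (hloc : ∀ n, LocApprox (Rs n) (us n) (gs n)) (hsol : ∀ n, IsSol A W V (Rs n) (us n) (gs n))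
    (hunif : ∀ r, 0 < r → r < m → ∀ ε > 0, ∀ᶠ n in l, ∀ z ∈ ball (0 : Plane) r,
      |us n z - φ z| ≤ ε) {a : ℝ} (ha : 0 < a) (ham : a < m) :
    ∃ G, MemLp G 2 (volB a) ∧ TendstoL2 (volB a) l gs G := by
  obtain ⟨r, har, hrm⟩ := exists_between ham
  obtain ⟨C, hC, hcac⟩ := (hc.mono hrm.le).exists_caccioppoli ha har
  set N := l2 (volB r) (fun _ : Plane => (1 : ℝ)) with hN
  have hN0 : 0 ≤ N := l2_nonneg _
  refine exists_tendstoL2_of_cauchy (fun n => (hgs n).mono_measure Measure.restrict_le_self)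
    fun ε hε => ?_
  set ε' := ε / (4 * (C * N + 1)) with hε'
  have hε0 : 0 < ε' := by positivity
  refine ⟨fun n => r < Rs n ∧ ∀ z ∈ ball (0 : Plane) r, |us n z - φ z| ≤ ε',
    (hRs r hrm).and (hunif r (ha.trans har) hrm ε' hε0), ?_⟩
  rintro n k ⟨hn, hn'⟩ ⟨hk, hk'⟩
  set R := min (min (Rs n) (Rs k)) m with hR
  have hRn : R ≤ Rs n := (min_le_left _ _).trans (min_le_left _ _)
  have hRk : R ≤ Rs k := (min_le_left _ _).trans (min_le_right _ _)
  -- The difference of two solutions is again a solution, and the Caccioppoli inequality turns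
  -- uniform closeness of the functions into L² closeness of the gradients.
  have hd : LocApprox R (fun z => us n z + -1 * us k z)
      (fun z => gs n z + (-1 : ℝ) • gs k z) :=
    ((hloc n).mono hRn).add (((hloc k).const_mul (-1)).mono hRk)
  have hds : IsSol A W V R (fun z => us n z + -1 * us k z)
      (fun z => gs n z + (-1 : ℝ) • gs k z) := fun ρ hρ η hη => by
    have m1 := (hloc n).memLp (hρ.trans_le hRn)
    have m2 := (hloc k).memLp (hρ.trans_le hRk)
    rw [(hc.mono (hρ.le.trans (min_le_right _ _))).form_add_smul_left (-1) m1.1 m1.2 m2.1 m2.2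
      (hη.memLp _) (hη.memLp_gradient _), hsol n ρ (hρ.trans_le hRn) η hη,
      hsol k ρ (hρ.trans_le hRk) η hη]
    ring
  have h1 := hcac R (lt_min (lt_min hn hk) hrm) _ _ hd hds
  have h2 : l2 (volB r) (fun z => us n z + -1 * us k z) ≤ 2 * ε' * N := by
    refine l2_le_of_abs_le (by positivity) ?_
    filter_upwards [ae_restrict_mem measurableSet_ball] with z hz
    have e1 := abs_le.1 (hn' z hz)
    have e2 := abs_le.1 (hk' z hz)
    rw [abs_le]
    constructor <;> linarith
  have e : (fun z => gs n z - gs k z) = fun z => gs n z + (-1 : ℝ) • gs k z :=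
    funext fun z => by module
  rw [e]
  have h3 := h1.trans (mul_le_mul_of_nonneg_left h2 hC)
  have h4 : C * (2 * ε' * N) ≤ ε / 2 := by
    calc C * (2 * ε' * N) = 2 * ε' * (C * N) := by ring
      _ ≤ 2 * ε' * (C * N + 1) := by gcongr; linarith
      _ = ε / 2 := by rw [hε']; field_simp; ring
  linarith

/-- Locally uniform limits of solutions are solutions. -/
theorem BoundedCoeff.isWeakSolution_of_tendsto (hc : BoundedCoeff A W V m lam K) (hm : 0 < m)
    {l : Filter ℕ} [l.NeBot] {us : ℕ → Plane → ℝ} {gs : ℕ → Plane → Plane} {Rs : ℕ → ℝ}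
    {φ : Plane → ℝ} (hus : ∀ n, MemLp (us n) 2 volume) (hgs : ∀ n, MemLp (gs n) 2 volume)
    (hRs : ∀ r < m, ∀ᶠ n in l, r < Rs n)
    (hloc : ∀ n, LocApprox (Rs n) (us n) (gs n)) (hsol : ∀ n, IsSol A W V (Rs n) (us n) (gs n))
    (hφ : ContinuousOn φ (ball 0 m))
    (hunif : ∀ r, 0 < r → r < m → ∀ ε > 0, ∀ᶠ n in l, ∀ z ∈ ball (0 : Plane) r,
      |us n z - φ z| ≤ ε) : IsWeakSolution A W V (ball 0 m) φ := by
  obtain ⟨g, hg⟩ := exists_patched_limit hm hgs fun a ha ham =>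
    hc.exists_tendstoL2_grad hgs hRs hloc hsol hunif ha ham
  have mus : ∀ r n, MemLp (us n) 2 (volB r) := fun r n =>
    (hus n).mono_measure Measure.restrict_le_self
  have mgs : ∀ r n, MemLp (gs n) 2 (volB r) := fun r n =>
    (hgs n).mono_measure Measure.restrict_le_self
  have mφ : ∀ r < m, MemLp φ 2 (volB r) := fun r hr => by
    obtain ⟨B, -, hB⟩ := exists_abs_le_closedBall hφ hr
    exact memLp_ball_of_bound (aestronglyMeasurable_of_continuousOn_ball hφ hr.le)
      (ae_ball_of_forall_closedBall hB)
  have tφ : ∀ r < m, TendstoL2 (volB r) l us φ := fun r hr => by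
    obtain ⟨r', hr', hm'⟩ := exists_between (max_lt hr hm)
    obtain ⟨B, -, hB⟩ := exists_abs_le_closedBall hφ hr
    refine TendstoL2.of_uniform (mus r) (mφ r hr) (ae_ball_of_forall_closedBall hB) fun ε hε => ?_
    filter_upwards [hunif r' ((le_max_right _ _).trans_lt hr') hm' ε hε] with n hn
    exact (ae_restrict_mem measurableSet_ball).mono fun z hz =>
      hn z (ball_subset_ball ((le_max_left _ _).trans hr'.le) hz)
  refine ⟨g, ⟨⟨?_, ?_, ?_⟩, ?_, ?_⟩, ?_⟩
  · exact locallyIntegrableOn_ball fun a ha => integrableOn_of_memLp_ball (mφ a ha)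
  · exact locallyIntegrableOn_ball fun a ha => integrableOn_of_memLp_ball (hg a ha).1
  · intro η hη i
    obtain ⟨r, hr, hη'⟩ := hη.exists_lt
    have hres : ∀ f : Plane → ℝ, (∀ z ∉ ball (0 : Plane) r, f z = 0) →
        ∫ z in ball (0 : Plane) m, f z = ∫ z in ball (0 : Plane) r, f z := fun f hf => by
      rw [setIntegral_eq_integral_of_forall_compl_eq_zero hf,
        setIntegral_eq_integral_of_forall_compl_eq_zero fun z hz =>
          hf z fun h => hz (ball_subset_ball hr.le h)]
    rw [hres _ fun z hz => by rw [hη'.gradient_eq_zero hz]; simp,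
      hres _ fun z hz => by rw [hη'.eq_zero hz, mul_zero]]
    have cη : MemLp (fun z => gradient η z i) 2 (volB r) :=
      memLp_ball_of_continuous (contDiff_gradient_apply hη.smooth i).continuous r
    have hcoord : ∀ {f : Plane → Plane}, MemLp f 2 (volB r) →
        MemLp (fun z => f z i) 2 (volB r) := fun {f} hf =>
      hf.of_le_mul (c := 1) ((EuclideanSpace.proj (𝕜 := ℝ) i).continuous.comp_aestronglyMeasurable
        hf.1) (ae_of_all _ fun z => by rw [one_mul]; exact abs_coord_le (f z) i)
    have l1 := (tφ r hr).mul cη (mus r) (mφ r hr)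
    have l2 := (TendstoL2.of_le (s' := fun n z => gs n z i) (f' := fun z => g z i) (hg r hr).2 1
      (Eventually.of_forall fun n => ae_of_all _ fun z => by
        rw [one_mul]; exact abs_coord_le (gs n z - g z) i)).mul (hη.memLp (volB r))
        (fun n => hcoord (mgs r n)) (hcoord (hg r hr).1)
    simp only [mul_comm (φ _), mul_comm (g _ _)]
    refine tendsto_nhds_unique l1 (l2.neg.congr' ?_)
    filter_upwards [hRs r hr] with n hn
    obtain ⟨s, hs, -⟩ := (hloc n).approx r hn
    have := hs.hasWeakGradientOn.2.2 η hη' i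
    simp only [mul_comm (us n _), mul_comm (gs n _ _)] at this
    exact this.symm
  · exact locallyIntegrableOn_ball fun a ha => (mφ a ha).integrable_sq
  · exact locallyIntegrableOn_ball fun a ha => (hg a ha).1.norm.integrable_sq
  · intro η hη
    obtain ⟨r, hr, hη'⟩ := hη.exists_lt
    rw [weakForm_eq_form, form_eq_of_isTestOn hη' hr.le]
    refine tendsto_nhds_unique ((hc.mono hr.le).tendsto_form_left (mus r) (mgs r) (mφ r hr)
      (hg r hr).1 (hη.memLp _) (hη.memLp_gradient _) (tφ r hr) (hg r hr).2)
      (tendsto_const_nhds.congr' ?_)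
    filter_upwards [hRs r hr] with n hn
    exact (hsol n r hn η hη').symm

/-- A positive supersolution yields a positive solution. -/
theorem BoundedCoeff.exists_pos_weakSolution (hc : BoundedCoeff A W V m lam K) (hm : 0 < m)
    (hA : ∀ i j, WeakGradientBoundedOn (fun z => A z i j) (ball 0 m) L) (hL : 0 ≤ L)
    {φ₂ : Plane → ℝ} (hpos : PosContOn φ₂ (ball 0 m))
    (hsup : IsWeakSupersolution A W V (ball 0 m) φ₂) :
    ∃ φ, PosContOn φ (ball 0 m) ∧ IsWeakSolution A W V (ball 0 m) φ := by
  obtain ⟨g₂, hw, hform⟩ := hsup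
  have hloc₂ := LocApprox.of_memW12Loc hw hpos.1
  have hsup₂ : IsSup A W V m φ₂ g₂ := isSup_of_form_nonneg fun η hη h0 => by
    rw [← weakForm_eq_form]; exact hform η hη h0
  obtain ⟨Rs, -, hRs, hRlim⟩ := exists_seq_strictMono_tendsto' hm
  choose us gs hus hgs hloc hsol hupos hu0 using fun n =>
    hc.exists_pos_solution hA hL hloc₂ hpos.2 hsup₂ (hRs n).1 (hRs n).2
  -- Along a nonprincipal ultrafilter every bounded sequence converges, so all pointwise limits
  -- exist at once, without extracting diagonal subsequences.
  set l : Filter ℕ := (hyperfilter ℕ : Filter ℕ) with hl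
  have hRl : ∀ r < m, ∀ᶠ n in l, r < Rs n := fun r hr =>
    Nat.hyperfilter_le_atTop (hRlim.eventually (lt_mem_nhds hr))
  have hbd : ∀ a, 0 < a → a < m → ∃ C > 0,
      (∀ᶠ n in l, ∀ z ∈ ball (0 : Plane) a, us n z ≤ C ∧ 1 ≤ C * us n z) ∧
      ∀ᶠ n in l, ∀ z ∈ ball (0 : Plane) a, ∀ z' ∈ ball (0 : Plane) a,
        |us n z' - us n z| ≤ C * √‖z' - z‖ := fun a ha ham => by
    obtain ⟨r, hr, C, hC, h⟩ := hc.exists_interior_bounds hA hL hloc₂ hpos.2 hsup₂ ha ham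
    have := fun n (hn : r < Rs n) => h (Rs n) hn (us n) (gs n) (hloc n) (hsol n) (hupos n) (hu0 n)
    exact ⟨C, hC, (hRl r hr).mono fun n hn => (this n hn).1,
      (hRl r hr).mono fun n hn => (this n hn).2⟩
  have hex : ∀ z ∈ ball (0 : Plane) m, ∃ a, 0 < a ∧ a < m ∧ z ∈ ball (0 : Plane) a := fun z hz => by
    obtain ⟨a, h1, h2⟩ := exists_between (mem_ball_zero_iff.1 hz)
    exact ⟨a, (norm_nonneg z).trans_lt h1, h2, mem_ball_zero_iff.2 h1⟩
  have hlim : ∀ z, ∃ t, z ∈ ball (0 : Plane) m → Tendsto (fun n => us n z) l (𝓝 t) := fun z => by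
    by_cases hz : z ∈ ball (0 : Plane) m
    · obtain ⟨a, ha, ham, hza⟩ := hex z hz
      obtain ⟨C, hC, h1, -⟩ := hbd a ha ham
      obtain ⟨t, -, ht⟩ := (isCompact_Icc (a := (0 : ℝ)) (b := C)).ultrafilter_le_nhds
        ((hyperfilter ℕ).map fun n => us n z) (le_principal_iff.2 (h1.mono fun n hn => by
          obtain ⟨e1, e2⟩ := hn z hza
          exact ⟨((pos_iff_pos_of_mul_pos (zero_lt_one.trans_le e2)).1 hC).le, e1⟩))
      exact ⟨t, fun _ => ht⟩
    · exact ⟨0, fun h => absurd h hz⟩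
  choose φ hφ using hlim
  have hloc' : ∀ a, 0 < a → a < m → ContinuousOn φ (ball 0 a) ∧
      ∀ ε > 0, ∀ᶠ n in l, ∀ z ∈ ball (0 : Plane) a, |us n z - φ z| ≤ ε := fun a ha ham => by
    obtain ⟨C, hC, -, h2⟩ := hbd a ha ham
    obtain ⟨h3, h4⟩ := uniform_of_holder hC h2 fun z hz => hφ z (ball_subset_ball ham.le hz)
    refine ⟨fun z hz => ?_, h4⟩
    rw [ContinuousWithinAt, tendsto_iff_dist_tendsto_zero]
    have hc0 : Tendsto (fun y : Plane => C * √‖y - z‖) (𝓝[ball 0 a] z) (𝓝 0) := by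
      have : Continuous fun y : Plane => C * √‖y - z‖ := by fun_prop
      have h5 := this.tendsto z
      simp only [sub_self, norm_zero, Real.sqrt_zero, mul_zero] at h5
      exact h5.mono_left nhdsWithin_le_nhds
    refine squeeze_zero' (Eventually.of_forall fun _ => dist_nonneg) ?_ hc0
    filter_upwards [self_mem_nhdsWithin] with y hy
    rw [Real.dist_eq]
    exact h3 z hz y hy
  have hcont : ContinuousOn φ (ball 0 m) := fun z hz => by
    obtain ⟨a, ha, ham, hza⟩ := hex z hz
    exact ((hloc' a ha ham).1.continuousAt (isOpen_ball.mem_nhds hza)).continuousWithinAt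
  refine ⟨φ, ⟨hcont, fun z hz => ?_⟩, hc.isWeakSolution_of_tendsto hm hus hgs hRl hloc hsol hcont
    fun r hr hrm => (hloc' r hr hrm).2⟩
  obtain ⟨a, ha, ham, hza⟩ := hex z hz
  obtain ⟨C, hC, h1, -⟩ := hbd a ha ham
  -- The lower Harnack bound for the normalised solutions passes to the limit and prevents it from
  -- vanishing.
  have h2 : 1 ≤ C * φ z := ge_of_tendsto ((hφ z hz).const_mul C) (h1.mono fun n hn => (hn z hza).2)
  exact (pos_iff_pos_of_mul_pos (zero_lt_one.trans_le h2)).1 hC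

end

/-! ### The two statements -/

theorem mainTheorem6 (lam : ℝ) (hlam : 0 < lam) :
    (∃ c : ℝ, 0 < c ∧
      ∀ (m K : ℝ) (A : Plane → Matrix (Fin 2) (Fin 2) ℝ) (W : Plane → Plane) (V : Plane → ℝ),
        1 < m → 1 ≤ K →
        EllipticBoundedOn A (ball 0 m) lam →
        (∀ i j, WeakGradientBoundedOn (fun z => A z i j) (ball 0 m) (lam / (4 * m))) →
        EssBoundedOn (fun z => max (V z) 0) (ball 0 m) (K ^ 2) →
        EssBoundedOn (fun z => max (-V z) 0) (ball 0 m) (lam / (m ^ 2 + 1)) →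
        EssBoundedOn W (ball 0 m) (lam / (2 * m)) →
        IsWeakSupersolution A W V (ball 0 m) (fun z => m ^ 2 + 1 - ‖z‖ ^ 2) ∧
        IsWeakSubsolution A W V (ball 0 m) (fun z => Real.exp (c * K * z 0)) ∧
        ∃ φ : Plane → ℝ, PosContOn φ (ball 0 m) ∧ IsWeakSolution A W V (ball 0 m) φ ∧
          ∀ z ∈ ball (0 : Plane) m,
            Real.exp (c * K * z 0) ≤ φ z ∧
            φ z ≤ Real.exp (c * K * m) * (m ^ 2 + 1 - ‖z‖ ^ 2)) ∧
    (∀ (m K : ℝ) (A : Plane → Matrix (Fin 2) (Fin 2) ℝ) (W : Plane → Plane) (V : Plane → ℝ),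
        1 < m → 1 ≤ K →
        EllipticBoundedOn A (ball 0 m) lam →
        (∀ i j, WeakGradientBoundedOn (fun z => A z i j) (ball 0 m) K) →
        EssBoundedOn V (ball 0 m) (K ^ 2) →
        EssBoundedOn W (ball 0 m) K →
        (∃ φ₂ : Plane → ℝ, PosContOn φ₂ (ball 0 m) ∧
          IsWeakSupersolution A W V (ball 0 m) φ₂) →
        ∃ φ : Plane → ℝ, PosContOn φ (ball 0 m) ∧ IsWeakSolution A W V (ball 0 m) φ) := by
  refine ⟨⟨1 + 1 / lam, by positivity, fun m K A W V hm hK hell hA hP hN hW =>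
    exists_solution_between_barriers hlam hm hK hell hA hP hN hW⟩, ?_⟩
  rintro m K A W V hm hK hell hA hV hW ⟨φ₂, hpos, hsup⟩
  -- Since K ≥ 1, the single constant K² bounds the drift as well as the potential.
  have hc : BoundedCoeff A W V m lam (K ^ 2) :=
    boundedCoeff_of_weakGradientBounded hlam (by positivity) hell hA
      (hW.mono subset_rfl (by nlinarith)) hV
  exact hc.exists_pos_weakSolution (by linarith) hA (by linarith) hpos hsup
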